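/- **Setting.** Let $[0,L]$, $L>0$, be a coordinate interval on the null branch $\mathcal N_L$ of a cylindrically symmetric double null sheet, with $x=0$ on the symmetry axis and $x=L$ on $S_0$. Let $\mu:[0,L]\to\mathbb C$ be smooth with $|\mu|<1$ (Beltrami coefficient; smoothness up to $x=0$ is the regularity at the axis), and let the area density $\rho:[0,L]\to\mathbb R$ be smooth with $\rho(0)=0$ and $\rho'>0$ on $(0,L]$. Nothing is assumed outside $[0,L]$; in particular there is no assumption of asymptotic flatness. Let $\mathcal V=\frac1{\sqrt{1-\mu\bar\mu}}\begin{pmatrix}1+\operatorname{Re}\mu&\operatorname{Im}\mu\\ \operatorname{Im}\mu&1-\operatorname{Re}\mu\end{pmatrix}$, a unit determinant zweibein of the conformal metric $e=\mathcal V\mathcal V^t$ determined by $e_{ab}d\theta^ad\theta^b=(1-\mu\bar\mu)^{-1}|dz+\mu\,d\bar z|^2$, $z=\theta^1+i\theta^2$. Let $J=\mathcal V^{-1}d\mathcal V$, $P=\frac12(J+J^t)$, $Q=\frac12(J-J^t)$ and, for $q$ between the axis and $r$, $$\hat J(q;r)=Q(q)+\frac{P(q)}{\sqrt{1-\rho(q)/\rho(r)}},\qquad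 \mathcal U(r)=\mathcal V(0)\,\mathcal P\exp\int_0^r\hat J(\cdot;r),\qquad \mathcal E=\mathcal U\,\mathcal U^t,$$ with the path ordered exponential (ordered from left to right) defined by its series of iterated integrals. $\mathcal E$ is the deformed conformal metric. **Poisson bracket.** Let $G_2$ be a real constant. The one-generator algebra is $\{\mu,\mu\}=\{\bar\mu,\bar\mu\}=\{\rho,\mu\}=\{\rho,\bar\mu\}=\{\rho,\rho\}=0$ and $$\{\mu(x),\bar\mu(y)\}=4\pi G_2\,H(x,y)\,\frac{(1-\mu\bar\mu)(x)}{\sqrt{\rho(x)}}\,\frac{(1-\mu\bar\mu)(y)}{\sqrt{\rho(y)}}\;\exp\int_x^y\frac{\bar\mu\,d\mu-\mu\,d\bar\mu}{1-\mu\bar\mu},$$ with $H(x,y)=1$ if $x\ge y$ and $0$ otherwise. For functionals $F$, $G$ of the data having integrable functional derivatives, $\delta F=\int_0^L\big(\frac{\delta F}{\delta\mu}\delta\mu+\frac{\delta F}{\delta\bar\mu}\delta\bar\mu\big)dx$ for all smooth variations $\delta\mu$ on $[0,L]$ (at fixed $\rho$, which is central), put $$\{F,G\}=\iint\Big(\tfrac{\delta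 F}{\delta\mu(x)}\tfrac{\delta G}{\delta\bar\mu(y)}\{\mu(x),\bar\mu(y)\}-\tfrac{\delta F}{\delta\bar\mu(x)}\tfrac{\delta G}{\delta\mu(y)}\{\mu(y),\bar\mu(x)\}\Big)dx\,dy .$$ **Claim 1.** The functionals $\int f\,\mathcal E_{ab}\,dx$ with $f\in C_c^\infty((0,L))$ real have such functional derivatives, the integral defining the bracket of any two of them converges absolutely, and, as distributions on $(0,L)^2$, $$\{\mathcal E_{ab}(\mathbf 1),\mathcal E_{cd}(\mathbf 2)\}=\mathrm{p.v.}\Big(\frac{16\pi G_2}{\rho(\mathbf 1)-\rho(\mathbf 2)}\Big)\operatorname{Sym}_{(ab),(cd)}\Big(\mathcal E_{ad}(\mathbf 1)\mathcal E_{cb}(\mathbf 2)-\tfrac12\mathcal E_{ab}(\mathbf 1)\mathcal E_{cd}(\mathbf 2)\Big),$$ where $\operatorname{Sym}$ is the average over exchanging $a\leftrightarrow b$ and $c\leftrightarrow d$, and the principal value is $\lim_{\epsilon\to0^+}$ of the integral over $|\rho(\mathbf 1)-\rho(\mathbf 2)|>\epsilon$. Equivalently, with $\Omega_a{}^b{}_c{}^d=\frac14(\delta_a^d\delta_c^b-\frac12\delta_a^b\delta_c^d)$,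 the superscripts $1,2$ denoting the tensor factor and ${}^t\Omega$, $\Omega^t$ the transposes in factor 1 and in factor 2, $$\{\overset1{\mathcal E},\overset2{\mathcal E}\}=\mathrm{p.v.}\Big(\frac{16\pi G_2}{\rho(\mathbf 1)-\rho(\mathbf 2)}\Big)\Big(\Omega\overset1{\mathcal E}\overset2{\mathcal E}+\overset1{\mathcal E}\,{}^t\Omega\,\overset2{\mathcal E}+\overset2{\mathcal E}\,\Omega^t\,\overset1{\mathcal E}+\overset1{\mathcal E}\overset2{\mathcal E}\,{}^t\Omega^t\Big).$$ **Claim 2.** Let $\rho^+\in\mathbb R$ and, for $w\in(-\rho^+,2\rho(L)-\rho^+)$, let $\mathcal M(w)=\mathcal E(r(w))$, where $2\rho(r(w))-\rho^+=w$. For every constant $Z\in SL(2,\mathbb R)$ the internal components $\mathcal M_{ij}$, defined by $\mathcal M_{ab}=Z_a{}^iZ_b{}^j\mathcal M_{ij}$, satisfy in the same sense (smeared with test functions of $w$ with compact support in that interval) $$\{\overset1{\mathcal M},\overset2{\mathcal M}\}=\mathrm{p.v.}\Big(\frac{32\pi G_2}{w_1-w_2}\Big)\Big(\Omega\overset1{\mathcal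 M}\overset2{\mathcal M}+\overset1{\mathcal M}\overset2{\mathcal M}\,\Omega-\overset1{\mathcal M}\,\Omega^\eta\,\overset2{\mathcal M}-\overset2{\mathcal M}\,\Omega^\eta\,\overset1{\mathcal M}\Big),\qquad\Omega^\eta=-\Omega^t .$$ -/

import Mathlib

open Set Filter Topology MeasureTheory Matrix
open scoped ContDiff Kronecker ComplexConjugate

noncomputable section

namespace CylGravity

/-! ## Fields on the branch `N_L`

The branch is coordinatized by `x ∈ [0, L]`: `x = 0` is the symmetry axis and `x = L` is the
intersection surface `S₀`. The data are the Beltrami coefficient `μ : ℝ → ℂ` and the area density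
`ρ : ℝ → ℝ`, of which only the values on `[0, L]` matter. -/

/-- Derivative along the branch. -/
def dBranch {E : Type*} [NormedAddCommGroup E] [NormedSpace ℝ E] (L : ℝ) (f : ℝ → E) (x : ℝ) : E :=
  derivWithin f (Icc 0 L) x

/-- Regular data on the branch: `μ` is smooth up to and including the axis with `|μ| < 1` (so the
conformal metric has a limit at the axis), `ρ` is smooth, vanishes at the axis and increases away
from it, with `dρ ≠ 0` off the axis. -/
structure IsRegularData (L : ℝ) (μ : ℝ → ℂ) (ρ : ℝ → ℝ) : Prop where
  smooth_mu : ContDiffOn ℝ ∞ μ (Icc 0 L)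
  norm_mu_lt : ∀ x ∈ Icc 0 L, ‖μ x‖ < 1
  smooth_rho : ContDiffOn ℝ ∞ ρ (Icc 0 L)
  rho_axis : ρ 0 = 0
  rho_increasing : ∀ x ∈ Ioc 0 L, 0 < dBranch L ρ x

/-- The conformal 2-metric `e`, defined by
`e_ab dθ^a dθ^b = (1 - |μ|²)⁻¹ |dz + μ dz̄|²` with `z = θ¹ + i θ²`. -/
def conformalMetric (m : ℂ) : Matrix (Fin 2) (Fin 2) ℝ :=
  (1 - ‖m‖ ^ 2)⁻¹ • !![‖1 + m‖ ^ 2, 2 * m.im; 2 * m.im, ‖1 - m‖ ^ 2]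

/-- The zweibein `V` of the conformal metric, in symmetric gauge. -/
def zweibein (m : ℂ) : Matrix (Fin 2) (Fin 2) ℝ :=
  (√(1 - ‖m‖ ^ 2))⁻¹ • !![1 + m.re, m.im; m.im, 1 - m.re]

theorem zweibein_mul_transpose {m : ℂ} (hm : ‖m‖ < 1) :
    zweibein m * (zweibein m)ᵀ = conformalMetric m := by
  have h : 0 < 1 - ‖m‖ ^ 2 := by nlinarith [norm_nonneg m]
  have hs : (√(1 - ‖m‖ ^ 2))⁻¹ * (√(1 - ‖m‖ ^ 2))⁻¹ = (1 - ‖m‖ ^ 2)⁻¹ := by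
    rw [← mul_inv, Real.mul_self_sqrt h.le]
  have e1 : ‖1 + m‖ ^ 2 = (1 + m.re) ^ 2 + m.im ^ 2 := by
    rw [Complex.sq_norm, Complex.normSq_apply]; simp; ring
  have e2 : ‖1 - m‖ ^ 2 = (1 - m.re) ^ 2 + m.im ^ 2 := by
    rw [Complex.sq_norm, Complex.normSq_apply]; simp; ring
  unfold zweibein conformalMetric
  rw [transpose_smul, Matrix.smul_mul, Matrix.mul_smul, smul_smul, hs, e1, e2]
  congr 1
  ext i j
  fin_cases i <;> fin_cases j <;> simp [Matrix.mul_apply, Fin.sum_univ_two] <;> ring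

theorem det_zweibein {m : ℂ} (hm : ‖m‖ < 1) : (zweibein m).det = 1 := by
  have h : 0 < 1 - ‖m‖ ^ 2 := by nlinarith [norm_nonneg m]
  have hs : (√(1 - ‖m‖ ^ 2))⁻¹ * (√(1 - ‖m‖ ^ 2))⁻¹ = (1 - ‖m‖ ^ 2)⁻¹ := by
    rw [← mul_inv, Real.mul_self_sqrt h.le]
  have e : ‖m‖ ^ 2 = m.re ^ 2 + m.im ^ 2 := by
    rw [Complex.sq_norm, Complex.normSq_apply]; ring
  unfold zweibein
  rw [Matrix.det_smul, Fintype.card_fin, sq, hs, inv_mul_eq_one₀ h.ne', Matrix.det_fin_two_of, e]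
  ring

/-! ## The transformation `μ ↦ E` -/

/-- Component of the connection `J = V⁻¹ dV` along the branch. -/
def connJ (L : ℝ) (μ : ℝ → ℂ) (x : ℝ) : Matrix (Fin 2) (Fin 2) ℝ :=
  (zweibein (μ x))⁻¹ * Matrix.of fun a i => dBranch L (fun y => zweibein (μ y) a i) x

/-- Symmetric part `P` of `J`. -/
def connP (L : ℝ) (μ : ℝ → ℂ) (x : ℝ) : Matrix (Fin 2) (Fin 2) ℝ :=
  (1 / 2 : ℝ) • (connJ L μ x + (connJ L μ x)ᵀ)

/-- Antisymmetric part `Q` of `J`. -/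
def connQ (L : ℝ) (μ : ℝ → ℂ) (x : ℝ) : Matrix (Fin 2) (Fin 2) ℝ :=
  (1 / 2 : ℝ) • (connJ L μ x - (connJ L μ x)ᵀ)

/-- The deformed connection `Ĵ(q; r) = Q(q) + (1 - ρ(q)/ρ(r))^(-1/2) P(q)`, for a field point `q`
between the axis and the deformation point `r`. -/
def connJhat (L : ℝ) (μ : ℝ → ℂ) (ρ : ℝ → ℝ) (r q : ℝ) : Matrix (Fin 2) (Fin 2) ℝ :=
  connQ L μ q + (1 / √(1 - ρ q / ρ r)) • connP L μ q

/-- The term of order `s` of the path ordered exponential of `A`,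
`∫_a^b dz₁ ∫_{z₁}^b dz₂ ⋯ ∫_{z_{s-1}}^b dz_s A(z₁) ⋯ A(z_s)`, as a function of `a`. -/
def pathOrdTerm (A : ℝ → Matrix (Fin 2) (Fin 2) ℝ) (b : ℝ) : ℕ → ℝ → Matrix (Fin 2) (Fin 2) ℝ
  | 0, _ => 1
  | s + 1, a => Matrix.of fun i j => ∫ z in a..b, (A z * pathOrdTerm A b s z) i j

/-- The path ordered exponential `𝒫 exp ∫_a^b A`, ordered from left to right. -/
def pathOrdExp (A : ℝ → Matrix (Fin 2) (Fin 2) ℝ) (a b : ℝ) : Matrix (Fin 2) (Fin 2) ℝ :=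
  ∑' s : ℕ, pathOrdTerm A b s a

/-- The deformed zweibein `V̂(p; r) = V(0) 𝒫 exp ∫_0^p Ĵ(·; r)`, for `p` between the axis
and `r`. -/
def deformedZweibein (L : ℝ) (μ : ℝ → ℂ) (ρ : ℝ → ℝ) (p r : ℝ) : Matrix (Fin 2) (Fin 2) ℝ :=
  zweibein (μ 0) * pathOrdExp (connJhat L μ ρ r) 0 p

/-- `U(r) = V̂(r; r)`. -/
def fieldU (L : ℝ) (μ : ℝ → ℂ) (ρ : ℝ → ℝ) (r : ℝ) : Matrix (Fin 2) (Fin 2) ℝ :=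
  deformedZweibein L μ ρ r r

/-- The deformed conformal metric `E = U Uᵗ`. -/
def deformedMetric (L : ℝ) (μ : ℝ → ℂ) (ρ : ℝ → ℝ) (r : ℝ) : Matrix (Fin 2) (Fin 2) ℝ :=
  fieldU L μ ρ r * (fieldU L μ ρ r)ᵀ

/-- The point `r(w)` of the branch with spectral parameter `w = 2 ρ(r) - ρ⁺`. -/
def pointOfSpectral (L ρplus : ℝ) (ρ : ℝ → ℝ) (w : ℝ) : ℝ :=
  Function.invFunOn ρ (Icc 0 L) ((w + ρplus) / 2)

/-- The monodromy matrix `M(w) = E(r(w))`. -/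
def monodromy (L ρplus : ℝ) (μ : ℝ → ℂ) (ρ : ℝ → ℝ) (w : ℝ) : Matrix (Fin 2) (Fin 2) ℝ :=
  deformedMetric L μ ρ (pointOfSpectral L ρplus ρ w)

/-- Internal components `M_ij` of the monodromy matrix with respect to a fixed (non-dynamical)
zweibein `Z`, that is `M_ab = Z_a^i Z_b^j M_ij`. -/
def monodromyInt (Z : Matrix (Fin 2) (Fin 2) ℝ) (L ρplus : ℝ) (μ : ℝ → ℂ) (ρ : ℝ → ℝ) (w : ℝ) :
    Matrix (Fin 2) (Fin 2) ℝ :=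
  Z⁻¹ * monodromy L ρplus μ ρ w * (Z⁻¹)ᵀ

/-! ## The one-generator Poisson bracket -/

/-- The bracket `{μ(x), μ̄(y)}`. The step function `H(x, y)` is `1` when `x` is not closer to the
axis than `y`, and `0` otherwise. All other brackets among `μ`, `μ̄`, `ρ` vanish, apart from
`{μ̄(x), μ(y)} = - {μ(y), μ̄(x)}`. -/
def muBarBracket (G₂ L : ℝ) (μ : ℝ → ℂ) (ρ : ℝ → ℝ) (x y : ℝ) : ℂ :=
  4 * Real.pi * G₂ * (if y ≤ x then 1 else 0)
    * ((1 - ‖μ x‖ ^ 2) / √(ρ x) : ℝ) * ((1 - ‖μ y‖ ^ 2) / √(ρ y) : ℝ)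
    * Complex.exp (∫ z in x..y,
        (conj (μ z) * dBranch L μ z - μ z * conj (dBranch L μ z)) / ((1 - ‖μ z‖ ^ 2 : ℝ) : ℂ))

/-- `dmu = δF/δμ` and `dmubar = δF/δμ̄` are the functional derivatives of `F` at `(μ, ρ)`:
`δF = ∫_0^L (dmu δμ + dmubar δμ̄) dx` for all variations `δμ = η` that are smooth on the branch,
the axis included. Since `ρ` Poisson commutes with `μ`, `μ̄` and `ρ`, the derivative with respect
to `ρ` enters no bracket. -/
structure IsFunctionalDeriv (L : ℝ) (F : (ℝ → ℂ) → (ℝ → ℝ) → ℂ) (μ : ℝ → ℂ) (ρ : ℝ → ℝ)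
    (dmu dmubar : ℝ → ℂ) : Prop where
  integrable_dmu : IntegrableOn dmu (Icc 0 L)
  integrable_dmubar : IntegrableOn dmubar (Icc 0 L)
  hasDerivAt : ∀ η : ℝ → ℂ, ContDiffOn ℝ ∞ η (Icc 0 L) →
    HasDerivAt (fun t : ℝ => F (fun x => μ x + t * η x) ρ)
      (∫ x in (0)..L, (dmu x * η x + dmubar x * conj (η x))) 0

/-- `{F, G} = c` at `(μ, ρ)`, where
`{F, G} = ∫∫ (δF/δμ(x) δG/δμ̄(y) {μ(x), μ̄(y)} + δF/δμ̄(x) δG/δμ(y) {μ̄(x), μ(y)}) dx dy`;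
it is part of the claim that the functional derivatives exist and that the integral converges
absolutely. (The functional derivatives are unique almost everywhere.) -/
def HasPoissonBracket (G₂ L : ℝ) (F G : (ℝ → ℂ) → (ℝ → ℝ) → ℂ) (μ : ℝ → ℂ) (ρ : ℝ → ℝ)
    (c : ℂ) : Prop :=
  ∃ Fμ Fμbar Gμ Gμbar : ℝ → ℂ,
    IsFunctionalDeriv L F μ ρ Fμ Fμbar ∧ IsFunctionalDeriv L G μ ρ Gμ Gμbar ∧
    IntegrableOn (fun p : ℝ × ℝ => Fμ p.1 * Gμbar p.2 * muBarBracket G₂ L μ ρ p.1 p.2)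
      (Icc 0 L ×ˢ Icc 0 L) ∧
    IntegrableOn (fun p : ℝ × ℝ => Fμbar p.1 * Gμ p.2 * muBarBracket G₂ L μ ρ p.2 p.1)
      (Icc 0 L ×ˢ Icc 0 L) ∧
    c = ∫ p in Icc 0 L ×ˢ Icc 0 L,
      (Fμ p.1 * Gμbar p.2 * muBarBracket G₂ L μ ρ p.1 p.2
        - Fμbar p.1 * Gμ p.2 * muBarBracket G₂ L μ ρ p.2 p.1)

/-! ## Distributions -/

/-- Smooth test functions with compact support in `S`. -/
structure IsTestFunction (S : Set ℝ) (f : ℝ → ℝ) : Prop where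
  smooth : ContDiff ℝ ∞ f
  compact : HasCompactSupport f
  support : tsupport f ⊆ S

/-- The functional `∫ f(x) Φ(x) dx` of the data, for a field `Φ` built from the data. -/
def smeared (f : ℝ → ℝ) (Φ : (ℝ → ℂ) → (ℝ → ℝ) → ℝ → ℝ) : (ℝ → ℂ) → (ℝ → ℝ) → ℂ :=
  fun μ ρ => ((∫ x, f x * Φ μ ρ x : ℝ) : ℂ)

/-- `p.v. ∫∫_{S × S} W(x, y) / (l(x) - l(y)) dx dy = c`, the Cauchy principal value with respect
to the function `l`. -/
def HasPrincipalValue (S : Set ℝ) (l : ℝ → ℝ) (W : ℝ → ℝ → ℝ) (c : ℝ) : Prop :=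
  Tendsto (fun ε : ℝ => ∫ p in {p : ℝ × ℝ | p.1 ∈ S ∧ p.2 ∈ S ∧ ε < |l p.1 - l p.2|},
    W p.1 p.2 / (l p.1 - l p.2)) (𝓝[>] 0) (𝓝 c)

/-! ## Tensors

An operator on `ℝ² ⊗ ℝ²` is a matrix `C` with row index `(a, c)` and column index `(b, d)` for the
components `C_a^b_c^d`: the first entry of each pair belongs to space 1, the second to space 2. -/

/-- `A` acting on space 1. -/
def inSpace1 (A : Matrix (Fin 2) (Fin 2) ℝ) : Matrix (Fin 2 × Fin 2) (Fin 2 × Fin 2) ℝ := A ⊗ₖ 1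

/-- `A` acting on space 2. -/
def inSpace2 (A : Matrix (Fin 2) (Fin 2) ℝ) : Matrix (Fin 2 × Fin 2) (Fin 2 × Fin 2) ℝ := 1 ⊗ₖ A

/-- Transposition in space 1. -/
def transpose1 (C : Matrix (Fin 2 × Fin 2) (Fin 2 × Fin 2) ℝ) :
    Matrix (Fin 2 × Fin 2) (Fin 2 × Fin 2) ℝ :=
  Matrix.of fun p q => C (q.1, p.2) (p.1, q.2)

/-- Transposition in space 2. -/
def transpose2 (C : Matrix (Fin 2 × Fin 2) (Fin 2 × Fin 2) ℝ) :
    Matrix (Fin 2 × Fin 2) (Fin 2 × Fin 2) ℝ :=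
  Matrix.of fun p q => C (p.1, q.2) (q.1, p.2)

/-- `Ω_a^b_c^d = ¼ (δ_a^d δ_c^b - ½ δ_a^b δ_c^d)`, the inverse of the Killing form of `sl₂`. -/
def Omega : Matrix (Fin 2 × Fin 2) (Fin 2 × Fin 2) ℝ :=
  Matrix.of fun p q => (1 / 4 : ℝ) * ((if p.1 = q.2 ∧ p.2 = q.1 then 1 else 0)
    - (1 / 2 : ℝ) * (if p.1 = q.1 ∧ p.2 = q.2 then 1 else 0))

/-- `Ω^η`: the involution `η(a) = -aᵗ` of `sl₂` applied to one of the two factors of `Ω`. -/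
def OmegaEta : Matrix (Fin 2 × Fin 2) (Fin 2 × Fin 2) ℝ := -transpose2 Omega

/-- `Ω A₁B₂ + A₁ ᵗΩ B₂ + B₂ Ωᵗ A₁ + A₁B₂ ᵗΩᵗ`, where `A₁` acts on space 1, `B₂` on space 2, and
`t` before and after `Ω` denotes transposition in space 1 and in space 2. -/
def quadE (A B : Matrix (Fin 2) (Fin 2) ℝ) : Matrix (Fin 2 × Fin 2) (Fin 2 × Fin 2) ℝ :=
  Omega * inSpace1 A * inSpace2 B + inSpace1 A * transpose1 Omega * inSpace2 B
    + inSpace2 B * transpose2 Omega * inSpace1 A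
    + inSpace1 A * inSpace2 B * transpose1 (transpose2 Omega)

/-- `Ω A₁B₂ + A₁B₂ Ω - A₁ Ω^η B₂ - B₂ Ω^η A₁`. -/
def quadM (A B : Matrix (Fin 2) (Fin 2) ℝ) : Matrix (Fin 2 × Fin 2) (Fin 2 × Fin 2) ℝ :=
  Omega * inSpace1 A * inSpace2 B + inSpace1 A * inSpace2 B * Omega
    - inSpace1 A * OmegaEta * inSpace2 B - inSpace2 B * OmegaEta * inSpace1 A

/-- Symmetrization (with unit weight) in the index pairs `(a, b)` and `(c, d)`. -/
def symPairs (X : Fin 2 → Fin 2 → Fin 2 → Fin 2 → ℝ) (a b c d : Fin 2) : ℝ :=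
  (X a b c d + X b a c d + X a b d c + X b a d c) / 4

end CylGravity

end

/-!
The area density `ρ` is used as coordinate on the branch, with `x = ρ(q)` for field points and
`y = ρ(r)` for deformation points. Rotating the frame by the angle `theta`, the primitive of the
rotational part of `J`, removes `Q`: the deformed connection becomes the symmetric traceless matrix
`h m(x)`, with `h = √y / √(y - x)` and a complex profile `m` that does not depend on `y`
(`pathOrdExp_connJhat`, `pathOrdExp_frameConn`). So `𝓔` is, up to conjugation by the zweibein on
the axis, `R Rᵗ` for the propagator `R = prop m 0 y` from the axis to `y`
(`deformedMetric_eq_flatMetric`).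

*Variation.* Varying the connection at `x` changes a component of `𝓔(y)` through the kernels `kerK`
(symmetric part, a complex number `K`) and `kerZ` (rotational part, a real number `ζ`). They are
obtained by conjugation with the propagator from `x` to `y`, and hence obey the linear system
`∂ₓK = -2i h ζ m`, `∂ₓζ = 2 h Im(m K̄)` (`hasDerivAt_kerK`, `hasDerivAt_kerZ`), with `ζ = 0` at
`x = y`. The variation of the connection in turn is the covariant derivative of a variation of the
frame, because the connection is flat in the directions of the branch and of the variation
(`dsymPart_comm`, `drotPart_comm`). An integration by parts then removes the rotational part and the
contribution of the axis, and leaves a half-integral over `y` of `√x K / √(y (y - x))` paired with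
the derivative of `√ρ` times the variation of `μ` (`variation_eq`, `hasDerivAt_smearedE`). The
functional derivative of a smeared component is thus, up to a phase and scalar factors, the
derivative of that half-integral, `smearK` (`isFunctionalDeriv_smearedE`).

*Bracket.* In the bracket of `μ` and `μ̄` the exponential cancels the phases of the rotated frame,
the remaining factors cancel those of the functional derivatives, and the step function integrates
one of the two derivatives back. The bracket of two smeared components is therefore
`2π G₂ ∫ ⟨k₁', k₂⟩ dx`, with `k₁`, `k₂` the two half-integrals (`hasPoissonBracket_funDeriv`).

*Evaluation.* For `x < y₂ < y₁` the product of the `x`-derivative of the kernel for `y₁` with the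
kernel for `y₂` is the total derivative of `primK / (y₁ - y₂)` (`hasDerivAt_primK`). The
primitive vanishes at `x = y₂`. At the axis it is an algebraic expression in `𝓔(y₁)` and `𝓔(y₂)`,
namely `-8` times the quadratic expression `quadE` (`axisPairing_entryL`). This is where
`1 / (ρ(1) - ρ(2))` and `Ω` come from.

*Convergence.* The `x`-derivative at fixed `y` of `√x K / √(y - x)` is of order `(y - x)^(-3/2)`, so
the half-integral cannot be differentiated in these coordinates. It is differentiated at fixed
`u = y - x`, which needs bounds on the derivative of the propagator along the diagonal
(`exists_propBounds`). An integration by parts in `x` antisymmetrizes the pairing, and passing back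
to `(y₁, y₂)` costs the `u`-derivative of a product that vanishes at `u₁ = u₂` and beyond the
supports (`integral_pairing`). The outcome is an absolutely convergent integral over `y₂ < y₁` of
`(Ψ(y₁, y₂) - Ψ(y₂, y₁)) / (y₁ - y₂)` (`integral_smearK_weightK`), which is the principal value of
`Ψ / (y₁ - y₂)` over the square (`tendsto_truncated`).

The two families of brackets are this result, `exists_hasPoissonBracket_smearedE`, in the
coordinates `y = ρ(x)` and `y = (w + ρ⁺) / 2`; the two quadratic expressions agree because `Ω` is
invariant under transposition in both factors (`quadM_eq_quadE`).
-/

section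
open scoped Matrix.Norms.Operator RealInnerProductSpace

noncomputable section
namespace CylGravity

/-! ### Linear transport equations with integrable coefficients -/

/-- Real `2 × 2` matrices, with the `L^∞` operator norm. -/
abbrev M2 := Matrix (Fin 2) (Fin 2) ℝ

/-- The topology of `M2` that the norm induces; it is the entrywise one, but not by unfolding
instances. -/
@[reducible] def topologicalSpaceM2 : TopologicalSpace M2 :=
  (Matrix.linftyOpNormedAddCommGroup :
    NormedAddCommGroup M2).toPseudoMetricSpace.toUniformSpace.toTopologicalSpace

attribute [local instance 2000] topologicalSpaceM2

/-- A connection along `(a, b)`: continuous in the interior, and integrable, so that integrable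
singularities at the two ends are allowed. -/
structure IsConn {E : Type*} [NormedAddCommGroup E] (A : ℝ → E) (a b : ℝ) : Prop where
  le : a ≤ b
  cont : ContinuousOn A (Ioo a b)
  int : IntegrableOn A (Ioo a b)

/-- `R` is the parallel transport of `A` towards `b`: `R' = -A R` and `R b = 1`. -/
structure IsTransport (A : ℝ → M2) (a b : ℝ) (R : ℝ → M2) : Prop where
  cont : ContinuousOn R (Icc a b)
  deriv : ∀ z ∈ Ioo a b, HasDerivAt R (-(A z * R z)) z
  final : R b = 1

section
variable {E : Type*} [NormedAddCommGroup E]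

theorem IsConn.intervalIntegrable {A : ℝ → E} {a b : ℝ} (h : IsConn A a b) {z : ℝ}
    (hz : z ∈ Icc a b) : IntervalIntegrable A volume z b := by
  rw [intervalIntegrable_iff_integrableOn_Ioo_of_le hz.2]
  exact h.int.mono_set (Ioo_subset_Ioo_left hz.1)

theorem IsConn.mono {A : ℝ → E} {a b : ℝ} (h : IsConn A a b) {a' b' : ℝ}
    (ha : a ≤ a') (hb : b' ≤ b) (hab : a' ≤ b') : IsConn A a' b' :=
  ⟨hab, h.cont.mono (Ioo_subset_Ioo ha hb), h.int.mono_set (Ioo_subset_Ioo ha hb)⟩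

theorem IsConn.norm {A : ℝ → E} {a b : ℝ} (h : IsConn A a b) : IsConn (fun z => ‖A z‖) a b :=
  ⟨h.le, h.cont.norm, h.int.norm⟩

variable [NormedSpace ℝ E]

theorem IsConn.hasDerivAt_integral [CompleteSpace E] {A : ℝ → E} {a b : ℝ} (h : IsConn A a b) {z : ℝ}
    (hz : z ∈ Ioo a b) : HasDerivAt (fun u => ∫ x in u..b, A x) (-A z) z := by
  have hn : Ioo a b ∈ 𝓝 z := isOpen_Ioo.mem_nhds hz
  exact intervalIntegral.integral_hasDerivAt_left (h.intervalIntegrable ⟨hz.1.le, hz.2.le⟩)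
    (h.cont.stronglyMeasurableAtFilter isOpen_Ioo z hz) (h.cont.continuousAt hn)

theorem IsConn.continuousOn_integral {A : ℝ → E} {a b : ℝ} (h : IsConn A a b) :
    ContinuousOn (fun u => ∫ x in u..b, A x) (Icc a b) := by
  have := intervalIntegral.continuousOn_primitive_interval_left (a := a) (b := b) (f := A)
    (μ := volume) (by rw [uIcc_of_le h.le, integrableOn_Icc_iff_integrableOn_Ioo]; exact h.int)
  rwa [uIcc_of_le h.le] at this

end

theorem IsConn.mul_continuousOn {A T : ℝ → M2} {a b : ℝ} (h : IsConn A a b)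
    (hT : ContinuousOn T (Icc a b)) : IsConn (fun z => A z * T z) a b := by
  refine ⟨h.le, h.cont.mul (hT.mono Ioo_subset_Icc_self), ?_⟩
  have h1 : IntegrableOn A (Icc a b) := by
    rw [integrableOn_Icc_iff_integrableOn_Ioo]; exact h.int
  obtain ⟨C, hC⟩ := isCompact_Icc.exists_bound_of_continuousOn hT
  refine Integrable.mono' (h.int.norm.mul_const C)
    ((h.cont.mul (hT.mono Ioo_subset_Icc_self)).aestronglyMeasurable measurableSet_Ioo) ?_
  filter_upwards [ae_restrict_mem measurableSet_Ioo] with z hz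
  exact (norm_mul_le _ _).trans
    (mul_le_mul_of_nonneg_left (hC z (Ioo_subset_Icc_self hz)) (norm_nonneg _))

theorem pathOrdTerm_succ_eq {A : ℝ → M2} {a b : ℝ} {s : ℕ}
    (h : IntervalIntegrable (fun z => A z * pathOrdTerm A b s z) volume a b) :
    pathOrdTerm A b (s + 1) a = ∫ z in a..b, A z * pathOrdTerm A b s z := by
  ext i j
  have := ContinuousLinearMap.intervalIntegral_comp_comm
    (LinearMap.toContinuousLinearMap (entryLinearMap ℝ ℝ i j : M2 →ₗ[ℝ] ℝ)) h
  simpa [pathOrdTerm] using this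

/-- The size of a connection measured from `z` to the end point. -/
def tail (A : ℝ → M2) (b z : ℝ) : ℝ := ∫ x in z..b, ‖A x‖

/-- `tail` is a primitive of `-‖A‖`, so the iterated integrals of `‖A‖` are its powers over the
factorials. -/
theorem IsConn.integral_tail_pow {A : ℝ → M2} {a b : ℝ} (h : IsConn A a b) (s : ℕ) {z : ℝ}
    (hz : z ∈ Icc a b) :
    IntervalIntegrable (fun x => ‖A x‖ * (tail A b x ^ s / s.factorial)) volume z b ∧
    ∫ x in z..b, ‖A x‖ * (tail A b x ^ s / s.factorial)
      = tail A b z ^ (s + 1) / (s + 1).factorial := by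
  have hc : ContinuousOn (tail A b) (Icc a b) := h.norm.continuousOn_integral
  have hi : IntervalIntegrable (fun x => ‖A x‖ * (tail A b x ^ s / s.factorial)) volume z b := by
    refine (h.norm.intervalIntegrable hz).mul_continuousOn ?_
    rw [uIcc_of_le hz.2]
    exact ((hc.mono (Icc_subset_Icc_left hz.1)).pow s).div_const _
  refine ⟨hi, ?_⟩
  have := intervalIntegral.integral_eq_sub_of_hasDerivAt_of_le hz.2
    (f := fun x => -(tail A b x ^ (s + 1) / (s + 1).factorial))
    (f' := fun x => ‖A x‖ * (tail A b x ^ s / s.factorial))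
    (((hc.mono (Icc_subset_Icc_left hz.1)).pow _).div_const _).neg
    (fun x hx => by
      have h1 := h.norm.hasDerivAt_integral (z := x) ⟨hz.1.trans_lt hx.1, hx.2⟩
      have h2 := ((h1.pow (s + 1)).div_const ((s + 1).factorial : ℝ)).neg
      refine h2.congr_deriv ?_
      have : ((s.factorial : ℕ) : ℝ) ≠ 0 := by positivity
      rw [Nat.factorial_succ]; push_cast
      have h3 : (s : ℝ) + 1 ≠ 0 := by positivity
      simp only [tail]
      field_simp) hi
  rw [this]
  simp [tail]

/-- The iterated integrals are continuous, with the factorial bound that makes their series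
converge. -/
theorem IsConn.pathOrdTerm_props {A : ℝ → M2} {a b : ℝ} (h : IsConn A a b) (s : ℕ) :
    ContinuousOn (pathOrdTerm A b s) (Icc a b) ∧
      ∀ z ∈ Icc a b, ‖pathOrdTerm A b s z‖ ≤ tail A b z ^ s / s.factorial := by
  induction s with
  | zero =>
    constructor
    · exact continuousOn_const
    · intro z _; simp [pathOrdTerm]
  | succ s ih =>
    have hA := h.mul_continuousOn ih.1
    have e : ∀ z ∈ Icc a b, pathOrdTerm A b (s + 1) z = ∫ x in z..b, A x * pathOrdTerm A b s x :=
      fun z hz => pathOrdTerm_succ_eq (hA.intervalIntegrable hz)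
    refine ⟨hA.continuousOn_integral.congr e, fun z hz => ?_⟩
    obtain ⟨i1, i2⟩ := h.integral_tail_pow s hz
    rw [e z hz, ← i2]
    refine intervalIntegral.norm_integral_le_of_norm_le hz.2 (Eventually.of_forall fun x hx => ?_) i1
    exact (norm_mul_le _ _).trans
      (mul_le_mul_of_nonneg_left (ih.2 x ⟨hz.1.trans hx.1.le, hx.2⟩) (norm_nonneg _))

theorem tail_nonneg {A : ℝ → M2} {b z : ℝ} (h : z ≤ b) : 0 ≤ tail A b z :=
  intervalIntegral.integral_nonneg h fun _ _ => norm_nonneg _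

theorem IsConn.tail_anti {A : ℝ → M2} {a b : ℝ} (h : IsConn A a b) {z : ℝ} (hz : z ∈ Icc a b) :
    tail A b z ≤ tail A b a := by
  refine intervalIntegral.integral_mono_interval hz.1 hz.2 le_rfl
    (Eventually.of_forall fun _ => norm_nonneg _) ?_
  exact h.norm.intervalIntegrable ⟨le_rfl, h.le⟩

/-- The path ordered exponential converges, and is the parallel transport. -/
theorem IsConn.isTransport {A : ℝ → M2} {a b : ℝ} (h : IsConn A a b) :
    IsTransport A a b (fun z => pathOrdExp A z b) ∧
      ∀ z ∈ Icc a b, ‖pathOrdExp A z b‖ ≤ Real.exp (tail A b z) := by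
  have hs : Summable fun s : ℕ => tail A b a ^ s / s.factorial := Real.summable_pow_div_factorial _
  have hb : ∀ s, ∀ z ∈ Icc a b, ‖pathOrdTerm A b s z‖ ≤ tail A b a ^ s / s.factorial := by
    intro s z hz
    refine ((h.pathOrdTerm_props s).2 z hz).trans ?_
    gcongr
    · exact tail_nonneg hz.2
    · exact h.tail_anti hz
  have hsum : ∀ z ∈ Icc a b, Summable fun s => pathOrdTerm A b s z := fun z hz =>
    Summable.of_norm_bounded hs fun s => hb s z hz
  have hc : ContinuousOn (fun z => pathOrdExp A z b) (Icc a b) :=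
    continuousOn_tsum (fun s => (h.pathOrdTerm_props s).1) hs hb
  have hAR := h.mul_continuousOn hc
  have heq : ∀ z ∈ Icc a b, pathOrdExp A z b = 1 + ∫ x in z..b, A x * pathOrdExp A x b := by
    intro z hz
    have hI : HasSum (fun s => ∫ x in z..b, A x * pathOrdTerm A b s x)
        (∫ x in z..b, A x * pathOrdExp A x b) := by
      refine intervalIntegral.hasSum_integral_of_dominated_convergence
        (fun s x => ‖A x‖ * (tail A b a ^ s / s.factorial)) ?_ ?_ ?_ ?_ ?_
      · intro s
        rw [uIoc_of_le hz.2]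
        exact ((h.mul_continuousOn (h.pathOrdTerm_props s).1).intervalIntegrable
          hz).1.aestronglyMeasurable
      · intro s
        refine Eventually.of_forall fun x hx => ?_
        rw [uIoc_of_le hz.2] at hx
        exact (norm_mul_le _ _).trans
          (mul_le_mul_of_nonneg_left (hb s x ⟨hz.1.trans hx.1.le, hx.2⟩) (norm_nonneg _))
      · exact Eventually.of_forall fun x _ => hs.mul_left _
      · simp_rw [tsum_mul_left]
        exact (h.norm.intervalIntegrable hz).mul_const _
      · refine Eventually.of_forall fun x hx => ?_
        rw [uIoc_of_le hz.2] at hx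
        exact (hsum x ⟨hz.1.trans hx.1.le, hx.2⟩).hasSum.mul_left _
    have e : ∀ s, pathOrdTerm A b (s + 1) z = ∫ x in z..b, A x * pathOrdTerm A b s x := fun s =>
      pathOrdTerm_succ_eq
        ((h.mul_continuousOn (h.pathOrdTerm_props s).1).intervalIntegrable hz)
    have h0 : pathOrdExp A z b = pathOrdTerm A b 0 z + ∑' s, pathOrdTerm A b (s + 1) z :=
      (hsum z hz).tsum_eq_zero_add
    rw [h0]
    simp_rw [e]
    rw [hI.tsum_eq]
    rfl
  refine ⟨⟨hc, fun z hz => ?_, ?_⟩, fun z hz => ?_⟩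
  · have hn : Ioo a b ∈ 𝓝 z := isOpen_Ioo.mem_nhds hz
    refine ((hAR.hasDerivAt_integral hz).const_add 1).congr_of_eventuallyEq ?_
    filter_upwards [hn] with w hw using heq w (Ioo_subset_Icc_self hw)
  · have := heq b ⟨h.le, le_rfl⟩
    simpa using this
  · have h1 : Summable fun s : ℕ => tail A b z ^ s / s.factorial :=
      Real.summable_pow_div_factorial _
    refine (tsum_of_norm_bounded h1.hasSum fun s => (h.pathOrdTerm_props s).2 z hz).trans ?_
    rw [Real.exp_eq_exp_ℝ, NormedSpace.exp_eq_tsum_div]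

/-- For a traceless `A` the adjugate of `R` satisfies the dual transport equation: adjugates stand
for the inverses of transports, which have determinant one. -/
theorem adjugate_neg_mul_of_trace_zero {A R : M2} (h : A.trace = 0) :
    (-(A * R)).adjugate = R.adjugate * A := by
  have : A 1 1 = - A 0 0 := by rw [trace_fin_two] at h; linarith
  ext i j
  fin_cases i <;> fin_cases j <;>
    simp [adjugate_fin_two, Matrix.mul_apply, Fin.sum_univ_two, this] <;> ring

/-- For `2 × 2` matrices the adjugate is linear. -/
def adjL : M2 →L[ℝ] M2 := LinearMap.toContinuousLinearMap
  { toFun := adjugate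
    map_add' := fun A B => by
      ext i j; fin_cases i <;> fin_cases j <;> simp [adjugate_fin_two] <;> ring
    map_smul' := fun c A => by
      ext i j; fin_cases i <;> fin_cases j <;> simp [adjugate_fin_two] }

@[simp] theorem adjL_apply (A : M2) : adjL A = A.adjugate := rfl

theorem IsTransport.hasDerivAt_adjugate {A : ℝ → M2} {a b : ℝ} {R : ℝ → M2}
    (h : IsTransport A a b R) (htr : ∀ z, (A z).trace = 0) {z : ℝ} (hz : z ∈ Ioo a b) :
    HasDerivAt (fun z => (R z).adjugate) ((R z).adjugate * A z) z := by
  have := adjL.hasFDerivAt.comp_hasDerivAt z (h.deriv z hz)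
  refine this.congr_deriv ?_
  rw [adjL_apply, adjugate_neg_mul_of_trace_zero (htr z)]

theorem IsTransport.continuousOn_adjugate {A : ℝ → M2} {a b : ℝ} {R : ℝ → M2}
    (h : IsTransport A a b R) : ContinuousOn (fun z => (R z).adjugate) (Icc a b) :=
  adjL.continuous.comp_continuousOn h.cont

theorem eq_of_hasDerivAt_zero {f : ℝ → M2} {a b : ℝ} (hc : ContinuousOn f (Icc a b))
    (hd : ∀ z ∈ Ioo a b, HasDerivAt f 0 z) {z : ℝ} (hz : z ∈ Icc a b) : f z = f b := by
  have := intervalIntegral.integral_eq_sub_of_hasDerivAt_of_le hz.2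
    (hc.mono (Icc_subset_Icc_left hz.1)) (f' := fun _ => 0)
    (fun x hx => hd x ⟨hz.1.trans_lt hx.1, hx.2⟩) (by simp)
  simp only [intervalIntegral.integral_zero] at this
  exact (sub_eq_zero.1 this.symm).symm

/-- Uniqueness: the adjugate of one solution inverts every other one. -/
theorem IsTransport.adjugate_mul {A : ℝ → M2} {a b : ℝ} {R S : ℝ → M2}
    (h : IsTransport A a b R) (h' : IsTransport A a b S) (htr : ∀ z, (A z).trace = 0) {z : ℝ}
    (hz : z ∈ Icc a b) : (R z).adjugate * S z = 1 := by
  have := eq_of_hasDerivAt_zero (f := fun z => (R z).adjugate * S z)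
    (h.continuousOn_adjugate.mul h'.cont) (fun x hx => by
      refine ((h.hasDerivAt_adjugate htr hx).mul (h'.deriv x hx)).congr_deriv ?_
      rw [Matrix.mul_neg, Matrix.mul_assoc, add_neg_cancel]) hz
  simpa [h.final, h'.final] using this

theorem IsTransport.det_eq_one {A : ℝ → M2} {a b : ℝ} {R : ℝ → M2}
    (h : IsTransport A a b R) (htr : ∀ z, (A z).trace = 0) {z : ℝ}
    (hz : z ∈ Icc a b) : (R z).det = 1 := by
  have h1 := h.adjugate_mul h htr hz
  rw [Matrix.adjugate_mul] at h1
  have := congrFun (congrFun h1 0) 0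
  simpa using this

theorem IsTransport.mul_adjugate {A : ℝ → M2} {a b : ℝ} {R : ℝ → M2}
    (h : IsTransport A a b R) (htr : ∀ z, (A z).trace = 0) {z : ℝ}
    (hz : z ∈ Icc a b) : R z * (R z).adjugate = 1 := by
  rw [Matrix.mul_adjugate, h.det_eq_one htr hz, one_smul]

/-- Two transports `R`, `S` of the same connection agree, since `R⁻¹ S` is constant. -/
theorem IsTransport.unique {A : ℝ → M2} {a b : ℝ} {R S : ℝ → M2}
    (h : IsTransport A a b R) (h' : IsTransport A a b S) (htr : ∀ z, (A z).trace = 0) {z : ℝ}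
    (hz : z ∈ Icc a b) : S z = R z := by
  have h1 := h.adjugate_mul h' htr hz
  calc S z = R z * ((R z).adjugate * S z) := by
        rw [← Matrix.mul_assoc, h.mul_adjugate htr hz, Matrix.one_mul]
    _ = R z := by rw [h1, Matrix.mul_one]

theorem IsTransport.eq_pathOrdExp {A : ℝ → M2} {a b : ℝ} {R : ℝ → M2} (hA : IsConn A a b)
    (h : IsTransport A a b R) (htr : ∀ z, (A z).trace = 0) {z : ℝ}
    (hz : z ∈ Icc a b) : pathOrdExp A z b = R z :=
  h.unique hA.isTransport.1 htr hz

theorem IsTransport.norm_le {A : ℝ → M2} {a b : ℝ} {R : ℝ → M2} (hA : IsConn A a b)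
    (h : IsTransport A a b R) (htr : ∀ z, (A z).trace = 0) {z : ℝ}
    (hz : z ∈ Icc a b) : ‖R z‖ ≤ Real.exp (tail A b a) := by
  rw [← h.eq_pathOrdExp hA htr hz]
  exact (hA.isTransport.2 z hz).trans (Real.exp_le_exp.2 (hA.tail_anti hz))

theorem norm_adjugate_le (A : M2) : ‖A.adjugate‖ ≤ 2 * ‖A‖ := by
  have h : ∀ i j, |A i j| ≤ ‖A‖ := by
    intro i j
    have : ‖A i j‖₊ ≤ ‖A‖₊ := by
      rw [Matrix.linfty_opNNNorm_def]
      exact (Finset.single_le_sum (f := fun j => ‖A i j‖₊) (fun _ _ => zero_le)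
        (Finset.mem_univ j)).trans (Finset.le_sup (f := fun i => ∑ j, ‖A i j‖₊) (Finset.mem_univ i))
    exact_mod_cast this
  have h2 : ‖A.adjugate‖₊ ≤ 2 * ‖A‖₊ := by
    rw [Matrix.linfty_opNNNorm_def]
    refine Finset.sup_le fun i _ => ?_
    rw [← NNReal.coe_le_coe]
    fin_cases i <;> simp [adjugate_fin_two, Fin.sum_univ_two]
    · linarith [h 1 1, h 0 1]
    · linarith [h 1 0, h 0 0]
  exact_mod_cast h2

/-- Duhamel's formula comparing two transports. -/
theorem IsTransport.duhamel {A B : ℝ → M2} {a b : ℝ} {R S : ℝ → M2} (hA : IsConn A a b)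
    (hB : IsConn B a b) (hR : IsTransport A a b R) (hS : IsTransport B a b S)
    (htr : ∀ z, (A z).trace = 0) {z : ℝ} (hz : z ∈ Icc a b) :
    S z = R z + R z * ∫ x in z..b, (R x).adjugate * (B x - A x) * S x := by
  have hi : IntervalIntegrable (fun x => (R x).adjugate * (B x - A x) * S x) volume z b := by
    have h1 := (hB.mul_continuousOn hS.cont).intervalIntegrable hz
    have h2 := (hA.mul_continuousOn hS.cont).intervalIntegrable hz
    have h3 := (h1.sub h2).continuousOn_mul (g := fun x => (R x).adjugate) (by
      rw [uIcc_of_le hz.2]; exact hR.continuousOn_adjugate.mono (Icc_subset_Icc_left hz.1))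
    refine h3.congr (fun x _ => ?_)
    simp [Matrix.mul_assoc, Matrix.sub_mul, Matrix.mul_sub]
  have := intervalIntegral.integral_eq_sub_of_hasDerivAt_of_le hz.2
    (f := fun z => -((R z).adjugate * S z))
    (f' := fun x => (R x).adjugate * (B x - A x) * S x)
    ((hR.continuousOn_adjugate.mul hS.cont).mono (Icc_subset_Icc_left hz.1)).neg (fun x hx => by
      have hx' : x ∈ Ioo a b := ⟨hz.1.trans_lt hx.1, hx.2⟩
      refine ((hR.hasDerivAt_adjugate htr hx').mul (hS.deriv x hx')).neg.congr_deriv ?_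
      simp only [Matrix.mul_assoc, Matrix.sub_mul, Matrix.mul_sub, Matrix.mul_neg]
      abel) hi
  rw [this, hR.final, hS.final]
  simp only [adjugate_one, Matrix.mul_one]
  rw [Matrix.mul_sub, Matrix.mul_neg, Matrix.mul_neg, Matrix.mul_one, ← Matrix.mul_assoc,
    hR.mul_adjugate htr hz, Matrix.one_mul]
  abel

/-- Transports depend on their connections in a Lipschitz way. -/
theorem IsTransport.norm_sub_le {A B : ℝ → M2} {a b : ℝ} {R S : ℝ → M2} (hA : IsConn A a b)
    (hB : IsConn B a b) (hR : IsTransport A a b R) (hS : IsTransport B a b S)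
    (htr : ∀ z, (A z).trace = 0) (htr' : ∀ z, (B z).trace = 0) {z : ℝ} (hz : z ∈ Icc a b)
    {T : ℝ} (hTA : tail A b a ≤ T) (hTB : tail B b a ≤ T) {g : ℝ → ℝ}
    (hg : IntegrableOn g (Ioo a b)) (hBA : ∀ x ∈ Ioo a b, ‖B x - A x‖ ≤ g x) :
    ‖S z - R z‖ ≤ 2 * Real.exp T ^ 3 * ∫ x in Ioo a b, g x := by
  rw [hR.duhamel hA hB hS htr hz, add_sub_cancel_left]
  have bR : ∀ x ∈ Icc a b, ‖R x‖ ≤ Real.exp T := fun x hx =>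
    (hR.norm_le hA htr hx).trans (Real.exp_le_exp.2 hTA)
  have bS : ∀ x ∈ Icc a b, ‖S x‖ ≤ Real.exp T := fun x hx =>
    (hS.norm_le hB htr' hx).trans (Real.exp_le_exp.2 hTB)
  have hgi : IntegrableOn (fun x => 2 * Real.exp T ^ 2 * g x) (Ioo a b) := hg.const_mul _
  have g0 : ∀ x ∈ Ioo a b, 0 ≤ g x := fun x hx => (norm_nonneg _).trans (hBA x hx)
  have h1 : ‖∫ x in z..b, (R x).adjugate * (B x - A x) * S x‖
      ≤ ∫ x in Ioo a b, 2 * Real.exp T ^ 2 * g x := by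
    rw [intervalIntegral.integral_of_le hz.2, integral_Ioc_eq_integral_Ioo]
    calc _ ≤ ∫ x in Ioo z b, 2 * Real.exp T ^ 2 * g x := by
          refine norm_integral_le_of_norm_le (hgi.mono_set (Ioo_subset_Ioo_left hz.1)) ?_
          filter_upwards [ae_restrict_mem measurableSet_Ioo] with x hx
          have hx' : x ∈ Ioo a b := ⟨hz.1.trans_lt hx.1, hx.2⟩
          have hx'' := Ioo_subset_Icc_self hx'
          calc ‖(R x).adjugate * (B x - A x) * S x‖
              ≤ ‖(R x).adjugate‖ * ‖B x - A x‖ * ‖S x‖ :=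
                (norm_mul_le _ _).trans (mul_le_mul_of_nonneg_right (norm_mul_le _ _)
                  (norm_nonneg _))
            _ ≤ (2 * Real.exp T) * g x * Real.exp T := by
                have := g0 x hx'
                gcongr
                · exact (norm_adjugate_le _).trans (by gcongr; exact bR x hx'')
                · exact hBA x hx'
                · exact bS x hx''
            _ = _ := by ring
      _ ≤ _ := by
          refine setIntegral_mono_set hgi ?_ (Ioo_subset_Ioo_left hz.1).eventuallyLE
          filter_upwards [ae_restrict_mem measurableSet_Ioo] with x hx
          have := g0 x hx
          simp only [Pi.zero_apply]
          positivity
  rw [integral_const_mul] at h1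
  calc _ ≤ ‖R z‖ * ‖∫ x in z..b, (R x).adjugate * (B x - A x) * S x‖ := norm_mul_le _ _
    _ ≤ Real.exp T * (2 * Real.exp T ^ 2 * ∫ x in Ioo a b, g x) := by
        gcongr
        exact bR z hz
    _ = _ := by ring

theorem tail_le_add {A B : ℝ → M2} {a b : ℝ} (hA : IsConn A a b) (hB : IsConn B a b) {g : ℝ → ℝ}
    (hg : IntegrableOn g (Ioo a b)) (hBA : ∀ x ∈ Ioo a b, ‖B x - A x‖ ≤ g x) :
    tail B b a ≤ tail A b a + ∫ x in Ioo a b, g x := by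
  unfold tail
  rw [intervalIntegral.integral_of_le hA.le, intervalIntegral.integral_of_le hA.le,
    integral_Ioc_eq_integral_Ioo, integral_Ioc_eq_integral_Ioo, ← integral_add hA.int.norm hg]
  refine setIntegral_mono_on hB.int.norm (hA.int.norm.add hg) measurableSet_Ioo fun x hx => ?_
  calc ‖B x‖ = ‖A x + (B x - A x)‖ := by rw [add_sub_cancel]
    _ ≤ _ := (norm_add_le _ _).trans (add_le_add_right (hBA x hx) _)

section Parameter
variable {H : Type*} [NormedAddCommGroup H] [NormedSpace ℝ H]

/-- Duhamel's formula, divided by the increment of the parameter, gives the derivative of the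
transport with respect to a parameter by dominated convergence. -/
theorem hasFDerivAt_transport {A R : H → ℝ → M2} {a b : ℝ} {p₀ : H} {s : Set H} (hs : s ∈ 𝓝 p₀)
    (hA : ∀ p ∈ s, IsConn (A p) a b) (hR : ∀ p ∈ s, IsTransport (A p) a b (R p))
    (htr : ∀ p z, (A p z).trace = 0) {g : ℝ → ℝ} (hg : IntegrableOn g (Ioo a b))
    (hlip : ∀ p ∈ s, ∀ x ∈ Ioo a b, ‖A p x - A p₀ x‖ ≤ g x * ‖p - p₀‖) {A' : ℝ → H →L[ℝ] M2}
    (hA' : ∀ x ∈ Ioo a b, HasFDerivAt (fun p => A p x) (A' x) p₀)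
    (hA'c : ContinuousOn A' (Ioo a b)) {z : ℝ} (hz : z ∈ Icc a b) :
    IntegrableOn (fun x => (ContinuousLinearMap.mulLeftRight ℝ M2 (R p₀ x).adjugate
          (R p₀ x)).comp (A' x)) (Ioo z b) ∧
    HasFDerivAt (fun p => R p z) ((ContinuousLinearMap.mul ℝ M2 (R p₀ z)).comp
      (∫ x in Ioo z b, (ContinuousLinearMap.mulLeftRight ℝ M2 (R p₀ x).adjugate
          (R p₀ x)).comp (A' x))) p₀ := by
  have hp₀ : p₀ ∈ s := mem_of_mem_nhds hs
  have hsub : Ioo z b ⊆ Ioo a b := Ioo_subset_Ioo_left hz.1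
  set s' := s ∩ Metric.ball p₀ 1 with hs'
  have hs'n : s' ∈ 𝓝 p₀ := inter_mem hs (Metric.ball_mem_nhds _ one_pos)
  have hgi : IntegrableOn (fun x => |g x|) (Ioo a b) := hg.abs
  -- a common bound on the size of the connections near `p₀`, hence on their transports
  set T : ℝ := tail (A p₀) b a + ∫ x in Ioo a b, |g x| with hT
  have hg0 : 0 ≤ ∫ x in Ioo a b, |g x| := integral_nonneg fun _ => abs_nonneg _
  have hT0 : tail (A p₀) b a ≤ T := by linarith
  have hTp : ∀ p ∈ s', tail (A p) b a ≤ T := fun p hp =>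
    tail_le_add (hA p₀ hp₀) (hA p hp.1) hgi fun x hx => by
      have h1 := hlip p hp.1 x hx
      have h2 : ‖p - p₀‖ ≤ 1 := by
        have := hp.2; rw [Metric.mem_ball, dist_eq_norm] at this; exact this.le
      calc _ ≤ g x * ‖p - p₀‖ := h1
        _ ≤ |g x| * 1 := mul_le_mul (le_abs_self _) h2 (norm_nonneg _) (abs_nonneg _)
        _ = _ := mul_one _
  have bR : ∀ p ∈ s', ∀ x ∈ Icc a b, ‖R p x‖ ≤ Real.exp T := fun p hp x hx =>
    ((hR p hp.1).norm_le (hA p hp.1) (htr p) hx).trans (Real.exp_le_exp.2 (hTp p hp))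
  have hp₀' : p₀ ∈ s' := mem_of_mem_nhds hs'n
  have hRlip : ∀ p ∈ s', ∀ x ∈ Icc a b, ‖R p x - R p₀ x‖ ≤
      (2 * Real.exp T ^ 3 * ∫ x in Ioo a b, g x) * ‖p - p₀‖ := by
    intro p hp x hx
    have := (hR p₀ hp₀).norm_sub_le (hA p₀ hp₀) (hA p hp.1) (hR p hp.1) (htr p₀) (htr p) hx hT0
      (hTp p hp) (hg.mul_const ‖p - p₀‖) (hlip p hp.1)
    rw [integral_mul_const] at this
    linarith
  have hRcont : ∀ x ∈ Icc a b, Tendsto (fun p => R p x) (𝓝 p₀) (𝓝 (R p₀ x)) := by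
    intro x hx
    rw [tendsto_iff_norm_sub_tendsto_zero]
    refine squeeze_zero' (Eventually.of_forall fun _ => norm_nonneg _)
      (Filter.mem_of_superset hs'n fun p hp => hRlip p hp x hx) ?_
    have : Tendsto (fun p : H => ‖p - p₀‖) (𝓝 p₀) (𝓝 0) := by
      have := (tendsto_id (α := H) (x := 𝓝 p₀)).sub_const p₀
      simpa using this.norm
    simpa using this.const_mul (2 * Real.exp T ^ 3 * ∫ x in Ioo a b, g x)
  have hF := hasFDerivAt_integral_of_dominated_loc_of_lip' (𝕜 := ℝ) (μ := volume.restrict (Ioo z b))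
    (F := fun p x => (R p₀ x).adjugate * (A p x - A p₀ x) * R p x) (x₀ := p₀)
    (F' := fun x => (ContinuousLinearMap.mulLeftRight ℝ M2 (R p₀ x).adjugate
          (R p₀ x)).comp (A' x)) (bound := fun x => 2 * Real.exp T ^ 2 * g x) hs'n
    (fun p hp => (((((hR p₀ hp₀).continuousOn_adjugate.mono Ioo_subset_Icc_self).mul
        ((hA p hp.1).cont.sub (hA p₀ hp₀).cont)).mul
        ((hR p hp.1).cont.mono Ioo_subset_Icc_self)).mono hsub).aestronglyMeasurable
          measurableSet_Ioo)
    (by simp)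
    (by
      refine ContinuousOn.aestronglyMeasurable ?_ measurableSet_Ioo
      have c1 := ((hR p₀ hp₀).continuousOn_adjugate.mono Ioo_subset_Icc_self).mono hsub
      have c2 := ((hR p₀ hp₀).cont.mono Ioo_subset_Icc_self).mono hsub
      have c3 := hA'c.mono hsub
      have c4 : ContinuousOn (fun x => ContinuousLinearMap.mulLeftRight ℝ M2
          (R p₀ x).adjugate (R p₀ x)) (Ioo z b) :=
        ((ContinuousLinearMap.mulLeftRight ℝ M2).continuous.comp_continuousOn c1).clm_apply c2
      exact c4.clm_comp c3)
    (by
      filter_upwards [ae_restrict_mem measurableSet_Ioo] with x hx p hp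
      have hx' := hsub hx
      have hx'' := Ioo_subset_Icc_self hx'
      simp only [sub_self, Matrix.mul_zero, Matrix.zero_mul, sub_zero]
      have g0 : 0 ≤ g x * ‖p - p₀‖ := (norm_nonneg _).trans (hlip p hp.1 x hx')
      calc ‖(R p₀ x).adjugate * (A p x - A p₀ x) * R p x‖
          ≤ ‖(R p₀ x).adjugate‖ * ‖A p x - A p₀ x‖ * ‖R p x‖ :=
            (norm_mul_le _ _).trans (mul_le_mul_of_nonneg_right (norm_mul_le _ _)
              (norm_nonneg _))
        _ ≤ (2 * Real.exp T) * (g x * ‖p - p₀‖) * Real.exp T := by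
            gcongr
            · exact (norm_adjugate_le _).trans (by gcongr; exact bR p₀ hp₀' x hx'')
            · exact hlip p hp.1 x hx'
            · exact bR p hp x hx''
        _ = _ := by ring)
    ((hg.mono_set hsub).const_mul _)
    (by
      filter_upwards [ae_restrict_mem measurableSet_Ioo] with x hx
      have hx' := hsub hx
      have hx'' := Ioo_subset_Icc_self hx'
      have h1 := (hA' x hx').isLittleO
      rw [hasFDerivAt_iff_isLittleO]
      -- the first term on the right is a product of two small increments, the second is the
      -- linearization error of the connection
      have e : ∀ p, (R p₀ x).adjugate * (A p x - A p₀ x) * R p x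
          - (R p₀ x).adjugate * (A p₀ x - A p₀ x) * R p₀ x
          - ((ContinuousLinearMap.mulLeftRight ℝ M2 (R p₀ x).adjugate
          (R p₀ x)).comp (A' x)) (p - p₀)
          = (R p₀ x).adjugate * (A p x - A p₀ x) * (R p x - R p₀ x)
            + (R p₀ x).adjugate * (A p x - A p₀ x - A' x (p - p₀)) * R p₀ x := by
        intro p
        simp only [ContinuousLinearMap.comp_apply, ContinuousLinearMap.mulLeftRight_apply,
          sub_self, Matrix.mul_zero, Matrix.zero_mul, sub_zero, Matrix.mul_sub, Matrix.sub_mul]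
        abel
      simp_rw [e]
      refine Asymptotics.IsLittleO.add ?_ ?_
      · have o1 : (fun p => A p x - A p₀ x) =O[𝓝 p₀] fun p => p - p₀ := (hA' x hx').isBigO_sub
        have o2 : (fun p => R p x - R p₀ x) =o[𝓝 p₀] fun _ => (1 : ℝ) := by
          rw [Asymptotics.isLittleO_one_iff]
          simpa using (hRcont x hx'').sub_const (R p₀ x)
        have o3 : (fun p => (R p₀ x).adjugate * (A p x - A p₀ x)) =O[𝓝 p₀] fun p => ‖p - p₀‖ :=
          (o1.const_mul_left _).norm_right
        simpa using (o3.mul_isLittleO o2).norm_right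
      · have o1 : (fun p => A p x - A p₀ x - A' x (p - p₀)) =o[𝓝 p₀] fun p => ‖p - p₀‖ :=
          h1.norm_right
        have o2 := (o1.const_mul_left (R p₀ x).adjugate).mul_isBigO
          (Asymptotics.isBigO_const_const (R p₀ x) (one_ne_zero (α := ℝ)) (𝓝 p₀))
        simpa using o2.norm_right)
  refine ⟨hF.1, ?_⟩
  have h2 := ((ContinuousLinearMap.mul ℝ M2 (R p₀ z)).hasFDerivAt.comp p₀ hF.2).const_add (R p₀ z)
  refine h2.congr_of_eventuallyEq ?_
  filter_upwards [hs] with p hp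
  rw [(hR p₀ hp₀).duhamel (hA p₀ hp₀) (hA p hp) (hR p hp) (htr p₀) hz,
    intervalIntegral.integral_of_le hz.2, integral_Ioc_eq_integral_Ioo]
  rfl

end Parameter

/-- The derivative of the transport with respect to a real parameter. -/
theorem hasDerivAt_transport {A R : ℝ → ℝ → M2} {a b : ℝ} {t₀ : ℝ} {s : Set ℝ} (hs : s ∈ 𝓝 t₀)
    (hA : ∀ p ∈ s, IsConn (A p) a b) (hR : ∀ p ∈ s, IsTransport (A p) a b (R p))
    (htr : ∀ p z, (A p z).trace = 0) {g : ℝ → ℝ} (hg : IntegrableOn g (Ioo a b))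
    (hlip : ∀ p ∈ s, ∀ x ∈ Ioo a b, ‖A p x - A t₀ x‖ ≤ g x * |p - t₀|) {A' : ℝ → M2}
    (hA' : ∀ x ∈ Ioo a b, HasDerivAt (fun p => A p x) (A' x) t₀)
    (hA'c : ContinuousOn A' (Ioo a b)) {z : ℝ} (hz : z ∈ Icc a b) :
    HasDerivAt (fun p => R p z)
      (R t₀ z * ∫ x in Ioo z b, (R t₀ x).adjugate * A' x * R t₀ x) t₀ := by
  obtain ⟨h1, h2⟩ := hasFDerivAt_transport (H := ℝ) hs hA hR htr hg
    (fun p hp x hx => by simpa [Real.norm_eq_abs] using hlip p hp x hx)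
    (A' := fun x => ContinuousLinearMap.toSpanSingleton ℝ (A' x))
    (fun x hx => (hA' x hx).hasFDerivAt)
    ((ContinuousLinearMap.toSpanSingletonCLE (𝕜 := ℝ) (E := M2)).continuous.comp_continuousOn hA'c) hz
  have h3 := h2.hasDerivAt
  refine h3.congr_deriv ?_
  rw [ContinuousLinearMap.comp_apply, ContinuousLinearMap.mul_apply',
    ContinuousLinearMap.integral_apply h1]
  simp

/-! ### The propagator in the flat frame -/

/-- The symmetric traceless matrix with complex coordinate `c`. -/
def symL : ℂ →L[ℝ] M2 := LinearMap.toContinuousLinearMap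
  { toFun := fun c => !![c.re, c.im; c.im, -c.re]
    map_add' := fun a b => by
      ext i j; fin_cases i <;> fin_cases j <;> simp [add_comm]
    map_smul' := fun c a => by
      ext i j; fin_cases i <;> fin_cases j <;> simp }

theorem symL_apply (c : ℂ) : symL c = !![c.re, c.im; c.im, -c.re] := rfl

/-- A profile: the connection `m` on `(0, Y)`, with derivative `m'`. -/
structure IsProfile (Y : ℝ) (m m' : ℝ → ℂ) : Prop where
  deriv : ∀ x ∈ Ioo 0 Y, HasDerivAt m (m' x) x
  cont_deriv : ContinuousOn m' (Ioo 0 Y)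
  int : IntegrableOn m (Ioo 0 Y)

theorem IsProfile.cont {Y : ℝ} {m m' : ℝ → ℂ} (h : IsProfile Y m m') : ContinuousOn m (Ioo 0 Y) :=
  fun x hx => (h.deriv x hx).continuousAt.continuousWithinAt

/-- The deformed connection in the flat frame, for the field point `z` and the deformation
point `y`. -/
def flatConn (m : ℝ → ℂ) (y z : ℝ) : M2 := symL ((√y / √(y - z)) • m z)

theorem trace_symL (c : ℂ) : (symL c).trace = 0 := by simp [symL_apply, trace_fin_two]

/-- The propagator of the deformed connection from `x` to `y`. -/
def prop (m : ℝ → ℂ) (x y : ℝ) : M2 := pathOrdExp (flatConn m y) x y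

/-- The square root singularity of the deformed connection at the deformation point is
integrable. -/
theorem integrableOn_inv_sqrt_sub {x y : ℝ} (hxy : x ≤ y) :
    IntegrableOn (fun z => (√(y - z))⁻¹) (Ioo x y) ∧ ∫ z in Ioo x y, (√(y - z))⁻¹ = 2 * √(y - x) := by
  have hc : ContinuousOn (fun z => -(2 * √(y - z))) (Icc x y) := by fun_prop
  have hd : ∀ z ∈ Ioo x y, HasDerivAt (fun z => -(2 * √(y - z))) ((√(y - z))⁻¹) z := by
    intro z hz
    have h0 : y - z ≠ 0 := (sub_pos.2 hz.2).ne'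
    have h1 : HasDerivAt (fun z => y - z) (-1) z := by simpa using (hasDerivAt_id z).const_sub y
    refine ((h1.sqrt h0).const_mul 2).neg.congr_deriv ?_
    field_simp
  have hi := intervalIntegral.integrableOn_deriv_of_nonneg hc hd
    fun z _ => inv_nonneg.2 (Real.sqrt_nonneg _)
  have hi' : IntervalIntegrable (fun z => (√(y - z))⁻¹) volume x y := by
    rwa [intervalIntegrable_iff_integrableOn_Ioc_of_le hxy]
  refine ⟨hi.mono_set Ioo_subset_Ioc_self, ?_⟩
  have := intervalIntegral.integral_eq_sub_of_hasDerivAt_of_le hxy hc hd hi'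
  rw [intervalIntegral.integral_of_le hxy, integral_Ioc_eq_integral_Ioo] at this
  rw [this]
  simp

section Profile
variable {Y : ℝ} {m m' : ℝ → ℂ}

theorem continuousOn_flatConn (hm : IsProfile Y m m') {y : ℝ} (hy : y < Y) :
    ContinuousOn (flatConn m y) (Ioo 0 y) := by
  suffices h : ContinuousOn (fun z => √y / √(y - z)) (Ioo 0 y) from
    symL.continuous.comp_continuousOn (h.smul (hm.cont.mono (Ioo_subset_Ioo_right hy.le)))
  refine ContinuousOn.div (by fun_prop) (by fun_prop) fun z hz => ?_
  exact (Real.sqrt_pos.2 (sub_pos.2 hz.2)).ne'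

theorem norm_flatConn_le (m : ℝ → ℂ) (y z : ℝ) :
    ‖flatConn m y z‖ ≤ ‖symL‖ * (√y / √(y - z)) * ‖m z‖ := by
  refine (symL.le_opNorm _).trans ?_
  rw [norm_smul, Real.norm_of_nonneg (by positivity), mul_assoc]

/-- Near the axis the deformation factor is bounded. -/
theorem warp_le {y z : ℝ} (hy : 0 < y) (hz : z ≤ y / 2) : √y / √(y - z) ≤ 2 := by
  rw [← Real.sqrt_div hy.le, Real.sqrt_le_left (by norm_num), div_le_iff₀ (by linarith)]
  linarith

theorem exists_flatConn_bound (hm : IsProfile Y m m') {a b : ℝ} (ha : 0 < a) (hb : b < Y) :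
    ∃ C, 0 ≤ C ∧ ∀ y ∈ Icc a b, ∀ z ∈ Ioo 0 y, ‖flatConn m y z‖ ≤ C * (‖m z‖ + (√(y - z))⁻¹) := by
  obtain ⟨M, hM⟩ := isCompact_Icc.exists_bound_of_continuousOn (hm.cont.mono
    (show Icc (a / 2) b ⊆ Ioo 0 Y from fun x hx => ⟨by linarith [hx.1], hx.2.trans_lt hb⟩))
  refine ⟨‖symL‖ * (2 + √b * |M|), by positivity, fun y hy z hz => ?_⟩
  refine (norm_flatConn_le m y z).trans ?_
  have hy0 : 0 < y := ha.trans_le hy.1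
  rw [mul_assoc, mul_assoc]
  refine mul_le_mul_of_nonneg_left ?_ (norm_nonneg _)
  have p1 : 0 ≤ (√(y - z))⁻¹ := by positivity
  have p2 : 0 ≤ √b * |M| := by positivity
  rcases le_total z (y / 2) with h | h
  · have := mul_le_mul_of_nonneg_right (warp_le hy0 h) (norm_nonneg (m z))
    nlinarith [norm_nonneg (m z), mul_nonneg p2 (norm_nonneg (m z)), mul_nonneg p2 p1]
  · have h1 : ‖m z‖ ≤ |M| := (hM z ⟨by linarith [hy.1], hz.2.le.trans hy.2⟩).trans (le_abs_self _)
    have h2 : √y ≤ √b := Real.sqrt_le_sqrt hy.2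
    calc √y / √(y - z) * ‖m z‖ = √y * ‖m z‖ * (√(y - z))⁻¹ := by ring
      _ ≤ √b * |M| * (√(y - z))⁻¹ := by gcongr
      _ ≤ _ := by nlinarith [norm_nonneg (m z), mul_nonneg p2 (norm_nonneg (m z)), mul_nonneg p2 p1]

theorem isConn_flatConn (hm : IsProfile Y m m') {y : ℝ} (hy : y ∈ Ioo 0 Y) :
    IsConn (flatConn m y) 0 y := by
  obtain ⟨C, hC, h⟩ := exists_flatConn_bound hm hy.1 hy.2
  refine ⟨hy.1.le, continuousOn_flatConn hm hy.2, ?_⟩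
  refine Integrable.mono' (((hm.int.mono_set (Ioo_subset_Ioo_right hy.2.le)).norm.add
    (integrableOn_inv_sqrt_sub hy.1.le).1).const_mul C)
    ((continuousOn_flatConn hm hy.2).aestronglyMeasurable measurableSet_Ioo) ?_
  filter_upwards [ae_restrict_mem measurableSet_Ioo] with z hz
  exact h y ⟨le_rfl, le_rfl⟩ z hz

theorem exists_tail_flatConn_le (hm : IsProfile Y m m') {a b : ℝ} (ha : 0 < a) (hb : b < Y) :
    ∃ T, 0 ≤ T ∧ ∀ y ∈ Icc a b, tail (flatConn m y) y 0 ≤ T := by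
  obtain ⟨C, hC, h⟩ := exists_flatConn_bound hm ha hb
  refine ⟨C * ((∫ z in Ioo 0 Y, ‖m z‖) + 2 * √b), ?_, fun y hy => ?_⟩
  · have : 0 ≤ ∫ z in Ioo 0 Y, ‖m z‖ := integral_nonneg fun _ => norm_nonneg _
    positivity
  have hy0 : 0 < y := ha.trans_le hy.1
  have hyY : y < Y := hy.2.trans_lt hb
  have i1 := (hm.int.mono_set (Ioo_subset_Ioo_right hyY.le)).norm
  have i2 := integrableOn_inv_sqrt_sub hy0.le
  unfold tail
  rw [intervalIntegral.integral_of_le hy0.le, integral_Ioc_eq_integral_Ioo]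
  calc _ ≤ ∫ z in Ioo 0 y, C * (‖m z‖ + (√(y - z))⁻¹) :=
        setIntegral_mono_on (isConn_flatConn hm ⟨hy0, hyY⟩).int.norm ((i1.add i2.1).const_mul C)
          measurableSet_Ioo fun z hz => h y hy z hz
    _ = C * ((∫ z in Ioo 0 y, ‖m z‖) + 2 * √(y - 0)) := by
        rw [integral_const_mul, integral_add i1 i2.1, i2.2]
    _ ≤ _ := by
        rw [sub_zero]
        refine mul_le_mul_of_nonneg_left (add_le_add ?_ ?_) hC
        · exact setIntegral_mono_set hm.int.norm (Eventually.of_forall fun _ => norm_nonneg _)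
            (Ioo_subset_Ioo_right hyY.le).eventuallyLE
        · gcongr; exact hy.2

theorem trace_flatConn (m : ℝ → ℂ) (y z : ℝ) : (flatConn m y z).trace = 0 := trace_symL _

theorem isTransport_prop (hm : IsProfile Y m m') {y : ℝ} (hy : y ∈ Ioo 0 Y) :
    IsTransport (flatConn m y) 0 y (fun x => prop m x y) := (isConn_flatConn hm hy).isTransport.1

theorem prop_mul_adjugate (hm : IsProfile Y m m') {x y : ℝ} (hy : y ∈ Ioo 0 Y) (hx : x ∈ Icc 0 y) :
    prop m x y * (prop m x y).adjugate = 1 :=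
  (isTransport_prop hm hy).mul_adjugate (trace_flatConn m y) hx

theorem prop_adjugate_mul (hm : IsProfile Y m m') {x y : ℝ} (hy : y ∈ Ioo 0 Y) (hx : x ∈ Icc 0 y) :
    (prop m x y).adjugate * prop m x y = 1 :=
  (isTransport_prop hm hy).adjugate_mul (isTransport_prop hm hy) (trace_flatConn m y) hx

/-- The connection after the substitution `z = y - (y - x) (1 - τ)²`, which removes the singularity
at the deformation point and fixes the interval of integration. -/
def unitConn (m : ℝ → ℂ) (p : ℝ × ℝ) (τ : ℝ) : M2 :=
  symL ((2 * √(p.2 * (p.2 - p.1))) • m (p.2 - (p.2 - p.1) * (1 - τ) ^ 2))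

/-- The propagator after the same substitution. -/
def unitProp (m : ℝ → ℂ) (p : ℝ × ℝ) (τ : ℝ) : M2 :=
  prop m (p.2 - (p.2 - p.1) * (1 - τ) ^ 2) p.2

theorem unit_mem {x y τ : ℝ} (hxy : x ≤ y) (hτ : τ ∈ Icc (0 : ℝ) 1) :
    y - (y - x) * (1 - τ) ^ 2 ∈ Icc x y := by
  have h1 : (1 - τ) ^ 2 ≤ 1 := by nlinarith [hτ.1, hτ.2]
  have h2 : 0 ≤ (1 - τ) ^ 2 := sq_nonneg _
  constructor <;> nlinarith

theorem unit_mem_Ioo {x y τ : ℝ} (hxy : x < y) (hτ : τ ∈ Ioo (0 : ℝ) 1) :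
    y - (y - x) * (1 - τ) ^ 2 ∈ Ioo x y := by
  have h1 : (1 - τ) ^ 2 < 1 := by nlinarith [hτ.1, hτ.2]
  have h2 : 0 < (1 - τ) ^ 2 := by have := hτ.2; have : 0 < 1 - τ := by linarith
                                  positivity
  constructor <;> nlinarith

theorem isConn_unitConn (hm : IsProfile Y m m') {p : ℝ × ℝ} (h1 : 0 < p.1) (h2 : p.1 ≤ p.2)
    (h3 : p.2 < Y) : IsConn (unitConn m p) 0 1 := by
  have hc : ContinuousOn (unitConn m p) (Icc 0 1) := by
    suffices h : ContinuousOn (fun τ => m (p.2 - (p.2 - p.1) * (1 - τ) ^ 2)) (Icc 0 1) from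
      symL.continuous.comp_continuousOn (h.const_smul (2 * √(p.2 * (p.2 - p.1))))
    refine hm.cont.comp (by fun_prop) fun τ hτ => ?_
    have := unit_mem h2 hτ
    exact ⟨h1.trans_le this.1, this.2.trans_lt h3⟩
  exact ⟨zero_le_one, hc.mono Ioo_subset_Icc_self,
    (hc.integrableOn_compact isCompact_Icc).mono_set Ioo_subset_Icc_self⟩

theorem trace_unitConn (m : ℝ → ℂ) (p : ℝ × ℝ) (τ : ℝ) : (unitConn m p τ).trace = 0 :=
  trace_symL _

/-- The factor `2 (y - x) (1 - τ)` from the substitution cancels the singularity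
`(y - z)^(-1/2)`. -/
theorem isTransport_unitProp (hm : IsProfile Y m m') {p : ℝ × ℝ} (h1 : 0 < p.1) (h2 : p.1 < p.2)
    (h3 : p.2 < Y) : IsTransport (unitConn m p) 0 1 (unitProp m p) := by
  obtain ⟨x, y⟩ := p
  simp only at h1 h2 h3
  have hy : y ∈ Ioo 0 Y := ⟨h1.trans h2, h3⟩
  have hR := isTransport_prop hm hy
  refine ⟨?_, fun τ hτ => ?_, ?_⟩
  · refine hR.cont.comp (f := fun τ : ℝ => y - (y - x) * (1 - τ) ^ 2) (by fun_prop) fun τ hτ => ?_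
    have := unit_mem h2.le hτ
    exact ⟨h1.le.trans this.1, this.2⟩
  · have hz := unit_mem_Ioo h2 hτ
    have hd := hR.deriv _ ⟨h1.trans hz.1, hz.2⟩
    have hτd : HasDerivAt (fun τ : ℝ => y - (y - x) * (1 - τ) ^ 2) (2 * (y - x) * (1 - τ)) τ := by
      have h1 : HasDerivAt (fun z : ℝ => 1 - z) (-1) τ := by
        simpa using (hasDerivAt_id τ).const_sub 1
      refine (((h1.pow 2).const_mul (y - x)).const_sub y).congr_deriv ?_
      norm_num; ring
    refine (hd.scomp τ hτd).congr_deriv ?_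
    have u0 : 0 < y - x := sub_pos.2 h2
    have t0 : 0 < 1 - τ := sub_pos.2 hτ.2
    have e : y - (y - (y - x) * (1 - τ) ^ 2) = (y - x) * (1 - τ) ^ 2 := by ring
    simp only [unitConn, unitProp, flatConn, e]
    rw [smul_neg, ← Matrix.smul_mul, ← map_smul, smul_smul]
    congr 4
    rw [Real.sqrt_mul u0.le, Real.sqrt_sq t0.le, Real.sqrt_mul hy.1.le]
    have := Real.sq_sqrt u0.le
    have s0 : 0 < √(y - x) := Real.sqrt_pos.2 u0
    field_simp
    linear_combination (-√y) * this
  · simp [unitProp, hR.final]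

theorem unitProp_zero (m : ℝ → ℂ) (p : ℝ × ℝ) : unitProp m p 0 = prop m p.1 p.2 := by
  simp [unitProp]

end Profile

/-- Bound on the derivative of a transport with respect to a parameter, given by Duhamel's
formula with the derivative `F` of the connection. -/
theorem norm_duhamel_le {R F : ℝ → M2} {a b z B : ℝ} {c : ℝ → ℝ}
    (hB : ∀ x ∈ Icc a b, ‖R x‖ ≤ B) (hc : ∀ x ∈ Ioo a b, ‖F x‖ ≤ c x)
    (hci : IntegrableOn c (Ioo a b)) (hz : z ∈ Icc a b) :
    ‖R z * ∫ x in Ioo z b, (R x).adjugate * F x * R x‖ ≤ 2 * B ^ 3 * ∫ x in Ioo a b, c x := by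
  have hB0 : 0 ≤ B := (norm_nonneg _).trans (hB z hz)
  have hcb : IntegrableOn (fun x => 2 * B ^ 2 * c x) (Ioo a b) := hci.const_mul _
  have h1 : ‖∫ x in Ioo z b, (R x).adjugate * F x * R x‖ ≤ ∫ x in Ioo a b, 2 * B ^ 2 * c x := by
    calc _ ≤ ∫ x in Ioo z b, 2 * B ^ 2 * c x := by
          refine norm_integral_le_of_norm_le (hcb.mono_set (Ioo_subset_Ioo_left hz.1)) ?_
          filter_upwards [ae_restrict_mem measurableSet_Ioo] with x hx
          have hx' : x ∈ Ioo a b := ⟨hz.1.trans_lt hx.1, hx.2⟩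
          have hx'' := Ioo_subset_Icc_self hx'
          have c0 : 0 ≤ c x := (norm_nonneg _).trans (hc x hx')
          calc ‖(R x).adjugate * F x * R x‖
              ≤ ‖(R x).adjugate‖ * ‖F x‖ * ‖R x‖ :=
                (norm_mul_le _ _).trans (mul_le_mul_of_nonneg_right (norm_mul_le _ _)
                  (norm_nonneg _))
            _ ≤ (2 * B) * c x * B := by
                gcongr
                · exact (norm_adjugate_le _).trans (by gcongr; exact hB x hx'')
                · exact hc x hx'
                · exact hB x hx''
            _ = _ := by ring
      _ ≤ _ := by
          refine setIntegral_mono_set hcb ?_ (Ioo_subset_Ioo_left hz.1).eventuallyLE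
          filter_upwards [ae_restrict_mem measurableSet_Ioo] with x hx
          have : 0 ≤ c x := (norm_nonneg _).trans (hc x hx)
          simp only [Pi.zero_apply]
          positivity
  rw [integral_const_mul] at h1
  calc _ ≤ ‖R z‖ * ‖∫ x in Ioo z b, (R x).adjugate * F x * R x‖ := norm_mul_le _ _
    _ ≤ B * (2 * B ^ 2 * ∫ x in Ioo a b, c x) := by
        gcongr
        exact hB z hz
    _ = _ := by ring

section Profile
variable {Y : ℝ} {m m' : ℝ → ℂ}

/-- The derivative of `unitConn` with respect to the two end points. -/
def unitConnDeriv (m m' : ℝ → ℂ) (p : ℝ × ℝ) (τ : ℝ) : ℝ × ℝ →L[ℝ] M2 :=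
  symL.comp
    ((2 * √(p.2 * (p.2 - p.1))) • (ContinuousLinearMap.snd ℝ ℝ ℝ
        - (1 - τ) ^ 2 • (ContinuousLinearMap.snd ℝ ℝ ℝ - ContinuousLinearMap.fst ℝ ℝ ℝ)).smulRight
          (m' (p.2 - (p.2 - p.1) * (1 - τ) ^ 2))
      + ((√(p.2 * (p.2 - p.1)))⁻¹ • (p.2 • (ContinuousLinearMap.snd ℝ ℝ ℝ
        - ContinuousLinearMap.fst ℝ ℝ ℝ) + (p.2 - p.1) • ContinuousLinearMap.snd ℝ ℝ ℝ)).smulRight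
          (m (p.2 - (p.2 - p.1) * (1 - τ) ^ 2)))

theorem hasFDerivAt_unitConn (hm : IsProfile Y m m') {p : ℝ × ℝ} (h1 : 0 < p.1) (h2 : p.1 < p.2)
    (h3 : p.2 < Y) {τ : ℝ} (hτ : τ ∈ Icc (0 : ℝ) 1) :
    HasFDerivAt (fun p => unitConn m p τ) (unitConnDeriv m m' p τ) p := by
  have e1 : HasFDerivAt (fun p : ℝ × ℝ => p.1) (ContinuousLinearMap.fst ℝ ℝ ℝ) p := hasFDerivAt_fst
  have e2 : HasFDerivAt (fun p : ℝ × ℝ => p.2) (ContinuousLinearMap.snd ℝ ℝ ℝ) p := hasFDerivAt_snd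
  have hq0 : 0 < p.2 * (p.2 - p.1) := mul_pos (h1.trans h2) (sub_pos.2 h2)
  have hq := ((e2.mul (e2.sub e1)).sqrt hq0.ne').const_mul 2
  have hz : HasFDerivAt (fun p : ℝ × ℝ => p.2 - (p.2 - p.1) * (1 - τ) ^ 2)
      (ContinuousLinearMap.snd ℝ ℝ ℝ
        - (1 - τ) ^ 2 • (ContinuousLinearMap.snd ℝ ℝ ℝ - ContinuousLinearMap.fst ℝ ℝ ℝ)) p :=
    e2.sub ((e2.sub e1).mul_const _)
  have hmem := unit_mem h2.le hτ
  have hmd := (hm.deriv _ ⟨h1.trans_le hmem.1, hmem.2.trans_lt h3⟩).hasFDerivAt.comp p hz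
  have := symL.hasFDerivAt.comp p (hq.smul hmd)
  refine this.congr_fderiv ?_
  unfold unitConnDeriv
  congr 1
  refine ContinuousLinearMap.ext fun v => ?_
  change (2 * √(p.2 * (p.2 - p.1))) • ((v.2 - (1 - τ) ^ 2 • (v.2 - v.1)) • m' _)
      + (2 * (1 / (2 * √(p.2 * (p.2 - p.1))) * (p.2 * (v.2 - v.1) + (p.2 - p.1) * v.2))) • m _
    = (2 * √(p.2 * (p.2 - p.1))) • ((v.2 - (1 - τ) ^ 2 • (v.2 - v.1)) • m' _)
      + ((√(p.2 * (p.2 - p.1)))⁻¹ * (p.2 * (v.2 - v.1) + (p.2 - p.1) * v.2)) • m _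
  congr 2
  ring

theorem continuousOn_unitConnDeriv (hm : IsProfile Y m m') :
    ContinuousOn (fun w : (ℝ × ℝ) × ℝ => unitConnDeriv m m' w.1 w.2)
      ({p | 0 < p.1 ∧ p.1 < p.2 ∧ p.2 < Y} ×ˢ Icc 0 1) := by
  have hz : MapsTo (fun w : (ℝ × ℝ) × ℝ => w.1.2 - (w.1.2 - w.1.1) * (1 - w.2) ^ 2)
      ({p | 0 < p.1 ∧ p.1 < p.2 ∧ p.2 < Y} ×ˢ Icc 0 1) (Ioo 0 Y) := by
    rintro ⟨p, τ⟩ ⟨⟨h1, h2, h3⟩, hτ⟩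
    have := unit_mem h2.le hτ
    exact ⟨h1.trans_le this.1, this.2.trans_lt h3⟩
  have c1 := hm.cont.comp (by fun_prop) hz
  have c2 := hm.cont_deriv.comp (by fun_prop) hz
  have c3 : ContinuousOn (fun w : (ℝ × ℝ) × ℝ => (√(w.1.2 * (w.1.2 - w.1.1)))⁻¹)
      ({p | 0 < p.1 ∧ p.1 < p.2 ∧ p.2 < Y} ×ˢ Icc 0 1) := by
    refine ContinuousOn.inv₀ (by fun_prop) ?_
    rintro ⟨p, τ⟩ ⟨⟨h1, h2, h3⟩, hτ⟩
    exact (Real.sqrt_pos.2 (mul_pos (h1.trans h2) (sub_pos.2 h2))).ne'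
  simp only [Function.comp_def] at c1 c2
  have d1 : ContinuousOn (fun w : (ℝ × ℝ) × ℝ => (2 * √(w.1.2 * (w.1.2 - w.1.1))) •
      (ContinuousLinearMap.smulRightL ℝ (ℝ × ℝ) ℂ (ContinuousLinearMap.snd ℝ ℝ ℝ
        - (1 - w.2) ^ 2 • (ContinuousLinearMap.snd ℝ ℝ ℝ - ContinuousLinearMap.fst ℝ ℝ ℝ)))
          (m' (w.1.2 - (w.1.2 - w.1.1) * (1 - w.2) ^ 2)))
      ({p | 0 < p.1 ∧ p.1 < p.2 ∧ p.2 < Y} ×ˢ Icc 0 1) := by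
    suffices h : ContinuousOn (fun w : (ℝ × ℝ) × ℝ =>
        ContinuousLinearMap.smulRightL ℝ (ℝ × ℝ) ℂ (ContinuousLinearMap.snd ℝ ℝ ℝ
        - (1 - w.2) ^ 2 • (ContinuousLinearMap.snd ℝ ℝ ℝ - ContinuousLinearMap.fst ℝ ℝ ℝ)))
        ({p | 0 < p.1 ∧ p.1 < p.2 ∧ p.2 < Y} ×ˢ Icc 0 1) from
      (show ContinuousOn (fun w : (ℝ × ℝ) × ℝ => 2 * √(w.1.2 * (w.1.2 - w.1.1))) _ by
        fun_prop).smul (h.clm_apply c2)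
    exact (ContinuousLinearMap.smulRightL ℝ (ℝ × ℝ) ℂ).continuous.comp_continuousOn
      (f := fun w : (ℝ × ℝ) × ℝ => ContinuousLinearMap.snd ℝ ℝ ℝ
        - (1 - w.2) ^ 2 • (ContinuousLinearMap.snd ℝ ℝ ℝ - ContinuousLinearMap.fst ℝ ℝ ℝ))
      (by fun_prop)
  have d2 : ContinuousOn (fun w : (ℝ × ℝ) × ℝ =>
      ContinuousLinearMap.smulRightL ℝ (ℝ × ℝ) ℂ ((√(w.1.2 * (w.1.2 - w.1.1)))⁻¹ •
        (w.1.2 • (ContinuousLinearMap.snd ℝ ℝ ℝ - ContinuousLinearMap.fst ℝ ℝ ℝ)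
          + (w.1.2 - w.1.1) • ContinuousLinearMap.snd ℝ ℝ ℝ))
          (m (w.1.2 - (w.1.2 - w.1.1) * (1 - w.2) ^ 2)))
      ({p | 0 < p.1 ∧ p.1 < p.2 ∧ p.2 < Y} ×ˢ Icc 0 1) := by
    refine ContinuousOn.clm_apply ?_ c1
    suffices h : ContinuousOn (fun w : (ℝ × ℝ) × ℝ => (√(w.1.2 * (w.1.2 - w.1.1)))⁻¹ •
        (w.1.2 • (ContinuousLinearMap.snd ℝ ℝ ℝ - ContinuousLinearMap.fst ℝ ℝ ℝ)
          + (w.1.2 - w.1.1) • ContinuousLinearMap.snd ℝ ℝ ℝ))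
        ({p | 0 < p.1 ∧ p.1 < p.2 ∧ p.2 < Y} ×ˢ Icc 0 1) from
      (ContinuousLinearMap.smulRightL ℝ (ℝ × ℝ) ℂ).continuous.comp_continuousOn h
    exact c3.smul (by fun_prop)
  exact continuousOn_const.clm_comp (d1.add d2)

/-- Along the diagonal direction `(1, 1)` the difference `y - x` is constant, so that the singular
factor `(y - x)^(-1/2)` of the derivative comes with a factor `y - x`. -/
theorem norm_unitConnDeriv_diag_le {x y b M τ : ℝ} (hx : 0 < x) (hxy : x < y) (hy : y ≤ b)
    (hM : ∀ z ∈ Icc x y, ‖m z‖ ≤ M ∧ ‖m' z‖ ≤ M) (hτ : τ ∈ Icc (0 : ℝ) 1) :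
    ‖unitConnDeriv m m' (x, y) τ (1, 1)‖ ≤ ‖symL‖ * ((2 * b + 1) * M) := by
  have hmem := hM _ (unit_mem hxy.le hτ)
  have u0 : 0 < y - x := sub_pos.2 hxy
  have y0 : 0 < y := hx.trans hxy
  set q := √(y * (y - x)) with hq
  have q0 : 0 < q := Real.sqrt_pos.2 (by positivity)
  have q2 : q ^ 2 = y * (y - x) := Real.sq_sqrt (by positivity)
  have qb : q ≤ b := by nlinarith
  have qu : q⁻¹ * (y - x) ≤ 1 := by
    rw [inv_mul_le_iff₀ q0]; nlinarith
  refine (symL.le_opNorm _).trans (mul_le_mul_of_nonneg_left ?_ (norm_nonneg _))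
  set z := y - (y - x) * (1 - τ) ^ 2
  have e : ((2 * q) • (ContinuousLinearMap.snd ℝ ℝ ℝ
        - (1 - τ) ^ 2 • (ContinuousLinearMap.snd ℝ ℝ ℝ - ContinuousLinearMap.fst ℝ ℝ ℝ)).smulRight
          (m' z)
      + (q⁻¹ • (y • (ContinuousLinearMap.snd ℝ ℝ ℝ
        - ContinuousLinearMap.fst ℝ ℝ ℝ) + (y - x) • ContinuousLinearMap.snd ℝ ℝ ℝ)).smulRight
          (m z)) (1, 1) = (2 * q) • m' z + (q⁻¹ * (y - x)) • m z := by
    simp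
  change ‖((2 * q) • (ContinuousLinearMap.snd ℝ ℝ ℝ
        - (1 - τ) ^ 2 • (ContinuousLinearMap.snd ℝ ℝ ℝ - ContinuousLinearMap.fst ℝ ℝ ℝ)).smulRight
          (m' z)
      + (q⁻¹ • (y • (ContinuousLinearMap.snd ℝ ℝ ℝ
        - ContinuousLinearMap.fst ℝ ℝ ℝ) + (y - x) • ContinuousLinearMap.snd ℝ ℝ ℝ)).smulRight
          (m z)) (1, 1)‖ ≤ _
  rw [e]
  refine (norm_add_le _ _).trans ?_
  rw [norm_smul, norm_smul, Real.norm_of_nonneg (by positivity), Real.norm_of_nonneg (by positivity)]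
  have M0 : 0 ≤ M := (norm_nonneg _).trans hmem.1
  calc _ ≤ 2 * b * M + 1 * M := by
        have b0 : 0 ≤ b := q0.le.trans qb
        gcongr
        · exact hmem.2
        · exact hmem.1
    _ = _ := by ring

theorem exists_norm_prop_le (hm : IsProfile Y m m') {a b : ℝ} (ha : 0 < a) (hb : b < Y) :
    ∃ B, 0 ≤ B ∧ ∀ y ∈ Icc a b, ∀ x ∈ Icc 0 y, ‖prop m x y‖ ≤ B := by
  obtain ⟨T, hT, h⟩ := exists_tail_flatConn_le hm ha hb
  refine ⟨Real.exp T, (Real.exp_pos _).le, fun y hy x hx => ?_⟩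
  have hy' : y ∈ Ioo 0 Y := ⟨ha.trans_le hy.1, hy.2.trans_lt hb⟩
  exact ((isTransport_prop hm hy').norm_le (isConn_flatConn hm hy') (trace_flatConn m y) hx).trans
    (Real.exp_le_exp.2 (h y hy))

/-- The propagator is jointly differentiable off the diagonal, with a derivative along the diagonal
direction that stays bounded on the diagonal. -/
theorem differentiableAt_prop (hm : IsProfile Y m m') {x y : ℝ} (hx : 0 < x) (hxy : x < y)
    (hy : y < Y) : DifferentiableAt ℝ (fun p : ℝ × ℝ => prop m p.1 p.2) (x, y) ∧
    ∀ b M B : ℝ, y ≤ b → (∀ z ∈ Icc x y, ‖m z‖ ≤ M ∧ ‖m' z‖ ≤ M) → (∀ z ∈ Icc x y, ‖prop m z y‖ ≤ B) →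
      ‖fderiv ℝ (fun p : ℝ × ℝ => prop m p.1 p.2) (x, y) (1, 1)‖
        ≤ 2 * B ^ 3 * (‖symL‖ * ((2 * b + 1) * M)) := by
  set O : Set (ℝ × ℝ) := {p | 0 < p.1 ∧ p.1 < p.2 ∧ p.2 < Y} with hO
  have hOo : IsOpen O := (isOpen_lt continuous_const continuous_fst).inter
    ((isOpen_lt continuous_fst continuous_snd).inter (isOpen_lt continuous_snd continuous_const))
  have hp : (x, y) ∈ O := ⟨hx, hxy, hy⟩
  -- a compact neighbourhood on which the derivative of `unitConn` is uniformly bounded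
  obtain ⟨δ, δ0, hδ⟩ := Metric.nhds_basis_closedBall.mem_iff.1 (hOo.mem_nhds hp)
  have hKc := ((isCompact_closedBall (x, y) δ).prod (isCompact_Icc (a := (0 : ℝ)) (b := 1)))
  obtain ⟨G, hG⟩ := hKc.exists_bound_of_continuousOn
    ((continuousOn_unitConnDeriv hm).mono (prod_mono_left hδ))
  obtain ⟨h1, h2⟩ := hasFDerivAt_transport (H := ℝ × ℝ) (A := unitConn m) (R := unitProp m)
    (a := 0) (b := 1) (p₀ := (x, y)) (Metric.closedBall_mem_nhds (x, y) δ0)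
    (fun p hp => isConn_unitConn hm (hδ hp).1 (hδ hp).2.1.le (hδ hp).2.2)
    (fun p hp => isTransport_unitProp hm (hδ hp).1 (hδ hp).2.1 (hδ hp).2.2)
    (trace_unitConn m) (g := fun _ => G) (by simp)
    (fun p hp τ hτ => by
      refine (convex_closedBall (x, y) δ).norm_image_sub_le_of_norm_hasFDerivWithin_le
        (f := fun p => unitConn m p τ) (f' := fun p => unitConnDeriv m m' p τ)
        (fun p hp => (hasFDerivAt_unitConn hm (hδ hp).1 (hδ hp).2.1 (hδ hp).2.2
          (Ioo_subset_Icc_self hτ)).hasFDerivWithinAt)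
        (fun p hp => hG (p, τ) ⟨hp, Ioo_subset_Icc_self hτ⟩)
        (Metric.mem_closedBall_self δ0.le) hp)
    (A' := unitConnDeriv m m' (x, y))
    (fun τ hτ => hasFDerivAt_unitConn hm hx hxy hy (Ioo_subset_Icc_self hτ))
    ((continuousOn_unitConnDeriv hm).comp (f := fun τ : ℝ => ((x, y), τ)) (by fun_prop)
      fun τ hτ => ⟨hp, Ioo_subset_Icc_self hτ⟩)
    (z := 0) ⟨le_rfl, zero_le_one⟩
  simp_rw [unitProp_zero] at h2
  refine ⟨h2.differentiableAt, fun b M B hyb hM hB => ?_⟩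
  rw [h2.fderiv, ContinuousLinearMap.comp_apply, ContinuousLinearMap.mul_apply',
    ContinuousLinearMap.integral_apply h1]
  have := norm_duhamel_le (R := unitProp m (x, y))
    (F := fun τ => unitConnDeriv m m' (x, y) τ (1, 1)) (a := 0) (b := 1) (z := 0) (B := B)
    (c := fun _ => ‖symL‖ * ((2 * b + 1) * M))
    (fun τ hτ => hB _ (unit_mem hxy.le hτ))
    (fun τ hτ => norm_unitConnDeriv_diag_le hx hxy hyb hM (Ioo_subset_Icc_self hτ))
    (integrableOn_const (by simp)) ⟨le_rfl, zero_le_one⟩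
  exact (le_of_eq (by rw [← unitProp_zero m (x, y)]; rfl)).trans (this.trans_eq (by simp))

end Profile

theorem hasDerivAt_warp {y z : ℝ} (hy : 0 < y) (hz : z < y) :
    HasDerivAt (fun y => √y / √(y - z)) (-z / (2 * √y * ((y - z) * √(y - z)))) y := by
  have u0 : 0 < y - z := sub_pos.2 hz
  have h1 : HasDerivAt (fun y : ℝ => y - z) 1 y := by simpa using (hasDerivAt_id y).sub_const z
  refine (((hasDerivAt_id y).sqrt hy.ne').div (h1.sqrt u0.ne')
    (Real.sqrt_pos.2 u0).ne').congr_deriv ?_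
  have a0 : 0 < √y := Real.sqrt_pos.2 hy
  have b0 : 0 < √(y - z) := Real.sqrt_pos.2 u0
  have a2 : √y ^ 2 = y := Real.sq_sqrt hy.le
  have b2 : √(y - z) ^ 2 = y - z := Real.sq_sqrt u0.le
  simp only [id]
  generalize √y = a at *
  generalize √(y - z) = b at *
  rw [← b2]
  have hz' : z = a ^ 2 - b ^ 2 := by linarith
  rw [hz']
  field_simp
  ring

theorem abs_warp_deriv_le {x₁ α y z : ℝ} (h1 : 0 < x₁) (hα : x₁ < α) (hy : α ≤ y) (hz0 : 0 ≤ z)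
    (hz : z ≤ x₁) : |-z / (2 * √y * ((y - z) * √(y - z)))|
      ≤ x₁ / (2 * √α * ((α - x₁) * √(α - x₁))) := by
  have u0 : 0 < α - x₁ := sub_pos.2 hα
  have a0 : 0 < √α := Real.sqrt_pos.2 (h1.trans hα)
  have b0 : 0 < √(α - x₁) := Real.sqrt_pos.2 u0
  have u1 : α - x₁ ≤ y - z := by linarith
  have u2 : 0 ≤ y - z := by linarith
  rw [abs_div, abs_neg, abs_of_nonneg hz0,
    abs_of_nonneg (by positivity : 0 ≤ 2 * √y * ((y - z) * √(y - z)))]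
  gcongr

section Profile
variable {Y : ℝ} {m m' : ℝ → ℂ}

/-- The part of the propagator between `x ≤ x₁` and `x₁`, as a transport. -/
theorem isTransport_prop_left (hm : IsProfile Y m m') {x₁ y : ℝ} (h0 : 0 < x₁) (h1 : x₁ < y)
    (hy : y < Y) : IsConn (flatConn m y) 0 x₁ ∧ IsTransport (flatConn m y) 0 x₁
      (fun x => prop m x y * (prop m x₁ y).adjugate) := by
  have hy' : y ∈ Ioo 0 Y := ⟨h0.trans h1, hy⟩
  have hR := isTransport_prop hm hy'
  refine ⟨(isConn_flatConn hm hy').mono le_rfl h1.le h0.le, ?_, fun z hz => ?_, ?_⟩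
  · exact (hR.cont.mono (Icc_subset_Icc_right h1.le)).mul continuousOn_const
  · refine ((hR.deriv z ⟨hz.1, hz.2.trans h1⟩).mul_const _).congr_deriv ?_
    rw [Matrix.neg_mul, Matrix.mul_assoc]
  · exact prop_mul_adjugate hm hy' ⟨h0.le, h1.le⟩

/-- Below `x₁` the deformed connection depends smoothly on the deformation point. -/
theorem exists_hasDerivAt_prop_left (hm : IsProfile Y m m') {x₁ a b : ℝ} (h0 : 0 < x₁)
    (h1 : x₁ < a) (hb : b < Y) : ∃ C, ∀ y ∈ Icc a b, ∀ x ∈ Icc 0 x₁, ∃ D : M2,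
      HasDerivAt (fun y => prop m x y * (prop m x₁ y).adjugate) D y ∧ ‖D‖ ≤ C := by
  obtain ⟨B, hB0, hB⟩ := exists_norm_prop_le hm (h0.trans h1) hb
  set a' := (x₁ + a) / 2 with ha'
  have ha1 : x₁ < a' := by rw [ha']; linarith
  have ha2 : a' < a := by rw [ha']; linarith
  set c := x₁ / (2 * √a' * ((a' - x₁) * √(a' - x₁))) with hc
  have c0 : 0 ≤ c := by
    have : 0 < a' - x₁ := sub_pos.2 ha1
    positivity
  set G := ∫ z in Ioo 0 x₁, ‖symL‖ * (c * ‖m z‖) with hG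
  refine ⟨2 * (2 * B ^ 2) ^ 3 * G, fun y hy x hx => ?_⟩
  have hyY : y < Y := hy.2.trans_lt hb
  have hs : Ioo a' Y ∈ 𝓝 y := isOpen_Ioo.mem_nhds ⟨ha2.trans_le hy.1, hyY⟩
  have hmi : IntegrableOn (fun z => ‖symL‖ * (c * ‖m z‖)) (Ioo 0 x₁) :=
    (((hm.int.mono_set (Ioo_subset_Ioo_right
      ((h1.le.trans hy.1).trans hyY.le))).norm).const_mul _).const_mul _
  have hwd : ∀ z ∈ Ioo 0 x₁, ∀ p ∈ Ioo a' Y, HasDerivAt (fun p => flatConn m p z)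
      (symL ((-z / (2 * √p * ((p - z) * √(p - z)))) • m z)) p := by
    intro z hz p hp
    have := (hasDerivAt_warp (h0.trans (ha1.trans hp.1)) (hz.2.trans (ha1.trans hp.1))).smul_const
      (m z)
    exact symL.hasFDerivAt.comp_hasDerivAt p this
  have hwb : ∀ z ∈ Ioo 0 x₁, ∀ p ∈ Ioo a' Y,
      ‖symL ((-z / (2 * √p * ((p - z) * √(p - z)))) • m z)‖ ≤ ‖symL‖ * (c * ‖m z‖) := by
    intro z hz p hp
    refine (symL.le_opNorm _).trans (mul_le_mul_of_nonneg_left ?_ (norm_nonneg _))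
    rw [norm_smul, Real.norm_eq_abs]
    exact mul_le_mul_of_nonneg_right (abs_warp_deriv_le h0 ha1 hp.1.le hz.1.le hz.2.le)
      (norm_nonneg _)
  have key := hasDerivAt_transport (A := flatConn m)
    (R := fun y x => prop m x y * (prop m x₁ y).adjugate) (a := 0) (b := x₁) (t₀ := y) hs
    (fun p hp => (isTransport_prop_left hm h0 (ha1.trans hp.1) hp.2).1)
    (fun p hp => (isTransport_prop_left hm h0 (ha1.trans hp.1) hp.2).2)
    (trace_flatConn m) hmi (fun p hp z hz => by
      have := (convex_Ioo a' Y).norm_image_sub_le_of_norm_hasDerivWithin_le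
        (f := fun p => flatConn m p z) (fun p hp => (hwd z hz p hp).hasDerivWithinAt)
        (hwb z hz) (mem_of_mem_nhds hs) hp
      simpa [Real.norm_eq_abs] using this)
    (fun z hz => hwd z hz y (mem_of_mem_nhds hs))
    (by
      have hcm : ContinuousOn m (Ioo 0 x₁) := hm.cont.mono
        (Ioo_subset_Ioo_right ((h1.le.trans hy.1).trans hyY.le))
      have hcw : ContinuousOn (fun z => -z / (2 * √y * ((y - z) * √(y - z)))) (Ioo 0 x₁) := by
        refine ContinuousOn.div (by fun_prop) (by fun_prop) fun z hz => ?_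
        have : 0 < y - z := by linarith [hz.2, hy.1]
        have : 0 < y := by linarith [hy.1]
        positivity
      exact symL.continuous.comp_continuousOn (hcw.smul hcm)) hx
  refine ⟨_, key, ?_⟩
  refine norm_duhamel_le (R := fun x => prop m x y * (prop m x₁ y).adjugate)
    (fun x hx => ?_) (fun z hz => hwb z hz y (mem_of_mem_nhds hs)) hmi hx
  have hx1y : x₁ ≤ y := h1.le.trans hy.1
  calc _ ≤ ‖prop m x y‖ * ‖(prop m x₁ y).adjugate‖ := norm_mul_le _ _
    _ ≤ B * (2 * B) := by
        gcongr
        · exact hB y hy x ⟨hx.1, hx.2.trans hx1y⟩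
        · exact (norm_adjugate_le _).trans (by gcongr; exact hB y hy x₁ ⟨h0.le, hx1y⟩)
    _ = _ := by ring

/-- The derivative in the first point, given by the transport equation. -/
theorem fderiv_prop_fst (hm : IsProfile Y m m') {x y : ℝ} (hx : 0 < x) (hxy : x < y)
    (hy : y < Y) : fderiv ℝ (fun p : ℝ × ℝ => prop m p.1 p.2) (x, y) (1, 0)
      = -(flatConn m y x * prop m x y) := by
  have h1 := (differentiableAt_prop hm hx hxy hy).1.hasFDerivAt
  have h2 : HasDerivAt (fun x => (x, y)) ((1 : ℝ), (0 : ℝ)) x :=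
    (hasDerivAt_id x).prodMk (hasDerivAt_const x y)
  have h3 : HasDerivAt (fun x => prop m x y)
      (fderiv ℝ (fun p : ℝ × ℝ => prop m p.1 p.2) (x, y) (1, 0)) x := by
    have := HasFDerivAt.comp_hasDerivAt (f := fun x => (x, y)) x h1 h2
    exact this
  exact h3.unique
    ((isTransport_prop hm ⟨hx.trans hxy, hy⟩).deriv x ⟨hx, hxy⟩)

theorem hasDerivAt_prop_snd (hm : IsProfile Y m m') {x y : ℝ} (hx : 0 < x) (hxy : x < y)
    (hy : y < Y) : HasDerivAt (fun y => prop m x y)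
      (fderiv ℝ (fun p : ℝ × ℝ => prop m p.1 p.2) (x, y) (0, 1)) y := by
  have h1 := (differentiableAt_prop hm hx hxy hy).1.hasFDerivAt
  have h2 : HasDerivAt (fun y => (x, y)) ((0 : ℝ), (1 : ℝ)) y :=
    (hasDerivAt_const y x).prodMk (hasDerivAt_id y)
  exact h1.comp_hasDerivAt y h2

/-- Uniform bounds on the propagator, for deformation points `y` in a compact interval. -/
structure PropBounds (m : ℝ → ℂ) (a b C : ℝ) : Prop where
  nonneg : 0 ≤ C
  norm_le : ∀ y ∈ Icc a b, ∀ x ∈ Icc 0 y, ‖prop m x y‖ ≤ C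
  sub_one : ∀ y ∈ Icc a b, ∀ x ∈ Icc 0 y, ‖prop m x y - 1‖ ≤ C * √(y - x)
  diag : ∀ y ∈ Icc a b, ∀ x ∈ Ioo 0 y,
    ‖fderiv ℝ (fun p : ℝ × ℝ => prop m p.1 p.2) (x, y) (1, 1)‖ ≤ C * (1 + ‖m x‖)
  axis : ∀ y ∈ Icc a b, DifferentiableAt ℝ (prop m 0) y ∧ ‖deriv (prop m 0) y‖ ≤ C

/-- The propagator tends to the identity like the square root of `y - x`: after the substitution
the connection is of that order, and Duhamel's formula compares it with the zero connection. -/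
theorem norm_prop_sub_one_le (hm : IsProfile Y m m') {x y M B : ℝ} (hx : 0 < x)
    (hxy : x < y) (hy : y < Y) (hM : ∀ z ∈ Icc x y, ‖m z‖ ≤ M)
    (hB : ∀ z ∈ Icc x y, ‖prop m z y‖ ≤ B) :
    ‖prop m x y - 1‖ ≤ ‖symL‖ * (2 * √Y * M) * B * √(y - x) := by
  have u0 : 0 ≤ y - x := (sub_pos.2 hxy).le
  have M0 : 0 ≤ M := (norm_nonneg _).trans (hM x ⟨le_rfl, hxy.le⟩)
  have hT := isTransport_unitProp hm (p := (x, y)) hx hxy hy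
  have hC := isConn_unitConn hm (p := (x, y)) hx hxy.le hy
  -- the zero connection, with transport `1`
  have h0 : IsTransport (fun _ => (0 : M2)) 0 1 (fun _ => 1) :=
    ⟨continuousOn_const, fun z _ => by simpa using hasDerivAt_const z (1 : M2), rfl⟩
  have h0' : IsConn (fun _ => (0 : M2)) 0 1 := ⟨zero_le_one, continuousOn_const, integrableOn_zero⟩
  have := h0.duhamel h0' hC hT (by simp) (z := 0) ⟨le_rfl, zero_le_one⟩
  rw [unitProp_zero] at this
  simp only at this
  rw [this, add_sub_cancel_left, Matrix.one_mul]
  refine (intervalIntegral.norm_integral_le_of_norm_le_const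
    (C := ‖symL‖ * (2 * √Y * M) * B * √(y - x)) fun τ hτ => ?_).trans (by simp)
  rw [uIoc_of_le zero_le_one] at hτ
  have hτ' : τ ∈ Icc (0 : ℝ) 1 := ⟨hτ.1.le, hτ.2⟩
  have hz := unit_mem hxy.le hτ'
  have e : ‖unitConn m (x, y) τ‖ ≤ ‖symL‖ * (2 * √Y * √(y - x) * M) := by
    refine (symL.le_opNorm _).trans (mul_le_mul_of_nonneg_left ?_ (norm_nonneg _))
    rw [norm_smul, Real.norm_of_nonneg (by positivity), Real.sqrt_mul (hx.trans hxy).le]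
    simp only
    rw [← mul_assoc]
    gcongr
    exact hM _ hz
  calc _ ≤ ‖unitConn m (x, y) τ‖ * ‖unitProp m (x, y) τ‖ := by
        simp only [adjugate_one, Matrix.one_mul, sub_zero]
        exact norm_mul_le _ _
    _ ≤ (‖symL‖ * (2 * √Y * √(y - x) * M)) * B := by
        gcongr
        exact hB _ hz
    _ = _ := by ring

/-- Bounds on the propagator that are uniform up to the axis and up to the deformation point. The
point `x₁ = a / 2` separates the two: above it the profile and its derivative are bounded and the
substitution of `unitConn` is used; below it the deformed connection is smooth in the deformation
point, while the profile need only be integrable. -/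
theorem exists_propBounds (hm : IsProfile Y m m') {a b : ℝ} (ha : 0 < a) (hb : b < Y) :
    ∃ C, PropBounds m a b C := by
  obtain ⟨B, hB0, hB⟩ := exists_norm_prop_le hm ha hb
  set x₁ := a / 2 with hx₁
  have h0 : 0 < x₁ := by rw [hx₁]; linarith
  have h1 : x₁ < a := by rw [hx₁]; linarith
  have hsub : Icc x₁ b ⊆ Ioo 0 Y := fun x hx => ⟨h0.trans_le hx.1, hx.2.trans_lt hb⟩
  obtain ⟨M₁, hM₁⟩ := isCompact_Icc.exists_bound_of_continuousOn (hm.cont.mono hsub)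
  obtain ⟨M₂, hM₂⟩ := isCompact_Icc.exists_bound_of_continuousOn (hm.cont_deriv.mono hsub)
  set M := max 0 (max M₁ M₂) with hMdef
  have hM0 : 0 ≤ M := le_max_left _ _
  have hM : ∀ z ∈ Icc x₁ b, ‖m z‖ ≤ M ∧ ‖m' z‖ ≤ M := fun z hz =>
    ⟨(hM₁ z hz).trans ((le_max_left _ _).trans (le_max_right _ _)),
      (hM₂ z hz).trans ((le_max_right _ _).trans (le_max_right _ _))⟩
  obtain ⟨C₁, hC₁⟩ := exists_hasDerivAt_prop_left hm h0 h1 hb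
  set CD := 2 * B ^ 3 * (‖symL‖ * ((2 * b + 1) * M)) with hCD
  -- the diagonal derivative away from the axis
  have hdiag : ∀ y ∈ Icc a b, ∀ x, x₁ ≤ x → x < y →
      ‖fderiv ℝ (fun p : ℝ × ℝ => prop m p.1 p.2) (x, y) (1, 1)‖ ≤ CD := fun y hy x hx hxy =>
    (differentiableAt_prop hm (h0.trans_le hx) hxy (hy.2.trans_lt hb)).2 b M B hy.2
      (fun z hz => hM z ⟨hx.trans hz.1, hz.2.trans hy.2⟩)
      (fun z hz => hB y hy z ⟨(h0.le.trans hx).trans hz.1, hz.2⟩)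
  -- the derivative in `y` is the diagonal derivative less the one in `x`
  have hsplit : ∀ D : ℝ × ℝ →L[ℝ] M2, D (1, 1) = D (1, 0) + D (0, 1) := fun D => by
    rw [← map_add]; simp
  set CW := ‖symL‖ * 2 with hCW
  have hconn : ∀ y ∈ Icc a b, ∀ x, x ≤ x₁ → ‖flatConn m y x‖ ≤ CW * ‖m x‖ := by
    intro y hy x hx
    refine (norm_flatConn_le m y x).trans ?_
    have := warp_le (ha.trans_le hy.1) (hx.trans (by rw [hx₁]; linarith [hy.1]) : x ≤ y / 2)
    rw [hCW]
    gcongr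
  have hCW0 : 0 ≤ CW := by positivity
  -- the derivative with respect to the deformation point, up to the axis
  set CY := |C₁| * B + 2 * B ^ 2 * (|CD| + CW * M * B) with hCY
  have hCY0 : 0 ≤ CY := by positivity
  have hyder : ∀ y ∈ Icc a b, ∀ x ∈ Icc 0 x₁, ∃ D : M2,
      HasDerivAt (fun y => prop m x y) D y ∧ ‖D‖ ≤ CY := by
    intro y hy x hx
    have hyY : y < Y := hy.2.trans_lt hb
    have hx1y : x₁ < y := h1.trans_le hy.1
    -- differentiate the product of the propagators from `x` to `x₁` and from `x₁` to `y`
    obtain ⟨D, hD, hDn⟩ := hC₁ y hy x hx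
    have hs := hasDerivAt_prop_snd hm h0 hx1y hyY
    have e1 : ‖fderiv ℝ (fun p : ℝ × ℝ => prop m p.1 p.2) (x₁, y) (0, 1)‖
        ≤ |CD| + CW * M * B := by
      have e := hsplit (fderiv ℝ (fun p : ℝ × ℝ => prop m p.1 p.2) (x₁, y))
      rw [fderiv_prop_fst hm h0 hx1y hyY] at e
      have e' : fderiv ℝ (fun p : ℝ × ℝ => prop m p.1 p.2) (x₁, y) (0, 1)
          = fderiv ℝ (fun p : ℝ × ℝ => prop m p.1 p.2) (x₁, y) (1, 1)
            + flatConn m y x₁ * prop m x₁ y := by rw [e]; abel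
      rw [e']
      refine (norm_add_le _ _).trans (add_le_add
        ((hdiag y hy x₁ le_rfl hx1y).trans (le_abs_self _)) ?_)
      refine (norm_mul_le _ _).trans (mul_le_mul ?_ (hB y hy x₁ ⟨h0.le, hx1y.le⟩)
        (norm_nonneg _) (by positivity))
      refine (hconn y hy x₁ le_rfl).trans (mul_le_mul_of_nonneg_left ?_ hCW0)
      exact (hM x₁ ⟨le_rfl, hx1y.le.trans hy.2⟩).1
    refine ⟨_, (hD.mul hs).congr_of_eventuallyEq ?_, ?_⟩
    · filter_upwards [isOpen_Ioo.mem_nhds (⟨hx1y, hyY⟩ : y ∈ Ioo x₁ Y)] with w hw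
      simp only [Pi.mul_apply]
      rw [Matrix.mul_assoc, prop_adjugate_mul hm ⟨h0.trans hw.1, hw.2⟩ ⟨h0.le, hw.1.le⟩,
        Matrix.mul_one]
    · have n1 := hB y hy x ⟨hx.1, hx.2.trans hx1y.le⟩
      have n2 := hB y hy x₁ ⟨h0.le, hx1y.le⟩
      refine (norm_add_le _ _).trans (add_le_add ?_ ?_)
      · exact (norm_mul_le _ _).trans (mul_le_mul (hDn.trans (le_abs_self _)) n2
          (norm_nonneg _) (abs_nonneg _))
      · refine (norm_mul_le _ _).trans (mul_le_mul ?_ e1 (norm_nonneg _) (by positivity))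
        calc _ ≤ ‖prop m x y‖ * ‖(prop m x₁ y).adjugate‖ := norm_mul_le _ _
          _ ≤ B * (2 * B) := by
              gcongr
              exact (norm_adjugate_le _).trans (by gcongr)
          _ = _ := by ring
  set C₂ := ‖symL‖ * (2 * √Y * M) * B with hC₂
  have hC₂0 : 0 ≤ C₂ := by positivity
  set C₃ := (B + 1) / √x₁ with hC₃
  have hsx : 0 < √x₁ := Real.sqrt_pos.2 h0
  have hC₃0 : 0 ≤ C₃ := by positivity
  refine ⟨B + C₂ + C₃ + |CD| + CY + CW * B, ⟨by positivity, ?_, ?_, ?_, ?_⟩⟩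
  · intro y hy x hx
    have := hB y hy x hx
    have : 0 ≤ |CD| := abs_nonneg _
    have : 0 ≤ CW * B := by positivity
    linarith
  · intro y hy x hx
    have hyY : y < Y := hy.2.trans_lt hb
    have k1 : 0 ≤ |CD| := abs_nonneg _
    have k2 : 0 ≤ CW * B := by positivity
    have k3 : 0 ≤ √(y - x) := Real.sqrt_nonneg _
    suffices h : ‖prop m x y - 1‖ ≤ (C₂ + C₃) * √(y - x) from
      h.trans (mul_le_mul_of_nonneg_right (by linarith) k3)
    rcases le_or_gt x x₁ with hxx | hxx
    -- far from the deformation point `y - x ≥ x₁`, and boundedness suffices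
    · have k4 : √x₁ ≤ √(y - x) := Real.sqrt_le_sqrt (by rw [hx₁] at hxx ⊢; linarith [hy.1])
      have : ‖prop m x y - 1‖ ≤ B + 1 :=
        (norm_sub_le _ _).trans (add_le_add (hB y hy x hx) (by simp))
      calc _ ≤ B + 1 := this
        _ = C₃ * √x₁ := by rw [hC₃]; field_simp
        _ ≤ C₃ * √(y - x) := by gcongr
        _ ≤ _ := by nlinarith
    · rcases hx.2.eq_or_lt with rfl | hxy
      · simp [(isTransport_prop hm ⟨ha.trans_le hy.1, hyY⟩).final]
      · have := norm_prop_sub_one_le hm (h0.trans hxx) hxy hyY (M := M) (B := B)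
          (fun z hz => (hM z ⟨hxx.le.trans hz.1, hz.2.trans hy.2⟩).1)
          (fun z hz => hB y hy z ⟨hx.1.trans hz.1, hz.2⟩)
        exact this.trans (mul_le_mul_of_nonneg_right (by linarith) k3)
  · intro y hy x hx
    have hyY : y < Y := hy.2.trans_lt hb
    have k1 : 0 ≤ |CD| := abs_nonneg _
    have k2 : 0 ≤ CW * B := by positivity
    have k3 := norm_nonneg (m x)
    suffices h : ‖fderiv ℝ (fun p : ℝ × ℝ => prop m p.1 p.2) (x, y) (1, 1)‖
        ≤ |CD| + CY + CW * B * ‖m x‖ by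
      have : 0 ≤ (B + C₂ + C₃ + |CD| + CY) * ‖m x‖ := by positivity
      nlinarith
    rcases le_or_gt x x₁ with hxx | hxx
    · obtain ⟨D, hD, hDn⟩ := hyder y hy x ⟨hx.1.le, hxx⟩
      rw [hsplit, fderiv_prop_fst hm hx.1 hx.2 hyY,
        (hasDerivAt_prop_snd hm hx.1 hx.2 hyY).unique hD]
      refine (norm_add_le _ _).trans ?_
      rw [norm_neg]
      have : ‖flatConn m y x * prop m x y‖ ≤ CW * ‖m x‖ * B :=
        (norm_mul_le _ _).trans (mul_le_mul (hconn y hy x hxx)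
          (hB y hy x ⟨hx.1.le, hx.2.le⟩) (norm_nonneg _) (by positivity))
      nlinarith
    · have := (hdiag y hy x hxx.le hx.2).trans (le_abs_self _)
      have : 0 ≤ CW * B * ‖m x‖ := by positivity
      linarith
  · intro y hy
    obtain ⟨D, hD, hDn⟩ := hyder y hy 0 ⟨le_rfl, h0.le⟩
    refine ⟨hD.differentiableAt, ?_⟩
    rw [show deriv (prop m 0) y = D from hD.deriv]
    have k1 : 0 ≤ |CD| := abs_nonneg _
    have k2 : 0 ≤ CW * B := by positivity
    linarith

end Profile

/-! ### The kernel of the variation -/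

/-- The generator of rotations. -/
def rotJ : M2 := !![0, -1; 1, 0]

/-- Transposition as a continuous linear map. -/
def transL : M2 →L[ℝ] M2 := LinearMap.toContinuousLinearMap
  { toFun := transpose
    map_add' := transpose_add
    map_smul' := transpose_smul }

@[simp] theorem transL_apply (A : M2) : transL A = Aᵀ := rfl

/-- `U R⁻¹ X R Uᵗ` plus its transpose, as a linear functional of `X`: the effect on the deformed
metric at `y` of an infinitesimal change `X` of the connection at `x`. Here `R` is the propagator
from `x` to `y` and `U` the one from the axis to `y`. -/
def kap (m : ℝ → ℂ) (X : M2) (x y : ℝ) : M2 :=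
  prop m 0 y * (prop m x y).adjugate * X * (prop m x y * transL (prop m 0 y))
    + transL (prop m 0 y * (prop m x y).adjugate * X * (prop m x y * transL (prop m 0 y)))

/-- The symmetric traceless components of `kap`, evaluated on a linear functional. -/
def kerK (m : ℝ → ℂ) (l : M2 →L[ℝ] ℝ) (x y : ℝ) : ℂ :=
  ⟨l (kap m (symL 1) x y), l (kap m (symL Complex.I) x y)⟩

/-- The rotational component of `kap`, evaluated on a linear functional. -/
def kerZ (m : ℝ → ℂ) (l : M2 →L[ℝ] ℝ) (x y : ℝ) : ℝ := l (kap m rotJ x y)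

theorem kap_add (m : ℝ → ℂ) (X X' : M2) (x y : ℝ) :
    kap m (X + X') x y = kap m X x y + kap m X' x y := by
  simp only [kap, Matrix.mul_add, Matrix.add_mul, map_add]; abel

theorem kap_smul (m : ℝ → ℂ) (c : ℝ) (X : M2) (x y : ℝ) :
    kap m (c • X) x y = c • kap m X x y := by
  simp only [kap, Matrix.mul_smul, Matrix.smul_mul, map_smul, smul_add]

theorem symL_eq (c : ℂ) : symL c = c.re • symL 1 + c.im • symL Complex.I := by
  rw [← map_smul, ← map_smul, ← map_add]
  congr 1
  apply Complex.ext <;> simp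

/-- The metric at the deformation point, up to the zweibein on the axis. -/
def flatMetric (m : ℝ → ℂ) (y : ℝ) : M2 := prop m 0 y * (prop m 0 y)ᵀ

theorem l_kap_symL (m : ℝ → ℂ) (l : M2 →L[ℝ] ℝ) (c : ℂ) (x y : ℝ) :
    l (kap m (symL c) x y) = (conj (kerK m l x y) * c).re := by
  rw [symL_eq, kap_add, kap_smul, kap_smul, map_add, map_smul, map_smul]
  simp [kerK]; ring

/-- The commutator of two symmetric traceless matrices is a rotation. -/
theorem comm_symL_symL (c d : ℂ) :
    symL c * symL d - symL d * symL c = (2 * (c * conj d).im) • rotJ := by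
  ext i j
  fin_cases i <;> fin_cases j <;>
    simp [symL_apply, rotJ] <;> ring

/-- The commutator of a symmetric traceless matrix with the generator of rotations. -/
theorem comm_symL_rotJ (c : ℂ) :
    symL c * rotJ - rotJ * symL c = symL (-2 * Complex.I * c) := by
  ext i j
  fin_cases i <;> fin_cases j <;>
    simp [symL_apply, rotJ] <;> ring

section Profile
variable {Y : ℝ} {m m' : ℝ → ℂ}

/-- Conjugation by the propagator turns the derivative in `x` into a commutator with the
connection. -/
theorem hasDerivAt_kap (hm : IsProfile Y m m') (X : M2) {x y : ℝ} (hx : 0 < x) (hxy : x < y)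
    (hy : y < Y) : HasDerivAt (fun x => kap m X x y)
      (kap m (flatConn m y x * X - X * flatConn m y x) x y) x := by
  have hR := isTransport_prop hm ⟨hx.trans hxy, hy⟩
  have d1 := hR.deriv x ⟨hx, hxy⟩
  have d2 := hR.hasDerivAt_adjugate (trace_flatConn m y) ⟨hx, hxy⟩
  have d3 := ((d2.const_mul (prop m 0 y)).mul_const X).mul (d1.mul_const (transL (prop m 0 y)))
  have d4 := d3.add (transL.hasFDerivAt.comp_hasDerivAt x d3)
  refine d4.congr_deriv ?_
  have e : prop m 0 y * ((prop m x y).adjugate * flatConn m y x) * X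
        * (prop m x y * transL (prop m 0 y)) + prop m 0 y * (prop m x y).adjugate * X *
        (-(flatConn m y x * prop m x y) * transL (prop m 0 y))
      = prop m 0 y * (prop m x y).adjugate * (flatConn m y x * X - X * flatConn m y x) *
        (prop m x y * transL (prop m 0 y)) := by
    simp only [Matrix.mul_sub, Matrix.sub_mul, Matrix.neg_mul, Matrix.mul_neg, Matrix.mul_assoc]
    abel
  rw [e]
  rfl

/-- With `hasDerivAt_kerZ`, the linear system obeyed by the two kernels. The symmetric and the
rotational parts are exchanged, because commutators of symmetric traceless matrices are rotations
and conversely. -/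
theorem hasDerivAt_kerK (hm : IsProfile Y m m') (l : M2 →L[ℝ] ℝ) {x y : ℝ} (hx : 0 < x)
    (hxy : x < y) (hy : y < Y) : HasDerivAt (fun x => kerK m l x y)
      (-2 * Complex.I * ((√y / √(y - x) * kerZ m l x y : ℝ) : ℂ) * m x) x := by
  have h1 := l.hasFDerivAt.comp_hasDerivAt x (hasDerivAt_kap hm (symL 1) hx hxy hy)
  have h2 := l.hasFDerivAt.comp_hasDerivAt x (hasDerivAt_kap hm (symL Complex.I) hx hxy hy)
  have e : (fun x => kerK m l x y) = fun x => ((l (kap m (symL 1) x y) : ℝ) : ℂ)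
      + ((l (kap m (symL Complex.I) x y) : ℝ) : ℂ) * Complex.I := by
    funext x; rw [← Complex.mk_eq_add_mul_I]; rfl
  rw [e]
  refine (h1.ofReal_comp.add (h2.ofReal_comp.mul_const Complex.I)).congr_deriv ?_
  rw [flatConn, comm_symL_symL, comm_symL_symL, kap_smul, kap_smul, map_smul, map_smul]
  apply Complex.ext <;> simp [kerZ] <;> ring

theorem hasDerivAt_kerZ (hm : IsProfile Y m m') (l : M2 →L[ℝ] ℝ) {x y : ℝ} (hx : 0 < x)
    (hxy : x < y) (hy : y < Y) : HasDerivAt (fun x => kerZ m l x y)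
      (2 * (√y / √(y - x)) * (m x * conj (kerK m l x y)).im) x := by
  have h1 := l.hasFDerivAt.comp_hasDerivAt x (hasDerivAt_kap hm rotJ hx hxy hy)
  refine h1.congr_deriv ?_
  rw [flatConn, comm_symL_rotJ, l_kap_symL]
  simp; ring

theorem continuousOn_kap (hm : IsProfile Y m m') (X : M2) {y : ℝ} (hy : y ∈ Ioo 0 Y) :
    ContinuousOn (fun x => kap m X x y) (Icc 0 y) := by
  have hR := isTransport_prop hm hy
  have d3 := ((continuousOn_const (c := prop m 0 y)).mul hR.continuousOn_adjugate).mul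
    (continuousOn_const (c := X)) |>.mul (hR.cont.mul (continuousOn_const (c := transL (prop m 0 y))))
  exact d3.add (transL.continuous.comp_continuousOn d3)

theorem continuousOn_kerZ (hm : IsProfile Y m m') (l : M2 →L[ℝ] ℝ) {y : ℝ} (hy : y ∈ Ioo 0 Y) :
    ContinuousOn (fun x => kerZ m l x y) (Icc 0 y) :=
  l.continuous.comp_continuousOn (continuousOn_kap hm _ hy)

theorem continuousOn_kerK (hm : IsProfile Y m m') (l : M2 →L[ℝ] ℝ) {y : ℝ} (hy : y ∈ Ioo 0 Y) :
    ContinuousOn (fun x => kerK m l x y) (Icc 0 y) := by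
  have e : (fun x => kerK m l x y) = fun x => ((l (kap m (symL 1) x y) : ℝ) : ℂ)
      + ((l (kap m (symL Complex.I) x y) : ℝ) : ℂ) * Complex.I := by
    funext x; rw [← Complex.mk_eq_add_mul_I]; rfl
  rw [e]
  exact (Complex.continuous_ofReal.comp_continuousOn
      (l.continuous.comp_continuousOn (continuousOn_kap hm _ hy))).add
    ((Complex.continuous_ofReal.comp_continuousOn
      (l.continuous.comp_continuousOn (continuousOn_kap hm _ hy))).mul continuousOn_const)

/-- A conjugate of an antisymmetric matrix by `U · Uᵗ` is antisymmetric. -/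
theorem rotJ_conj_add_transpose (U : M2) : U * rotJ * Uᵀ + (U * rotJ * Uᵀ)ᵀ = 0 := by
  ext i j
  fin_cases i <;> fin_cases j <;>
    simp [rotJ, Matrix.mul_apply, Fin.sum_univ_two]

/-- At the deformation point the rotational component drops out of the symmetric metric. -/
theorem kerZ_self (hm : IsProfile Y m m') (l : M2 →L[ℝ] ℝ) {y : ℝ} (hy : y ∈ Ioo 0 Y) :
    kerZ m l y y = 0 := by
  have : prop m y y = 1 := (isTransport_prop hm hy).final
  have := rotJ_conj_add_transpose (prop m 0 y)
  simp_all [kerZ, kap]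

/-- On the axis `x = 0` the two propagators in `kap` cancel, and `flatMetric` remains. -/
theorem kap_axis (hm : IsProfile Y m m') (X : M2) {y : ℝ} (hy : y ∈ Ioo 0 Y) :
    kap m X 0 y = X * flatMetric m y + (X * flatMetric m y)ᵀ := by
  have : prop m 0 y * (prop m 0 y).adjugate = 1 := prop_mul_adjugate hm hy ⟨le_rfl, hy.1.le⟩
  simp only [kap, this, Matrix.one_mul, transL_apply, flatMetric]

theorem norm_kap_le {a b C : ℝ} (hC : PropBounds m a b C) (X : M2) {x y : ℝ} (hy : y ∈ Icc a b)
    (hx : x ∈ Icc 0 y) (h0 : 0 ≤ y) :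
    ‖kap m X x y‖ ≤ (1 + ‖transL‖) * (2 * C ^ 4 * ‖transL‖) * ‖X‖ := by
  have n0 := hC.norm_le y hy 0 ⟨le_rfl, h0⟩
  have n1 := hC.norm_le y hy x hx
  have C0 := hC.nonneg
  have hT : ‖prop m 0 y * (prop m x y).adjugate * X * (prop m x y * transL (prop m 0 y))‖
      ≤ 2 * C ^ 4 * ‖transL‖ * ‖X‖ := by
    calc _ ≤ ‖prop m 0 y‖ * ‖(prop m x y).adjugate‖ * ‖X‖
          * (‖prop m x y‖ * ‖transL (prop m 0 y)‖) :=
          (norm_mul_le _ _).trans (mul_le_mul ((norm_mul_le _ _).trans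
            (mul_le_mul_of_nonneg_right (norm_mul_le _ _) (norm_nonneg _))) (norm_mul_le _ _)
            (norm_nonneg _) (by positivity))
      _ ≤ C * (2 * C) * ‖X‖ * (C * (‖transL‖ * C)) := by
          gcongr
          · exact (norm_adjugate_le _).trans (by gcongr)
          · exact (transL.le_opNorm _).trans (by gcongr)
      _ = _ := by ring
  calc _ ≤ ‖prop m 0 y * (prop m x y).adjugate * X * (prop m x y * transL (prop m 0 y))‖
        + ‖transL‖ * ‖prop m 0 y * (prop m x y).adjugate * X *
          (prop m x y * transL (prop m 0 y))‖ :=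
        (norm_add_le _ _).trans (add_le_add le_rfl (transL.le_opNorm _))
    _ ≤ (2 * C ^ 4 * ‖transL‖ * ‖X‖) + ‖transL‖ * (2 * C ^ 4 * ‖transL‖ * ‖X‖) := by gcongr
    _ = _ := by ring

/-- The rotational kernel vanishes like `√(y - x)` at the deformation point, since rotations of
the frame at `x = y` leave the metric unchanged. This bounds the derivative of `kerK` in `x`, which
has a factor `kerZ / √(y - x)`. -/
theorem abs_kerZ_le (hm : IsProfile Y m m') {a b C : ℝ} (ha : 0 < a) (hb : b < Y)
    (hC : PropBounds m a b C) (l : M2 →L[ℝ] ℝ) {x y : ℝ} (hy : y ∈ Icc a b) (hx : x ∈ Icc 0 y) :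
    |kerZ m l x y| ≤ ‖l‖ * ((1 + ‖transL‖) * (4 * C ^ 4 * ‖transL‖ * ‖rotJ‖)) * √(y - x) := by
  have hy' : y ∈ Ioo 0 Y := ⟨ha.trans_le hy.1, hy.2.trans_lt hb⟩
  have n0 := hC.norm_le y hy 0 ⟨le_rfl, hy'.1.le⟩
  have n1 := hC.norm_le y hy x hx
  have n2 := hC.sub_one y hy x hx
  have C0 := hC.nonneg
  set U := prop m 0 y
  set R := prop m x y
  set S := U * (R.adjugate * (rotJ * (R - 1) - (R - 1) * rotJ)) * transL U with hS
  have hRR : R.adjugate * R = 1 := prop_adjugate_mul hm hy' hx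
  -- subtracting the conjugate of `rotJ` by `U`, whose symmetrization vanishes, leaves a commutator
  -- of `rotJ` with `R - 1`
  have e : kap m rotJ x y = S + transL S := by
    have e1 : U * R.adjugate * rotJ * (R * transL U) = S + U * rotJ * transL U := by
      rw [hS]
      have : rotJ * (R - 1) - (R - 1) * rotJ = rotJ * R - R * rotJ := by
        simp only [Matrix.mul_sub, Matrix.sub_mul, Matrix.mul_one, Matrix.one_mul]; abel
      rw [this, Matrix.mul_sub, ← Matrix.mul_assoc R.adjugate R, hRR, Matrix.one_mul,
        Matrix.mul_sub, Matrix.sub_mul, sub_add_cancel]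
      simp only [Matrix.mul_assoc]
    have e2 := rotJ_conj_add_transpose U
    change U * R.adjugate * rotJ * (R * transL U) + transL (U * R.adjugate * rotJ * (R * transL U))
      = _
    rw [e1, map_add]
    rw [← transL_apply, ← transL_apply] at e2
    calc _ = S + transL S + (U * rotJ * transL U + transL (U * rotJ * transL U)) := by abel
      _ = _ := by rw [e2, add_zero]
  have hSn : ‖S‖ ≤ 4 * C ^ 4 * ‖transL‖ * ‖rotJ‖ * √(y - x) := by
    have k : ‖rotJ * (R - 1) - (R - 1) * rotJ‖ ≤ 2 * ‖rotJ‖ * (C * √(y - x)) := by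
      calc _ ≤ ‖rotJ‖ * ‖R - 1‖ + ‖R - 1‖ * ‖rotJ‖ :=
            (norm_sub_le _ _).trans (add_le_add (norm_mul_le _ _) (norm_mul_le _ _))
        _ = 2 * ‖rotJ‖ * ‖R - 1‖ := by ring
        _ ≤ _ := by gcongr
    calc _ ≤ ‖U‖ * (‖R.adjugate‖ * ‖rotJ * (R - 1) - (R - 1) * rotJ‖) * ‖transL U‖ :=
          (norm_mul_le _ _).trans (mul_le_mul_of_nonneg_right ((norm_mul_le _ _).trans
            (mul_le_mul_of_nonneg_left (norm_mul_le _ _) (norm_nonneg _))) (norm_nonneg _))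
      _ ≤ C * ((2 * C) * (2 * ‖rotJ‖ * (C * √(y - x)))) * (‖transL‖ * C) := by
          gcongr
          · exact (norm_adjugate_le _).trans (by gcongr)
          · exact (transL.le_opNorm _).trans (by gcongr)
      _ = _ := by ring
  have hk : ‖kap m rotJ x y‖ ≤ (1 + ‖transL‖) * (4 * C ^ 4 * ‖transL‖ * ‖rotJ‖ * √(y - x)) := by
    rw [e]
    calc _ ≤ ‖S‖ + ‖transL‖ * ‖S‖ := (norm_add_le _ _).trans (add_le_add le_rfl (transL.le_opNorm _))
      _ = (1 + ‖transL‖) * ‖S‖ := by ring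
      _ ≤ _ := by gcongr
  calc |kerZ m l x y| ≤ ‖l‖ * ‖kap m rotJ x y‖ := l.le_opNorm _
    _ ≤ ‖l‖ * ((1 + ‖transL‖) * (4 * C ^ 4 * ‖transL‖ * ‖rotJ‖ * √(y - x))) := by gcongr
    _ = _ := by ring

/-- Joint differentiability of `kap`, with a bound on the derivative along the diagonal. -/
theorem differentiableAt_kap (hm : IsProfile Y m m') {a b C : ℝ} (hb : b < Y)
    (hC : PropBounds m a b C) (X : M2) {x y : ℝ} (hy : y ∈ Icc a b) (hx : x ∈ Ioo 0 y) :
    ∃ D : ℝ × ℝ →L[ℝ] M2, HasFDerivAt (fun p : ℝ × ℝ => kap m X p.1 p.2) D (x, y) ∧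
      ‖D (1, 1)‖ ≤ (1 + ‖transL‖) * (8 * C ^ 4 * ‖transL‖ * ‖X‖) * (1 + ‖m x‖) := by
  have hyY : y < Y := hy.2.trans_lt hb
  have C0 := hC.nonneg
  have n0 := hC.norm_le y hy 0 ⟨le_rfl, hx.1.le.trans hx.2.le⟩
  have n1 := hC.norm_le y hy x ⟨hx.1.le, hx.2.le⟩
  have hR := (differentiableAt_prop hm hx.1 hx.2 hyY).1.hasFDerivAt
  have nR := hC.diag y hy x hx
  set DR := fderiv ℝ (fun p : ℝ × ℝ => prop m p.1 p.2) (x, y) with hDR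
  obtain ⟨hUd, nU⟩ := hC.axis y hy
  have hsnd : HasFDerivAt (fun p : ℝ × ℝ => p.2) (ContinuousLinearMap.snd ℝ ℝ ℝ) (x, y) :=
    hasFDerivAt_snd
  have hU : HasFDerivAt (fun p : ℝ × ℝ => prop m 0 p.2)
      ((ContinuousLinearMap.toSpanSingleton ℝ (deriv (prop m 0) y)).comp
        (ContinuousLinearMap.snd ℝ ℝ ℝ)) (x, y) :=
    HasFDerivAt.comp (x, y) (g := prop m 0) hUd.hasDerivAt.hasFDerivAt hsnd
  have hAd := adjL.hasFDerivAt.comp (x, y) hR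
  have hUt := transL.hasFDerivAt.comp (x, y) hU
  have hT := ((hU.mul' hAd).mul_const' X).mul' (hR.mul' hUt)
  have hK := hT.add (transL.hasFDerivAt.comp (x, y) hT)
  refine ⟨_, hK, ?_⟩
  set U := prop m 0 y
  set R := prop m x y
  set U' := deriv (prop m 0) y
  set R' := DR (1, 1)
  -- the derivative along the diagonal of the first summand of `kap`
  set T' := U * R.adjugate * X * (R * transL U' + R' * transL U)
    + (U * R'.adjugate + U' * R.adjugate) * X * (R * transL U) with hT'
  have hT'n : ‖T'‖ ≤ 8 * C ^ 4 * ‖transL‖ * ‖X‖ * (1 + ‖m x‖) := by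
    have i1 : ‖R.adjugate‖ ≤ 2 * C := (norm_adjugate_le _).trans (by gcongr)
    have i2 : ‖R'.adjugate‖ ≤ 2 * (C * (1 + ‖m x‖)) := (norm_adjugate_le _).trans (by gcongr)
    have i3 : ‖transL U‖ ≤ ‖transL‖ * C := (transL.le_opNorm _).trans (by gcongr)
    have i4 : ‖transL U'‖ ≤ ‖transL‖ * C := (transL.le_opNorm _).trans (by gcongr)
    have m0 : 0 ≤ ‖m x‖ := norm_nonneg _
    have j1 : ‖U * R.adjugate * X * (R * transL U' + R' * transL U)‖
        ≤ C * (2 * C) * ‖X‖ * (C * (‖transL‖ * C) + C * (1 + ‖m x‖) * (‖transL‖ * C)) :=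
      calc _ ≤ ‖U‖ * ‖R.adjugate‖ * ‖X‖ * (‖R‖ * ‖transL U'‖ + ‖R'‖ * ‖transL U‖) :=
            (norm_mul_le _ _).trans (mul_le_mul ((norm_mul_le _ _).trans
            (mul_le_mul_of_nonneg_right (norm_mul_le _ _) (norm_nonneg _)))
            ((norm_add_le _ _).trans (add_le_add (norm_mul_le _ _) (norm_mul_le _ _)))
            (norm_nonneg _) (by positivity))
        _ ≤ _ := by gcongr
    have j2 : ‖(U * R'.adjugate + U' * R.adjugate) * X * (R * transL U)‖
        ≤ (C * (2 * (C * (1 + ‖m x‖))) + C * (2 * C)) * ‖X‖ * (C * (‖transL‖ * C)) :=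
      calc _ ≤ (‖U‖ * ‖R'.adjugate‖ + ‖U'‖ * ‖R.adjugate‖) * ‖X‖ * (‖R‖ * ‖transL U‖) :=
            (norm_mul_le _ _).trans (mul_le_mul ((norm_mul_le _ _).trans
            (mul_le_mul_of_nonneg_right ((norm_add_le _ _).trans
              (add_le_add (norm_mul_le _ _) (norm_mul_le _ _))) (norm_nonneg _)))
            (norm_mul_le _ _) (norm_nonneg _) (by positivity))
        _ ≤ _ := by gcongr
    have : 0 ≤ C ^ 4 * ‖transL‖ * ‖X‖ * ‖m x‖ := by positivity
    have := (norm_add_le _ _).trans (add_le_add j1 j2)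
    refine this.trans ?_
    nlinarith
  have e : ‖T' + transL T'‖ ≤ ‖T'‖ + ‖transL‖ * ‖T'‖ :=
    (norm_add_le _ _).trans (add_le_add le_rfl (transL.le_opNorm _))
  have fin : ‖T' + transL T'‖ ≤ (1 + ‖transL‖) * (8 * C ^ 4 * ‖transL‖ * ‖X‖) * (1 + ‖m x‖) := by
    calc _ ≤ (1 + ‖transL‖) * ‖T'‖ := e.trans_eq (by ring)
      _ ≤ (1 + ‖transL‖) * (8 * C ^ 4 * ‖transL‖ * ‖X‖ * (1 + ‖m x‖)) := by gcongr
      _ = _ := by ring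
  refine le_trans (le_of_eq ?_) fin
  congr 1
  have hTe : T' = U * R.adjugate * X * (R * transL ((1 : ℝ) • U') + R' * transL U)
      + ((U * R'.adjugate + (1 : ℝ) • U' * R.adjugate) * X) * (R * transL U) := by
    rw [hT', one_smul]
  rw [hTe]
  rfl

end Profile

/-! ### Pairing of half-integrals -/

/-- A kernel `φ(x, y)` on the triangle `0 < x < y` that vanishes for `y ≥ b`, with bounds on the
kernel and on its derivatives along the first coordinate and along the diagonal. -/
structure IsSmearedKernel (b C : ℝ) (β : ℝ → ℝ) (φ : ℝ × ℝ → ℂ) : Prop where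
  vanish : ∀ x y, b ≤ y → φ (x, y) = 0
  diff : ∀ x y, 0 < x → x < y → DifferentiableAt ℝ φ (x, y)
  bound : ∀ x y, 0 < x → x < y → ‖φ (x, y)‖ ≤ C
  fst : ∀ x y, 0 < x → x < y → ‖fderiv ℝ φ (x, y) (1, 0)‖ ≤ β x
  diag : ∀ x y, 0 < x → x < y → ‖fderiv ℝ φ (x, y) (1, 1)‖ ≤ β x

/-- `√x φ(x, x + u)`. -/
def shiftK (φ : ℝ × ℝ → ℂ) (x u : ℝ) : ℂ := √x • φ (x, x + u)

/-- The derivative of `shiftK φ x u` in `x`. -/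
def dshiftK (φ : ℝ × ℝ → ℂ) (x u : ℝ) : ℂ :=
  (1 / (2 * √x)) • φ (x, x + u) + √x • fderiv ℝ φ (x, x + u) (1, 1)

/-- The half-integral `√x ∫ φ(x, y) (y - x)^(-1/2) dy`, in terms of `u = y - x`. -/
def smearK (b : ℝ) (φ : ℝ × ℝ → ℂ) (x : ℝ) : ℂ := ∫ u in Ioo 0 b, (√u)⁻¹ • shiftK φ x u

/-- The derivative of the half-integral. -/
def dsmearK (b : ℝ) (φ : ℝ × ℝ → ℂ) (x : ℝ) : ℂ := ∫ u in Ioo 0 b, (√u)⁻¹ • dshiftK φ x u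

/-- A bound for `dshiftK`. -/
def shiftBound (C : ℝ) (β : ℝ → ℝ) (x : ℝ) : ℝ := 1 / (2 * √x) * C + √x * β x

section
variable {Y b C : ℝ} {β : ℝ → ℝ} {φ ψ : ℝ × ℝ → ℂ}

theorem hasDerivAt_shiftK (h : IsSmearedKernel b C β φ) {x u : ℝ} (hx : 0 < x) (hu : 0 < u) :
    HasDerivAt (fun x => shiftK φ x u) (dshiftK φ x u) x := by
  have h1 : HasDerivAt (fun x => (x, x + u)) ((1 : ℝ), (1 : ℝ)) x :=
    (hasDerivAt_id x).prodMk ((hasDerivAt_id x).add_const u)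
  have h2 := HasFDerivAt.comp_hasDerivAt (f := fun x => (x, x + u)) x
    (h.diff x (x + u) hx (by linarith)).hasFDerivAt h1
  have h3 := ((hasDerivAt_id x).sqrt hx.ne').smul h2
  refine h3.congr_deriv ?_
  rw [dshiftK, add_comm]
  rfl

theorem norm_shiftK_le (h : IsSmearedKernel b C β φ) {x u : ℝ} (hx : 0 < x) (hu : 0 < u) :
    ‖shiftK φ x u‖ ≤ √x * C := by
  rw [shiftK, norm_smul, Real.norm_of_nonneg (Real.sqrt_nonneg _)]
  exact mul_le_mul_of_nonneg_left (h.bound x _ hx (by linarith)) (Real.sqrt_nonneg _)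

theorem norm_dshiftK_le (h : IsSmearedKernel b C β φ) {x u : ℝ} (hx : 0 < x) (hu : 0 < u) :
    ‖dshiftK φ x u‖ ≤ shiftBound C β x := by
  refine (norm_add_le _ _).trans (add_le_add ?_ ?_)
  · rw [norm_smul, Real.norm_of_nonneg (by positivity)]
    exact mul_le_mul_of_nonneg_left (h.bound x _ hx (by linarith)) (by positivity)
  · rw [norm_smul, Real.norm_of_nonneg (by positivity)]
    exact mul_le_mul_of_nonneg_left (h.diag x _ hx (by linarith)) (by positivity)

theorem continuousOn_shift (h : IsSmearedKernel b C β φ) :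
    ContinuousOn (fun w : ℝ × ℝ => φ (w.1, w.1 + w.2)) (Ioi 0 ×ˢ Ioi 0) := by
  rintro ⟨x, u⟩ ⟨hx, hu⟩
  have hx' : 0 < x := hx
  have hu' : 0 < u := hu
  have h1 : ContinuousAt φ (x, x + u) := (h.diff x (x + u) hx' (by linarith)).continuousAt
  have h2 : ContinuousAt (fun w : ℝ × ℝ => (w.1, w.1 + w.2)) (x, u) := by fun_prop
  exact (ContinuousAt.comp (f := fun w : ℝ × ℝ => (w.1, w.1 + w.2)) h1 h2).continuousWithinAt

section
variable {α : Type*} [TopologicalSpace α] [MeasurableSpace α] [BorelSpace α]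
  {ν : Measure α} {p : α → ℝ × ℝ} {S : Set α}

theorem aestronglyMeasurable_shiftK (h : IsSmearedKernel b C β φ) (hp : Continuous p)
    (hS : MeasurableSet S) (hpS : ∀ w ∈ S, p w ∈ Ioi (0 : ℝ) ×ˢ Ioi (0 : ℝ)) :
    AEStronglyMeasurable (fun w => shiftK φ (p w).1 (p w).2) (ν.restrict S) := by
  have h1 : AEStronglyMeasurable (fun w => φ ((p w).1, (p w).1 + (p w).2)) (ν.restrict S) :=
    ((continuousOn_shift h).comp hp.continuousOn hpS).aestronglyMeasurable hS
  have h2 : Continuous fun w => √(p w).1 := by fun_prop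
  exact h2.aestronglyMeasurable.smul h1

theorem aestronglyMeasurable_dshiftK (h : IsSmearedKernel b C β φ) (hp : Continuous p)
    (hS : MeasurableSet S) (hpS : ∀ w ∈ S, p w ∈ Ioi (0 : ℝ) ×ˢ Ioi (0 : ℝ)) :
    AEStronglyMeasurable (fun w => dshiftK φ (p w).1 (p w).2) (ν.restrict S) := by
  have h1 : AEStronglyMeasurable (fun w => φ ((p w).1, (p w).1 + (p w).2)) (ν.restrict S) :=
    ((continuousOn_shift h).comp hp.continuousOn hpS).aestronglyMeasurable hS
  have hp' := hp.measurable
  have h0 : AEStronglyMeasurable (fun w => 1 / (2 * √(p w).1)) (ν.restrict S) :=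
    (by fun_prop : Measurable fun w => 1 / (2 * √(p w).1)).aestronglyMeasurable
  have h2 : Measurable (fun w => √(p w).1 • fderiv ℝ φ ((p w).1, (p w).1 + (p w).2) (1, 1)) := by
    have := (measurable_fderiv_apply_const ℝ φ ((1, 1) : ℝ × ℝ)).comp
      (by fun_prop : Measurable fun w => ((p w).1, (p w).1 + (p w).2))
    exact (by fun_prop : Measurable fun w => √(p w).1).smul this
  exact (h0.smul h1).add h2.aestronglyMeasurable

end

theorem integrableOn_inv_sqrt (b : ℝ) : IntegrableOn (fun u => (√u)⁻¹) (Ioo 0 b) := by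
  have h := intervalIntegral.intervalIntegrable_rpow' (a := 0) (b := b) (r := -(1 / 2 : ℝ))
    (by norm_num)
  refine (h.1.mono_set Ioo_subset_Ioc_self).congr_fun (fun u hu => ?_) measurableSet_Ioo
  change u ^ (-(1 / 2) : ℝ) = _
  rw [Real.rpow_neg hu.1.le, ← Real.sqrt_eq_rpow]

theorem aestronglyMeasurable_inv_sqrt_smul {g : ℝ → ℂ} {S : Set ℝ}
    (hg : AEStronglyMeasurable g (volume.restrict S)) :
    AEStronglyMeasurable (fun u => (√u)⁻¹ • g u) (volume.restrict S) := by
  have h0 : AEStronglyMeasurable (fun u : ℝ => (√u)⁻¹) (volume.restrict S) :=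
    (by fun_prop : Measurable fun u : ℝ => (√u)⁻¹).aestronglyMeasurable
  exact h0.smul hg

theorem integrableOn_slice {g : ℝ → ℂ} {M : ℝ} {S : Set ℝ} (hS : MeasurableSet S)
    (hSb : S ⊆ Ioo 0 b)
    (hg : AEStronglyMeasurable g (volume.restrict S)) (hM : ∀ u ∈ S, ‖g u‖ ≤ M) :
    IntegrableOn (fun u => (√u)⁻¹ • g u) S := by
  refine Integrable.mono' (((integrableOn_inv_sqrt b).mono_set hSb).mul_const M)
    (aestronglyMeasurable_inv_sqrt_smul hg) ?_
  filter_upwards [ae_restrict_mem hS] with u hu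
  rw [norm_smul, Real.norm_of_nonneg (by positivity)]
  exact mul_le_mul_of_nonneg_left (hM u hu) (by positivity)

theorem aestronglyMeasurable_shiftK_slice (h : IsSmearedKernel b C β φ) {x : ℝ} (hx : 0 < x)
    {S : Set ℝ} (hS : MeasurableSet S) (hS0 : S ⊆ Ioi 0) :
    AEStronglyMeasurable (shiftK φ x) (volume.restrict S) :=
  aestronglyMeasurable_shiftK h (p := fun u : ℝ => (x, u)) (by fun_prop) hS
    fun _ hu => ⟨hx, hS0 hu⟩

theorem aestronglyMeasurable_dshiftK_slice (h : IsSmearedKernel b C β φ) {x : ℝ} (hx : 0 < x)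
    {S : Set ℝ} (hS : MeasurableSet S) (hS0 : S ⊆ Ioi 0) :
    AEStronglyMeasurable (dshiftK φ x) (volume.restrict S) :=
  aestronglyMeasurable_dshiftK h (p := fun u : ℝ => (x, u)) (by fun_prop) hS
    fun _ hu => ⟨hx, hS0 hu⟩

/-- At fixed `u = y - x` the half-integral may be differentiated under the integral sign. -/
theorem hasDerivAt_smearK (h : IsSmearedKernel b C β φ) (hβ : ContinuousOn β (Ioo 0 Y)) {x : ℝ}
    (hx : x ∈ Ioo 0 Y) : HasDerivAt (smearK b φ) (dsmearK b φ x) x := by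
  have hbc : ContinuousOn (shiftBound C β) (Ioo 0 Y) := by
    have : ContinuousOn (fun x : ℝ => 1 / (2 * √x)) (Ioo 0 Y) :=
      ContinuousOn.div (by fun_prop) (by fun_prop) fun z hz => by
        have := Real.sqrt_pos.2 hz.1; positivity
    exact (this.mul continuousOn_const).add (ContinuousOn.mul (by fun_prop) hβ)
  obtain ⟨δ, δ0, hδ⟩ := Metric.nhds_basis_closedBall.mem_iff.1 (isOpen_Ioo.mem_nhds hx)
  obtain ⟨M, hM⟩ := (isCompact_closedBall x δ).exists_bound_of_continuousOn (hbc.mono hδ)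
  refine (hasDerivAt_integral_of_dominated_loc_of_deriv_le (s := Metric.closedBall x δ)
    (bound := fun u => (√u)⁻¹ * M)
    (F := fun x u => (√u)⁻¹ • shiftK φ x u) (F' := fun x u => (√u)⁻¹ • dshiftK φ x u)
    (Metric.closedBall_mem_nhds x δ0) ?_ ?_ ?_ ?_ ((integrableOn_inv_sqrt b).mul_const M) ?_).2
  · filter_upwards [isOpen_Ioo.mem_nhds hx] with z hz
    exact aestronglyMeasurable_inv_sqrt_smul (aestronglyMeasurable_shiftK_slice h hz.1
      measurableSet_Ioo Ioo_subset_Ioi_self)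
  · exact integrableOn_slice measurableSet_Ioo le_rfl (aestronglyMeasurable_shiftK_slice h hx.1
      measurableSet_Ioo Ioo_subset_Ioi_self) fun u hu => norm_shiftK_le h hx.1 hu.1
  · exact aestronglyMeasurable_inv_sqrt_smul (aestronglyMeasurable_dshiftK_slice h hx.1
      measurableSet_Ioo Ioo_subset_Ioi_self)
  · filter_upwards [ae_restrict_mem measurableSet_Ioo] with u hu z hz
    rw [norm_smul, Real.norm_of_nonneg (by positivity)]
    refine mul_le_mul_of_nonneg_left ?_ (by positivity)
    exact (norm_dshiftK_le h (hδ hz).1 hu.1).trans ((le_abs_self _).trans (hM z hz))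
  · filter_upwards [ae_restrict_mem measurableSet_Ioo] with u hu z hz
    exact (hasDerivAt_shiftK h (hδ hz).1 hu.1).fun_const_smul _

theorem norm_smearK_le (h : IsSmearedKernel b C β φ) {x : ℝ} (hx : 0 < x) :
    ‖smearK b φ x‖ ≤ (∫ u in Ioo 0 b, (√u)⁻¹) * (√x * C) := by
  rw [← integral_mul_const]
  refine norm_integral_le_of_norm_le ((integrableOn_inv_sqrt b).mul_const _) ?_
  filter_upwards [ae_restrict_mem measurableSet_Ioo] with u hu
  rw [norm_smul, Real.norm_of_nonneg (by positivity)]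
  exact mul_le_mul_of_nonneg_left (norm_shiftK_le h hx hu.1) (by positivity)

theorem norm_dsmearK_le (h : IsSmearedKernel b C β φ) {x : ℝ} (hx : 0 < x) :
    ‖dsmearK b φ x‖ ≤ (∫ u in Ioo 0 b, (√u)⁻¹) * shiftBound C β x := by
  rw [← integral_mul_const]
  refine norm_integral_le_of_norm_le ((integrableOn_inv_sqrt b).mul_const _) ?_
  filter_upwards [ae_restrict_mem measurableSet_Ioo] with u hu
  rw [norm_smul, Real.norm_of_nonneg (by positivity)]
  exact mul_le_mul_of_nonneg_left (norm_dshiftK_le h hx hu.1) (by positivity)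

theorem integral_prod_inner {α γ : Type*} [MeasurableSpace α] [MeasurableSpace γ] {μ : Measure α}
    {ν : Measure γ} [SFinite μ] [SFinite ν] {f : α → ℂ} {g : γ → ℂ} (hf : Integrable f μ)
    (hg : Integrable g ν) :
    ∫ p, inner ℝ (f p.1) (g p.2) ∂(μ.prod ν) = inner ℝ (∫ a, f a ∂μ) (∫ c, g c ∂ν) := by
  have h1 := integral_prod_mul (μ := μ) (ν := ν) (fun a => conj (f a)) g
  have hf' : Integrable (fun a => conj (f a)) μ := by
    simpa using! (Complex.conjCLE.toContinuousLinearMap.integrable_comp hf)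
  have h2 := integral_re (𝕜 := ℂ) (hf'.mul_prod hg)
  simp only [Complex.inner, RCLike.re_to_complex] at h2 ⊢
  simp only [mul_comm (g _)]
  rw [h2, h1, integral_conj, mul_comm]

end

/-! ### Integration by parts for a pair of half-integrals -/

/-- The integrand of the half-integral, `u^(-1/2) √x φ(x, x + u)`. -/
def halfK (φ : ℝ × ℝ → ℂ) (x u : ℝ) : ℂ := (√u)⁻¹ • shiftK φ x u

/-- The integrand of the derivative of the half-integral. -/
def dhalfK (φ : ℝ × ℝ → ℂ) (x u : ℝ) : ℂ := (√u)⁻¹ • dshiftK φ x u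

/-- The integrand of the pairing of a derivative of a half-integral with a half-integral. -/
def pairK (φ ψ : ℝ × ℝ → ℂ) (w : ℝ × ℝ × ℝ) : ℝ := ⟪dhalfK φ w.1 w.2.1, halfK ψ w.1 w.2.2⟫

section
variable {Y b C : ℝ} {β : ℝ → ℝ} {φ ψ : ℝ × ℝ → ℂ}

theorem hasDerivAt_halfK (h : IsSmearedKernel b C β φ) {x u : ℝ} (hx : 0 < x) (hu : 0 < u) :
    HasDerivAt (fun x => halfK φ x u) (dhalfK φ x u) x :=
  (hasDerivAt_shiftK h hx hu).fun_const_smul _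

theorem norm_halfK_le (h : IsSmearedKernel b C β φ) {x u : ℝ} (hx : 0 < x) (hu : 0 < u) :
    ‖halfK φ x u‖ ≤ (√u)⁻¹ * (√x * C) := by
  rw [halfK, norm_smul, Real.norm_of_nonneg (by positivity)]
  exact mul_le_mul_of_nonneg_left (norm_shiftK_le h hx hu) (by positivity)

theorem norm_dhalfK_le (h : IsSmearedKernel b C β φ) {x u : ℝ} (hx : 0 < x) (hu : 0 < u) :
    ‖dhalfK φ x u‖ ≤ (√u)⁻¹ * shiftBound C β x := by
  rw [dhalfK, norm_smul, Real.norm_of_nonneg (by positivity)]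
  exact mul_le_mul_of_nonneg_left (norm_dshiftK_le h hx hu) (by positivity)

theorem IsSmearedKernel.C_nonneg (h : IsSmearedKernel b C β φ) : 0 ≤ C :=
  (norm_nonneg _).trans (h.bound 1 2 (by norm_num) (by norm_num))

theorem IsSmearedKernel.β_nonneg (h : IsSmearedKernel b C β φ) {x : ℝ} (hx : 0 < x) : 0 ≤ β x :=
  (norm_nonneg _).trans (h.fst x (x + 1) hx (by linarith))

theorem abs_pairK_le (h : IsSmearedKernel b C β φ) (h' : IsSmearedKernel b C β ψ) {x u v : ℝ}
    (hx : 0 < x) (hu : 0 < u) (hv : 0 < v) :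
    |pairK φ ψ (x, u, v)| ≤ (C / 2 + x * β x) * C * ((√u)⁻¹ * (√v)⁻¹) := by
  have hC := h.C_nonneg
  have hβ := h.β_nonneg hx
  have hs := Real.mul_self_sqrt hx.le
  have hs0 := Real.sqrt_pos.2 hx
  refine (abs_real_inner_le_norm _ _).trans ((mul_le_mul (norm_dhalfK_le h hx hu)
    (norm_halfK_le h' hx hv) (norm_nonneg _) ?_).trans (le_of_eq ?_))
  · unfold shiftBound; positivity
  · have e : shiftBound C β x * √x = C / 2 + x * β x := by
      unfold shiftBound
      field_simp
      nlinarith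
    rw [← e]; ring

/-- The domain of integration of `pairK`. -/
def pairDomain (Y b : ℝ) : Set (ℝ × ℝ × ℝ) := Ioo 0 Y ×ˢ Ioo 0 b ×ˢ Ioo 0 b

theorem measurableSet_pairDomain : MeasurableSet (pairDomain Y b) :=
  measurableSet_Ioo.prod (measurableSet_Ioo.prod measurableSet_Ioo)

theorem integrableOn_of_bound {g : ℝ × ℝ × ℝ → ℝ} {γ : ℝ → ℝ}
    (hγ : IntegrableOn γ (Ioo 0 Y))
    (hg : AEStronglyMeasurable g (volume.restrict (pairDomain Y b)))
    (hle : ∀ x ∈ Ioo 0 Y, ∀ u ∈ Ioo 0 b, ∀ v ∈ Ioo 0 b,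
      |g (x, u, v)| ≤ γ x * ((√u)⁻¹ * (√v)⁻¹)) : IntegrableOn g (pairDomain Y b) := by
  have h1 : IntegrableOn (fun w : ℝ × ℝ × ℝ => γ w.1 * ((√w.2.1)⁻¹ * (√w.2.2)⁻¹))
      (pairDomain Y b) := by
    have h2 := (integrableOn_inv_sqrt b).mul_prod (integrableOn_inv_sqrt b)
    have h3 := Integrable.mul_prod hγ h2
    rw [Measure.prod_restrict, Measure.prod_restrict] at h3
    exact h3
  refine Integrable.mono' h1 hg ?_
  filter_upwards [ae_restrict_mem measurableSet_pairDomain] with w hw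
  exact hle w.1 hw.1 w.2.1 hw.2.1 w.2.2 hw.2.2

theorem integrableOn_mul_id (hβi : IntegrableOn β (Ioo 0 Y)) :
    IntegrableOn (fun x => x * β x) (Ioo 0 Y) := by
  refine Integrable.mono' (hβi.norm.const_mul Y)
    (AEStronglyMeasurable.mul (by fun_prop) hβi.aestronglyMeasurable) ?_
  filter_upwards [ae_restrict_mem measurableSet_Ioo] with x hx
  rw [norm_mul, Real.norm_of_nonneg hx.1.le]
  exact mul_le_mul_of_nonneg_right hx.2.le (norm_nonneg _)

theorem integrableOn_const_Ioo (c : ℝ) : IntegrableOn (fun _ : ℝ => c) (Ioo 0 Y) :=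
  integrableOn_const (by simp)

theorem aestronglyMeasurable_half (h : IsSmearedKernel b C β φ) {p : ℝ × ℝ × ℝ → ℝ × ℝ}
    (hp : Continuous p) (hpS : ∀ w ∈ pairDomain Y b, p w ∈ Ioi (0 : ℝ) ×ˢ Ioi (0 : ℝ)) :
    AEStronglyMeasurable (fun w => halfK φ (p w).1 (p w).2) (volume.restrict (pairDomain Y b)) ∧
    AEStronglyMeasurable (fun w => dhalfK φ (p w).1 (p w).2)
      (volume.restrict (pairDomain Y b)) := by
  have hp' := hp.measurable
  have h0 : AEStronglyMeasurable (fun w => (√(p w).2)⁻¹) (volume.restrict (pairDomain Y b)) :=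
    (by fun_prop : Measurable fun w => (√(p w).2)⁻¹).aestronglyMeasurable
  exact ⟨h0.smul (aestronglyMeasurable_shiftK h hp measurableSet_pairDomain hpS),
    h0.smul (aestronglyMeasurable_dshiftK h hp measurableSet_pairDomain hpS)⟩

theorem integrableOn_pairK (h : IsSmearedKernel b C β φ) (h' : IsSmearedKernel b C β ψ)
    (hβi : IntegrableOn β (Ioo 0 Y)) : IntegrableOn (pairK φ ψ) (pairDomain Y b) := by
  refine integrableOn_of_bound (γ := fun x => (C / 2 + x * β x) * C)
    (((integrableOn_const_Ioo _).add (integrableOn_mul_id hβi)).mul_const _) ?_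
    fun x hx u hu v hv => abs_pairK_le h h' hx.1 hu.1 hv.1
  exact AEStronglyMeasurable.inner
    (aestronglyMeasurable_half h (p := fun w => (w.1, w.2.1)) (by fun_prop)
      fun w hw => ⟨hw.1.1, hw.2.1.1⟩).2
    (aestronglyMeasurable_half h' (p := fun w => (w.1, w.2.2)) (by fun_prop)
      fun w hw => ⟨hw.1.1, hw.2.2.1⟩).1

theorem integral_inner_smearK (h : IsSmearedKernel b C β φ) (h' : IsSmearedKernel b C β ψ)
    (hβi : IntegrableOn β (Ioo 0 Y)) :
    ∫ x in Ioo 0 Y, ⟪dsmearK b φ x, smearK b ψ x⟫ = ∫ w in pairDomain Y b, pairK φ ψ w := by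
  have hi := integrableOn_pairK h h' hβi
  rw [pairDomain] at hi ⊢
  rw [Measure.volume_eq_prod, setIntegral_prod _ hi]
  refine setIntegral_congr_fun measurableSet_Ioo fun x hx => ?_
  have h1 : IntegrableOn (fun u => dhalfK φ x u) (Ioo 0 b) :=
    integrableOn_slice measurableSet_Ioo le_rfl (aestronglyMeasurable_dshiftK_slice h hx.1
      measurableSet_Ioo Ioo_subset_Ioi_self) fun u hu => norm_dshiftK_le h hx.1 hu.1
  have h2 : IntegrableOn (fun u => halfK ψ x u) (Ioo 0 b) :=
    integrableOn_slice measurableSet_Ioo le_rfl (aestronglyMeasurable_shiftK_slice h' hx.1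
      measurableSet_Ioo Ioo_subset_Ioi_self) fun u hu => norm_shiftK_le h' hx.1 hu.1
  have h3 := integral_prod_inner h1 h2
  rw [Measure.prod_restrict] at h3
  exact h3.symm

theorem halfK_eq_zero (h : IsSmearedKernel b C β φ) {x u : ℝ} (hu : b ≤ x + u) :
    halfK φ x u = 0 := by
  rw [halfK, shiftK, h.vanish _ _ hu, smul_zero, smul_zero]

/-- Integration by parts in the first coordinate at fixed `u = y - x`. -/
theorem integral_pairK_swap (h : IsSmearedKernel b C β φ) (h' : IsSmearedKernel b C β ψ)
    (hb : 0 < b) (hbY : b < Y) {u v : ℝ} (hu : 0 < u) (hv : 0 < v)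
    (h1 : IntegrableOn (fun x => pairK φ ψ (x, u, v)) (Ioo 0 Y))
    (h2 : IntegrableOn (fun x => pairK ψ φ (x, v, u)) (Ioo 0 Y)) :
    ∫ x in Ioo 0 Y, pairK φ ψ (x, u, v) = - ∫ x in Ioo 0 Y, pairK ψ φ (x, v, u) := by
  have hY : 0 < Y := hb.trans hbY
  have hd : ∀ x, 0 < x → HasDerivAt (fun x => ⟪halfK φ x u, halfK ψ x v⟫)
      (pairK φ ψ (x, u, v) + pairK ψ φ (x, v, u)) x := fun x hx => by
    refine ((hasDerivAt_halfK h hx hu).inner ℝ (hasDerivAt_halfK h' hx hv)).congr_deriv ?_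
    rw [add_comm, pairK, pairK, real_inner_comm (dhalfK ψ x v)]
  have hc : ContinuousOn (fun x => ⟪halfK φ x u, halfK ψ x v⟫) (Icc 0 Y) := by
    intro x hx
    rcases hx.1.eq_or_lt with rfl | hx0
    -- the factors `√x` make the product vanish at the axis
    · have e : ⟪halfK φ 0 u, halfK ψ 0 v⟫ = 0 := by simp [halfK, shiftK]
      rw [ContinuousWithinAt, e]
      refine squeeze_zero_norm' (a := fun x => (√u)⁻¹ * (√x * C) * ((√v)⁻¹ * (√x * C))) ?_ ?_
      · filter_upwards [self_mem_nhdsWithin] with x hx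
        rcases hx.1.eq_or_lt with rfl | hx0
        · simp [halfK, shiftK]
        · have hC := h.C_nonneg
          exact (abs_real_inner_le_norm _ _).trans (mul_le_mul (norm_halfK_le h hx0 hu)
            (norm_halfK_le h' hx0 hv) (norm_nonneg _) (by positivity))
      · have : Continuous fun x : ℝ => (√u)⁻¹ * (√x * C) * ((√v)⁻¹ * (√x * C)) := by fun_prop
        have h0 := (this.tendsto 0).mono_left (nhdsWithin_le_nhds (s := Icc 0 Y))
        simpa using h0
    · exact (hd x hx0).continuousAt.continuousWithinAt
  have hi : IntervalIntegrable (fun x => pairK φ ψ (x, u, v) + pairK ψ φ (x, v, u)) volume 0 Y := by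
    rw [intervalIntegrable_iff_integrableOn_Ioo_of_le hY.le]
    exact h1.add h2
  have h3 := intervalIntegral.integral_eq_sub_of_hasDerivAt_of_le hY.le hc
    (fun x hx => hd x hx.1) hi
  rw [halfK_eq_zero h (by linarith), intervalIntegral.integral_of_le hY.le,
    integral_Ioc_eq_integral_Ioo, integral_add h1 h2] at h3
  have e : ⟪halfK φ 0 u, halfK ψ 0 v⟫ = 0 := by simp [halfK, shiftK]
  rw [inner_zero_left, e] at h3
  linarith

/-- The part `v < u` of the square `(0, b)²`. -/
def lowerTriangle (b : ℝ) : Set (ℝ × ℝ) := {p | 0 < p.2 ∧ p.2 < p.1 ∧ p.1 < b}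

theorem measurableSet_lowerTriangle : MeasurableSet (lowerTriangle b) :=
  (measurableSet_lt measurable_const measurable_snd).inter
    ((measurableSet_lt measurable_snd measurable_fst).inter
      (measurableSet_lt measurable_fst measurable_const))

theorem lowerTriangle_subset : lowerTriangle b ⊆ Ioo 0 b ×ˢ Ioo 0 b :=
  fun _ hp => ⟨⟨hp.1.trans hp.2.1, hp.2.2⟩, ⟨hp.1, hp.2.1.trans hp.2.2⟩⟩

/-- An integral over a square folds onto the triangle below the diagonal. -/
theorem setIntegral_square_eq {g : ℝ × ℝ → ℝ} (hg : IntegrableOn g (Ioo 0 b ×ˢ Ioo 0 b)) :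
    IntegrableOn (fun p => g p + g p.swap) (lowerTriangle b) ∧
    ∫ p in Ioo 0 b ×ˢ Ioo 0 b, g p = ∫ p in lowerTriangle b, (g p + g p.swap) := by
  have hm : MeasurePreserving (Prod.swap : ℝ × ℝ → ℝ × ℝ) volume volume :=
    Measure.measurePreserving_swap
  have he : MeasurableEmbedding (Prod.swap : ℝ × ℝ → ℝ × ℝ) :=
    MeasurableEquiv.prodComm.measurableEmbedding
  have hs : Prod.swap ⁻¹' (Ioo (0:ℝ) b ×ˢ Ioo (0:ℝ) b) = Ioo 0 b ×ˢ Ioo 0 b := by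
    ext p; simp [and_comm]
  have hg' : IntegrableOn (fun p => g p.swap) (Ioo 0 b ×ˢ Ioo 0 b) := by
    rw [← hs]
    exact (hm.integrableOn_comp_preimage he).2 hg
  have h1 := hg.mono_set lowerTriangle_subset
  have h2 := hg'.mono_set lowerTriangle_subset
  refine ⟨h1.add h2, ?_⟩
  rw [integral_add h1 h2]
  have e2 : ∫ p in lowerTriangle b, g p.swap = ∫ p in Prod.swap ⁻¹' lowerTriangle b, g p := by
    rw [← hm.setIntegral_preimage_emb he]
    rfl
  have ms : MeasurableSet (Prod.swap ⁻¹' lowerTriangle b) :=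
    he.measurable measurableSet_lowerTriangle
  have sub : Prod.swap ⁻¹' lowerTriangle b ⊆ Ioo 0 b ×ˢ Ioo 0 b := fun p hp =>
    ⟨⟨hp.1, hp.2.1.trans hp.2.2⟩, ⟨hp.1.trans hp.2.1, hp.2.2⟩⟩
  rw [e2, ← setIntegral_union ?_ ms h1 (hg.mono_set sub)]
  · refine setIntegral_congr_set ?_
    have hdiag : ∀ᵐ p : ℝ × ℝ, p.1 ≠ p.2 := by
      have := (Measure.ae_prod_iff_ae_ae (μ := (volume : Measure ℝ)) (ν := (volume : Measure ℝ))
        (p := fun p => p.1 ≠ p.2)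
        (measurableSet_eq_fun measurable_fst measurable_snd).compl).2
        (Eventually.of_forall fun x => by
          filter_upwards [compl_mem_ae_iff.2 (measure_singleton x)] with y hy
          exact fun h => hy h.symm)
      exact this
    filter_upwards [hdiag] with p hp
    refine propext ⟨fun h => ?_, fun h => ?_⟩
    · rcases lt_or_gt_of_ne hp with h3 | h3
      · exact Or.inr ⟨h.1.1, h3, h.2.2⟩
      · exact Or.inl ⟨h.2.1, h3, h.1.2⟩
    · exact h.elim (fun h => lowerTriangle_subset h) (fun h => sub h)
  · rw [Set.disjoint_left]
    intro p hp hq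
    exact lt_asymm hp.2.1 hq.2.1

end

/-- The kernel `√x (y - x)^(-1/2) φ(x, y)` of the half-integral. -/
def coreK (φ : ℝ × ℝ → ℂ) (x y : ℝ) : ℂ := (√x / √(y - x)) • φ (x, y)

/-- The derivative of `coreK φ x y` in `x` at fixed `y`; it is not integrable in `y`. -/
def dcoreK (φ : ℝ × ℝ → ℂ) (x y : ℝ) : ℂ :=
  (√x / √(y - x) * (1 / (2 * x) + 1 / (2 * (y - x)))) • φ (x, y)
    + (√x / √(y - x)) • fderiv ℝ φ (x, y) (1, 0)

/-- The antisymmetrized pairing of a derivative with a kernel. -/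
def antiK (φ ψ : ℝ × ℝ → ℂ) (w : ℝ × ℝ × ℝ) : ℝ :=
  ⟪dcoreK φ w.1 w.2.1, coreK ψ w.1 w.2.2⟫ - ⟪dcoreK ψ w.1 w.2.1, coreK φ w.1 w.2.2⟫

/-- The derivative of `halfK φ x u` in `u`. -/
def uhalfK (φ : ℝ × ℝ → ℂ) (x u : ℝ) : ℂ :=
  (-(1 / (2 * u)) * (√u)⁻¹) • shiftK φ x u + ((√u)⁻¹ * √x) • fderiv ℝ φ (x, x + u) (0, 1)

section
variable {Y b C : ℝ} {β : ℝ → ℝ} {φ ψ : ℝ × ℝ → ℂ}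

theorem coreK_add (x u : ℝ) : coreK φ x (x + u) = halfK φ x u := by
  rw [coreK, halfK, shiftK, smul_smul, add_sub_cancel_left, div_eq_inv_mul]

/-- At fixed `y` an increase of `x` decreases `u = y - x`, so the derivative of `coreK` differs
from that at fixed `u` by the `u`-derivative. -/
theorem dcoreK_add {x u : ℝ} (hx : 0 < x) (hu : 0 < u) :
    dcoreK φ x (x + u) = dhalfK φ x u - uhalfK φ x u := by
  have e : fderiv ℝ φ (x, x + u) (1, 1)
      = fderiv ℝ φ (x, x + u) (1, 0) + fderiv ℝ φ (x, x + u) (0, 1) := by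
    rw [← map_add]; simp
  have hs := Real.mul_self_sqrt hx.le
  have hs0 := Real.sqrt_pos.2 hx
  have hs' := Real.sqrt_pos.2 hu
  rw [dcoreK, dhalfK, uhalfK, dshiftK, shiftK, e, add_sub_cancel_left]
  have e2 : √x / √u * (1 / (2 * x) + 1 / (2 * u))
      = (√u)⁻¹ * (1 / (2 * √x)) + 1 / (2 * u) * (√u)⁻¹ * √x := by
    have : √x * (1 / (2 * x)) = 1 / (2 * √x) := by
      field_simp; nlinarith
    rw [← this]; ring
  rw [e2]
  module

theorem hasDerivAt_shiftK_snd (h : IsSmearedKernel b C β φ) {x u : ℝ} (hx : 0 < x) (hu : 0 < u) :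
    HasDerivAt (shiftK φ x) (√x • fderiv ℝ φ (x, x + u) (0, 1)) u := by
  have h1 : HasDerivAt (fun u => (x, x + u)) ((0 : ℝ), (1 : ℝ)) u :=
    (hasDerivAt_const u x).prodMk ((hasDerivAt_id u).const_add x)
  have h2 := HasFDerivAt.comp_hasDerivAt (f := fun u => (x, x + u)) u
    (h.diff x (x + u) hx (by linarith)).hasFDerivAt h1
  exact h2.fun_const_smul _

theorem hasDerivAt_halfK_snd (h : IsSmearedKernel b C β φ) {x u : ℝ} (hx : 0 < x) (hu : 0 < u) :
    HasDerivAt (halfK φ x) (uhalfK φ x u) u := by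
  have h1 : HasDerivAt (fun u : ℝ => (√u)⁻¹) (-(1 / (2 * u)) * (√u)⁻¹) u := by
    refine ((Real.hasDerivAt_sqrt hu.ne').inv (Real.sqrt_pos.2 hu).ne').congr_deriv ?_
    have hs := Real.mul_self_sqrt hu.le
    have hs0 := Real.sqrt_pos.2 hu
    field_simp
    nlinarith
  refine (h1.smul (hasDerivAt_shiftK_snd h hx hu)).congr_deriv ?_
  rw [uhalfK, smul_smul, add_comm]

/-- The derivative in `y` is the difference of the derivatives along the diagonal and in `x`. -/
theorem norm_fderiv_snd_le (h : IsSmearedKernel b C β φ) {x u : ℝ} (hx : 0 < x) (hu : 0 < u) :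
    ‖√x • fderiv ℝ φ (x, x + u) (0, 1)‖ ≤ √x * (2 * β x) := by
  have e : fderiv ℝ φ (x, x + u) (0, 1)
      = fderiv ℝ φ (x, x + u) (1, 1) - fderiv ℝ φ (x, x + u) (1, 0) := by
    rw [← map_sub]; simp
  rw [norm_smul, Real.norm_of_nonneg (Real.sqrt_nonneg _), e]
  refine mul_le_mul_of_nonneg_left ((norm_sub_le _ _).trans ?_) (Real.sqrt_nonneg _)
  linarith [h.fst x (x + u) hx (by linarith), h.diag x (x + u) hx (by linarith)]

/-- The antisymmetrized product whose `u`-derivative has to be added to pass from shifted to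
original coordinates. -/
def crossK (φ ψ : ℝ × ℝ → ℂ) (x v u : ℝ) : ℝ :=
  ⟪halfK φ x u, halfK ψ x v⟫ - ⟪halfK ψ x u, halfK φ x v⟫

/-- The derivative of `crossK` in `u`. -/
def dcrossK (φ ψ : ℝ × ℝ → ℂ) (x v u : ℝ) : ℝ :=
  ⟪uhalfK φ x u, halfK ψ x v⟫ - ⟪uhalfK ψ x u, halfK φ x v⟫

theorem hasDerivAt_crossK (h : IsSmearedKernel b C β φ) (h' : IsSmearedKernel b C β ψ)
    {x u v : ℝ} (hx : 0 < x) (hu : 0 < u) :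
    HasDerivAt (crossK φ ψ x v) (dcrossK φ ψ x v u) u := by
  have h1 := (hasDerivAt_halfK_snd h hx hu).inner ℝ (hasDerivAt_const u (halfK ψ x v))
  have h2 := (hasDerivAt_halfK_snd h' hx hu).inner ℝ (hasDerivAt_const u (halfK φ x v))
  refine (h1.sub h2).congr_deriv ?_
  simp [dcrossK]

theorem crossK_self (x v : ℝ) : crossK φ ψ x v v = 0 := by
  rw [crossK, real_inner_comm, sub_self]

/-- The singularity of `dcrossK` at `u = 0` is only `u^(-1/2)`, since the antisymmetrized product
vanishes on the diagonal. -/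
theorem abs_dcrossK_le (h : IsSmearedKernel b C β φ) (h' : IsSmearedKernel b C β ψ)
    {x u v : ℝ} (hx : 0 < x) (hv : 0 < v) (huv : v < u) :
    |dcrossK φ ψ x v u| ≤ 6 * (x * β x) * C * ((√u)⁻¹ * (√v)⁻¹) := by
  have hu := hv.trans huv
  have hC := h.C_nonneg
  have hβ := h.β_nonneg hx
  have hs := Real.mul_self_sqrt hx.le
  have hsu := Real.sqrt_pos.2 hu
  have hsv := Real.sqrt_pos.2 hv
  set k : ℝ → ℝ := fun u => ⟪shiftK φ x u, shiftK ψ x v⟫ - ⟪shiftK ψ x u, shiftK φ x v⟫ with hk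
  set k' : ℝ → ℝ := fun u => ⟪√x • fderiv ℝ φ (x, x + u) (0, 1), shiftK ψ x v⟫
    - ⟪√x • fderiv ℝ ψ (x, x + u) (0, 1), shiftK φ x v⟫ with hk'
  have hkd : ∀ u, 0 < u → HasDerivAt k (k' u) u := fun u hu => by
    have h1 := (hasDerivAt_shiftK_snd h hx hu).inner ℝ (hasDerivAt_const u (shiftK ψ x v))
    have h2 := (hasDerivAt_shiftK_snd h' hx hu).inner ℝ (hasDerivAt_const u (shiftK φ x v))
    refine (h1.sub h2).congr_deriv ?_
    simp [hk']
  have hkb : ∀ u, 0 < u → ‖k' u‖ ≤ 4 * (x * β x) * C := fun u hu => by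
    have a1 : ‖⟪√x • fderiv ℝ φ (x, x + u) (0, 1), shiftK ψ x v⟫‖
        ≤ √x * (2 * β x) * (√x * C) :=
      (norm_inner_le_norm _ _).trans (mul_le_mul (norm_fderiv_snd_le h hx hu)
        (norm_shiftK_le h' hx hv) (norm_nonneg _) (by positivity))
    have a2 : ‖⟪√x • fderiv ℝ ψ (x, x + u) (0, 1), shiftK φ x v⟫‖
        ≤ √x * (2 * β x) * (√x * C) :=
      (norm_inner_le_norm _ _).trans (mul_le_mul (norm_fderiv_snd_le h' hx hu)
        (norm_shiftK_le h hx hv) (norm_nonneg _) (by positivity))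
    refine (norm_sub_le _ _).trans ((add_le_add a1 a2).trans (le_of_eq ?_))
    linear_combination 4 * β x * C * hs
  have hk0 : k v = 0 := by simp only [hk]; rw [real_inner_comm, sub_self]
  have hku : ‖k u‖ ≤ 4 * (x * β x) * C * u := by
    have := (convex_Icc v u).norm_image_sub_le_of_norm_hasDerivWithin_le (f := k) (f' := k')
      (C := 4 * (x * β x) * C)
      (fun z hz => (hkd z (hv.trans_le hz.1)).hasDerivWithinAt)
      (fun z hz => hkb z (hv.trans_le hz.1)) (left_mem_Icc.2 huv.le) (right_mem_Icc.2 huv.le)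
    rw [hk0, sub_zero, Real.norm_of_nonneg (sub_nonneg.2 huv.le)] at this
    refine this.trans (mul_le_mul_of_nonneg_left (by linarith) (by positivity))
  have e : dcrossK φ ψ x v u
      = -(1 / (2 * u)) * (√u)⁻¹ * (√v)⁻¹ * k u + (√u)⁻¹ * (√v)⁻¹ * k' u := by
    simp only [dcrossK, uhalfK, halfK, hk, hk', inner_add_left, real_inner_smul_left,
      real_inner_smul_right]
    ring
  rw [e]
  have b1 : |-(1 / (2 * u)) * (√u)⁻¹ * (√v)⁻¹ * k u|
      ≤ 2 * (x * β x) * C * ((√u)⁻¹ * (√v)⁻¹) := by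
    rw [abs_mul, abs_mul, abs_mul, abs_neg, abs_of_nonneg (by positivity : 0 ≤ 1 / (2 * u)),
      abs_of_nonneg (by positivity : 0 ≤ (√u)⁻¹), abs_of_nonneg (by positivity : 0 ≤ (√v)⁻¹)]
    refine (mul_le_mul_of_nonneg_left hku (by positivity)).trans (le_of_eq ?_)
    field_simp
    ring
  have b2 : |(√u)⁻¹ * (√v)⁻¹ * k' u| ≤ 4 * (x * β x) * C * ((√u)⁻¹ * (√v)⁻¹) := by
    rw [abs_mul, abs_of_nonneg (by positivity : 0 ≤ (√u)⁻¹ * (√v)⁻¹), mul_comm]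
    exact mul_le_mul_of_nonneg_right (hkb u hu) (by positivity)
  refine (abs_add_le _ _).trans ((add_le_add b1 b2).trans (le_of_eq ?_))
  ring

/-- The part of the domain of integration below the diagonal. -/
def pairTriangle (Y b : ℝ) : Set (ℝ × ℝ × ℝ) := Ioo 0 Y ×ˢ lowerTriangle b

theorem measurableSet_pairTriangle : MeasurableSet (pairTriangle Y b) :=
  measurableSet_Ioo.prod measurableSet_lowerTriangle

theorem pairTriangle_subset : pairTriangle Y b ⊆ pairDomain Y b :=
  Set.prod_mono le_rfl lowerTriangle_subset

theorem aestronglyMeasurable_uhalfK (h : IsSmearedKernel b C β φ) :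
    AEStronglyMeasurable (fun w : ℝ × ℝ × ℝ => uhalfK φ w.1 w.2.1)
      (volume.restrict (pairDomain Y b)) := by
  have h0 : AEStronglyMeasurable (fun w : ℝ × ℝ × ℝ => -(1 / (2 * w.2.1)) * (√w.2.1)⁻¹)
      (volume.restrict (pairDomain Y b)) :=
    (by fun_prop : Measurable fun w : ℝ × ℝ × ℝ =>
      -(1 / (2 * w.2.1)) * (√w.2.1)⁻¹).aestronglyMeasurable
  have h1 := aestronglyMeasurable_shiftK (ν := volume) h (p := fun w : ℝ × ℝ × ℝ => (w.1, w.2.1))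
    (by fun_prop) (measurableSet_pairDomain (Y := Y) (b := b)) fun w hw => ⟨hw.1.1, hw.2.1.1⟩
  have h2 : Measurable (fun w : ℝ × ℝ × ℝ => ((√w.2.1)⁻¹ * √w.1) •
      fderiv ℝ φ (w.1, w.1 + w.2.1) (0, 1)) := by
    have := (measurable_fderiv_apply_const ℝ φ ((0, 1) : ℝ × ℝ)).comp
      (by fun_prop : Measurable fun w : ℝ × ℝ × ℝ => (w.1, w.1 + w.2.1))
    exact (by fun_prop : Measurable fun w : ℝ × ℝ × ℝ => (√w.2.1)⁻¹ * √w.1).smul this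
  exact (h0.smul h1).add h2.aestronglyMeasurable

theorem aestronglyMeasurable_dcrossK (h : IsSmearedKernel b C β φ)
    (h' : IsSmearedKernel b C β ψ) :
    AEStronglyMeasurable (fun w : ℝ × ℝ × ℝ => dcrossK φ ψ w.1 w.2.2 w.2.1)
      (volume.restrict (pairDomain Y b)) := by
  have a1 := (aestronglyMeasurable_half h (Y := Y) (b := b) (p := fun w => (w.1, w.2.2))
    (by fun_prop) fun w hw => ⟨hw.1.1, hw.2.2.1⟩).1
  have a2 := (aestronglyMeasurable_half h' (Y := Y) (b := b) (p := fun w => (w.1, w.2.2))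
    (by fun_prop) fun w hw => ⟨hw.1.1, hw.2.2.1⟩).1
  exact ((aestronglyMeasurable_uhalfK h).inner a2).sub ((aestronglyMeasurable_uhalfK h').inner a1)

theorem integrableOn_dcrossK (h : IsSmearedKernel b C β φ) (h' : IsSmearedKernel b C β ψ)
    (hβi : IntegrableOn β (Ioo 0 Y)) :
    IntegrableOn (fun w : ℝ × ℝ × ℝ => dcrossK φ ψ w.1 w.2.2 w.2.1) (pairTriangle Y b) := by
  have h1 : IntegrableOn ((pairTriangle Y b).indicator
      fun w : ℝ × ℝ × ℝ => dcrossK φ ψ w.1 w.2.2 w.2.1) (pairDomain Y b) := by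
    refine integrableOn_of_bound (γ := fun x => 6 * (x * β x) * C)
      (((integrableOn_mul_id hβi).const_mul 6).mul_const _)
      ((aestronglyMeasurable_dcrossK h h').indicator measurableSet_pairTriangle) ?_
    intro x hx u hu v hv
    have hC := h.C_nonneg
    have hβ := h.β_nonneg hx.1
    have hx0 := hx.1
    by_cases hw : (x, u, v) ∈ pairTriangle Y b
    · rw [indicator_of_mem hw]
      exact abs_dcrossK_le h h' hx.1 hv.1 hw.2.2.1
    · rw [indicator_of_notMem hw, abs_zero]
      positivity
  rw [integrableOn_indicator_iff measurableSet_pairTriangle,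
    inter_eq_self_of_subset_left pairTriangle_subset] at h1
  exact h1

/-- The correction from passing to fixed `y` integrates to zero over `v < u < b`: `crossK` vanishes
at `u = v` by antisymmetry and at `u = b` by the support of the kernels. -/
theorem integral_dcrossK (h : IsSmearedKernel b C β φ) (h' : IsSmearedKernel b C β ψ)
    (hβi : IntegrableOn β (Ioo 0 Y)) :
    ∫ w in pairTriangle Y b, dcrossK φ ψ w.1 w.2.2 w.2.1 = 0 := by
  have hi := integrableOn_dcrossK h h' hβi
  have hi' := hi
  rw [pairTriangle] at hi ⊢
  rw [Measure.volume_eq_prod, setIntegral_prod _ hi]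
  refine (integral_congr_ae ?_).trans (integral_zero _ _)
  rw [IntegrableOn, Measure.volume_eq_prod, ← Measure.prod_restrict] at hi
  filter_upwards [hi.prod_right_ae, ae_restrict_mem measurableSet_Ioo] with x hx1 hx
  change ∫ p in lowerTriangle b, dcrossK φ ψ x p.2 p.1 = 0
  have h1 : Integrable ((lowerTriangle b).indicator fun p : ℝ × ℝ => dcrossK φ ψ x p.2 p.1)
      (volume.prod volume) := (integrable_indicator_iff measurableSet_lowerTriangle).2 hx1
  rw [← integral_indicator measurableSet_lowerTriangle, Measure.volume_eq_prod,
    integral_prod_symm _ h1]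
  refine (integral_congr_ae ?_).trans (integral_zero _ _)
  filter_upwards [h1.prod_left_ae] with v hv
  by_cases hvb : v ∈ Ioo 0 b
  -- at fixed `v` the section of the triangle is `v < u < b`
  · have e : (fun u => (lowerTriangle b).indicator (fun p : ℝ × ℝ => dcrossK φ ψ x p.2 p.1) (u, v))
        = (Ioo v b).indicator (dcrossK φ ψ x v) := by
      ext u
      by_cases hu : u ∈ Ioo v b
      · rw [indicator_of_mem hu, indicator_of_mem (show (u, v) ∈ lowerTriangle b from
          ⟨hvb.1, hu.1, hu.2⟩)]
      · rw [indicator_of_notMem hu, indicator_of_notMem fun h => hu ⟨h.2.1, h.2.2⟩]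
    rw [e, integrable_indicator_iff measurableSet_Ioo] at hv
    change ∫ u, (lowerTriangle b).indicator (fun p : ℝ × ℝ => dcrossK φ ψ x p.2 p.1) (u, v) = 0
    rw [e, integral_indicator measurableSet_Ioo, ← integral_Ioc_eq_integral_Ioo,
      ← intervalIntegral.integral_of_le hvb.2.le]
    have hd : ∀ u, v ≤ u → HasDerivAt (crossK φ ψ x v) (dcrossK φ ψ x v u) u := fun u hu =>
      hasDerivAt_crossK h h' hx.1 (hvb.1.trans_le hu)
    rw [intervalIntegral.integral_eq_sub_of_hasDerivAt_of_le hvb.2.le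
      (fun u hu => (hd u hu.1).continuousAt.continuousWithinAt) (fun u hu => hd u hu.1.le)
      ((intervalIntegrable_iff_integrableOn_Ioo_of_le hvb.2.le).2 hv), crossK_self, crossK,
      halfK_eq_zero (u := b) h (by linarith [hx.1]),
      halfK_eq_zero (u := b) h' (by linarith [hx.1])]
    simp
  · change ∫ u, (lowerTriangle b).indicator (fun p : ℝ × ℝ => dcrossK φ ψ x p.2 p.1) (u, v) = 0
    refine (integral_congr_ae (Eventually.of_forall fun u => ?_)).trans (integral_zero _ _)
    exact indicator_of_notMem (fun h => hvb ⟨h.1, h.2.1.trans h.2.2⟩) _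

/-- The shear `(x, u, v) ↦ (x, x + u, x + v)`. -/
def shear : ℝ × ℝ × ℝ ≃ᵐ ℝ × ℝ × ℝ where
  toFun w := (w.1, w.1 + w.2.1, w.1 + w.2.2)
  invFun w := (w.1, w.2.1 - w.1, w.2.2 - w.1)
  left_inv w := by simp
  right_inv w := by simp
  measurable_toFun := by
    change Measurable fun w : ℝ × ℝ × ℝ => (w.1, w.1 + w.2.1, w.1 + w.2.2)
    fun_prop
  measurable_invFun := by
    change Measurable fun w : ℝ × ℝ × ℝ => (w.1, w.2.1 - w.1, w.2.2 - w.1)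
    fun_prop

theorem measurePreserving_shear : MeasurePreserving shear volume volume := by
  refine MeasurePreserving.skew_product (μa := volume) (μb := volume) (μc := volume)
    (μd := volume) (MeasurePreserving.id volume)
    (g := fun (x : ℝ) (p : ℝ × ℝ) => (x + p.1, x + p.2)) (by fun_prop) ?_
  refine Eventually.of_forall fun x => ?_
  have : (fun p : ℝ × ℝ => (x + p.1, x + p.2)) = fun p => (x, x) + p := rfl
  rw [this]
  exact map_add_left_eq_self volume (x, x)

/-- The pairing in terms of `antiK`, still in the coordinates `(x, u, v)`: folding the square in
`(u, v)` onto the triangle and integrating by parts in `x` antisymmetrizes the product of the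
derivatives at fixed `u`, and `dcrossK` converts these to derivatives at fixed `y`. -/
theorem integrableOn_antiK (h : IsSmearedKernel b C β φ) (h' : IsSmearedKernel b C β ψ)
    (hβi : IntegrableOn β (Ioo 0 Y)) (hb : 0 < b) (hbY : b < Y) :
    IntegrableOn (fun w => antiK φ ψ (shear w)) (pairTriangle Y b) ∧
    ∫ x in Ioo 0 Y, ⟪dsmearK b φ x, smearK b ψ x⟫
      = ∫ w in pairTriangle Y b, antiK φ ψ (shear w) := by
  have i1 := integrableOn_pairK h h' hβi
  have i2 := integrableOn_pairK h' h hβi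
  have j1 := i1.mono_set pairTriangle_subset
  have j2 := i2.mono_set pairTriangle_subset
  have hcr := integrableOn_dcrossK h h' hβi
  have hcr0 := integral_dcrossK h h' hβi
  -- `antiK` at the sheared point, by `dcoreK_add`
  have hG : EqOn (fun w => antiK φ ψ (shear w))
      (fun w => (pairK φ ψ w - pairK ψ φ w) - dcrossK φ ψ w.1 w.2.2 w.2.1) (pairTriangle Y b) := by
    intro w hw
    have hx := hw.1.1
    have hv := hw.2.1
    have hu := hv.trans hw.2.2.1
    simp only [antiK, shear, MeasurableEquiv.coe_mk, Equiv.coe_fn_mk, dcoreK_add hx hu, coreK_add,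
      pairK, dcrossK, inner_sub_left]
    ring
  have hint := (j1.sub j2).sub hcr
  refine ⟨(integrableOn_congr_fun hG measurableSet_pairTriangle).2 hint, ?_⟩
  rw [setIntegral_congr_fun measurableSet_pairTriangle hG]
  have e0 : ∫ w in pairTriangle Y b, (pairK φ ψ w - pairK ψ φ w - dcrossK φ ψ w.1 w.2.2 w.2.1)
      = ∫ w in pairTriangle Y b, (pairK φ ψ w - pairK ψ φ w) := by
    have := integral_sub (j1.sub j2) hcr
    rw [hcr0, sub_zero] at this
    exact this
  rw [e0, integral_inner_smearK h h' hβi]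
  -- integrate over `x` first
  set I : (ℝ × ℝ → ℂ) → (ℝ × ℝ → ℂ) → ℝ × ℝ → ℝ := fun φ ψ p => ∫ x in Ioo 0 Y, pairK φ ψ (x, p)
    with hI
  rw [pairDomain, IntegrableOn, Measure.volume_eq_prod, ← Measure.prod_restrict] at i1 i2
  rw [pairTriangle, IntegrableOn, Measure.volume_eq_prod, ← Measure.prod_restrict] at j1 j2
  have k1 : ∫ w in pairDomain Y b, pairK φ ψ w = ∫ p in Ioo 0 b ×ˢ Ioo 0 b, I φ ψ p := by
    rw [pairDomain, Measure.volume_eq_prod, ← Measure.prod_restrict, integral_prod_symm _ i1]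
  have k2 : ∫ w in pairTriangle Y b, (pairK φ ψ w - pairK ψ φ w)
      = ∫ p in lowerTriangle b, (I φ ψ p - I ψ φ p) := by
    rw [pairTriangle, Measure.volume_eq_prod, ← Measure.prod_restrict]
    refine (integral_prod_symm _ (j1.sub j2)).trans (integral_congr_ae ?_)
    filter_upwards [j1.prod_left_ae, j2.prod_left_ae] with p h1 h2
    exact integral_sub h1 h2
  rw [k1, k2, (setIntegral_square_eq i1.integral_prod_right).2]
  refine integral_congr_ae ?_
  have hm : MeasurePreserving (Prod.swap : ℝ × ℝ → ℝ × ℝ) volume volume :=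
    Measure.measurePreserving_swap
  have a1 := (ae_restrict_iff' (measurableSet_Ioo.prod measurableSet_Ioo)).1 i1.prod_left_ae
  have a2 := (ae_restrict_iff' measurableSet_lowerTriangle).2
    (Eventually.mono (hm.quasiMeasurePreserving.ae a1) fun p hp (hl : p ∈ lowerTriangle b) =>
      hp ⟨(lowerTriangle_subset hl).2, (lowerTriangle_subset hl).1⟩)
  filter_upwards [a2, j2.prod_left_ae, ae_restrict_mem measurableSet_lowerTriangle] with p h1 h2 hp
  have := integral_pairK_swap h h' hb hbY hp.1 (hp.1.trans hp.2.1) h1 h2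
  change I φ ψ p + I φ ψ p.swap = I φ ψ p - I ψ φ p
  rw [show I φ ψ p.swap = - I ψ φ p from this, sub_eq_add_neg]

theorem dcoreK_eq_zero (h : IsSmearedKernel b C β φ) {x y : ℝ} (hx : 0 < x) (hxy : x < y)
    (hy : b ≤ y) : dcoreK φ x y = 0 := by
  have h1 : HasDerivAt (fun x => (x, y)) ((1 : ℝ), (0 : ℝ)) x :=
    (hasDerivAt_id x).prodMk (hasDerivAt_const x y)
  have h2 := HasFDerivAt.comp_hasDerivAt (f := fun x => (x, y)) x
    (h.diff x y hx hxy).hasFDerivAt h1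
  have h3 : (φ ∘ fun x => (x, y)) = fun _ => 0 := funext fun z => h.vanish z y hy
  rw [h3] at h2
  rw [dcoreK, h.vanish x y hy, h2.unique (hasDerivAt_const x 0), smul_zero, smul_zero, add_zero]

/-- The pairing of the derivative of a half-integral with another half-integral, as an absolutely
convergent integral over pairs `y₂ < y₁` of inner integrals over `0 < x < y₂`. -/
theorem integral_pairing (h : IsSmearedKernel b C β φ) (h' : IsSmearedKernel b C β ψ)
    (hβi : IntegrableOn β (Ioo 0 Y)) (hb : 0 < b) (hbY : b < Y) :
    (∀ᵐ p ∂volume.restrict (lowerTriangle b),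
      IntegrableOn (fun x => antiK φ ψ (x, p)) (Ioo 0 p.2)) ∧
    IntegrableOn (fun p : ℝ × ℝ => ∫ x in Ioo 0 p.2, antiK φ ψ (x, p)) (lowerTriangle b) ∧
    ∫ x in Ioo 0 Y, ⟪dsmearK b φ x, smearK b ψ x⟫
      = ∫ p in lowerTriangle b, ∫ x in Ioo 0 p.2, antiK φ ψ (x, p) := by
  obtain ⟨hi, he⟩ := integrableOn_antiK h h' hβi hb hbY
  -- the region `0 < x < y₂ < y₁ < b`; the sheared triangle is larger, but the integrand vanishes
  -- for `y₁ ≥ b`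
  set R : Set (ℝ × ℝ × ℝ) := {w | w.2 ∈ lowerTriangle b ∧ w.1 ∈ Ioo 0 w.2.2} with hR
  have mR : MeasurableSet R := by
    refine (measurable_snd measurableSet_lowerTriangle).inter ?_
    exact (measurableSet_lt measurable_const measurable_fst).inter
      (measurableSet_lt measurable_fst (by fun_prop))
  have sub : shear ⁻¹' R ⊆ pairTriangle Y b := by
    rintro ⟨x, u, v⟩ ⟨⟨h1, h2, h3⟩, h4, h5⟩
    simp only [shear, MeasurableEquiv.coe_mk, Equiv.coe_fn_mk] at h1 h2 h3 h4 h5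
    refine ⟨⟨h4, ?_⟩, ?_, ?_, ?_⟩ <;> dsimp only <;> linarith
  have hz : ∀ w ∈ pairTriangle Y b \ shear ⁻¹' R, antiK φ ψ (shear w) = 0 := by
    rintro ⟨x, u, v⟩ ⟨⟨⟨hx, hxY⟩, hv, huv, hub⟩, hnR⟩
    dsimp only at hx hxY hv huv hub
    have hbx : b ≤ x + u := by
      by_contra hlt
      refine hnR ⟨⟨?_, ?_, ?_⟩, ?_, ?_⟩ <;>
        simp only [shear, MeasurableEquiv.coe_mk, Equiv.coe_fn_mk] <;> linarith
    simp only [antiK, shear, MeasurableEquiv.coe_mk, Equiv.coe_fn_mk]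
    rw [dcoreK_eq_zero h hx (by linarith) hbx, dcoreK_eq_zero h' hx (by linarith) hbx]
    simp
  have hiR : IntegrableOn (antiK φ ψ) R :=
    (measurePreserving_shear.integrableOn_comp_preimage shear.measurableEmbedding).1
      (hi.mono_set sub)
  have heR : ∫ w in pairTriangle Y b, antiK φ ψ (shear w) = ∫ w in R, antiK φ ψ w := by
    rw [← measurePreserving_shear.setIntegral_preimage_emb shear.measurableEmbedding _ R]
    exact setIntegral_eq_of_subset_of_forall_sdiff_eq_zero measurableSet_pairTriangle sub hz
  have h1 : Integrable (R.indicator (antiK φ ψ)) (volume.prod volume) :=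
    (integrable_indicator_iff mR).2 hiR
  have hsl : ∀ p : ℝ × ℝ, p ∈ lowerTriangle b →
      (fun x => R.indicator (antiK φ ψ) (x, p))
        = (Ioo 0 p.2).indicator fun x => antiK φ ψ (x, p) := by
    intro p hp
    ext x
    by_cases hx : x ∈ Ioo 0 p.2
    · rw [indicator_of_mem hx, indicator_of_mem (show (x, p) ∈ R from ⟨hp, hx⟩)]
    · rw [indicator_of_notMem hx, indicator_of_notMem fun h => hx h.2]
  have hsl' : (fun p : ℝ × ℝ => ∫ x, R.indicator (antiK φ ψ) (x, p))
      = (lowerTriangle b).indicator fun p => ∫ x in Ioo 0 p.2, antiK φ ψ (x, p) := by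
    ext p
    by_cases hp : p ∈ lowerTriangle b
    · rw [indicator_of_mem hp, ← integral_indicator measurableSet_Ioo, ← hsl p hp]
    · rw [indicator_of_notMem hp]
      refine (integral_congr_ae (Eventually.of_forall fun x => ?_)).trans (integral_zero _ _)
      exact indicator_of_notMem (fun h => hp h.1) _
  refine ⟨?_, ?_, ?_⟩
  · rw [ae_restrict_iff' measurableSet_lowerTriangle]
    filter_upwards [h1.prod_left_ae] with p hp hpl
    rw [hsl p hpl, integrable_indicator_iff measurableSet_Ioo] at hp
    exact hp
  · have h2 := h1.integral_prod_right
    rw [hsl', integrable_indicator_iff measurableSet_lowerTriangle] at h2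
    exact h2
  · rw [he, heR, ← integral_indicator mR, Measure.volume_eq_prod, integral_prod_symm _ h1,
      ← integral_indicator measurableSet_lowerTriangle, hsl']

end

/-! ### The half-integral kernels of two smeared metric components -/

section
variable {Y : ℝ} {m m' : ℝ → ℂ}

theorem kerK_eq (l : M2 →L[ℝ] ℝ) (x y : ℝ) : kerK m l x y =
    ContinuousLinearMap.toSpanSingleton ℝ (1 : ℂ) (l (kap m (symL 1) x y))
      + ContinuousLinearMap.toSpanSingleton ℝ Complex.I (l (kap m (symL Complex.I) x y)) := by
  apply Complex.ext <;> simp [kerK]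

theorem norm_kerK_le_add (l : M2 →L[ℝ] ℝ) (x y : ℝ) :
    ‖kerK m l x y‖ ≤ ‖l‖ * (‖kap m (symL 1) x y‖ + ‖kap m (symL Complex.I) x y‖) := by
  rw [kerK_eq]
  refine (norm_add_le _ _).trans ?_
  rw [mul_add]
  refine add_le_add ?_ ?_ <;>
  · simp only [ContinuousLinearMap.toSpanSingleton_apply, norm_smul, norm_one, Complex.norm_I,
      mul_one]
    exact l.le_opNorm _

/-- Joint differentiability of `kerK`, with a bound on the kernel and on its derivative along the
diagonal. -/
theorem exists_kerK_bounds (hm : IsProfile Y m m') {a b : ℝ} (ha : 0 < a) (hb : b < Y)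
    (l : M2 →L[ℝ] ℝ) : ∃ C, 0 ≤ C ∧ ∀ y ∈ Icc a b, ∀ x ∈ Ioo 0 y,
      ‖kerK m l x y‖ ≤ C ∧ |kerZ m l x y| ≤ C * √(y - x) ∧
      ∃ D : ℝ × ℝ →L[ℝ] ℂ, HasFDerivAt (fun p : ℝ × ℝ => kerK m l p.1 p.2) D (x, y) ∧
        ‖D (1, 1)‖ ≤ C * (1 + ‖m x‖) := by
  obtain ⟨B, hB⟩ := exists_propBounds hm ha hb
  have B0 := hB.nonneg
  set c1 := ‖l‖ * ((1 + ‖transL‖) * (2 * B ^ 4 * ‖transL‖) * ‖symL 1‖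
    + (1 + ‖transL‖) * (2 * B ^ 4 * ‖transL‖) * ‖symL Complex.I‖) with hc1
  set c2 := ‖l‖ * ((1 + ‖transL‖) * (4 * B ^ 4 * ‖transL‖ * ‖rotJ‖)) with hc2
  set c3 := ‖l‖ * ((1 + ‖transL‖) * (8 * B ^ 4 * ‖transL‖ * ‖symL 1‖)
    + (1 + ‖transL‖) * (8 * B ^ 4 * ‖transL‖ * ‖symL Complex.I‖)) with hc3
  have h1 : 0 ≤ c1 := by positivity
  have h2 : 0 ≤ c2 := by positivity
  have h3 : 0 ≤ c3 := by positivity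
  refine ⟨c1 + c2 + c3, by positivity, fun y hy x hx => ⟨?_, ?_, ?_⟩⟩
  · have hx' : x ∈ Icc 0 y := ⟨hx.1.le, hx.2.le⟩
    have y0 : 0 ≤ y := hx.1.le.trans hx.2.le
    refine (norm_kerK_le_add l x y).trans (le_trans ?_ (by linarith : c1 ≤ c1 + c2 + c3))
    exact mul_le_mul_of_nonneg_left (add_le_add (norm_kap_le hB _ hy hx' y0)
      (norm_kap_le hB _ hy hx' y0)) (norm_nonneg _)
  · refine (abs_kerZ_le hm ha hb hB l hy ⟨hx.1.le, hx.2.le⟩).trans ?_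
    exact mul_le_mul_of_nonneg_right (by linarith) (Real.sqrt_nonneg _)
  · obtain ⟨D1, hD1, n1⟩ := differentiableAt_kap hm hb hB (symL 1) hy hx
    obtain ⟨D2, hD2, n2⟩ := differentiableAt_kap hm hb hB (symL Complex.I) hy hx
    have e1 := ((ContinuousLinearMap.toSpanSingleton ℝ (1 : ℂ)).comp l).hasFDerivAt.comp (x, y) hD1
    have e2 := ((ContinuousLinearMap.toSpanSingleton ℝ Complex.I).comp l).hasFDerivAt.comp
      (x, y) hD2
    refine ⟨_, (e1.add e2).congr_of_eventuallyEq (Eventually.of_forall fun p => kerK_eq l _ _), ?_⟩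
    have f1 : ‖ContinuousLinearMap.toSpanSingleton ℝ (1 : ℂ) (l (D1 (1, 1)))‖
        ≤ ‖l‖ * ((1 + ‖transL‖) * (8 * B ^ 4 * ‖transL‖ * ‖symL 1‖) * (1 + ‖m x‖)) := by
      simp only [ContinuousLinearMap.toSpanSingleton_apply, norm_smul, norm_one, mul_one]
      exact (l.le_opNorm _).trans (mul_le_mul_of_nonneg_left n1 (norm_nonneg _))
    have f2 : ‖ContinuousLinearMap.toSpanSingleton ℝ Complex.I (l (D2 (1, 1)))‖
        ≤ ‖l‖ * ((1 + ‖transL‖) * (8 * B ^ 4 * ‖transL‖ * ‖symL Complex.I‖) * (1 + ‖m x‖)) := by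
      simp only [ContinuousLinearMap.toSpanSingleton_apply, norm_smul, Complex.norm_I, mul_one]
      exact (l.le_opNorm _).trans (mul_le_mul_of_nonneg_left n2 (norm_nonneg _))
    refine (norm_add_le _ _).trans ((add_le_add f1 f2).trans ?_)
    have : 0 ≤ (c1 + c2) * (1 + ‖m x‖) := by positivity
    calc _ = c3 * (1 + ‖m x‖) := by rw [hc3]; ring
      _ ≤ _ := by linarith

/-- A continuously differentiable weight on the line, with derivative `f'`, that vanishes off
`(a, b)`. -/
structure IsWeight (a b : ℝ) (f f' : ℝ → ℝ) : Prop where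
  deriv : ∀ y, HasDerivAt f (f' y) y
  cont_deriv : Continuous f'
  support : ∀ y, y ∉ Ioo a b → f y = 0

/-- The kernel whose half-integral is the variation of a smeared metric component. -/
def weightK (m : ℝ → ℂ) (l : M2 →L[ℝ] ℝ) (f : ℝ → ℝ) (p : ℝ × ℝ) : ℂ :=
  (f p.2 / √p.2) • kerK m l p.1 p.2

variable {a b : ℝ} {f f' g g' : ℝ → ℝ}

theorem IsWeight.cont (hf : IsWeight a b f f') : Continuous f :=
  continuous_iff_continuousAt.2 fun y => (hf.deriv y).continuousAt

theorem IsWeight.exists_bound (hf : IsWeight a b f f') (ha : 0 < a) : ∃ M, 0 ≤ M ∧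
    ∀ y ∈ Icc a b, |f y| ≤ M ∧ |f y / √y| ≤ M ∧
      ∃ d, HasDerivAt (fun y => f y / √y) d y ∧ |d| ≤ M := by
  obtain ⟨M1, h1⟩ := (isCompact_Icc (a := a) (b := b)).exists_bound_of_continuousOn
    hf.cont.continuousOn
  have c2 : ContinuousOn (fun y => f y / √y) (Icc a b) :=
    hf.cont.continuousOn.div (by fun_prop) fun y hy => (Real.sqrt_pos.2 (ha.trans_le hy.1)).ne'
  obtain ⟨M2', h2⟩ := (isCompact_Icc (a := a) (b := b)).exists_bound_of_continuousOn c2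
  have c3 : ContinuousOn (fun y => (f' y * √y - f y * (1 / (2 * √y))) / √y ^ 2) (Icc a b) := by
    have s0 : ∀ y ∈ Icc a b, √y ≠ 0 := fun y hy => (Real.sqrt_pos.2 (ha.trans_le hy.1)).ne'
    have hc := hf.cont
    have hc' := hf.cont_deriv
    refine ContinuousOn.div ?_ (by fun_prop) fun y hy => pow_ne_zero _ (s0 y hy)
    refine ContinuousOn.sub (by fun_prop) (ContinuousOn.mul (by fun_prop) ?_)
    exact ContinuousOn.div (by fun_prop) (by fun_prop) fun y hy =>
      mul_ne_zero two_ne_zero (s0 y hy)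
  obtain ⟨M3, h3⟩ := (isCompact_Icc (a := a) (b := b)).exists_bound_of_continuousOn c3
  refine ⟨max 0 (max M1 (max M2' M3)), le_max_left _ _, fun y hy => ⟨?_, ?_, _,
    (hf.deriv y).div (Real.hasDerivAt_sqrt (ha.trans_le hy.1).ne')
      (Real.sqrt_pos.2 (ha.trans_le hy.1)).ne', ?_⟩⟩
  · exact (h1 y hy).trans (by simp)
  · exact (h2 y hy).trans (by simp)
  · exact (h3 y hy).trans (by simp)

theorem weightK_eventuallyEq (hf : IsWeight a b f f') (l : M2 →L[ℝ] ℝ) {x y : ℝ}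
    (hy : y ∉ Icc a b) : weightK m l f =ᶠ[𝓝 (x, y)] fun _ => 0 := by
  have : (Icc a b)ᶜ ∈ 𝓝 y := isClosed_Icc.isOpen_compl.mem_nhds hy
  filter_upwards [continuous_snd.continuousAt.preimage_mem_nhds (x := (x, y)) this] with p hp
  rw [weightK, hf.support _ fun h => hp (Ioo_subset_Icc_self h), zero_div, zero_smul]

/-- The weighted kernels satisfy the bounds that the calculus of half-integrals needs. The constant
may be enlarged, so that two kernels can share it. -/
theorem exists_isSmearedKernel (hm : IsProfile Y m m') (ha : 0 < a) (hb : b < Y)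
    (hf : IsWeight a b f f') (l : M2 →L[ℝ] ℝ) :
    ∃ C₀, 0 ≤ C₀ ∧ ∀ C, C₀ ≤ C →
      IsSmearedKernel b C (fun x => C * (1 + ‖m x‖)) (weightK m l f) := by
  obtain ⟨B, hB0, hB⟩ := exists_kerK_bounds hm ha hb l
  obtain ⟨M, hM0, hM⟩ := hf.exists_bound ha
  refine ⟨2 * M * B, by positivity, fun C hC => ?_⟩
  have hC0 : 0 ≤ C := le_trans (by positivity) hC
  have hMB : 0 ≤ M * B := by positivity
  have key : ∀ x y, 0 < x → x < y → y ∈ Icc a b → ∃ D : ℝ × ℝ →L[ℝ] ℂ,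
      HasFDerivAt (weightK m l f) D (x, y) ∧ ‖D (1, 1)‖ ≤ C * (1 + ‖m x‖) := by
    intro x y hx hxy hy
    obtain ⟨hK, -, D, hD, hDn⟩ := hB y hy x ⟨hx, hxy⟩
    obtain ⟨-, hw, d, hd, hdn⟩ := hM y hy
    have hsnd : HasFDerivAt (fun p : ℝ × ℝ => p.2) (ContinuousLinearMap.snd ℝ ℝ ℝ) (x, y) :=
      hasFDerivAt_snd
    have h1 := HasFDerivAt.comp (x, y) (g := fun y => f y / √y) hd.hasFDerivAt hsnd
    refine ⟨_, h1.smul hD, ?_⟩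
    have e : ‖(f y / √y) • D (1, 1) + ((1 : ℝ) • d) • kerK m l x y‖
        ≤ M * (B * (1 + ‖m x‖)) + M * B := by
      refine (norm_add_le _ _).trans (add_le_add ?_ ?_)
      · rw [norm_smul]; exact mul_le_mul hw hDn (norm_nonneg _) hM0
      · rw [norm_smul, one_smul]; exact mul_le_mul hdn hK (norm_nonneg _) hM0
    refine le_trans e ?_
    have m0 := norm_nonneg (m x)
    have : M * B * ‖m x‖ ≤ 2 * M * B * ‖m x‖ := by nlinarith
    calc _ = 2 * M * B + M * B * ‖m x‖ := by ring
      _ ≤ 2 * M * B * (1 + ‖m x‖) := by linarith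
      _ ≤ _ := by gcongr
  refine ⟨fun x y hy => ?_, fun x y hx hxy => ?_, fun x y hx hxy => ?_, fun x y hx hxy => ?_,
    fun x y hx hxy => ?_⟩
  · rw [weightK, hf.support y fun h => absurd h.2 (not_lt.2 hy), zero_div, zero_smul]
  · by_cases hy : y ∈ Icc a b
    · obtain ⟨D, hD, -⟩ := key x y hx hxy hy
      exact hD.differentiableAt
    · exact ((hasFDerivAt_const (0 : ℂ) (x, y)).congr_of_eventuallyEq
        (weightK_eventuallyEq hf l hy)).differentiableAt
  · by_cases hy : y ∈ Icc a b
    · rw [weightK, norm_smul]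
      exact (mul_le_mul (hM y hy).2.1 (hB y hy x ⟨hx, hxy⟩).1 (norm_nonneg _) hM0).trans
        (by linarith)
    · rw [(weightK_eventuallyEq hf l hy).self_of_nhds, norm_zero]; exact hC0
  · by_cases hy : y ∈ Icc a b
    · obtain ⟨D, hD, -⟩ := key x y hx hxy hy
      have h1 : HasDerivAt (fun x => (x, y)) ((1 : ℝ), (0 : ℝ)) x :=
        (hasDerivAt_id x).prodMk (hasDerivAt_const x y)
      have h2 := HasFDerivAt.comp_hasDerivAt (f := fun x => (x, y)) x hD h1
      have h3 : HasDerivAt (fun x => weightK m l f (x, y)) _ x :=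
        (hasDerivAt_kerK hm l hx hxy (hy.2.trans_lt hb)).fun_const_smul (f y / √y)
      rw [hD.fderiv, h2.unique h3, norm_smul, norm_mul, norm_mul, norm_mul, norm_neg,
        Complex.norm_I, Complex.norm_ofNat, Complex.norm_real]
      have hs := Real.sqrt_pos.2 (ha.trans_le hy.1)
      have hsx := Real.sqrt_pos.2 (sub_pos.2 hxy)
      -- `|ζ| ≤ B √(y - x)` compensates the singular factor in the derivative of `kerK`
      have hz := (hB y hy x ⟨hx, hxy⟩).2.1
      have : ‖f y / √y‖ * ‖√y / √(y - x) * kerZ m l x y‖ ≤ M * B := by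
        have e : ‖f y / √y‖ * ‖√y / √(y - x) * kerZ m l x y‖
            = |f y| * (|kerZ m l x y| / √(y - x)) := by
          simp only [Real.norm_eq_abs, abs_mul, abs_div, abs_of_pos hs, abs_of_pos hsx]
          field_simp
        rw [e]
        exact mul_le_mul (hM y hy).1 ((div_le_iff₀ hsx).2 hz) (by positivity) hM0
      have m0 := norm_nonneg (m x)
      calc _ = 2 * (‖f y / √y‖ * ‖√y / √(y - x) * kerZ m l x y‖) * ‖m x‖ := by ring
        _ ≤ 2 * (M * B) * ‖m x‖ := by gcongr
        _ = 2 * M * B * ‖m x‖ := by ring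
        _ ≤ C * (1 + ‖m x‖) := by
          refine mul_le_mul hC (by linarith) m0 hC0
    · rw [((hasFDerivAt_const (0 : ℂ) (x, y)).congr_of_eventuallyEq
        (weightK_eventuallyEq hf l hy)).fderiv]
      simp; positivity
  · by_cases hy : y ∈ Icc a b
    · obtain ⟨D, hD, hDn⟩ := key x y hx hxy hy
      rw [hD.fderiv]; exact hDn
    · rw [((hasFDerivAt_const (0 : ℂ) (x, y)).congr_of_eventuallyEq
        (weightK_eventuallyEq hf l hy)).fderiv]
      simp; positivity

/-- The value on the axis of the invariant pairing of two kernels. -/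
def axisPairing (m : ℝ → ℂ) (l l' : M2 →L[ℝ] ℝ) (y₁ y₂ : ℝ) : ℝ :=
  ⟪kerK m l 0 y₁, kerK m l' 0 y₂⟫ - kerZ m l 0 y₁ * kerZ m l' 0 y₂

theorem axisPairing_comm (l l' : M2 →L[ℝ] ℝ) (y₁ y₂ : ℝ) :
    axisPairing m l l' y₁ y₂ = axisPairing m l' l y₂ y₁ := by
  rw [axisPairing, axisPairing, real_inner_comm, mul_comm]

/-- The primitive, up to the factor `1 / (y₁ - y₂)`, of the product of the derivative of one kernel
with another one. -/
def primK (m : ℝ → ℂ) (l l' : M2 →L[ℝ] ℝ) (y₁ y₂ x : ℝ) : ℝ :=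
  kerZ m l x y₁ * kerZ m l' x y₂
    - (√y₁ * √(y₂ - x) / (√y₂ * √(y₁ - x))) * ⟪kerK m l x y₁, kerK m l' x y₂⟫

/-- The product of the derivative of one kernel with another one is a total derivative. This is
where the isomonodromic structure of the deformation enters. -/
theorem hasDerivAt_primK (hm : IsProfile Y m m') (ha : 0 < a) (hb : b < Y)
    (hf : IsWeight a b f f') (g : ℝ → ℝ) (l l' : M2 →L[ℝ] ℝ) {x y₁ y₂ : ℝ}
    (hx : 0 < x) (hx2 : x < y₂) (h21 : y₂ < y₁) (h1Y : y₁ < Y) :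
    HasDerivAt (fun x => f y₁ * g y₂ * (primK m l l' y₁ y₂ x / (y₁ - y₂)))
      ⟪dcoreK (weightK m l f) x y₁, coreK (weightK m l' g) x y₂⟫ x := by
  have hx1 := hx2.trans h21
  have y2 := hx.trans hx2
  have y1 := y2.trans h21
  have dK1 := hasDerivAt_kerK hm l hx hx1 h1Y
  have dK2 := hasDerivAt_kerK hm l' hx hx2 (h21.trans h1Y)
  have dZ1 := hasDerivAt_kerZ hm l hx hx1 h1Y
  have dZ2 := hasDerivAt_kerZ hm l' hx hx2 (h21.trans h1Y)
  have s1 : HasDerivAt (fun x => √(y₁ - x)) (-1 / (2 * √(y₁ - x))) x :=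
    ((hasDerivAt_id x).const_sub y₁).sqrt (sub_pos.2 hx1).ne'
  have s2 : HasDerivAt (fun x => √(y₂ - x)) (-1 / (2 * √(y₂ - x))) x :=
    ((hasDerivAt_id x).const_sub y₂).sqrt (sub_pos.2 hx2).ne'
  have p1 := Real.sqrt_pos.2 (sub_pos.2 hx1)
  have p2 := Real.sqrt_pos.2 (sub_pos.2 hx2)
  have q1 := Real.sqrt_pos.2 y1
  have q2 := Real.sqrt_pos.2 y2
  have q0 := Real.sqrt_pos.2 hx
  have hr : HasDerivAt (fun x => √y₁ * √(y₂ - x) / (√y₂ * √(y₁ - x))) _ x :=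
    (s2.const_mul √y₁).div (s1.const_mul √y₂) (by positivity)
  have hW := ((dZ1.mul dZ2).sub (hr.mul (dK1.inner ℝ dK2))).div_const (y₁ - y₂)
  have hW' := hW.const_mul (f y₁ * g y₂)
  -- the derivative of the weighted kernel in the first coordinate
  have hfd : fderiv ℝ (weightK m l f) (x, y₁) (1, 0)
      = (f y₁ / √y₁) • (-2 * Complex.I * ((√y₁ / √(y₁ - x) * kerZ m l x y₁ : ℝ) : ℂ) * m x) := by
    obtain ⟨C₀, -, hC⟩ := exists_isSmearedKernel hm ha hb hf l
    have hd := (hC C₀ le_rfl).diff x y₁ hx hx1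
    have h1 : HasDerivAt (fun x => (x, y₁)) ((1 : ℝ), (0 : ℝ)) x :=
      (hasDerivAt_id x).prodMk (hasDerivAt_const x y₁)
    have h2 := HasFDerivAt.comp_hasDerivAt (f := fun x => (x, y₁)) x hd.hasFDerivAt h1
    have h3 : HasDerivAt (fun x => weightK m l f (x, y₁)) _ x :=
      dK1.fun_const_smul (f y₁ / √y₁)
    exact h2.unique h3
  refine hW'.congr_deriv ?_
  have r1 := Real.sq_sqrt (sub_pos.2 hx1).le
  have r2 := Real.sq_sqrt (sub_pos.2 hx2).le
  have t1 := Real.sq_sqrt y1.le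
  have t2 := Real.sq_sqrt y2.le
  have t0 := Real.sq_sqrt hx.le
  rw [dcoreK, hfd, coreK]
  simp only [weightK, Complex.inner]
  have e1 : y₁ - x = √(y₁ - x) ^ 2 := r1.symm
  have e12 : y₁ - y₂ = √(y₁ - x) ^ 2 - √(y₂ - x) ^ 2 := by rw [r1, r2]; ring
  have hne : √(y₁ - x) ^ 2 - √(y₂ - x) ^ 2 ≠ 0 := by rw [← e12]; linarith
  have ex : x = √x ^ 2 := t0.symm
  generalize kerK m l x y₁ = K1
  generalize kerK m l' x y₂ = K2
  generalize kerZ m l x y₁ = Z1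
  generalize kerZ m l' x y₂ = Z2
  generalize m x = M
  -- the derivative of `√x / √(y₁ - x)`, with all occurrences of `x` as squares of square roots
  have hA : √x / √(y₁ - x) * (1 / (2 * x) + 1 / (2 * (y₁ - x)))
      = √y₁ ^ 2 / (2 * √x * √(y₁ - x) ^ 3) := by
    have : 1 / (2 * x) + 1 / (2 * (y₁ - x)) = y₁ / (2 * x * (y₁ - x)) := by
      have := (sub_pos.2 hx1).ne'
      field_simp; ring
    calc _ = √x / √(y₁ - x) * (√y₁ ^ 2 / (2 * √x ^ 2 * √(y₁ - x) ^ 2)) := by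
          rw [this, t0, r1, t1]
      _ = _ := by field_simp
  rw [hA, e12]
  -- the relations between the five square roots by which the two sides differ
  have k1 : √y₁ ^ 2 - √x ^ 2 = √(y₁ - x) ^ 2 := by rw [t1, t0, r1]
  have k2 : √y₂ ^ 2 - √x ^ 2 = √(y₂ - x) ^ 2 := by rw [t2, t0, r2]
  clear hW hW' hr s1 s2 dK1 dK2 dZ1 dZ2 hfd hA e1 ex e12 r1 r2 t0 t1 t2
  simp only [Complex.add_re, Complex.mul_re, Complex.mul_im, Complex.real_smul, Complex.conj_re,
    Complex.conj_im, Complex.ofReal_re, Complex.ofReal_im, Complex.neg_re, Complex.neg_im,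
    Complex.I_re, Complex.I_im, Complex.add_im, map_add, map_mul, Complex.re_ofNat, Complex.im_ofNat]
  generalize √(y₁ - x) = u1 at *
  generalize √(y₂ - x) = u2 at *
  generalize √y₁ = v1 at *
  generalize √y₂ = v2 at *
  generalize √x = v0 at *
  field_simp
  linear_combination 4 * f y₁ * g y₂ * v1 * u1 * v0 * (M.im * Z1 * K2.re - M.re * Z1 * K2.im)
    * (u1 ^ 2 * k2 - u2 ^ 2 * k1)

end

section
variable {Y a b : ℝ} {m m' : ℝ → ℂ} {f f' g g' : ℝ → ℝ}

/-- The density of the bracket of two smeared metric components, up to constants, without the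
singular factor. -/
def bracketDensity (m : ℝ → ℂ) (l l' : M2 →L[ℝ] ℝ) (f g : ℝ → ℝ) (p : ℝ × ℝ) : ℝ :=
  f p.1 * g p.2 * axisPairing m l l' p.1 p.2

theorem continuousOn_primK (hm : IsProfile Y m m') (l l' : M2 →L[ℝ] ℝ) {y₁ y₂ : ℝ}
    (h2 : 0 < y₂) (h21 : y₂ < y₁) (h1Y : y₁ < Y) :
    ContinuousOn (primK m l l' y₁ y₂) (Icc 0 y₂) := by
  have sub : Icc 0 y₂ ⊆ Icc 0 y₁ := Icc_subset_Icc_right h21.le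
  have i1 : y₁ ∈ Ioo 0 Y := ⟨h2.trans h21, h1Y⟩
  have i2 : y₂ ∈ Ioo 0 Y := ⟨h2, h21.trans h1Y⟩
  have q2 := Real.sqrt_pos.2 h2
  refine ContinuousOn.sub (((continuousOn_kerZ hm l i1).mono sub).mul (continuousOn_kerZ hm l' i2))
    (ContinuousOn.mul ?_ (((continuousOn_kerK hm l i1).mono sub).inner
      (𝕜 := ℝ) (continuousOn_kerK hm l' i2)))
  refine ContinuousOn.div (by fun_prop) (by fun_prop) fun x hx => ?_
  have := Real.sqrt_pos.2 (sub_pos.2 (hx.2.trans_lt h21))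
  positivity

/-- At `x = y₂` both the rotational kernel and the factor `√(y₂ - x)` vanish. -/
theorem primK_self (hm : IsProfile Y m m') (l l' : M2 →L[ℝ] ℝ) {y₁ y₂ : ℝ}
    (h2 : 0 < y₂) (h2Y : y₂ < Y) : primK m l l' y₁ y₂ y₂ = 0 := by
  rw [primK, kerZ_self hm l' ⟨h2, h2Y⟩]; simp

/-- On the axis the ratio of square roots in `primK` is one. -/
theorem primK_axis (l l' : M2 →L[ℝ] ℝ) {y₁ y₂ : ℝ} (h1 : 0 < y₁) (h2 : 0 < y₂) :
    primK m l l' y₁ y₂ 0 = - axisPairing m l l' y₁ y₂ := by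
  have q1 := Real.sqrt_pos.2 h1
  have q2 := Real.sqrt_pos.2 h2
  rw [primK, sub_zero, sub_zero, mul_comm √y₁, div_self (by positivity), axisPairing]
  ring

/-- Integrating the total derivatives from the axis to `y₂` leaves the values on the axis. -/
theorem integral_antiK (hm : IsProfile Y m m') (ha : 0 < a) (hb : b < Y)
    (hf : IsWeight a b f f') (hg : IsWeight a b g g') (l l' : M2 →L[ℝ] ℝ) {p : ℝ × ℝ}
    (hp : p ∈ lowerTriangle b)
    (hi : IntegrableOn (fun x => antiK (weightK m l f) (weightK m l' g) (x, p)) (Ioo 0 p.2)) :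
    ∫ x in Ioo 0 p.2, antiK (weightK m l f) (weightK m l' g) (x, p)
      = (bracketDensity m l l' f g p - bracketDensity m l l' f g p.swap) / (p.1 - p.2) := by
  obtain ⟨y₁, y₂⟩ := p
  obtain ⟨h2, h21, h1b⟩ := hp
  dsimp only at h2 h21 h1b hi ⊢
  have h1Y := h1b.trans hb
  have hd : ∀ x ∈ Ioo 0 y₂, HasDerivAt
      (fun x => f y₁ * g y₂ * (primK m l l' y₁ y₂ x / (y₁ - y₂))
        - g y₁ * f y₂ * (primK m l' l y₁ y₂ x / (y₁ - y₂)))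
      (antiK (weightK m l f) (weightK m l' g) (x, y₁, y₂)) x := fun x hx =>
    (hasDerivAt_primK hm ha hb hf g l l' hx.1 hx.2 h21 h1Y).sub
      (hasDerivAt_primK hm ha hb hg f l' l hx.1 hx.2 h21 h1Y)
  have hc : ContinuousOn (fun x => f y₁ * g y₂ * (primK m l l' y₁ y₂ x / (y₁ - y₂))
        - g y₁ * f y₂ * (primK m l' l y₁ y₂ x / (y₁ - y₂))) (Icc 0 y₂) :=
    (((continuousOn_primK hm l l' h2 h21 h1Y).div_const _).const_mul _).sub
      (((continuousOn_primK hm l' l h2 h21 h1Y).div_const _).const_mul _)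
  rw [← integral_Ioc_eq_integral_Ioo, ← intervalIntegral.integral_of_le h2.le,
    intervalIntegral.integral_eq_sub_of_hasDerivAt_of_le h2.le hc hd
      ((intervalIntegrable_iff_integrableOn_Ioo_of_le h2.le).2 hi),
    primK_self hm l l' h2 (h21.trans h1Y), primK_self hm l' l h2 (h21.trans h1Y),
    primK_axis l l' (h2.trans h21) h2, primK_axis l' l (h2.trans h21) h2, axisPairing_comm l' l]
  simp only [bracketDensity, Prod.swap, zero_div, mul_zero, sub_zero]
  ring

theorem bracketDensity_eq_zero (hf : IsWeight a b f f') (hg : IsWeight a b g g')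
    (l l' : M2 →L[ℝ] ℝ) {p : ℝ × ℝ} (hp : b ≤ p.1 ∨ b ≤ p.2) :
    bracketDensity m l l' f g p = 0 := by
  rw [bracketDensity]
  rcases hp with h | h
  · rw [hf.support _ fun h' => absurd h'.2 (not_lt.2 h)]; simp
  · rw [hg.support _ fun h' => absurd h'.2 (not_lt.2 h)]; simp

/-- The pairing of two variation kernels is the principal value integral of the bracket density,
written as an absolutely convergent integral. -/
theorem integral_smearK_weightK (hm : IsProfile Y m m') (ha : 0 < a) (hab : a < b) (hb : b < Y)
    (hf : IsWeight a b f f') (hg : IsWeight a b g g') (l l' : M2 →L[ℝ] ℝ) :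
    IntegrableOn (fun p => (bracketDensity m l l' f g p - bracketDensity m l l' f g p.swap)
      / (p.1 - p.2)) (lowerTriangle Y) ∧
    ∫ x in Ioo 0 Y, ⟪dsmearK b (weightK m l f) x, smearK b (weightK m l' g) x⟫
      = ∫ p in lowerTriangle Y, (bracketDensity m l l' f g p - bracketDensity m l l' f g p.swap)
        / (p.1 - p.2) := by
  obtain ⟨C1, -, h1⟩ := exists_isSmearedKernel hm ha hb hf l
  obtain ⟨C2, -, h2⟩ := exists_isSmearedKernel hm ha hb hg l'
  have k1 := h1 (max C1 C2) (le_max_left _ _)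
  have k2 := h2 (max C1 C2) (le_max_right _ _)
  have hβ : IntegrableOn (fun x => max C1 C2 * (1 + ‖m x‖)) (Ioo 0 Y) :=
    ((integrableOn_const_Ioo 1).add hm.int.norm).const_mul _
  obtain ⟨e1, e2, e3⟩ := integral_pairing k1 k2 hβ (ha.trans hab) hb
  -- the inner integrals are evaluated for almost every pair `(y₁, y₂)`
  have e4 : (fun p : ℝ × ℝ => ∫ x in Ioo 0 p.2, antiK (weightK m l f) (weightK m l' g) (x, p))
      =ᵐ[volume.restrict (lowerTriangle b)] fun p =>
        (bracketDensity m l l' f g p - bracketDensity m l l' f g p.swap) / (p.1 - p.2) := by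
    filter_upwards [e1, ae_restrict_mem measurableSet_lowerTriangle] with p h hp
    exact integral_antiK hm ha hb hf hg l l' hp h
  have sub : lowerTriangle b ⊆ lowerTriangle Y := fun p hp => ⟨hp.1, hp.2.1, hp.2.2.trans hb⟩
  have hz : ∀ p ∈ lowerTriangle Y \ lowerTriangle b,
      (bracketDensity m l l' f g p - bracketDensity m l l' f g p.swap) / (p.1 - p.2) = 0 := by
    rintro p ⟨⟨h1, h2, -⟩, hp⟩
    have : b ≤ p.1 := not_lt.1 fun h => hp ⟨h1, h2, h⟩
    rw [bracketDensity_eq_zero hf hg l l' (Or.inl this),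
      bracketDensity_eq_zero hf hg l l' (Or.inr this)]
    simp
  refine ⟨IntegrableOn.of_forall_sdiff_eq_zero ((integrable_congr e4).1 e2)
    measurableSet_lowerTriangle hz, ?_⟩
  rw [e3, integral_congr_ae e4]
  exact (setIntegral_eq_of_subset_of_forall_sdiff_eq_zero measurableSet_lowerTriangle sub hz).symm

/-! ### Principal values -/

/-- Truncating symmetrically about the diagonal folds the integral onto the triangle below it. -/
theorem tendsto_truncated {Ψ : ℝ × ℝ → ℝ} (hΨ : IntegrableOn Ψ (Ioo 0 Y ×ˢ Ioo 0 Y))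
    (hi : IntegrableOn (fun p => (Ψ p - Ψ p.swap) / (p.1 - p.2)) (lowerTriangle Y)) :
    Tendsto (fun ε : ℝ => ∫ p in {p : ℝ × ℝ | p.1 ∈ Ioo 0 Y ∧ p.2 ∈ Ioo 0 Y ∧ ε < |p.1 - p.2|},
      Ψ p / (p.1 - p.2)) (𝓝[>] 0)
      (𝓝 (∫ p in lowerTriangle Y, (Ψ p - Ψ p.swap) / (p.1 - p.2))) := by
  have mS : ∀ ε : ℝ, MeasurableSet {p : ℝ × ℝ | ε < |p.1 - p.2|} := fun ε =>
    measurableSet_lt measurable_const (by fun_prop)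
  have key : ∀ ε : ℝ, 0 < ε →
      ∫ p in {p : ℝ × ℝ | p.1 ∈ Ioo 0 Y ∧ p.2 ∈ Ioo 0 Y ∧ ε < |p.1 - p.2|}, Ψ p / (p.1 - p.2)
        = ∫ p in lowerTriangle Y, {p : ℝ × ℝ | ε < |p.1 - p.2|}.indicator
          (fun p => (Ψ p - Ψ p.swap) / (p.1 - p.2)) p := by
    intro ε hε
    set h : ℝ × ℝ → ℝ := {p : ℝ × ℝ | ε < |p.1 - p.2|}.indicator fun p => Ψ p / (p.1 - p.2) with hh
    have hint : IntegrableOn h (Ioo 0 Y ×ˢ Ioo 0 Y) := by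
      refine Integrable.mono' (hΨ.norm.const_mul ε⁻¹) ?_ (Eventually.of_forall fun p => ?_)
      · refine AEStronglyMeasurable.indicator ?_ (mS ε)
        exact hΨ.aestronglyMeasurable.div₀
          (by fun_prop : Measurable fun p : ℝ × ℝ => p.1 - p.2).aestronglyMeasurable
      · by_cases hp : p ∈ {p : ℝ × ℝ | ε < |p.1 - p.2|}
        · rw [hh, indicator_of_mem hp, norm_div, div_eq_inv_mul]
          have hp' : ε < |p.1 - p.2| := hp
          refine mul_le_mul_of_nonneg_right ?_ (norm_nonneg _)
          exact inv_anti₀ hε hp'.le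
        · rw [hh, indicator_of_notMem hp, norm_zero]
          positivity
    have e1 : {p : ℝ × ℝ | p.1 ∈ Ioo 0 Y ∧ p.2 ∈ Ioo 0 Y ∧ ε < |p.1 - p.2|}
        = (Ioo 0 Y ×ˢ Ioo 0 Y) ∩ {p : ℝ × ℝ | ε < |p.1 - p.2|} := by
      ext p; simp [and_assoc]
    rw [e1, ← setIntegral_indicator (mS ε), (setIntegral_square_eq hint).2]
    refine setIntegral_congr_fun measurableSet_lowerTriangle fun p _ => ?_
    by_cases hp : p ∈ {p : ℝ × ℝ | ε < |p.1 - p.2|}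
    · have hp' : p.swap ∈ {p : ℝ × ℝ | ε < |p.1 - p.2|} := by
        simpa [abs_sub_comm] using hp
      simp only [hh]
      rw [indicator_of_mem hp, indicator_of_mem hp', indicator_of_mem hp]
      simp only [Prod.fst_swap, Prod.snd_swap]
      rw [← neg_sub p.1 p.2, div_neg]
      ring
    · have hp' : p.swap ∉ {p : ℝ × ℝ | ε < |p.1 - p.2|} := by
        simpa [abs_sub_comm] using hp
      simp only [hh]
      rw [indicator_of_notMem hp, indicator_of_notMem hp', indicator_of_notMem hp, add_zero]
  refine Tendsto.congr' (f₁ := fun ε => ∫ p in lowerTriangle Y,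
    {p : ℝ × ℝ | ε < |p.1 - p.2|}.indicator (fun p => (Ψ p - Ψ p.swap) / (p.1 - p.2)) p) ?_ ?_
  · filter_upwards [self_mem_nhdsWithin] with ε hε
    exact (key ε hε).symm
  · refine tendsto_integral_filter_of_dominated_convergence
      (fun p => ‖(Ψ p - Ψ p.swap) / (p.1 - p.2)‖) (Eventually.of_forall fun ε =>
        hi.aestronglyMeasurable.indicator (mS ε)) (Eventually.of_forall fun ε =>
        Eventually.of_forall fun p => norm_indicator_le_norm_self _ _) hi.norm ?_
    filter_upwards [ae_restrict_mem measurableSet_lowerTriangle] with p hp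
    refine tendsto_const_nhds.congr' ?_
    have h0 : 0 < |p.1 - p.2| := abs_pos.2 (sub_ne_zero.2 hp.2.1.ne')
    filter_upwards [nhdsWithin_le_nhds (Iio_mem_nhds h0)] with ε hε
    rw [indicator_of_mem (show p ∈ {p : ℝ × ℝ | ε < |p.1 - p.2|} from hε)]

/-- Change of variables in a principal value. -/
theorem hasPrincipalValue_of_tendsto {S : Set ℝ} {l lam lam' : ℝ → ℝ} {W : ℝ → ℝ → ℝ}
    {Ψ : ℝ × ℝ → ℝ} {c κ : ℝ} (hS : MeasurableSet S) (hκ : 0 < κ)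
    (hl : ∀ x ∈ S, ∀ y ∈ S, l x - l y = κ * (lam x - lam y))
    (hd : ∀ x ∈ S, HasDerivAt lam (lam' x) x) (hpos : ∀ x ∈ S, 0 < lam' x)
    (hinj : InjOn lam S) (him : lam '' S = Ioo 0 Y)
    (hW : ∀ x ∈ S, ∀ y ∈ S, W x y = κ * (lam' x * lam' y * Ψ (lam x, lam y)))
    (hc : Tendsto (fun ε : ℝ =>
      ∫ p in {p : ℝ × ℝ | p.1 ∈ Ioo 0 Y ∧ p.2 ∈ Ioo 0 Y ∧ ε < |p.1 - p.2|},
        Ψ p / (p.1 - p.2)) (𝓝[>] 0) (𝓝 c)) : HasPrincipalValue S l W c := by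
  -- the truncation `ε` in `l` is the truncation `ε / κ` in `lam`
  have hsc : Tendsto (fun ε : ℝ => ε / κ) (𝓝[>] 0) (𝓝[>] 0) := by
    refine tendsto_nhdsWithin_of_tendsto_nhds_of_eventually_within _ ?_ ?_
    · have : Tendsto (fun ε : ℝ => ε / κ) (𝓝 0) (𝓝 (0 / κ)) :=
        (continuous_id.div_const κ).tendsto 0
      rw [zero_div] at this
      exact this.mono_left nhdsWithin_le_nhds
    · filter_upwards [self_mem_nhdsWithin] with ε hε
      exact div_pos hε hκ
  refine (hc.comp hsc).congr' ?_
  filter_upwards [self_mem_nhdsWithin] with ε hε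
  have hm : ∀ x ∈ S, lam x ∈ Ioo 0 Y := fun x hx => him ▸ mem_image_of_mem _ hx
  set D : Set (ℝ × ℝ) := {p | p.1 ∈ S ∧ p.2 ∈ S ∧ ε < |l p.1 - l p.2|} with hD
  set F : ℝ × ℝ → ℝ × ℝ := Prod.map lam lam with hF
  have hcond : ∀ x ∈ S, ∀ y ∈ S, (ε < |l x - l y| ↔ ε / κ < |lam x - lam y|) := by
    intro x hx y hy
    rw [hl x hx y hy, abs_mul, abs_of_pos hκ, div_lt_iff₀' hκ]
  have himD : F '' D
      = {p : ℝ × ℝ | p.1 ∈ Ioo 0 Y ∧ p.2 ∈ Ioo 0 Y ∧ ε / κ < |p.1 - p.2|} := by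
    ext ⟨y, z⟩
    constructor
    · rintro ⟨⟨p, q⟩, ⟨hp, hq, h⟩, he⟩
      obtain ⟨rfl, rfl⟩ := Prod.mk.inj he
      exact ⟨hm p hp, hm q hq, (hcond p hp q hq).1 h⟩
    · rintro ⟨hy, hz, h⟩
      rw [← him] at hy hz
      obtain ⟨p, hp, rfl⟩ := hy
      obtain ⟨q, hq, rfl⟩ := hz
      exact ⟨(p, q), ⟨hp, hq, (hcond p hp q hq).2 h⟩, rfl⟩
  have mD : MeasurableSet D := by
    have hlc : ContinuousOn lam S := fun x hx => (hd x hx).continuousAt.continuousWithinAt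
    have h1 : ContinuousOn (fun p : ℝ × ℝ => |lam p.1 - lam p.2|) (S ×ˢ S) :=
      ((hlc.comp continuousOn_fst fun p hp => hp.1).sub
        (hlc.comp continuousOn_snd fun p hp => hp.2)).abs
    have e : D = (S ×ˢ S) ∩ (fun p : ℝ × ℝ => |lam p.1 - lam p.2|) ⁻¹' Ioi (ε / κ) := by
      ext ⟨p, q⟩
      constructor
      · rintro ⟨hp, hq, h⟩
        exact ⟨⟨hp, hq⟩, (hcond p hp q hq).1 h⟩
      · rintro ⟨⟨hp, hq⟩, h⟩
        exact ⟨hp, hq, (hcond p hp q hq).2 h⟩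
    rw [e]
    obtain ⟨u, hu, hu'⟩ := continuousOn_iff'.1 h1 _ (isOpen_Ioi (a := ε / κ))
    rw [inter_comm, hu']
    exact hu.measurableSet.inter (hS.prod hS)
  have hdF : ∀ p ∈ D, HasFDerivWithinAt F
      (((1 : ℝ →L[ℝ] ℝ).smulRight (lam' p.1)).prodMap ((1 : ℝ →L[ℝ] ℝ).smulRight (lam' p.2)))
      D p := by
    rintro ⟨p, q⟩ ⟨hp, hq, -⟩
    exact ((hd p hp).hasFDerivAt.prodMap (p, q) (hd q hq).hasFDerivAt).hasFDerivWithinAt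
  have hinjF : InjOn F D := by
    rintro ⟨p, q⟩ ⟨hp, hq, -⟩ ⟨p', q'⟩ ⟨hp', hq', -⟩ he
    obtain ⟨e1, e2⟩ := Prod.mk.inj he
    exact Prod.ext (hinj hp hp' e1) (hinj hq hq' e2)
  have hcv := integral_image_eq_integral_abs_det_fderiv_smul volume mD hdF hinjF
    (fun p => Ψ p / (p.1 - p.2))
  change ∫ p in {p : ℝ × ℝ | p.1 ∈ Ioo 0 Y ∧ p.2 ∈ Ioo 0 Y ∧ ε / κ < |p.1 - p.2|},
    Ψ p / (p.1 - p.2) = ∫ p in D, W p.1 p.2 / (l p.1 - l p.2)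
  rw [← himD, hcv]
  refine setIntegral_congr_fun mD fun p hp => ?_
  have hdet : (((1 : ℝ →L[ℝ] ℝ).smulRight (lam' p.1)).prodMap
      ((1 : ℝ →L[ℝ] ℝ).smulRight (lam' p.2))).det = lam' p.1 * lam' p.2 := by
    rw [ContinuousLinearMap.det, ContinuousLinearMap.coe_prodMap, LinearMap.det_prodMap]
    congr 1 <;> simp [LinearMap.det_ring]
  have h1 := hpos p.1 hp.1
  have h2 := hpos p.2 hp.2.1
  simp only [hdet, hW p.1 hp.1 p.2 hp.2.1, hl p.1 hp.1 p.2 hp.2.1, smul_eq_mul,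
    abs_of_pos (mul_pos h1 h2), hF, Prod.map_fst, Prod.map_snd]
  rw [mul_div_mul_left _ _ hκ.ne', mul_div_assoc]
  rfl

end

/-! ### The tensor structure -/

/-- The component `(i, j)` of `A X Aᵗ`, as a linear functional of `X`. -/
def entryL (A : M2) (i j : Fin 2) : M2 →L[ℝ] ℝ := LinearMap.toContinuousLinearMap
  { toFun := fun X => (A * X * Aᵀ) i j
    map_add' := fun X X' => by simp [Matrix.mul_add, Matrix.add_mul]
    map_smul' := fun c X => by simp }

@[simp] theorem entryL_apply (A : M2) (i j : Fin 2) (X : M2) :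
    entryL A i j X = (A * X * Aᵀ) i j := rfl

/-- The components of `quadE` for symmetric matrices. -/
theorem quadE_apply {A B : M2} (hA : Aᵀ = A) (hB : Bᵀ = B) (a b c d : Fin 2) :
    quadE A B (a, c) (b, d) = 1 / 4 * (A a d * B c b + A a c * B b d + A b d * B a c + A b c * B a d)
      - 1 / 2 * (A a b * B c d) := by
  have hA' : A 1 0 = A 0 1 := congr_fun₂ hA _ _
  have hB' : B 1 0 = B 0 1 := congr_fun₂ hB _ _
  fin_cases a <;> fin_cases b <;> fin_cases c <;> fin_cases d <;>
    simp [quadE, Omega, inSpace1, inSpace2, transpose1, transpose2, Matrix.mul_apply,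
      Fintype.sum_prod_type, Fin.sum_univ_two, Matrix.one_apply, hA', hB'] <;> ring

theorem quadE_eq_symPairs {A B : M2} (hA : Aᵀ = A) (hB : Bᵀ = B) (a b c d : Fin 2) :
    symPairs (fun a' b' c' d' => A a' d' * B c' b' - 1 / 2 * (A a' b' * B c' d')) a b c d
      = quadE A B (a, c) (b, d) := by
  have hA' : ∀ i j, A j i = A i j := fun i j => congr_fun₂ hA _ _
  have hB' : ∀ i j, B j i = B i j := fun i j => congr_fun₂ hB _ _
  rw [quadE_apply hA hB, symPairs]
  rw [hA' a b, hB' c d, hB' b d, hB' a d, hB' b c, hB' a c]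
  ring

/-- The two quadratic expressions agree, since `Ω` is invariant under transposition in both
factors. -/
theorem quadM_eq_quadE (A B : M2) : quadM A B = quadE A B := by
  have h : transpose1 (transpose2 Omega) = Omega := by
    ext ⟨a, c⟩ ⟨b, d⟩
    fin_cases a <;> fin_cases b <;> fin_cases c <;> fin_cases d <;>
      simp [transpose1, transpose2, Omega]
  have h' : transpose1 Omega = transpose2 Omega := by
    ext ⟨a, c⟩ ⟨b, d⟩
    fin_cases a <;> fin_cases b <;> fin_cases c <;> fin_cases d <;>
      simp [transpose1, transpose2, Omega]
  rw [quadM, quadE, h, h', OmegaEta]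
  simp only [Matrix.mul_neg, Matrix.neg_mul]
  abel

theorem flatMetric_transpose (m : ℝ → ℂ) (y : ℝ) : (flatMetric m y)ᵀ = flatMetric m y := by
  rw [flatMetric, Matrix.transpose_mul, Matrix.transpose_transpose]

/-- The invariant pairing on the axis is the contraction of the two metrics with the inverse
Killing form. -/
theorem axisPairing_entryL {Y : ℝ} {m m' : ℝ → ℂ} (hm : IsProfile Y m m') (A : M2)
    (i j k l : Fin 2) {y₁ y₂ : ℝ} (h1 : y₁ ∈ Ioo 0 Y) (h2 : y₂ ∈ Ioo 0 Y) :
    axisPairing m (entryL A i j) (entryL A k l) y₁ y₂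
      = 8 * quadE (A * flatMetric m y₁ * Aᵀ) (A * flatMetric m y₂ * Aᵀ) (i, k) (j, l) := by
  have t1 := flatMetric_transpose m y₁
  have t2 := flatMetric_transpose m y₂
  rw [quadE_apply (by simp [Matrix.transpose_mul, t1, Matrix.mul_assoc])
    (by simp [Matrix.transpose_mul, t2, Matrix.mul_assoc]), axisPairing, kerK, kerK, kerZ, kerZ]
  simp only [kap_axis hm _ h1, kap_axis hm _ h2, Complex.inner, entryL_apply]
  -- both sides are polynomials in the entries, once the metrics are known to be symmetric
  have s1 : flatMetric m y₁ 1 0 = flatMetric m y₁ 0 1 := congr_fun₂ t1 0 1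
  have s2 : flatMetric m y₂ 1 0 = flatMetric m y₂ 0 1 := congr_fun₂ t2 0 1
  simp only [symL_apply, rotJ, Matrix.mul_apply, Fin.sum_univ_two, Matrix.transpose_apply,
    Matrix.add_apply, Matrix.of_apply, Matrix.cons_val', Matrix.cons_val_zero, Matrix.cons_val_one,
    Matrix.cons_val_fin_one, s1, s2, Complex.mul_re, Complex.conj_re, Complex.conj_im,
    Complex.one_re, Complex.one_im, Complex.I_re, Complex.I_im]
  ring

/-! ### The connection in terms of the Beltrami coefficient -/

/-- The symmetric part of the connection, for the value `z` and the velocity `v` of the Beltrami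
coefficient. -/
def symPart (z v : ℂ) : ℂ := (1 - ‖z‖ ^ 2)⁻¹ • v

/-- The rotational part of the connection, for the value `z` and the velocity `v` of the Beltrami
coefficient. -/
def rotPart (z v : ℂ) : ℝ := (1 - ‖z‖ ^ 2)⁻¹ * (conj z * v).im

/-- The derivative of `symPart z v` when `z` and `v` have the derivatives `z'` and `v'`. -/
def dsymPart (z v z' v' : ℂ) : ℂ :=
  (1 - ‖z‖ ^ 2)⁻¹ • v' + ((1 - ‖z‖ ^ 2)⁻¹ ^ 2 * (2 * (conj z * z').re)) • v

/-- The derivative of `rotPart z v` when `z` and `v` have the derivatives `z'` and `v'`. -/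
def drotPart (z v z' v' : ℂ) : ℝ :=
  (1 - ‖z‖ ^ 2)⁻¹ * (conj z' * v + conj z * v').im
    + ((1 - ‖z‖ ^ 2)⁻¹ ^ 2 * (2 * (conj z * z').re)) * (conj z * v).im

theorem one_sub_normSq_pos {z : ℂ} (hz : ‖z‖ < 1) : 0 < 1 - ‖z‖ ^ 2 := by
  nlinarith [norm_nonneg z]

theorem hasDerivWithinAt_one_sub_normSq {z : ℝ → ℂ} {z' : ℂ} {S : Set ℝ} {s : ℝ}
    (h : HasDerivWithinAt z z' S s) :
    HasDerivWithinAt (fun s => 1 - ‖z s‖ ^ 2) (-(2 * (conj (z s) * z').re)) S s := by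
  refine (h.norm_sq.const_sub 1).congr_deriv ?_
  rw [Complex.inner, mul_comm z']

theorem hasDerivWithinAt_inv_one_sub_normSq {z : ℝ → ℂ} {z' : ℂ} {S : Set ℝ} {s : ℝ}
    (h : HasDerivWithinAt z z' S s) (hz : ‖z s‖ < 1) :
    HasDerivWithinAt (fun s => (1 - ‖z s‖ ^ 2)⁻¹)
      ((1 - ‖z s‖ ^ 2)⁻¹ ^ 2 * (2 * (conj (z s) * z').re)) S s := by
  have h0 := one_sub_normSq_pos hz
  refine ((hasDerivWithinAt_one_sub_normSq h).inv h0.ne').congr_deriv ?_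
  rw [neg_neg, div_eq_mul_inv, inv_pow, mul_comm]

theorem hasDerivWithinAt_symPart {z v : ℝ → ℂ} {z' v' : ℂ} {S : Set ℝ} {s : ℝ}
    (h : HasDerivWithinAt z z' S s) (h' : HasDerivWithinAt v v' S s) (hz : ‖z s‖ < 1) :
    HasDerivWithinAt (fun s => symPart (z s) (v s)) (dsymPart (z s) (v s) z' v') S s :=
  (hasDerivWithinAt_inv_one_sub_normSq h hz).smul h'

theorem hasDerivWithinAt_rotPart {z v : ℝ → ℂ} {z' v' : ℂ} {S : Set ℝ} {s : ℝ}
    (h : HasDerivWithinAt z z' S s) (h' : HasDerivWithinAt v v' S s) (hz : ‖z s‖ < 1) :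
    HasDerivWithinAt (fun s => rotPart (z s) (v s)) (drotPart (z s) (v s) z' v') S s := by
  have hc : HasDerivWithinAt (fun s => conj (z s)) (conj z') S s :=
    Complex.conjCLE.toContinuousLinearMap.hasFDerivAt.comp_hasDerivWithinAt s h
  have hi : HasDerivWithinAt (fun s => (conj (z s) * v s).im) (conj z' * v s + conj (z s) * v').im
      S s := Complex.imCLM.hasFDerivAt.comp_hasDerivWithinAt s (hc.mul h')
  refine ((hasDerivWithinAt_inv_one_sub_normSq h hz).mul hi).congr_deriv ?_
  rw [drotPart, add_comm]

theorem normSq_expand (z : ℂ) : ‖z‖ ^ 2 = z.re ^ 2 + z.im ^ 2 := by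
  rw [Complex.sq_norm, Complex.normSq_apply]; ring

/-- Flatness of the connection in the directions of the branch and of the variation, symmetric
part. -/
theorem dsymPart_comm (z v e v' : ℂ) :
    dsymPart z v e v' = dsymPart z e v v' + 2 * Complex.I * (rotPart z v : ℂ) * symPart z e
      - 2 * Complex.I * (rotPart z e : ℂ) * symPart z v := by
  generalize hw : (1 - ‖z‖ ^ 2)⁻¹ = w
  simp only [dsymPart, symPart, rotPart, hw]
  apply Complex.ext <;> simp [pow_two] <;> ring

/-- Flatness of the connection in the directions of the branch and of the variation, rotational
part. -/
theorem drotPart_comm (z v e v' : ℂ) (hz : ‖z‖ < 1) :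
    drotPart z v e v' = drotPart z e v v' - 2 * (conj (symPart z v) * symPart z e).im := by
  have h0 := (one_sub_normSq_pos hz).ne'
  have hw : (1 - (z.re ^ 2 + z.im ^ 2)) * (1 - ‖z‖ ^ 2)⁻¹ = 1 := by
    rw [← normSq_expand]; exact mul_inv_cancel₀ h0
  generalize hw' : (1 - ‖z‖ ^ 2)⁻¹ = w at hw
  simp only [drotPart, symPart, hw']
  simp [pow_two]
  linear_combination 2 * w * (v.re * e.im - v.im * e.re) * hw

/-! ### Regular data -/

theorem zweibein_eq (z : ℂ) : zweibein z = (√(1 - ‖z‖ ^ 2))⁻¹ • (1 + symL z) := by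
  rw [zweibein, symL_apply]
  congr 1
  ext i j
  fin_cases i <;> fin_cases j <;> simp [sub_eq_add_neg]

theorem symL_mul_symL (c d : ℂ) :
    symL c * symL d = (conj c * d).re • (1 : M2) - (conj c * d).im • rotJ := by
  rw [symL_apply, symL_apply, rotJ]
  ext i j
  fin_cases i <;> fin_cases j <;> simp [Matrix.mul_apply, Fin.sum_univ_two] <;> ring

theorem inv_zweibein {z : ℂ} (hz : ‖z‖ < 1) :
    (zweibein z)⁻¹ = (√(1 - ‖z‖ ^ 2))⁻¹ • (1 - symL z) := by
  have h0 := one_sub_normSq_pos hz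
  have hs := Real.sqrt_pos.2 h0
  apply Matrix.inv_eq_left_inv
  rw [zweibein_eq, Matrix.smul_mul, Matrix.mul_smul, smul_smul]
  have e : (1 - symL z) * (1 + symL z) = (1 - ‖z‖ ^ 2) • (1 : M2) := by
    have h1 := symL_mul_symL z z
    have h2 : (conj z * z).im = 0 := by simp; ring
    have h3 : (conj z * z).re = ‖z‖ ^ 2 := by rw [normSq_expand]; simp; ring
    rw [h2, h3, zero_smul, sub_zero] at h1
    rw [Matrix.sub_mul, Matrix.mul_add, Matrix.mul_add, h1]
    simp only [Matrix.one_mul, Matrix.mul_one, sub_smul, one_smul]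
    abel
  rw [e, smul_smul, ← mul_inv, Real.mul_self_sqrt h0.le, inv_mul_cancel₀ h0.ne', one_smul]

/-- The zweibein along a curve of Beltrami coefficients: its logarithmic derivative has no trace,
and consists of the symmetric and the rotational part. -/
theorem hasDerivWithinAt_zweibein {z : ℝ → ℂ} {z' : ℂ} {S : Set ℝ} {s : ℝ}
    (hd : HasDerivWithinAt z z' S s) (hz : ‖z s‖ < 1) :
    HasDerivWithinAt (fun s => zweibein (z s))
      (zweibein (z s) * (symL (symPart (z s) z') + rotPart (z s) z' • rotJ)) S s := by
  have h0 := one_sub_normSq_pos hz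
  have hs := Real.sqrt_pos.2 h0
  set σ := √(1 - ‖z s‖ ^ 2) with hσdef
  have hk' : HasDerivWithinAt (fun y => (√(1 - ‖z y‖ ^ 2))⁻¹)
      (σ⁻¹ * (σ⁻¹ * σ⁻¹) * (conj (z s) * z').re) S s := by
    refine (((hasDerivWithinAt_one_sub_normSq hd).sqrt h0.ne').inv hs.ne').congr_deriv ?_
    rw [← hσdef]
    field_simp
  set k := σ⁻¹ * (σ⁻¹ * σ⁻¹) * (conj (z s) * z').re with hkdef
  have hk := hk'
  have hV : HasDerivWithinAt (fun y => zweibein (z y))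
      (σ⁻¹ • symL z' + k • (1 + symL (z s))) S s := by
    have h1 : HasDerivWithinAt (fun y => 1 + symL (z y)) (symL z') S s :=
      (symL.hasFDerivAt.comp_hasDerivWithinAt s hd).const_add 1
    exact (hk.smul h1).congr (fun y _ => zweibein_eq _) (zweibein_eq _)
  have hss : σ⁻¹ * σ⁻¹ = (1 - ‖z s‖ ^ 2)⁻¹ := by
    rw [← mul_inv, hσdef, Real.mul_self_sqrt h0.le]
  have e1 : (1 - symL (z s)) * (1 + symL (z s)) = (1 - ‖z s‖ ^ 2) • (1 : M2) := by
    have h1 := symL_mul_symL (z s) (z s)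
    have h2 : (conj (z s) * z s).im = 0 := by simp; ring
    have h3 : (conj (z s) * z s).re = ‖z s‖ ^ 2 := by rw [normSq_expand]; simp; ring
    rw [h2, h3, zero_smul, sub_zero] at h1
    rw [Matrix.sub_mul, Matrix.mul_add, Matrix.mul_add, h1]
    simp only [Matrix.one_mul, Matrix.mul_one, sub_smul, one_smul]
    abel
  have hc : σ⁻¹ * k * (1 - ‖z s‖ ^ 2) = (1 - ‖z s‖ ^ 2)⁻¹ * (conj (z s) * z').re := by
    rw [hkdef, hss]
    calc _ = (σ⁻¹ * σ⁻¹) * ((1 - ‖z s‖ ^ 2)⁻¹ * (1 - ‖z s‖ ^ 2))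
          * (conj (z s) * z').re := by ring
      _ = _ := by rw [hss, inv_mul_cancel₀ h0.ne', mul_one]
  have hX : (zweibein (z s))⁻¹ * (σ⁻¹ • symL z' + k • (1 + symL (z s)))
      = symL (symPart (z s) z') + rotPart (z s) z' • rotJ := by
    rw [inv_zweibein hz, ← hσdef, Matrix.mul_add, Matrix.smul_mul, Matrix.mul_smul,
      Matrix.smul_mul, Matrix.mul_smul, e1, smul_smul, smul_smul, hss, Matrix.sub_mul,
      symL_mul_symL, Matrix.one_mul, symPart, rotPart, map_smul, smul_smul, hc]
    module
  refine hV.congr_deriv ?_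
  rw [← hX, Matrix.mul_nonsing_inv_cancel_left _ _ (by rw [det_zweibein hz]; exact isUnit_one)]

theorem symL_transpose (c : ℂ) : (symL c)ᵀ = symL c := by
  rw [symL_apply]
  ext i j
  fin_cases i <;> fin_cases j <;> simp

theorem rotJ_transpose : rotJᵀ = -rotJ := by
  rw [rotJ]
  ext i j
  fin_cases i <;> fin_cases j <;> simp

section Data
variable {L : ℝ} {μ : ℝ → ℂ} {ρ : ℝ → ℝ}

theorem IsRegularData.hasDerivWithinAt_mu (h : IsRegularData L μ ρ) {q : ℝ} (hq : q ∈ Icc 0 L) :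
    HasDerivWithinAt μ (dBranch L μ q) (Icc 0 L) q :=
  (h.smooth_mu.differentiableOn (by simp) q hq).hasDerivWithinAt

theorem IsRegularData.hasDerivWithinAt_rho (h : IsRegularData L μ ρ) {q : ℝ} (hq : q ∈ Icc 0 L) :
    HasDerivWithinAt ρ (dBranch L ρ q) (Icc 0 L) q :=
  (h.smooth_rho.differentiableOn (by simp) q hq).hasDerivWithinAt

theorem contDiffOn_dBranch {E : Type*} [NormedAddCommGroup E] [NormedSpace ℝ E] (hL : 0 < L)
    {f : ℝ → E} (h : ContDiffOn ℝ ∞ f (Icc 0 L)) : ContDiffOn ℝ ∞ (dBranch L f) (Icc 0 L) :=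
  h.derivWithin (uniqueDiffOn_Icc hL) (by simp)

/-- The connection of the zweibein, split into its symmetric traceless and rotational parts. -/
theorem connJ_eq (hL : 0 < L) (h : IsRegularData L μ ρ) {q : ℝ} (hq : q ∈ Icc 0 L) :
    connJ L μ q = symL (symPart (μ q) (dBranch L μ q))
      + rotPart (μ q) (dBranch L μ q) • rotJ := by
  have hz := h.norm_mu_lt q hq
  have hV := hasDerivWithinAt_zweibein (h.hasDerivWithinAt_mu hq) hz
  have hd : (Matrix.of fun a i => dBranch L (fun y => zweibein (μ y) a i) q : M2)
      = zweibein (μ q) * (symL (symPart (μ q) (dBranch L μ q))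
        + rotPart (μ q) (dBranch L μ q) • rotJ) := by
    ext a i
    have hL' : HasDerivWithinAt (fun y => zweibein (μ y) a i)
        ((zweibein (μ q) * (symL (symPart (μ q) (dBranch L μ q))
          + rotPart (μ q) (dBranch L μ q) • rotJ)) a i) (Icc 0 L) q := by
      have := (entryL 1 a i).hasFDerivAt.comp_hasDerivWithinAt q hV
      simpa [Function.comp_def] using this
    exact hL'.derivWithin (uniqueDiffOn_Icc hL q hq)
  rw [connJ, hd, Matrix.nonsing_inv_mul_cancel_left _ _ (by rw [det_zweibein hz]; exact isUnit_one)]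

theorem connP_eq (hL : 0 < L) (h : IsRegularData L μ ρ) {q : ℝ} (hq : q ∈ Icc 0 L) :
    connP L μ q = symL (symPart (μ q) (dBranch L μ q)) := by
  rw [connP, connJ_eq hL h hq]
  simp only [Matrix.transpose_add, Matrix.transpose_smul, symL_transpose, rotJ_transpose]
  module

theorem connQ_eq (hL : 0 < L) (h : IsRegularData L μ ρ) {q : ℝ} (hq : q ∈ Icc 0 L) :
    connQ L μ q = rotPart (μ q) (dBranch L μ q) • rotJ := by
  rw [connQ, connJ_eq hL h hq]
  simp only [Matrix.transpose_add, Matrix.transpose_smul, symL_transpose, rotJ_transpose]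
  module

end Data

/-! ### The area density as a coordinate -/

section Data
variable {L : ℝ} {μ : ℝ → ℂ} {ρ : ℝ → ℝ}

/-- The inverse of the area density on the branch. -/
def rInv (L : ℝ) (ρ : ℝ → ℝ) (x : ℝ) : ℝ := Function.invFunOn ρ (Icc 0 L) x

theorem IsRegularData.hasDerivAt_rho (h : IsRegularData L μ ρ) {q : ℝ} (hq : q ∈ Ioo 0 L) :
    HasDerivAt ρ (dBranch L ρ q) q :=
  (h.hasDerivWithinAt_rho (Ioo_subset_Icc_self hq)).hasDerivAt (Icc_mem_nhds hq.1 hq.2)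

theorem IsRegularData.dBranch_rho_pos (h : IsRegularData L μ ρ) {q : ℝ} (hq : q ∈ Ioo 0 L) :
    0 < dBranch L ρ q := h.rho_increasing q (Ioo_subset_Ioc_self hq)

theorem IsRegularData.strictMonoOn_rho (h : IsRegularData L μ ρ) : StrictMonoOn ρ (Icc 0 L) := by
  refine strictMonoOn_of_deriv_pos (convex_Icc 0 L) h.smooth_rho.continuousOn fun q hq => ?_
  rw [interior_Icc] at hq
  rw [(h.hasDerivAt_rho hq).deriv]
  exact h.dBranch_rho_pos hq

theorem IsRegularData.injOn_rho (h : IsRegularData L μ ρ) : InjOn ρ (Ioo 0 L) :=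
  h.strictMonoOn_rho.injOn.mono Ioo_subset_Icc_self

theorem IsRegularData.image_rho (h : IsRegularData L μ ρ) {r : ℝ} (hr : r ∈ Icc 0 L) :
    ρ '' Ioo 0 r = Ioo 0 (ρ r) := by
  have := (h.smooth_rho.continuousOn.mono (Icc_subset_Icc_right hr.2)).image_Ioo_of_strictMonoOn
    hr.1 (h.strictMonoOn_rho.mono (Icc_subset_Icc_right hr.2))
  rwa [h.rho_axis] at this

theorem IsRegularData.rho_mem (h : IsRegularData L μ ρ) {q r : ℝ} (hr : r ∈ Icc 0 L)
    (hq : q ∈ Ioo 0 r) : ρ q ∈ Ioo 0 (ρ r) := h.image_rho hr ▸ mem_image_of_mem _ hq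

theorem IsRegularData.rInv_rho (h : IsRegularData L μ ρ) {q : ℝ} (hq : q ∈ Icc 0 L) :
    rInv L ρ (ρ q) = q := h.strictMonoOn_rho.injOn.leftInvOn_invFunOn hq

theorem IsRegularData.rInv_mem (hL : 0 < L) (h : IsRegularData L μ ρ) {x : ℝ}
    (hx : x ∈ Ioo 0 (ρ L)) : rInv L ρ x ∈ Ioo 0 L ∧ ρ (rInv L ρ x) = x := by
  rw [← h.image_rho ⟨hL.le, le_rfl⟩] at hx
  obtain ⟨q, hq, rfl⟩ := hx
  rw [h.rInv_rho (Ioo_subset_Icc_self hq)]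
  exact ⟨hq, rfl⟩

theorem IsRegularData.rho_L_pos (hL : 0 < L) (h : IsRegularData L μ ρ) : 0 < ρ L := by
  rw [← h.rho_axis]
  exact h.strictMonoOn_rho ⟨le_rfl, hL.le⟩ ⟨hL.le, le_rfl⟩ hL

theorem IsRegularData.rInv_image (hL : 0 < L) (h : IsRegularData L μ ρ) :
    rInv L ρ '' Ioo 0 (ρ L) = Ioo 0 L := by
  ext q
  refine ⟨?_, fun hq => ⟨ρ q, h.rho_mem ⟨hL.le, le_rfl⟩ hq, h.rInv_rho (Ioo_subset_Icc_self hq)⟩⟩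
  rintro ⟨x, hx, rfl⟩
  exact (h.rInv_mem hL hx).1

theorem IsRegularData.hasDerivAt_rInv (hL : 0 < L) (h : IsRegularData L μ ρ) {x : ℝ}
    (hx : x ∈ Ioo 0 (ρ L)) : HasDerivAt (rInv L ρ) (dBranch L ρ (rInv L ρ x))⁻¹ x := by
  obtain ⟨hr, hρ⟩ := h.rInv_mem hL hx
  have hmono : MonotoneOn (rInv L ρ) (Ioo 0 (ρ L)) := by
    intro x hx y hy hxy
    obtain ⟨hx1, hx2⟩ := h.rInv_mem hL hx
    obtain ⟨hy1, hy2⟩ := h.rInv_mem hL hy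
    rw [← h.strictMonoOn_rho.le_iff_le (Ioo_subset_Icc_self hx1) (Ioo_subset_Icc_self hy1), hx2, hy2]
    exact hxy
  have hc : ContinuousAt (rInv L ρ) x := by
    refine continuousAt_of_monotoneOn_of_image_mem_nhds hmono (isOpen_Ioo.mem_nhds hx) ?_
    rw [h.rInv_image hL]
    exact isOpen_Ioo.mem_nhds hr
  refine HasDerivAt.of_local_left_inverse hc (h.hasDerivAt_rho hr) (h.dBranch_rho_pos hr).ne' ?_
  filter_upwards [isOpen_Ioo.mem_nhds hx] with y hy
  exact (h.rInv_mem hL hy).2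

/-- Change of variables from the area density to the coordinate on the branch. -/
theorem IsRegularData.integral_rho (h : IsRegularData L μ ρ) {r : ℝ} (hr : r ∈ Icc 0 L)
    {E : Type*} [NormedAddCommGroup E] [NormedSpace ℝ E] (g : ℝ → E) :
    (IntegrableOn g (Ioo 0 (ρ r)) ↔ IntegrableOn (fun q => dBranch L ρ q • g (ρ q)) (Ioo 0 r)) ∧
    ∫ x in Ioo 0 (ρ r), g x = ∫ q in Ioo 0 r, dBranch L ρ q • g (ρ q) := by
  have sub : Ioo 0 r ⊆ Ioo 0 L := Ioo_subset_Ioo_right hr.2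
  have hd : ∀ q ∈ Ioo 0 r, HasDerivWithinAt ρ (dBranch L ρ q) (Ioo 0 r) q := fun q hq =>
    (h.hasDerivAt_rho (sub hq)).hasDerivWithinAt
  have e : EqOn (fun q => |dBranch L ρ q| • g (ρ q)) (fun q => dBranch L ρ q • g (ρ q))
      (Ioo 0 r) := fun q hq => by simp only [abs_of_pos (h.dBranch_rho_pos (sub hq))]
  refine ⟨?_, ?_⟩
  · rw [← h.image_rho hr, integrableOn_image_iff_integrableOn_abs_deriv_smul measurableSet_Ioo hd
      (h.injOn_rho.mono sub)]
    exact integrableOn_congr_fun e measurableSet_Ioo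
  · rw [← h.image_rho hr, integral_image_eq_integral_abs_deriv_smul measurableSet_Ioo hd
      (h.injOn_rho.mono sub)]
    exact setIntegral_congr_fun measurableSet_Ioo e

/-- The square root singularity of the deformed connection, uniformly in the deformation point. -/
theorem IsRegularData.exists_warp_le (hL : 0 < L) (h : IsRegularData L μ ρ) {ra : ℝ}
    (hra : 0 < ra) (hraL : ra ≤ L) : ∃ C, 0 ≤ C ∧ ∀ r ∈ Icc ra L, ∀ q ∈ Ioo 0 r,
      √(ρ r) / √(ρ r - ρ q) ≤ C * (1 + (√(r - q))⁻¹) := by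
  have hcont : ContinuousOn (dBranch L ρ) (Icc (ra / 2) L) :=
    (contDiffOn_dBranch hL h.smooth_rho).continuousOn.mono (Icc_subset_Icc_left (by linarith))
  -- the slope of `ρ` is bounded below away from the axis, where it may vanish; field points nearer to
  -- the axis than `ra / 2` are at a distance from `r` anyway
  obtain ⟨q₀, hq₀, hmin⟩ := isCompact_Icc.exists_isMinOn
    (nonempty_Icc.2 (by linarith : ra / 2 ≤ L)) hcont
  have c0 : 0 < dBranch L ρ q₀ := h.rho_increasing q₀ ⟨by linarith [hq₀.1], hq₀.2⟩
  set c := dBranch L ρ q₀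
  have d0 : 0 < ρ ra - ρ (ra / 2) := sub_pos.2
    (h.strictMonoOn_rho ⟨by linarith, by linarith⟩ ⟨hra.le, hraL⟩ (by linarith))
  set d := ρ ra - ρ (ra / 2)
  have hle : ∀ r ∈ Icc ra L, ρ r ≤ ρ L := fun r hr =>
    h.strictMonoOn_rho.monotoneOn ⟨hra.le.trans hr.1, hr.2⟩ ⟨hL.le, le_rfl⟩ hr.2
  have sc := Real.sqrt_pos.2 c0
  have sd := Real.sqrt_pos.2 d0
  refine ⟨√(ρ L) / √d + √(ρ L) / √c, by positivity, fun r hr q hq => ?_⟩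
  have hrL : r ∈ Icc 0 L := ⟨hra.le.trans hr.1, hr.2⟩
  have hrq := Real.sqrt_pos.2 (sub_pos.2 hq.2)
  have P1 : 0 ≤ √(ρ L) / √d * (√(r - q))⁻¹ := by positivity
  have P2 : 0 ≤ √(ρ L) / √c := by positivity
  have P3 : 0 ≤ √(ρ L) / √d := by positivity
  have P4 : 0 ≤ √(ρ L) / √c * (√(r - q))⁻¹ := by positivity
  rcases lt_or_ge q (ra / 2) with hlt | hge
  · have h1 : d ≤ ρ r - ρ q := by
      have e1 := h.strictMonoOn_rho.monotoneOn ⟨hra.le, hraL⟩ hrL hr.1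
      have e2 := h.strictMonoOn_rho.monotoneOn ⟨hq.1.le, (hq.2.le).trans hr.2⟩
        ⟨by linarith, by linarith⟩ hlt.le
      simp only [d]; linarith
    calc √(ρ r) / √(ρ r - ρ q) ≤ √(ρ L) / √d := by
          gcongr
          exact hle r hr
      _ ≤ _ := by nlinarith
  · have h1 : c * (r - q) ≤ ρ r - ρ q := by
      refine Convex.mul_sub_le_image_sub_of_le_deriv (convex_Icc q r) (f := ρ)
        (h.smooth_rho.continuousOn.mono (Icc_subset_Icc hq.1.le hr.2)) ?_ ?_ q ⟨le_rfl, hq.2.le⟩ r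
        ⟨hq.2.le, le_rfl⟩ hq.2.le
      · rw [interior_Icc]
        exact fun z hz => (h.hasDerivAt_rho ⟨hq.1.trans hz.1, hz.2.trans_le hr.2⟩).differentiableAt
          |>.differentiableWithinAt
      · rw [interior_Icc]
        intro z hz
        rw [(h.hasDerivAt_rho ⟨hq.1.trans hz.1, hz.2.trans_le hr.2⟩).deriv]
        exact hmin ⟨hge.trans hz.1.le, hz.2.le.trans hr.2⟩
    have h2 : √c * √(r - q) ≤ √(ρ r - ρ q) := by
      rw [← Real.sqrt_mul c0.le]; exact Real.sqrt_le_sqrt h1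
    calc √(ρ r) / √(ρ r - ρ q) ≤ √(ρ L) / (√c * √(r - q)) := by
          gcongr
          exact hle r hr
      _ = √(ρ L) / √c * (√(r - q))⁻¹ := by rw [div_mul_eq_div_div, div_eq_mul_inv _ √(r - q)]
      _ ≤ _ := by nlinarith

theorem integrableOn_warpBound {r C : ℝ} (hr : 0 ≤ r) :
    IntegrableOn (fun q => C * (1 + (√(r - q))⁻¹)) (Ioo 0 r) ∧
    ∫ q in Ioo 0 r, C * (1 + (√(r - q))⁻¹) = C * (r + 2 * √r) := by
  obtain ⟨h1, h2⟩ := integrableOn_inv_sqrt_sub hr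
  have h3 : IntegrableOn (fun _ : ℝ => (1 : ℝ)) (Ioo 0 r) := integrableOn_const_Ioo 1
  refine ⟨(h3.add h1).const_mul C, ?_⟩
  rw [integral_const_mul, integral_add h3 h1, h2]
  simp [hr]

/-! ### The flat frame -/

/-- The rotational part of the connection along the branch. -/
def rotDens (L : ℝ) (μ : ℝ → ℂ) (q : ℝ) : ℝ := rotPart (μ q) (dBranch L μ q)

/-- The angle by which the frame has to be rotated to remove the rotational part. -/
def theta (L : ℝ) (μ : ℝ → ℂ) (q : ℝ) : ℝ := ∫ z in (0 : ℝ)..q, rotDens L μ z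

/-- The phase of the symmetric part of a connection under a rotation of the frame by `θ`. -/
def phase (θ : ℝ) : ℂ := Complex.exp ((2 * θ : ℝ) * Complex.I)

/-- The symmetric part of the connection in the rotated frame. -/
def frameM (L : ℝ) (μ : ℝ → ℂ) (q : ℝ) : ℂ :=
  phase (theta L μ q) * symPart (μ q) (dBranch L μ q)

/-- The symmetric part of the connection in the rotated frame, in terms of the area density. -/
def prof (L : ℝ) (μ : ℝ → ℂ) (ρ : ℝ → ℝ) (x : ℝ) : ℂ :=
  (dBranch L ρ (rInv L ρ x))⁻¹ • frameM L μ (rInv L ρ x)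

theorem norm_phase (θ : ℝ) : ‖phase θ‖ = 1 := Complex.norm_exp_ofReal_mul_I _

theorem hasDerivAt_phase (θ : ℝ) : HasDerivAt phase (2 * Complex.I * phase θ) θ := by
  have h1 : HasDerivAt (fun θ : ℝ => ((2 * θ : ℝ) : ℂ) * Complex.I) (2 * Complex.I) θ := by
    have := (((hasDerivAt_id θ).const_mul (2 : ℝ)).ofReal_comp).mul_const Complex.I
    simpa using this
  refine h1.cexp.congr_deriv ?_
  rw [phase, mul_comm]

theorem phase_mul_conj (θ : ℝ) : phase θ * conj (phase θ) = 1 := by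
  rw [Complex.mul_conj, Complex.normSq_eq_norm_sq, norm_phase]; simp

theorem contDiffOn_inv_one_sub (h : IsRegularData L μ ρ) :
    ContDiffOn ℝ ∞ (fun q => (1 - ‖μ q‖ ^ 2)⁻¹) (Icc 0 L) := by
  refine ContDiffOn.inv (contDiffOn_const.sub (h.smooth_mu.norm_sq ℝ)) fun q hq => ?_
  exact (one_sub_normSq_pos (h.norm_mu_lt q hq)).ne'

theorem contDiffOn_symPart (h : IsRegularData L μ ρ) {v : ℝ → ℂ}
    (hv : ContDiffOn ℝ ∞ v (Icc 0 L)) :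
    ContDiffOn ℝ ∞ (fun q => symPart (μ q) (v q)) (Icc 0 L) :=
  (contDiffOn_inv_one_sub h).smul hv

theorem contDiffOn_rotPart (h : IsRegularData L μ ρ) {v : ℝ → ℂ}
    (hv : ContDiffOn ℝ ∞ v (Icc 0 L)) :
    ContDiffOn ℝ ∞ (fun q => rotPart (μ q) (v q)) (Icc 0 L) := by
  have h1 : ContDiffOn ℝ ∞ (fun q => conj (μ q)) (Icc 0 L) :=
    Complex.conjCLE.contDiff.comp_contDiffOn h.smooth_mu
  have h2 : ContDiffOn ℝ ∞ (fun q => (conj (μ q) * v q).im) (Icc 0 L) :=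
    Complex.imCLM.contDiff.comp_contDiffOn (h1.mul hv)
  exact (contDiffOn_inv_one_sub h).mul h2

theorem continuousOn_rotDens (hL : 0 < L) (h : IsRegularData L μ ρ) :
    ContinuousOn (rotDens L μ) (Icc 0 L) :=
  (contDiffOn_rotPart h (contDiffOn_dBranch hL h.smooth_mu)).continuousOn

theorem continuousOn_theta (hL : 0 < L) (h : IsRegularData L μ ρ) :
    ContinuousOn (theta L μ) (Icc 0 L) := by
  have hi : IntegrableOn (rotDens L μ) (uIcc 0 L) := by
    rw [uIcc_of_le hL.le]; exact (continuousOn_rotDens hL h).integrableOn_Icc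
  have := intervalIntegral.continuousOn_primitive_interval hi
  rwa [uIcc_of_le hL.le] at this

theorem hasDerivAt_theta (hL : 0 < L) (h : IsRegularData L μ ρ) {q : ℝ} (hq : q ∈ Ioo 0 L) :
    HasDerivAt (theta L μ) (rotDens L μ q) q := by
  have hc := continuousOn_rotDens hL h
  have hn : Icc 0 L ∈ 𝓝 q := Icc_mem_nhds hq.1 hq.2
  refine intervalIntegral.integral_hasDerivAt_right ?_
    (hc.stronglyMeasurableAtFilter_nhdsWithin measurableSet_Icc q |>.filter_mono
      (by rw [nhdsWithin_eq_nhds.2 hn])) (hc.continuousAt hn)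
  rw [intervalIntegrable_iff_integrableOn_Icc_of_le hq.1.le]
  exact (hc.mono (Icc_subset_Icc_right hq.2.le)).integrableOn_Icc

theorem continuousOn_phase_theta (hL : 0 < L) (h : IsRegularData L μ ρ) :
    ContinuousOn (fun q => phase (theta L μ q)) (Icc 0 L) :=
  (continuous_iff_continuousAt.2 fun θ => (hasDerivAt_phase θ).continuousAt).comp_continuousOn
    (continuousOn_theta hL h)

theorem hasDerivAt_phase_theta (hL : 0 < L) (h : IsRegularData L μ ρ) {q : ℝ} (hq : q ∈ Ioo 0 L) :
    HasDerivAt (fun q => phase (theta L μ q))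
      (2 * Complex.I * (rotDens L μ q : ℂ) * phase (theta L μ q)) q := by
  refine ((hasDerivAt_phase _).scomp q (hasDerivAt_theta hL h hq)).congr_deriv ?_
  rw [Complex.real_smul]; ring

theorem continuousOn_frameM (hL : 0 < L) (h : IsRegularData L μ ρ) :
    ContinuousOn (frameM L μ) (Icc 0 L) :=
  (continuousOn_phase_theta hL h).mul
    (contDiffOn_symPart h (contDiffOn_dBranch hL h.smooth_mu)).continuousOn

/-- The connection along the branch in terms of the profile. -/
theorem prof_rho (h : IsRegularData L μ ρ) {q : ℝ} (hq : q ∈ Ioo 0 L) :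
    dBranch L ρ q • prof L μ ρ (ρ q) = frameM L μ q := by
  rw [prof, h.rInv_rho (Ioo_subset_Icc_self hq), smul_smul,
    mul_inv_cancel₀ (h.dBranch_rho_pos hq).ne', one_smul]

/-- The profile is continuously differentiable off the axis, and integrable because the connection
is bounded along the branch. It may be unbounded at the axis, where `ρ'` is allowed to vanish. -/
theorem exists_isProfile (hL : 0 < L) (h : IsRegularData L μ ρ) :
    ∃ m', IsProfile (ρ L) (prof L μ ρ) m' := by
  set v := dBranch L μ
  have hvs := contDiffOn_dBranch hL h.smooth_mu
  have hw := contDiffOn_symPart h hvs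
  have hρ' := contDiffOn_dBranch hL h.smooth_rho
  have nh : ∀ q ∈ Ioo 0 L, Icc 0 L ∈ 𝓝 q := fun q hq => Icc_mem_nhds hq.1 hq.2
  -- the derivative of the profile in terms of the coordinate of the branch
  set D : ℝ → ℂ := fun q => (dBranch L ρ q)⁻¹ •
    (2 * Complex.I * (rotDens L μ q : ℂ) * phase (theta L μ q) * symPart (μ q) (v q)
      + phase (theta L μ q) * dBranch L (fun q => symPart (μ q) (v q)) q)
    + (-(dBranch L (dBranch L ρ) q) / dBranch L ρ q ^ 2) • frameM L μ q with hD
  have hder : ∀ q ∈ Ioo 0 L,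
      HasDerivAt (fun q => (dBranch L ρ q)⁻¹ • frameM L μ q) (D q) q := by
    intro q hq
    have hq' := Ioo_subset_Icc_self hq
    have h1 : HasDerivAt (fun q => symPart (μ q) (v q)) _ q :=
      (hw.differentiableOn (by simp) q hq').hasDerivWithinAt.hasDerivAt (nh q hq)
    have h2 : HasDerivAt (dBranch L ρ) (dBranch L (dBranch L ρ) q) q :=
      (hρ'.differentiableOn (by simp) q hq').hasDerivWithinAt.hasDerivAt (nh q hq)
    exact (h2.inv (h.dBranch_rho_pos hq).ne').smul ((hasDerivAt_phase_theta hL h hq).mul h1)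
  have hDc : ContinuousOn D (Ioo 0 L) := by
    have s := Ioo_subset_Icc_self (a := (0 : ℝ)) (b := L)
    have c1 := hρ'.continuousOn.mono s
    have c2 := (contDiffOn_dBranch hL hρ').continuousOn.mono s
    have c3 := (continuousOn_phase_theta hL h).mono s
    have c4 := hw.continuousOn.mono s
    have c5 := (contDiffOn_dBranch hL hw).continuousOn.mono s
    have c6 := Complex.continuous_ofReal.comp_continuousOn ((continuousOn_rotDens hL h).mono s)
    have c7 := (continuousOn_frameM hL h).mono s
    have n0 : ∀ q ∈ Ioo 0 L, dBranch L ρ q ≠ 0 := fun q hq => (h.dBranch_rho_pos hq).ne'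
    exact ((c1.inv₀ n0).smul ((((continuousOn_const.mul c6).mul c3).mul c4).add (c3.mul c5))).add
      ((c2.neg.div (c1.pow 2) fun q hq => pow_ne_zero _ (n0 q hq)).smul c7)
  have hrc : ContinuousOn (rInv L ρ) (Ioo 0 (ρ L)) := fun x hx =>
    (h.hasDerivAt_rInv hL hx).continuousAt.continuousWithinAt
  have hrm : MapsTo (rInv L ρ) (Ioo 0 (ρ L)) (Ioo 0 L) := fun x hx => (h.rInv_mem hL hx).1
  refine ⟨fun x => (dBranch L ρ (rInv L ρ x))⁻¹ • D (rInv L ρ x), fun x hx => ?_, ?_, ?_⟩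
  · exact (hder _ (hrm hx)).scomp x (h.hasDerivAt_rInv hL hx)
  · have c1 := (hρ'.continuousOn.mono Ioo_subset_Icc_self).comp hrc hrm
    exact (c1.inv₀ fun x hx => (h.dBranch_rho_pos (hrm hx)).ne').smul (hDc.comp hrc hrm)
  · rw [(h.integral_rho ⟨hL.le, le_rfl⟩ _).1]
    refine (integrableOn_congr_fun (fun q hq => prof_rho h hq) measurableSet_Ioo).2 ?_
    exact ((continuousOn_frameM hL h).integrableOn_Icc).mono_set Ioo_subset_Icc_self

end Data

/-! ### The deformed metric in the flat frame -/

/-- Rotation by the angle `θ`. -/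
def rot (θ : ℝ) : M2 := Real.cos θ • 1 + Real.sin θ • rotJ

theorem rotJ_mul_rotJ : rotJ * rotJ = -1 := by
  rw [rotJ]
  ext i j
  fin_cases i <;> fin_cases j <;> simp [Matrix.mul_apply, Fin.sum_univ_two]

theorem rot_zero : rot 0 = 1 := by simp [rot]

theorem rot_mul_neg (θ : ℝ) : rot (-θ) * rot θ = 1 := by
  have h := Real.cos_sq_add_sin_sq θ
  have e : rot (-θ) * rot θ = (Real.cos θ ^ 2 + Real.sin θ ^ 2) • (1 : M2) := by
    simp only [rot, Real.cos_neg, Real.sin_neg, Matrix.add_mul, Matrix.mul_add, Matrix.smul_mul,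
      Matrix.mul_smul, Matrix.one_mul, Matrix.mul_one, rotJ_mul_rotJ, neg_smul, Matrix.neg_mul]
    module
  rw [e, h, one_smul]

theorem rot_mul_transpose (θ : ℝ) : rot θ * (rot θ)ᵀ = 1 := by
  have h := Real.cos_sq_add_sin_sq θ
  have e : rot θ * (rot θ)ᵀ = (Real.cos θ ^ 2 + Real.sin θ ^ 2) • (1 : M2) := by
    simp only [rot, Matrix.transpose_add, Matrix.transpose_smul, Matrix.transpose_one,
      rotJ_transpose, Matrix.add_mul, Matrix.mul_add, Matrix.smul_mul,
      Matrix.mul_smul, Matrix.one_mul, Matrix.mul_one, rotJ_mul_rotJ, Matrix.mul_neg, smul_neg]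
    module
  rw [e, h, one_smul]

/-- A rotation of the frame by `θ` rotates the complex coordinate of a symmetric traceless matrix
by `2θ`. -/
theorem symL_mul_rot (θ : ℝ) (c : ℂ) :
    symL c * rot (-θ) = rot (-θ) * symL (phase θ * c) := by
  have h : phase θ = ⟨Real.cos (2 * θ), Real.sin (2 * θ)⟩ := by
    rw [phase, Complex.exp_mul_I, ← Complex.ofReal_cos, ← Complex.ofReal_sin,
      Complex.mk_eq_add_mul_I]
  have hs := Real.sin_sq_add_cos_sq θ
  rw [h, Real.cos_two_mul, Real.sin_two_mul, symL_apply, symL_apply, rot, rotJ, Real.cos_neg,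
    Real.sin_neg]
  ext i j
  fin_cases i <;> fin_cases j <;> simp [Matrix.mul_apply, Fin.sum_univ_two]
  · linear_combination (-2 * Real.cos θ * c.re) * hs
  · linear_combination (-2 * Real.cos θ * c.im) * hs
  · linear_combination (-2 * Real.cos θ * c.im) * hs
  · linear_combination (2 * Real.cos θ * c.re) * hs

theorem hasDerivAt_rot_neg {θ : ℝ → ℝ} {θ' q : ℝ} (h : HasDerivAt θ θ' q) :
    HasDerivAt (fun q => rot (-θ q)) (-(θ' • rotJ * rot (-θ q))) q := by
  have h1 := (h.cos.smul_const (1 : M2)).sub (h.sin.smul_const rotJ)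
  have e : (fun q => rot (-θ q))
      = (fun q => Real.cos (θ q) • (1 : M2)) - fun q => Real.sin (θ q) • rotJ := by
    ext q : 1
    simp [rot, sub_eq_add_neg]
  rw [e]
  refine h1.congr_deriv ?_
  simp only [rot, Real.cos_neg, Real.sin_neg, Matrix.mul_add, Matrix.smul_mul, Matrix.mul_smul,
    Matrix.mul_one, rotJ_mul_rotJ]
  module

section Data
variable {L : ℝ} {μ : ℝ → ℂ} {ρ : ℝ → ℝ}

/-- The factor by which the deformation multiplies the symmetric part of the connection. -/
def warp (ρ : ℝ → ℝ) (r q : ℝ) : ℝ := √(ρ r) / √(ρ r - ρ q)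

/-- The deformed connection in the rotated frame. -/
def frameConn (L : ℝ) (μ : ℝ → ℂ) (ρ : ℝ → ℝ) (r q : ℝ) : M2 :=
  symL (warp ρ r q • frameM L μ q)

theorem warp_nonneg (r q : ℝ) : 0 ≤ warp ρ r q := by unfold warp; positivity

theorem one_div_sqrt_eq_warp {r q : ℝ} (hr : 0 < ρ r) : 1 / √(1 - ρ q / ρ r) = warp ρ r q := by
  have : 1 - ρ q / ρ r = (ρ r - ρ q) / ρ r := by field_simp
  rw [this, Real.sqrt_div' _ hr.le, one_div_div, warp]

theorem continuousOn_warp (h : IsRegularData L μ ρ) {r : ℝ} (hr : r ∈ Icc 0 L) :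
    ContinuousOn (warp ρ r) (Ioo 0 r) := by
  have hc : ContinuousOn ρ (Ioo 0 r) := h.smooth_rho.continuousOn.mono
    (Ioo_subset_Icc_self.trans (Icc_subset_Icc_right hr.2))
  refine ContinuousOn.div continuousOn_const (continuousOn_const.sub hc).sqrt fun q hq => ?_
  exact (Real.sqrt_pos.2 (sub_pos.2 (h.rho_mem hr hq).2)).ne'

theorem integrableOn_warp (hL : 0 < L) (h : IsRegularData L μ ρ) {r : ℝ} (hr : r ∈ Ioc 0 L) :
    IntegrableOn (warp ρ r) (Ioo 0 r) := by
  obtain ⟨C, hC, hle⟩ := h.exists_warp_le hL hr.1 hr.2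
  refine Integrable.mono' (integrableOn_warpBound (C := C) hr.1.le).1
    ((continuousOn_warp h ⟨hr.1.le, hr.2⟩).aestronglyMeasurable measurableSet_Ioo) ?_
  filter_upwards [ae_restrict_mem measurableSet_Ioo] with q hq
  rw [Real.norm_of_nonneg (warp_nonneg _ _)]
  exact hle r ⟨le_rfl, hr.2⟩ q hq

theorem isConn_warp_smul (hL : 0 < L) (h : IsRegularData L μ ρ) {r : ℝ} (hr : r ∈ Ioc 0 L)
    {E : Type*} [NormedAddCommGroup E] [NormedSpace ℝ E] {v : ℝ → E}
    (hv : ContinuousOn v (Icc 0 L)) : IsConn (fun q => warp ρ r q • v q) 0 r := by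
  obtain ⟨C, hC⟩ := isCompact_Icc.exists_bound_of_continuousOn hv
  have sub : Ioo 0 r ⊆ Icc 0 L := Ioo_subset_Icc_self.trans (Icc_subset_Icc_right hr.2)
  have hc : ContinuousOn (fun q => warp ρ r q • v q) (Ioo 0 r) :=
    (continuousOn_warp h ⟨hr.1.le, hr.2⟩).smul (hv.mono sub)
  refine ⟨hr.1.le, hc, Integrable.mono' ((integrableOn_warp hL h hr).mul_const C)
    (hc.aestronglyMeasurable measurableSet_Ioo) ?_⟩
  filter_upwards [ae_restrict_mem measurableSet_Ioo] with q hq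
  rw [norm_smul, Real.norm_of_nonneg (warp_nonneg _ _)]
  exact mul_le_mul_of_nonneg_left (hC q (sub hq)) (warp_nonneg _ _)

theorem isConn_frameConn (hL : 0 < L) (h : IsRegularData L μ ρ) {r : ℝ} (hr : r ∈ Ioc 0 L) :
    IsConn (frameConn L μ ρ r) 0 r := by
  have hv : ContinuousOn (fun q => symL (frameM L μ q)) (Icc 0 L) :=
    symL.continuous.comp_continuousOn (continuousOn_frameM hL h)
  have := isConn_warp_smul hL h hr hv
  have e : frameConn L μ ρ r = fun q => warp ρ r q • symL (frameM L μ q) := by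
    ext q : 1; rw [frameConn, map_smul]
  rwa [e]

theorem isTransport_frameConn (hL : 0 < L) (h : IsRegularData L μ ρ) {r : ℝ} (hr : r ∈ Ioc 0 L) :
    IsTransport (frameConn L μ ρ r) 0 r (pathOrdExp (frameConn L μ ρ r) · r) :=
  (isConn_frameConn hL h hr).isTransport.1

theorem trace_frameConn (r q : ℝ) : (frameConn L μ ρ r q).trace = 0 := trace_symL _

theorem connJhat_eq (hL : 0 < L) (h : IsRegularData L μ ρ) {r q : ℝ} (hr : r ∈ Ioc 0 L)
    (hq : q ∈ Icc 0 L) : connJhat L μ ρ r q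
      = rotDens L μ q • rotJ + warp ρ r q • symL (symPart (μ q) (dBranch L μ q)) := by
  have hρ : 0 < ρ r := by
    rw [← h.rho_axis]
    exact h.strictMonoOn_rho ⟨le_rfl, hL.le⟩ ⟨hr.1.le, hr.2⟩ hr.1
  rw [connJhat, connQ_eq hL h hq, connP_eq hL h hq, one_div_sqrt_eq_warp hρ, rotDens]

theorem trace_connJhat (hL : 0 < L) (h : IsRegularData L μ ρ) {r : ℝ} (hr : r ∈ Ioc 0 L) (q : ℝ) :
    (connJhat L μ ρ r q).trace = 0 := by
  by_cases hq : q ∈ Icc 0 L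
  · rw [connJhat_eq hL h hr hq, Matrix.trace_add, Matrix.trace_smul, Matrix.trace_smul, trace_symL]
    simp [rotJ, Matrix.trace_fin_two]
  · have h0 : (Matrix.of fun a i => dBranch L (fun y => zweibein (μ y) a i) q : M2) = 0 := by
      ext a i
      exact derivWithin_zero_of_notMem_closure (by rwa [closure_Icc])
    have hJ : connJ L μ q = 0 := by rw [connJ, h0, Matrix.mul_zero]
    simp [connJhat, connP, connQ, hJ]

theorem isConn_connJhat (hL : 0 < L) (h : IsRegularData L μ ρ) {r : ℝ} (hr : r ∈ Ioc 0 L) :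
    IsConn (connJhat L μ ρ r) 0 r := by
  have sub : Ioo 0 r ⊆ Icc 0 L := Ioo_subset_Icc_self.trans (Icc_subset_Icc_right hr.2)
  have hv : ContinuousOn (fun q => symL (symPart (μ q) (dBranch L μ q))) (Icc 0 L) :=
    symL.continuous.comp_continuousOn
      (contDiffOn_symPart h (contDiffOn_dBranch hL h.smooth_mu)).continuousOn
  have h1 := isConn_warp_smul hL h hr hv
  have hQ : ContinuousOn (fun q => rotDens L μ q • rotJ) (Icc 0 L) :=
    (continuousOn_rotDens hL h).smul continuousOn_const
  have e : EqOn (connJhat L μ ρ r) (fun q => rotDens L μ q • rotJ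
      + warp ρ r q • symL (symPart (μ q) (dBranch L μ q))) (Ioo 0 r) :=
    fun q hq => connJhat_eq hL h hr (sub hq)
  refine ⟨hr.1.le, ((hQ.mono sub).add h1.cont).congr e, ?_⟩
  exact (integrableOn_congr_fun e measurableSet_Ioo).2
    ((hQ.integrableOn_Icc.mono_set sub).add h1.int)

/-- Rotating the frame removes the rotational part of the deformed connection. -/
theorem pathOrdExp_connJhat (hL : 0 < L) (h : IsRegularData L μ ρ) {r : ℝ} (hr : r ∈ Ioo 0 L) :
    pathOrdExp (connJhat L μ ρ r) 0 r
      = pathOrdExp (frameConn L μ ρ r) 0 r * rot (theta L μ r) := by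
  have hr' : r ∈ Ioc 0 L := Ioo_subset_Ioc_self hr
  have hR := isTransport_frameConn hL h hr'
  have sub : Icc 0 r ⊆ Icc 0 L := Icc_subset_Icc_right hr.2.le
  have hS : IsTransport (connJhat L μ ρ r) 0 r
      (fun q => rot (-theta L μ q) * pathOrdExp (frameConn L μ ρ r) q r * rot (theta L μ r)) := by
    refine ⟨?_, fun q hq => ?_, ?_⟩
    · have hc : Continuous fun θ : ℝ => rot (-θ) :=
        continuous_iff_continuousAt.2 fun θ => (hasDerivAt_rot_neg (hasDerivAt_id θ)).continuousAt
      exact ((hc.comp_continuousOn ((continuousOn_theta hL h).mono sub)).mul hR.cont).mul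
        continuousOn_const
    · have hqL : q ∈ Ioo 0 L := ⟨hq.1, hq.2.trans hr.2⟩
      have h1 := ((hasDerivAt_rot_neg (hasDerivAt_theta hL h hqL)).mul (hR.deriv q hq)).mul_const
        (rot (theta L μ r))
      refine h1.congr_deriv ?_
      rw [connJhat_eq hL h hr' (Ioo_subset_Icc_self hqL), frameConn, frameM]
      have e := symL_mul_rot (theta L μ q) (symPart (μ q) (dBranch L μ q))
      simp only [Matrix.add_mul, map_smul, Matrix.smul_mul, Matrix.mul_smul, Matrix.neg_mul,
        Matrix.mul_neg, ← Matrix.mul_assoc, neg_add]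
      rw [e]
    · have : pathOrdExp (frameConn L μ ρ r) r r = 1 := hR.final
      rw [this, Matrix.mul_one, rot_mul_neg]
  have h0 : theta L μ 0 = 0 := intervalIntegral.integral_same
  rw [hS.eq_pathOrdExp (isConn_connJhat hL h hr') (trace_connJhat hL h hr') ⟨le_rfl, hr.1.le⟩, h0,
    neg_zero, rot_zero, Matrix.one_mul]

/-- The rotation at the deformation point drops out of the deformed metric. -/
theorem deformedMetric_eq (hL : 0 < L) (h : IsRegularData L μ ρ) {r : ℝ} (hr : r ∈ Ioo 0 L) :
    deformedMetric L μ ρ r = zweibein (μ 0) *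
      (pathOrdExp (frameConn L μ ρ r) 0 r * (pathOrdExp (frameConn L μ ρ r) 0 r)ᵀ)
      * (zweibein (μ 0))ᵀ := by
  rw [deformedMetric, fieldU, deformedZweibein, pathOrdExp_connJhat hL h hr]
  simp only [Matrix.transpose_mul, Matrix.mul_assoc]
  rw [← Matrix.mul_assoc (rot _), rot_mul_transpose, Matrix.one_mul]

/-- In terms of the area density as coordinate the transport is that of the profile. -/
theorem pathOrdExp_frameConn (hL : 0 < L) (h : IsRegularData L μ ρ) {r q : ℝ} (hr : r ∈ Ioo 0 L)
    (hq : q ∈ Icc 0 r) :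
    pathOrdExp (frameConn L μ ρ r) q r = prop (prof L μ ρ) (ρ q) (ρ r) := by
  obtain ⟨m', hm⟩ := exists_isProfile hL h
  have hrL : r ∈ Icc 0 L := Ioo_subset_Icc_self hr
  have hy : ρ r ∈ Ioo 0 (ρ L) := h.rho_mem ⟨hL.le, le_rfl⟩ hr
  have hT := isTransport_prop hm hy
  have sub : Icc 0 r ⊆ Icc 0 L := Icc_subset_Icc_right hr.2.le
  have hmap : MapsTo ρ (Icc 0 r) (Icc 0 (ρ r)) := fun q hq => by
    refine ⟨?_, h.strictMonoOn_rho.monotoneOn (sub hq) hrL hq.2⟩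
    rw [← h.rho_axis]
    exact h.strictMonoOn_rho.monotoneOn ⟨le_rfl, hL.le⟩ (sub hq) hq.1
  have hS : IsTransport (frameConn L μ ρ r) 0 r (fun q => prop (prof L μ ρ) (ρ q) (ρ r)) := by
    refine ⟨hT.cont.comp (h.smooth_rho.continuousOn.mono sub) hmap, fun q hq => ?_, hT.final⟩
    have hqL : q ∈ Ioo 0 L := ⟨hq.1, hq.2.trans hr.2⟩
    have h1 := (hT.deriv (ρ q) (h.rho_mem hrL hq)).scomp q (h.hasDerivAt_rho hqL)
    refine h1.congr_deriv ?_
    rw [frameConn, flatConn, ← prof_rho h hqL, warp, smul_comm, map_smul _ (dBranch L ρ q),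
      Matrix.smul_mul, smul_neg]
  exact hS.eq_pathOrdExp (isConn_frameConn hL h (Ioo_subset_Ioc_self hr)) (trace_frameConn r) hq

end Data

/-! ### Variation of the Beltrami coefficient -/

/-- Differentiation under the integral sign at `0`, where the integrands need be differentiable at
`0` only, with a Lipschitz bound relative to `0`. -/
theorem hasDerivAt_integral_of_lipschitz_at {α E : Type*} [MeasurableSpace α] {ν : Measure α}
    [NormedAddCommGroup E] [NormedSpace ℝ E] {F : ℝ → α → E} {F' : α → E} {g : α → ℝ} {δ : ℝ}
    (hδ : 0 < δ) (hm : ∀ t, |t| < δ → AEStronglyMeasurable (F t) ν) (h0 : Integrable (F 0) ν)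
    (hm' : AEStronglyMeasurable F' ν) (hg : Integrable g ν)
    (hle : ∀ᵐ a ∂ν, ∀ t, |t| < δ → ‖F t a - F 0 a‖ ≤ g a * |t|)
    (hd : ∀ᵐ a ∂ν, HasDerivAt (fun t => F t a) (F' a) 0) :
    HasDerivAt (fun t => ∫ a, F t a ∂ν) (∫ a, F' a ∂ν) 0 := by
  have hb : Metric.ball (0 : ℝ) δ ∈ 𝓝 0 := Metric.ball_mem_nhds 0 hδ
  have hmem : ∀ t : ℝ, t ∈ Metric.ball (0 : ℝ) δ ↔ |t| < δ := fun t => by simp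
  let T := ContinuousLinearMap.toSpanSingletonCLE (𝕜 := ℝ) (E := E)
  have h := hasFDerivAt_integral_of_dominated_loc_of_lip' (𝕜 := ℝ) (μ := ν) (F := F) (x₀ := 0)
    (F' := fun a => ContinuousLinearMap.toSpanSingleton ℝ (F' a)) (bound := g) hb
    (fun t ht => hm t ((hmem t).1 ht)) h0 ?_ ?_ hg ?_
  · have := h.2.hasDerivAt
    refine this.congr_deriv ?_
    rw [ContinuousLinearMap.integral_apply h.1]
    simp
  · exact ((ContinuousLinearMap.toSpanSingletonLE ℝ ℝ E).toLinearMap.mkContinuous 1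
      (by simp)).continuous.comp_aestronglyMeasurable hm'
  · filter_upwards [hle] with a ha t ht
    simpa [Real.norm_eq_abs] using ha t ((hmem t).1 ht)
  · filter_upwards [hd] with a ha
    exact ha.hasFDerivAt

/-- The varied Beltrami coefficient. -/
def pert (μ η : ℝ → ℂ) (t : ℝ) (x : ℝ) : ℂ := μ x + t * η x

section Data
variable {L : ℝ} {μ η : ℝ → ℂ} {ρ : ℝ → ℝ}

/-- The variation of the frame, symmetric part, in the rotated frame. -/
def flatVar (L : ℝ) (μ η : ℝ → ℂ) (q : ℝ) : ℂ := phase (theta L μ q) * symPart (μ q) (η q)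

/-- The derivative of `flatVar` along the branch. -/
def dflatVar (L : ℝ) (μ η : ℝ → ℂ) (q : ℝ) : ℂ :=
  2 * Complex.I * (rotDens L μ q : ℂ) * phase (theta L μ q) * symPart (μ q) (η q)
    + phase (theta L μ q) * dsymPart (μ q) (η q) (dBranch L μ q) (dBranch L η q)

/-- The rotational part of the variation of the frame, less the variation of the angle `theta`. -/
def angVar (L : ℝ) (μ η : ℝ → ℂ) (q : ℝ) : ℝ :=
  rotPart (μ q) (η q)
    - ∫ z in (0 : ℝ)..q, drotPart (μ z) (dBranch L μ z) (η z) (dBranch L η z)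

theorem hasDerivAt_of_contDiffOn {E : Type*} [NormedAddCommGroup E] [NormedSpace ℝ E] {f : ℝ → E}
    (hf : ContDiffOn ℝ ∞ f (Icc 0 L)) {q : ℝ} (hq : q ∈ Ioo 0 L) :
    HasDerivAt f (dBranch L f q) q :=
  (hf.differentiableOn (by simp) q (Ioo_subset_Icc_self hq)).hasDerivWithinAt.hasDerivAt
    (Icc_mem_nhds hq.1 hq.2)

theorem continuousOn_inv_one_sub (h : IsRegularData L μ ρ) :
    ContinuousOn (fun q => (1 - ‖μ q‖ ^ 2)⁻¹) (Icc 0 L) := (contDiffOn_inv_one_sub h).continuousOn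

theorem continuousOn_dsymPart (h : IsRegularData L μ ρ) {v z' v' : ℝ → ℂ}
    (hv : ContinuousOn v (Icc 0 L)) (hz' : ContinuousOn z' (Icc 0 L))
    (hv' : ContinuousOn v' (Icc 0 L)) :
    ContinuousOn (fun q => dsymPart (μ q) (v q) (z' q) (v' q)) (Icc 0 L) := by
  have hw := continuousOn_inv_one_sub h
  have hc : ContinuousOn (fun q => conj (μ q)) (Icc 0 L) :=
    Complex.continuous_conj.comp_continuousOn h.smooth_mu.continuousOn
  have hr : ContinuousOn (fun q => (conj (μ q) * z' q).re) (Icc 0 L) :=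
    Complex.continuous_re.comp_continuousOn (hc.mul hz')
  exact (hw.smul hv').add (((hw.pow 2).mul (continuousOn_const.mul hr)).smul hv)

theorem continuousOn_drotPart (h : IsRegularData L μ ρ) {v z' v' : ℝ → ℂ}
    (hv : ContinuousOn v (Icc 0 L)) (hz' : ContinuousOn z' (Icc 0 L))
    (hv' : ContinuousOn v' (Icc 0 L)) :
    ContinuousOn (fun q => drotPart (μ q) (v q) (z' q) (v' q)) (Icc 0 L) := by
  have hw := continuousOn_inv_one_sub h
  have hc : ContinuousOn (fun q => conj (μ q)) (Icc 0 L) :=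
    Complex.continuous_conj.comp_continuousOn h.smooth_mu.continuousOn
  have hc' : ContinuousOn (fun q => conj (z' q)) (Icc 0 L) :=
    Complex.continuous_conj.comp_continuousOn hz'
  have hr : ContinuousOn (fun q => (conj (μ q) * z' q).re) (Icc 0 L) :=
    Complex.continuous_re.comp_continuousOn (hc.mul hz')
  have hi : ContinuousOn (fun q => (conj (μ q) * v q).im) (Icc 0 L) :=
    Complex.continuous_im.comp_continuousOn (hc.mul hv)
  have hi' : ContinuousOn (fun q => (conj (z' q) * v q + conj (μ q) * v' q).im) (Icc 0 L) :=
    Complex.continuous_im.comp_continuousOn ((hc'.mul hv).add (hc.mul hv'))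
  exact (hw.mul hi').add (((hw.pow 2).mul (continuousOn_const.mul hr)).mul hi)

theorem continuousOn_flatVar (hL : 0 < L) (h : IsRegularData L μ ρ)
    (hη : ContDiffOn ℝ ∞ η (Icc 0 L)) : ContinuousOn (flatVar L μ η) (Icc 0 L) :=
  (continuousOn_phase_theta hL h).mul (contDiffOn_symPart h hη).continuousOn

theorem continuousOn_dflatVar (hL : 0 < L) (h : IsRegularData L μ ρ)
    (hη : ContDiffOn ℝ ∞ η (Icc 0 L)) : ContinuousOn (dflatVar L μ η) (Icc 0 L) := by
  have h1 := continuousOn_phase_theta hL h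
  have h2 := (contDiffOn_symPart h hη).continuousOn
  have h3 := continuousOn_dsymPart h hη.continuousOn
    (contDiffOn_dBranch hL h.smooth_mu).continuousOn (contDiffOn_dBranch hL hη).continuousOn
  have h4 := Complex.continuous_ofReal.comp_continuousOn (continuousOn_rotDens hL h)
  exact (((continuousOn_const.mul h4).mul h1).mul h2).add (h1.mul h3)

theorem hasDerivAt_flatVar (hL : 0 < L) (h : IsRegularData L μ ρ)
    (hη : ContDiffOn ℝ ∞ η (Icc 0 L)) {q : ℝ} (hq : q ∈ Ioo 0 L) :
    HasDerivAt (flatVar L μ η) (dflatVar L μ η q) q := by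
  have h1 := hasDerivWithinAt_symPart (S := univ) (hasDerivAt_of_contDiffOn h.smooth_mu hq).hasDerivWithinAt
    (hasDerivAt_of_contDiffOn hη hq).hasDerivWithinAt (h.norm_mu_lt q (Ioo_subset_Icc_self hq))
  exact (hasDerivAt_phase_theta hL h hq).mul (hasDerivWithinAt_univ.1 h1)

theorem primitive_of_continuousOn (hL : 0 < L) {f : ℝ → ℝ} (hf : ContinuousOn f (Icc 0 L)) :
    ContinuousOn (fun q => ∫ z in (0 : ℝ)..q, f z) (Icc 0 L) ∧
    ∀ q ∈ Ioo 0 L, HasDerivAt (fun q => ∫ z in (0 : ℝ)..q, f z) (f q) q := by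
  refine ⟨?_, fun q hq => ?_⟩
  · have hi : IntegrableOn f (uIcc 0 L) := by
      rw [uIcc_of_le hL.le]; exact hf.integrableOn_Icc
    have := intervalIntegral.continuousOn_primitive_interval hi
    rwa [uIcc_of_le hL.le] at this
  · have hn : Icc 0 L ∈ 𝓝 q := Icc_mem_nhds hq.1 hq.2
    refine intervalIntegral.integral_hasDerivAt_right ?_
      (hf.stronglyMeasurableAtFilter_nhdsWithin measurableSet_Icc q |>.filter_mono
        (by rw [nhdsWithin_eq_nhds.2 hn])) (hf.continuousAt hn)
    rw [intervalIntegrable_iff_integrableOn_Icc_of_le hq.1.le]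
    exact (hf.mono (Icc_subset_Icc_right hq.2.le)).integrableOn_Icc

theorem continuousOn_drot_var (hL : 0 < L) (h : IsRegularData L μ ρ)
    (hη : ContDiffOn ℝ ∞ η (Icc 0 L)) :
    ContinuousOn (fun z => drotPart (μ z) (dBranch L μ z) (η z) (dBranch L η z)) (Icc 0 L) :=
  continuousOn_drotPart h (contDiffOn_dBranch hL h.smooth_mu).continuousOn hη.continuousOn
    (contDiffOn_dBranch hL hη).continuousOn

theorem continuousOn_angVar (hL : 0 < L) (h : IsRegularData L μ ρ)
    (hη : ContDiffOn ℝ ∞ η (Icc 0 L)) : ContinuousOn (angVar L μ η) (Icc 0 L) :=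
  (contDiffOn_rotPart h hη).continuousOn.sub
    (primitive_of_continuousOn hL (continuousOn_drot_var hL h hη)).1

theorem angVar_zero : angVar L μ η 0 = rotPart (μ 0) (η 0) := by simp [angVar]

/-- By flatness the derivative of `angVar` contains no derivative of the variation. -/
theorem hasDerivAt_angVar (hL : 0 < L) (h : IsRegularData L μ ρ)
    (hη : ContDiffOn ℝ ∞ η (Icc 0 L)) {q : ℝ} (hq : q ∈ Ioo 0 L) :
    HasDerivAt (angVar L μ η) (2 * (conj (frameM L μ q) * flatVar L μ η q).im) q := by
  have hz := h.norm_mu_lt q (Ioo_subset_Icc_self hq)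
  have h1 := hasDerivWithinAt_univ.1 (hasDerivWithinAt_rotPart (S := univ)
    (hasDerivAt_of_contDiffOn h.smooth_mu hq).hasDerivWithinAt
    (hasDerivAt_of_contDiffOn hη hq).hasDerivWithinAt hz)
  have h2 := (primitive_of_continuousOn hL (continuousOn_drot_var hL h hη)).2 q hq
  refine (h1.sub h2).congr_deriv ?_
  rw [drotPart_comm _ (dBranch L μ q) _ _ hz, frameM, flatVar, map_mul]
  have := phase_mul_conj (theta L μ q)
  rw [show conj (phase (theta L μ q)) * conj (symPart (μ q) (dBranch L μ q))
      * (phase (theta L μ q) * symPart (μ q) (η q))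
      = (phase (theta L μ q) * conj (phase (theta L μ q)))
        * (conj (symPart (μ q) (dBranch L μ q)) * symPart (μ q) (η q)) by ring, this, one_mul]
  ring

theorem hasDerivAt_pert (x t : ℝ) : HasDerivAt (fun t => pert μ η t x) (η x) t := by
  have := (((hasDerivAt_id t).ofReal_comp).mul_const (η x)).const_add (μ x)
  simpa [pert] using this

theorem pert_zero : pert μ η 0 = μ := by ext x; simp [pert]

theorem dBranch_pert (hL : 0 < L) (h : IsRegularData L μ ρ) (hη : ContDiffOn ℝ ∞ η (Icc 0 L))
    (t : ℝ) {q : ℝ} (hq : q ∈ Icc 0 L) :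
    dBranch L (pert μ η t) q = pert (dBranch L μ) (dBranch L η) t q := by
  have h1 := (hη.differentiableOn (by simp) q hq).hasDerivWithinAt
  exact ((h.hasDerivWithinAt_mu hq).add (h1.const_mul (t : ℂ))).derivWithin
    (uniqueDiffOn_Icc hL q hq)

theorem contDiffOn_pert (h : IsRegularData L μ ρ) (hη : ContDiffOn ℝ ∞ η (Icc 0 L)) (t : ℝ) :
    ContDiffOn ℝ ∞ (pert μ η t) (Icc 0 L) := h.smooth_mu.add (contDiffOn_const.mul hη)

/-- Small variations of regular data are regular, with uniform Lipschitz bounds. -/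
theorem exists_pert_bounds (hL : 0 < L) (h : IsRegularData L μ ρ)
    (hη : ContDiffOn ℝ ∞ η (Icc 0 L)) : ∃ δ C, 0 < δ ∧ 0 ≤ C ∧ ∀ t, |t| < δ →
      IsRegularData L (pert μ η t) ρ ∧ ∀ q ∈ Icc 0 L,
        ‖symPart (pert μ η t q) (dBranch L (pert μ η t) q) - symPart (μ q) (dBranch L μ q)‖
          ≤ C * |t| ∧
        |rotDens L (pert μ η t) q - rotDens L μ q| ≤ C * |t| := by
  have hne : (Icc 0 L).Nonempty := nonempty_Icc.2 hL.le
  obtain ⟨q₀, hq₀, hmax⟩ := isCompact_Icc.exists_isMaxOn hne h.smooth_mu.continuousOn.norm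
  obtain ⟨N₁, hN₁⟩ := isCompact_Icc.exists_bound_of_continuousOn hη.continuousOn
  obtain ⟨N₂, hN₂⟩ := isCompact_Icc.exists_bound_of_continuousOn
    (contDiffOn_dBranch hL hη).continuousOn
  obtain ⟨N₃, hN₃⟩ := isCompact_Icc.exists_bound_of_continuousOn
    (contDiffOn_dBranch hL h.smooth_mu).continuousOn
  set N := max N₁ (max N₂ N₃) with hN
  have hη1 : ∀ q ∈ Icc 0 L, ‖η q‖ ≤ N := fun q hq => (hN₁ q hq).trans (by simp [hN])
  have hη2 : ∀ q ∈ Icc 0 L, ‖dBranch L η q‖ ≤ N := fun q hq => (hN₂ q hq).trans (by simp [hN])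
  have hμ2 : ∀ q ∈ Icc 0 L, ‖dBranch L μ q‖ ≤ N := fun q hq => (hN₃ q hq).trans (by simp [hN])
  have N0 : 0 ≤ N := (norm_nonneg _).trans (hη1 q₀ hq₀)
  set M := ‖μ q₀‖ with hM
  have M1 : M < 1 := h.norm_mu_lt q₀ hq₀
  have M0 : 0 ≤ M := norm_nonneg _
  -- a bound for the varied coefficient, halfway between the maximum of `‖μ‖` and `1`
  set κ := (1 + M) / 2 with hκ
  have κ0 : 0 ≤ κ := by rw [hκ]; linarith
  have κ1 : κ < 1 := by rw [hκ]; linarith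
  set W := (1 - κ ^ 2)⁻¹ with hW
  have hκ2 : 0 < 1 - κ ^ 2 := by nlinarith
  have W0 : 0 ≤ W := by rw [hW]; positivity
  set δ := min 1 ((1 - M) / (2 * (N + 1))) with hδ
  have δ0 : 0 < δ := lt_min one_pos (div_pos (by linarith) (by linarith))
  have hnorm : ∀ t, |t| < δ → ∀ q ∈ Icc 0 L, ‖pert μ η t q‖ ≤ κ := by
    intro t ht q hq
    have t2 : |t| * (2 * (N + 1)) < 1 - M :=
      (lt_div_iff₀ (by linarith)).1 (ht.trans_le (min_le_right _ _))
    have e1 : ‖(t : ℂ) * η q‖ ≤ |t| * N := by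
      rw [norm_mul, Complex.norm_real]
      exact mul_le_mul_of_nonneg_left (hη1 q hq) (abs_nonneg _)
    have e2 : ‖μ q‖ ≤ M := hmax hq
    have := (norm_add_le (μ q) ((t : ℂ) * η q)).trans (add_le_add e2 e1)
    refine this.trans ?_
    have := abs_nonneg t
    rw [hκ]; nlinarith
  have hw : ∀ t, |t| < δ → ∀ q ∈ Icc 0 L, (1 - ‖pert μ η t q‖ ^ 2)⁻¹ ≤ W ∧
      0 ≤ (1 - ‖pert μ η t q‖ ^ 2)⁻¹ := by
    intro t ht q hq
    have h1 := hnorm t ht q hq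
    have h2 : 1 - κ ^ 2 ≤ 1 - ‖pert μ η t q‖ ^ 2 := by
      have := norm_nonneg (pert μ η t q)
      nlinarith
    exact ⟨inv_anti₀ hκ2 h2, by have := hκ2.trans_le h2; positivity⟩
  have hv : ∀ t, |t| < δ → ∀ q ∈ Icc 0 L, ‖pert (dBranch L μ) (dBranch L η) t q‖ ≤ 2 * N := by
    intro t ht q hq
    have t1 : |t| ≤ 1 := (ht.trans_le (min_le_left _ _)).le
    refine (norm_add_le _ _).trans ?_
    rw [norm_mul, Complex.norm_real]
    have : ‖t‖ * ‖dBranch L η q‖ ≤ 1 * N := mul_le_mul t1 (hη2 q hq) (norm_nonneg _) zero_le_one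
    linarith [hμ2 q hq]
  refine ⟨δ, W * (N * (2 * N) + N) + W ^ 2 * (2 * N) * (2 * N) + W * N, δ0, by positivity,
    fun t ht => ⟨⟨contDiffOn_pert h hη t, fun q hq => (hnorm t ht q hq).trans_lt κ1,
      h.smooth_rho, h.rho_axis, h.rho_increasing⟩, fun q hq => ?_⟩⟩
  have hseg : ∀ s ∈ uIcc 0 t, |s| < δ := fun s hs => by
    refine lt_of_le_of_lt ?_ ht
    rcases le_total 0 t with h0 | h0
    · rw [uIcc_of_le h0] at hs; rw [abs_of_nonneg hs.1, abs_of_nonneg h0]; exact hs.2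
    · rw [uIcc_of_ge h0] at hs; rw [abs_of_nonpos hs.2, abs_of_nonpos h0]; linarith [hs.1]
  have aux : ∀ s ∈ uIcc 0 t, |(conj (pert μ η s q) * η q).re| ≤ N := fun s hs => by
    refine (Complex.abs_re_le_norm _).trans ?_
    rw [norm_mul, RCLike.norm_conj]
    calc _ ≤ 1 * N := mul_le_mul ((hnorm s (hseg s hs) q hq).trans κ1.le) (hη1 q hq)
          (norm_nonneg _) zero_le_one
      _ = N := one_mul N
  have e : ∀ t, dBranch L (pert μ η t) q = pert (dBranch L μ) (dBranch L η) t q := fun t =>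
    dBranch_pert hL h hη t hq
  have hb1 : ∀ s ∈ uIcc 0 t, (1 - ‖pert μ η s q‖ ^ 2)⁻¹ ^ 2
      * |2 * (conj (pert μ η s q) * η q).re| ≤ W ^ 2 * (2 * N) := fun s hs => by
    obtain ⟨w1, w0⟩ := hw s (hseg s hs) q hq
    rw [abs_mul, abs_two]
    have := aux s hs
    gcongr
  constructor
  · have hd : ∀ s ∈ uIcc 0 t, HasDerivWithinAt
        (fun s => symPart (pert μ η s q) (pert (dBranch L μ) (dBranch L η) s q))
        (dsymPart (pert μ η s q) (pert (dBranch L μ) (dBranch L η) s q) (η q) (dBranch L η q))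
        (uIcc 0 t) s := fun s hs => hasDerivWithinAt_symPart (hasDerivAt_pert q s).hasDerivWithinAt
          (hasDerivAt_pert q s).hasDerivWithinAt ((hnorm s (hseg s hs) q hq).trans_lt κ1)
    have := (convex_uIcc 0 t).norm_image_sub_le_of_norm_hasDerivWithin_le hd
      (C := W * N + W ^ 2 * (2 * N) * (2 * N)) (fun s hs => ?_) left_mem_uIcc right_mem_uIcc
    · rw [e, show dBranch L μ q = pert (dBranch L μ) (dBranch L η) 0 q by rw [pert_zero],
        show symPart (μ q) (pert (dBranch L μ) (dBranch L η) 0 q)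
          = symPart (pert μ η 0 q) (pert (dBranch L μ) (dBranch L η) 0 q) by rw [pert_zero (μ := μ)]]
      refine this.trans ?_
      rw [sub_zero, Real.norm_eq_abs]
      refine mul_le_mul_of_nonneg_right ?_ (abs_nonneg _)
      have : 0 ≤ W * (N * (2 * N) + N) := by positivity
      linarith
    · obtain ⟨w1, w0⟩ := hw s (hseg s hs) q hq
      refine (norm_add_le _ _).trans (add_le_add ?_ ?_)
      · rw [norm_smul, Real.norm_of_nonneg w0]
        exact mul_le_mul w1 (hη2 q hq) (norm_nonneg _) W0
      · rw [norm_smul, norm_mul, Real.norm_of_nonneg (by positivity)]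
        exact mul_le_mul (hb1 s hs) (hv s (hseg s hs) q hq) (norm_nonneg _) (by positivity)
  · have hd : ∀ s ∈ uIcc 0 t, HasDerivWithinAt
        (fun s => rotPart (pert μ η s q) (pert (dBranch L μ) (dBranch L η) s q))
        (drotPart (pert μ η s q) (pert (dBranch L μ) (dBranch L η) s q) (η q) (dBranch L η q))
        (uIcc 0 t) s := fun s hs => hasDerivWithinAt_rotPart (hasDerivAt_pert q s).hasDerivWithinAt
          (hasDerivAt_pert q s).hasDerivWithinAt ((hnorm s (hseg s hs) q hq).trans_lt κ1)
    have := (convex_uIcc 0 t).norm_image_sub_le_of_norm_hasDerivWithin_le hd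
      (C := W * (N * (2 * N) + N) + W ^ 2 * (2 * N) * (2 * N)) (fun s hs => ?_)
      left_mem_uIcc right_mem_uIcc
    · rw [rotDens, rotDens, e, show dBranch L μ q = pert (dBranch L μ) (dBranch L η) 0 q by rw [pert_zero],
        show rotPart (μ q) (pert (dBranch L μ) (dBranch L η) 0 q)
          = rotPart (pert μ η 0 q) (pert (dBranch L μ) (dBranch L η) 0 q) by rw [pert_zero (μ := μ)]]
      refine this.trans ?_
      rw [sub_zero, Real.norm_eq_abs]
      refine mul_le_mul_of_nonneg_right ?_ (abs_nonneg _)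
      have : 0 ≤ W * N := by positivity
      linarith
    · obtain ⟨w1, w0⟩ := hw s (hseg s hs) q hq
      have n1 := hnorm s (hseg s hs) q hq
      have n2 := hv s (hseg s hs) q hq
      refine (abs_add_le _ _).trans (add_le_add ?_ ?_)
      · rw [abs_mul, abs_of_nonneg w0]
        refine mul_le_mul w1 ((Complex.abs_im_le_norm _).trans ((norm_add_le _ _).trans
          (add_le_add ?_ ?_))) (abs_nonneg _) W0
        · rw [norm_mul, RCLike.norm_conj]
          exact mul_le_mul (hη1 q hq) n2 (norm_nonneg _) N0
        · rw [norm_mul, RCLike.norm_conj]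
          calc _ ≤ 1 * N := mul_le_mul (n1.trans κ1.le) (hη2 q hq) (norm_nonneg _) zero_le_one
            _ = N := one_mul N
      · rw [abs_mul, abs_mul, abs_of_nonneg (by positivity : 0 ≤ (1 - ‖pert μ η s q‖ ^ 2)⁻¹ ^ 2)]
        refine mul_le_mul (hb1 s hs) ((Complex.abs_im_le_norm _).trans ?_) (abs_nonneg _)
          (by positivity)
        rw [norm_mul, RCLike.norm_conj]
        calc _ ≤ 1 * (2 * N) := mul_le_mul (n1.trans κ1.le) n2 (norm_nonneg _) zero_le_one
          _ = 2 * N := one_mul _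

end Data

section Data
variable {L : ℝ} {μ η : ℝ → ℂ} {ρ : ℝ → ℝ}

theorem norm_phase_sub_le (a b : ℝ) : ‖phase a - phase b‖ ≤ 2 * |a - b| := by
  have := convex_univ.norm_image_sub_le_of_norm_hasDerivWithin_le (𝕜 := ℝ) (f := phase) (C := 2)
    (fun θ _ => (hasDerivAt_phase θ).hasDerivWithinAt) (fun θ _ => by simp [norm_phase])
    (mem_univ b) (mem_univ a)
  simpa [Real.norm_eq_abs] using this

theorem theta_eq_setIntegral (ν : ℝ → ℂ) {q : ℝ} (hq : 0 ≤ q) :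
    theta L ν q = ∫ z in Ioo 0 q, rotDens L ν z := by
  rw [theta, intervalIntegral.integral_of_le hq, integral_Ioc_eq_integral_Ioo]

theorem abs_theta_pert_sub_le (hL : 0 < L) {ν : ℝ → ℂ} (h : IsRegularData L μ ρ)
    (h' : IsRegularData L ν ρ) {c : ℝ} (hc : ∀ q ∈ Icc 0 L, |rotDens L ν q - rotDens L μ q| ≤ c)
    {q : ℝ} (hq : q ∈ Icc 0 L) : |theta L ν q - theta L μ q| ≤ c * L := by
  have hi : ∀ {ν : ℝ → ℂ}, IsRegularData L ν ρ → IntervalIntegrable (rotDens L ν) volume 0 q :=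
    fun h => (((continuousOn_rotDens hL h).mono (Icc_subset_Icc_right hq.2)).intervalIntegrable_of_Icc
      hq.1)
  rw [theta, theta, ← intervalIntegral.integral_sub (hi h') (hi h)]
  have := intervalIntegral.norm_integral_le_of_norm_le_const (a := 0) (b := q) (C := c)
    (f := fun z => rotDens L ν z - rotDens L μ z) fun z hz => by
      rw [uIoc_of_le hq.1] at hz
      exact hc z ⟨hz.1.le, hz.2.trans hq.2⟩
  rw [Real.norm_eq_abs, sub_zero, abs_of_nonneg hq.1] at this
  have c0 : 0 ≤ c := (abs_nonneg _).trans (hc q hq)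
  exact this.trans (mul_le_mul_of_nonneg_left hq.2 c0)

/-- Small variations of regular data are regular, and change the frame in a Lipschitz way. -/
theorem exists_frameM_pert_le (hL : 0 < L) (h : IsRegularData L μ ρ)
    (hη : ContDiffOn ℝ ∞ η (Icc 0 L)) : ∃ δ C, 0 < δ ∧ 0 ≤ C ∧ ∀ t, |t| < δ →
      IsRegularData L (pert μ η t) ρ ∧
      ∀ q ∈ Icc 0 L, ‖frameM L (pert μ η t) q - frameM L μ q‖ ≤ C * |t| := by
  obtain ⟨δ, C, δ0, C0, hb⟩ := exists_pert_bounds hL h hη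
  obtain ⟨N, hN⟩ := isCompact_Icc.exists_bound_of_continuousOn
    (contDiffOn_symPart h (contDiffOn_dBranch hL h.smooth_mu)).continuousOn
  have N0 : 0 ≤ N := (norm_nonneg _).trans (hN 0 ⟨le_rfl, hL.le⟩)
  refine ⟨δ, C + 2 * (C * L) * N, δ0, by positivity, fun t ht => ⟨(hb t ht).1, fun q hq => ?_⟩⟩
  obtain ⟨h1, h2⟩ := hb t ht
  have e1 := abs_theta_pert_sub_le hL h h1 (fun q hq => (h2 q hq).2) hq
  have e2 := (norm_phase_sub_le (theta L (pert μ η t) q) (theta L μ q)).trans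
    (mul_le_mul_of_nonneg_left e1 zero_le_two)
  rw [frameM, frameM, show ∀ a b c d : ℂ, a * b - c * d = a * (b - d) + (a - c) * d by
    intros; ring]
  refine (norm_add_le _ _).trans ?_
  rw [norm_mul, norm_mul, norm_phase, one_mul]
  have := mul_le_mul e2 (hN q hq) (norm_nonneg _) (by positivity)
  have := (h2 q hq).1
  nlinarith

theorem hasDerivAt_dBranch_pert (hL : 0 < L) (h : IsRegularData L μ ρ)
    (hη : ContDiffOn ℝ ∞ η (Icc 0 L)) {q : ℝ} (hq : q ∈ Icc 0 L) (t : ℝ) :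
    HasDerivAt (fun t => dBranch L (pert μ η t) q) (dBranch L η q) t := by
  have : (fun t => dBranch L (pert μ η t) q) = fun t => pert (dBranch L μ) (dBranch L η) t q :=
    funext fun t => dBranch_pert hL h hη t hq
  rw [this]
  exact hasDerivAt_pert q t

theorem hasDerivAt_rotDens_pert (hL : 0 < L) (h : IsRegularData L μ ρ)
    (hη : ContDiffOn ℝ ∞ η (Icc 0 L)) {q : ℝ} (hq : q ∈ Icc 0 L) :
    HasDerivAt (fun t => rotDens L (pert μ η t) q)
      (drotPart (μ q) (dBranch L μ q) (η q) (dBranch L η q)) 0 := by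
  have := hasDerivWithinAt_univ.1 (hasDerivWithinAt_rotPart (S := univ)
    (hasDerivAt_pert (μ := μ) (η := η) q 0).hasDerivWithinAt
    (hasDerivAt_dBranch_pert hL h hη hq 0).hasDerivWithinAt
    (by rw [pert_zero]; exact h.norm_mu_lt q hq))
  rw [pert_zero] at this
  exact this

theorem hasDerivAt_theta_pert (hL : 0 < L) (h : IsRegularData L μ ρ)
    (hη : ContDiffOn ℝ ∞ η (Icc 0 L)) {q : ℝ} (hq : q ∈ Icc 0 L) :
    HasDerivAt (fun t => theta L (pert μ η t) q) (rotPart (μ q) (η q) - angVar L μ η q) 0 := by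
  obtain ⟨δ, C, δ0, C0, hb⟩ := exists_pert_bounds hL h hη
  have sub : Ioo 0 q ⊆ Icc 0 L := fun z hz => ⟨hz.1.le, hz.2.le.trans hq.2⟩
  have hm : ∀ {f : ℝ → ℝ}, ContinuousOn f (Icc 0 L) →
      AEStronglyMeasurable f (volume.restrict (Ioo 0 q)) :=
    fun hf => (hf.mono sub).aestronglyMeasurable measurableSet_Ioo
  have hres : ∀ᵐ z ∂volume.restrict (Ioo 0 q), z ∈ Icc 0 L :=
    (ae_restrict_mem measurableSet_Ioo).mono fun z hz => sub hz
  have key := hasDerivAt_integral_of_lipschitz_at (ν := volume.restrict (Ioo 0 q))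
    (F := fun t z => rotDens L (pert μ η t) z) (g := fun _ => C)
    (F' := fun z => drotPart (μ z) (dBranch L μ z) (η z) (dBranch L η z)) δ0
    (fun t ht => hm (continuousOn_rotDens hL (hb t ht).1))
    (by rw [pert_zero]
        exact (continuousOn_rotDens hL h).integrableOn_Icc.mono_set sub)
    (hm (continuousOn_drot_var hL h hη)) (integrableOn_const_Ioo C)
    (by filter_upwards [hres] with z hz t ht
        have := ((hb t ht).2 z hz).2
        rw [pert_zero]
        exact this)
    (by filter_upwards [hres] with z hz
        exact hasDerivAt_rotDens_pert hL h hη hz)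
  have e : (fun t => theta L (pert μ η t) q)
      = fun t => ∫ z in Ioo 0 q, rotDens L (pert μ η t) z :=
    funext fun t => theta_eq_setIntegral _ hq.1
  rw [e]
  refine key.congr_deriv ?_
  rw [angVar, sub_sub_cancel, intervalIntegral.integral_of_le hq.1, integral_Ioc_eq_integral_Ioo]

/-- The variation of the frame; flatness turns it into a derivative along the branch, up to a
rotation. -/
theorem hasDerivAt_frameM_pert (hL : 0 < L) (h : IsRegularData L μ ρ)
    (hη : ContDiffOn ℝ ∞ η (Icc 0 L)) {q : ℝ} (hq : q ∈ Icc 0 L) :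
    HasDerivAt (fun t => frameM L (pert μ η t) q)
      (dflatVar L μ η q - 2 * Complex.I * (angVar L μ η q : ℂ) * frameM L μ q) 0 := by
  have h1 := hasDerivWithinAt_univ.1 (hasDerivWithinAt_symPart (S := univ)
    (hasDerivAt_pert (μ := μ) (η := η) q 0).hasDerivWithinAt
    (hasDerivAt_dBranch_pert hL h hη hq 0).hasDerivWithinAt
    (by rw [pert_zero]; exact h.norm_mu_lt q hq))
  have h2 := (hasDerivAt_phase (theta L (pert μ η 0) q)).scomp 0 (hasDerivAt_theta_pert hL h hη hq)
  refine (h2.mul h1).congr_deriv ?_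
  simp only [pert_zero, Function.comp]
  rw [dsymPart_comm, dflatVar, frameM, rotDens, Complex.real_smul]
  push_cast
  ring

/-- The variation of the zweibein on the axis, where the angle `theta` vanishes. -/
theorem hasDerivAt_zweibein_pert (hL : 0 < L) (h : IsRegularData L μ ρ) :
    HasDerivAt (fun t : ℝ => zweibein (pert μ η t 0))
      (zweibein (μ 0) * (symL (symPart (μ 0) (η 0)) + rotPart (μ 0) (η 0) • rotJ)) 0 := by
  have := hasDerivWithinAt_univ.1 (hasDerivWithinAt_zweibein (S := univ)
    (hasDerivAt_pert (μ := μ) (η := η) 0 0).hasDerivWithinAt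
    (by rw [pert_zero]; exact h.norm_mu_lt 0 ⟨le_rfl, hL.le⟩))
  rw [pert_zero] at this
  exact this

end Data

/-! ### Variation of the deformed metric -/

theorem IsConn.continuousOn_mul {A T : ℝ → M2} {a b : ℝ} (h : IsConn A a b)
    (hT : ContinuousOn T (Icc a b)) : IsConn (fun z => T z * A z) a b := by
  refine ⟨h.le, (hT.mono Ioo_subset_Icc_self).mul h.cont, ?_⟩
  obtain ⟨C, hC⟩ := isCompact_Icc.exists_bound_of_continuousOn hT
  refine Integrable.mono' (h.int.norm.const_mul C)
    (((hT.mono Ioo_subset_Icc_self).mul h.cont).aestronglyMeasurable measurableSet_Ioo) ?_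
  filter_upwards [ae_restrict_mem measurableSet_Ioo] with z hz
  exact (norm_mul_le _ _).trans
    (mul_le_mul_of_nonneg_right (hC z (Ioo_subset_Icc_self hz)) (norm_nonneg _))

/-- Conjugation of a functional of the metric by a constant frame `V`. -/
def conjFrame (V : M2) (l : M2 →L[ℝ] ℝ) : M2 →L[ℝ] ℝ :=
  l.comp (ContinuousLinearMap.mulLeftRight ℝ M2 V Vᵀ)

theorem conjFrame_apply (V : M2) (l : M2 →L[ℝ] ℝ) (X : M2) : conjFrame V l X = l (V * X * Vᵀ) :=
  rfl

section Data
variable {L : ℝ} {μ η : ℝ → ℂ} {ρ : ℝ → ℝ}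

/-- The variation of the frame. -/
def dframeM (L : ℝ) (μ η : ℝ → ℂ) (q : ℝ) : ℂ :=
  dflatVar L μ η q - 2 * Complex.I * (angVar L μ η q : ℂ) * frameM L μ q

theorem continuousOn_dframeM (hL : 0 < L) (h : IsRegularData L μ ρ)
    (hη : ContDiffOn ℝ ∞ η (Icc 0 L)) : ContinuousOn (dframeM L μ η) (Icc 0 L) :=
  (continuousOn_dflatVar hL h hη).sub ((continuousOn_const.mul
    (Complex.continuous_ofReal.comp_continuousOn (continuousOn_angVar hL h hη))).mul
    (continuousOn_frameM hL h))

theorem norm_frameConn_sub_le (μ ν : ℝ → ℂ) (r q : ℝ) :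
    ‖frameConn L ν ρ r q - frameConn L μ ρ r q‖
      ≤ ‖symL‖ * (warp ρ r q * ‖frameM L ν q - frameM L μ q‖) := by
  rw [frameConn, frameConn, ← map_sub, ← smul_sub]
  refine (symL.le_opNorm _).trans_eq ?_
  rw [norm_smul, Real.norm_of_nonneg (warp_nonneg _ _)]

/-- The variation of the transport along the whole branch up to `r`, by Duhamel's formula. -/
theorem hasDerivAt_pathOrdExp_pert (hL : 0 < L) (h : IsRegularData L μ ρ)
    (hη : ContDiffOn ℝ ∞ η (Icc 0 L)) {r : ℝ} (hr : r ∈ Ioo 0 L) :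
    HasDerivAt (fun t => pathOrdExp (frameConn L (pert μ η t) ρ r) 0 r)
      (pathOrdExp (frameConn L μ ρ r) 0 r * ∫ q in Ioo 0 r,
        (pathOrdExp (frameConn L μ ρ r) q r).adjugate * symL (warp ρ r q • dframeM L μ η q)
          * pathOrdExp (frameConn L μ ρ r) q r) 0 := by
  obtain ⟨δ, C, δ0, C0, hb⟩ := exists_frameM_pert_le hL h hη
  have hr' := Ioo_subset_Ioc_self hr
  have hrc := Ioo_subset_Icc_self hr
  have sub : Ioo 0 r ⊆ Icc 0 L := Ioo_subset_Icc_self.trans (Icc_subset_Icc_right hr.2.le)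
  have hmem : ∀ t : ℝ, t ∈ Metric.ball (0 : ℝ) δ → |t| < δ := fun t ht => by simpa using ht
  have key := hasDerivAt_transport (t₀ := 0) (A := fun t => frameConn L (pert μ η t) ρ r)
    (R := fun t q => pathOrdExp (frameConn L (pert μ η t) ρ r) q r) (a := 0) (b := r)
    (s := Metric.ball 0 δ) (g := fun q => ‖symL‖ * C * warp ρ r q)
    (A' := fun q => symL (warp ρ r q • dframeM L μ η q)) (z := 0) (Metric.ball_mem_nhds 0 δ0)
    (fun t ht => isConn_frameConn hL (hb t (hmem t ht)).1 hr')
    (fun t ht => isTransport_frameConn hL (hb t (hmem t ht)).1 hr')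
    (fun t q => trace_frameConn r q) ((integrableOn_warp hL h hr').const_mul _)
    (fun t ht q hq => by
      rw [pert_zero, sub_zero]
      refine (norm_frameConn_sub_le _ _ _ _).trans ?_
      have := mul_le_mul_of_nonneg_left ((hb t (hmem t ht)).2 q (sub hq))
        (mul_nonneg (norm_nonneg symL) (warp_nonneg (ρ := ρ) r q))
      linarith)
    (fun q hq => symL.hasFDerivAt.comp_hasDerivAt 0
      ((hasDerivAt_frameM_pert hL h hη (sub hq)).fun_const_smul (warp ρ r q)))
    (symL.continuous.comp_continuousOn ((continuousOn_warp h hrc).smul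
      ((continuousOn_dframeM hL h hη).mono sub))) ⟨le_rfl, hr.1.le⟩
  simpa only [pert_zero] using key

theorem hasDerivAt_mul_transpose {W : ℝ → M2} {W' : M2} {t : ℝ} (h : HasDerivAt W W' t) :
    HasDerivAt (fun t => W t * (W t)ᵀ) (W' * (W t)ᵀ + (W' * (W t)ᵀ)ᵀ) t := by
  have h2 : HasDerivAt (fun t => (W t)ᵀ) W'ᵀ t := transL.hasFDerivAt.comp_hasDerivAt t h
  refine (h.mul h2).congr_deriv ?_
  rw [Matrix.transpose_mul, Matrix.transpose_transpose]

/-- The variation of the deformed metric: a contribution of the zweibein on the axis, and an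
integral over the field points. -/
theorem hasDerivAt_deformedMetric_pert (hL : 0 < L) (h : IsRegularData L μ ρ)
    (hη : ContDiffOn ℝ ∞ η (Icc 0 L)) (l : M2 →L[ℝ] ℝ) {r : ℝ} (hr : r ∈ Ioo 0 L) :
    HasDerivAt (fun t => l (deformedMetric L (pert μ η t) ρ r))
      ((conj (kerK (prof L μ ρ) (conjFrame (zweibein (μ 0)) l) 0 (ρ r)) * symPart (μ 0) (η 0)).re
        + rotPart (μ 0) (η 0) * kerZ (prof L μ ρ) (conjFrame (zweibein (μ 0)) l) 0 (ρ r)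
        + ∫ q in Ioo 0 r, warp ρ r q *
          (conj (kerK (prof L μ ρ) (conjFrame (zweibein (μ 0)) l) (ρ q) (ρ r))
            * dframeM L μ η q).re) 0 := by
  obtain ⟨δ, C, δ0, C0, hb⟩ := exists_frameM_pert_le hL h hη
  obtain ⟨m', hm⟩ := exists_isProfile hL h
  have hr' := Ioo_subset_Ioc_self hr
  have hy : ρ r ∈ Ioo 0 (ρ L) := h.rho_mem ⟨hL.le, le_rfl⟩ hr
  set m := prof L μ ρ
  set V := zweibein (μ 0)
  -- the variation of the zweibein on the axis, as a matrix acting from the right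
  set X : M2 := symL (symPart (μ 0) (η 0)) + rotPart (μ 0) (η 0) • rotJ with hX
  set R : ℝ → M2 := fun q => pathOrdExp (frameConn L μ ρ r) q r with hR
  set G : ℝ → M2 := fun q => (R q).adjugate * symL (warp ρ r q • dframeM L μ η q) * R q with hG
  have d1 : HasDerivAt (fun t => zweibein (pert μ η t 0)) (V * X) 0 :=
    hasDerivAt_zweibein_pert hL h
  have d2 : HasDerivAt (fun t => pathOrdExp (frameConn L (pert μ η t) ρ r) 0 r)
      (R 0 * ∫ q in Ioo 0 r, G q) 0 := hasDerivAt_pathOrdExp_pert hL h hη hr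
  have hT := isTransport_frameConn hL h hr'
  have hGi : IntegrableOn G (Ioo 0 r) := by
    have e : (fun q => symL (warp ρ r q • dframeM L μ η q))
        = fun q => warp ρ r q • symL (dframeM L μ η q) := by ext1 q; rw [map_smul]
    have c : IsConn (fun q => symL (warp ρ r q • dframeM L μ η q)) 0 r := by
      rw [e]
      exact isConn_warp_smul hL h hr'
        (symL.continuous.comp_continuousOn (continuousOn_dframeM hL h hη))
    exact ((c.continuousOn_mul hT.continuousOn_adjugate).mul_continuousOn hT.cont).int
  have d3 := hasDerivAt_mul_transpose (d1.mul d2)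
  have d4 := l.hasFDerivAt.comp_hasDerivAt 0 d3
  have ev : (fun t => l (deformedMetric L (pert μ η t) ρ r)) =ᶠ[𝓝 0]
      fun t => l (zweibein (pert μ η t 0) * pathOrdExp (frameConn L (pert μ η t) ρ r) 0 r
        * (zweibein (pert μ η t 0) * pathOrdExp (frameConn L (pert μ η t) ρ r) 0 r)ᵀ) := by
    filter_upwards [Metric.ball_mem_nhds 0 δ0] with t ht
    rw [deformedMetric_eq hL (hb t (by simpa using ht)).1 hr, Matrix.transpose_mul]
    simp only [Matrix.mul_assoc]
  refine (d4.congr_of_eventuallyEq ev).congr_deriv ?_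
  have hR0 : R 0 = prop m 0 (ρ r) := by
    have := pathOrdExp_frameConn hL h hr (left_mem_Icc.2 hr.1.le)
    rw [h.rho_axis] at this
    exact this
  simp only [pert_zero]
  -- the linear functional through which the integrand enters
  set Λ : M2 →L[ℝ] ℝ := (conjFrame V l).comp (((1 : M2 →L[ℝ] M2) + transL).comp
    (ContinuousLinearMap.mulLeftRight ℝ M2 (R 0) (R 0)ᵀ)) with hΛ
  have hΛa : ∀ Z, Λ Z = l (V * (R 0 * Z * (R 0)ᵀ + (R 0 * Z * (R 0)ᵀ)ᵀ) * Vᵀ) := fun Z => rfl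
  have hint : ∫ q in Ioo 0 r, warp ρ r q * (conj (kerK m (conjFrame V l) (ρ q) (ρ r))
      * dframeM L μ η q).re = Λ (∫ q in Ioo 0 r, G q) := by
    rw [← Λ.integral_comp_comm hGi]
    refine setIntegral_congr_fun measurableSet_Ioo fun q hq => ?_
    have hRq : R q = prop m (ρ q) (ρ r) := pathOrdExp_frameConn hL h hr (Ioo_subset_Icc_self hq)
    have e : Λ (G q) = conjFrame V l (kap m (symL (warp ρ r q • dframeM L μ η q)) (ρ q) (ρ r)) := by
      rw [hΛa, conjFrame_apply, hG, kap, ← hRq, ← hR0]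
      simp only [Matrix.mul_assoc]
      rfl
    rw [e, l_kap_symL, mul_smul_comm, Complex.smul_re, smul_eq_mul]
  have haxis : (conj (kerK m (conjFrame V l) 0 (ρ r)) * symPart (μ 0) (η 0)).re
      + rotPart (μ 0) (η 0) * kerZ m (conjFrame V l) 0 (ρ r)
      = l (V * (X * (R 0 * (R 0)ᵀ) + (X * (R 0 * (R 0)ᵀ))ᵀ) * Vᵀ) := by
    rw [← l_kap_symL, kerZ, ← smul_eq_mul, ← map_smul, ← kap_smul, ← map_add, ← kap_add,
      kap_axis hm _ hy, conjFrame_apply, flatMetric, ← hR0]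
  rw [hint, haxis, hΛa, ← map_add]
  simp only [Pi.mul_apply, pert_zero]
  congr 1
  change (V * X * R 0 + V * (R 0 * ∫ q in Ioo 0 r, G q)) * (V * R 0)ᵀ
    + ((V * X * R 0 + V * (R 0 * ∫ q in Ioo 0 r, G q)) * (V * R 0)ᵀ)ᵀ = _
  simp only [Matrix.transpose_mul, Matrix.transpose_add, Matrix.mul_add, Matrix.add_mul,
    Matrix.transpose_transpose, Matrix.mul_assoc]
  abel

end Data

section Data
variable {L : ℝ} {μ η : ℝ → ℂ} {ρ : ℝ → ℝ}

/-- The density through which a variation `η` of the Beltrami coefficient enters the variation of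
the deformed metric: `√ρ` times the derivative of `√ρ` times `flatVar`. -/
def varDens (L : ℝ) (μ η : ℝ → ℂ) (ρ : ℝ → ℝ) (q : ℝ) : ℂ :=
  ρ q • dflatVar L μ η q + (dBranch L ρ q / 2) • flatVar L μ η q

theorem continuousOn_varDens (hL : 0 < L) (h : IsRegularData L μ ρ)
    (hη : ContDiffOn ℝ ∞ η (Icc 0 L)) : ContinuousOn (varDens L μ η ρ) (Icc 0 L) :=
  (h.smooth_rho.continuousOn.smul (continuousOn_dflatVar hL h hη)).add
    (((contDiffOn_dBranch hL h.smooth_rho).continuousOn.div_const 2).smul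
      (continuousOn_flatVar hL h hη))

/-- The algebra behind `variation_eq`, with `a = √y`, `b = √(y - x)`, `ρ'` the derivative of the
area density, `ζ` and `K` the kernels, `X` and `π` the rotational and symmetric parts of the
variation of the frame, `π'` the derivative of `π`, and `M` the connection along the branch. -/
theorem total_derivative_identity {a b x : ℝ} (ha : a ≠ 0) (hb : b ≠ 0) (hx : x = a ^ 2 - b ^ 2)
    (ρ' ζ X : ℝ) (K π π' M : ℂ) :
    2 * (a / b) * (M * conj K).im * X + ζ * (2 * (conj M * π).im)
      + (-ρ' / (2 * b) / a * (conj K * π).re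
        + b / a * (conj (-2 * Complex.I * ((a / b * ζ : ℝ) : ℂ) * M) * π + conj K * π').re)
    = a / b * (conj K * (π' - 2 * Complex.I * (X : ℂ) * M)).re
      - a⁻¹ * b⁻¹ * (conj K * (x • π' + (ρ' / 2) • π)).re := by
  simp
  subst hx
  field_simp
  ring

theorem integrableOn_warp_mul (hL : 0 < L) (h : IsRegularData L μ ρ) {r : ℝ} (hr : r ∈ Ioc 0 L)
    {v : ℝ → ℝ} (hv : ContinuousOn v (Icc 0 r)) :
    IntegrableOn (fun q => warp ρ r q * v q) (Ioo 0 r) := by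
  have h1 : IntegrableOn (warp ρ r) (Icc 0 r) := by
    rw [integrableOn_Icc_iff_integrableOn_Ioo]; exact integrableOn_warp hL h hr
  exact (h1.mul_continuousOn hv isCompact_Icc).mono_set Ioo_subset_Icc_self

/-- The integrand of the variation is a total derivative along the branch, up to a term without
rotational part; the boundary terms cancel the contribution of the axis. -/
theorem variation_eq (hL : 0 < L) (h : IsRegularData L μ ρ)
    (hη : ContDiffOn ℝ ∞ η (Icc 0 L)) (l : M2 →L[ℝ] ℝ) {r : ℝ} (hr : r ∈ Ioo 0 L) :
    (conj (kerK (prof L μ ρ) l 0 (ρ r)) * symPart (μ 0) (η 0)).re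
        + rotPart (μ 0) (η 0) * kerZ (prof L μ ρ) l 0 (ρ r)
        + ∫ q in Ioo 0 r, warp ρ r q *
          (conj (kerK (prof L μ ρ) l (ρ q) (ρ r)) * dframeM L μ η q).re
      = ∫ q in Ioo 0 r, (√(ρ r))⁻¹ * (√(ρ r - ρ q))⁻¹ *
          (conj (kerK (prof L μ ρ) l (ρ q) (ρ r)) * varDens L μ η ρ q).re := by
  obtain ⟨m', hm⟩ := exists_isProfile hL h
  have hr' := Ioo_subset_Ioc_self hr
  have hrc := Ioo_subset_Icc_self hr
  have hy : ρ r ∈ Ioo 0 (ρ L) := h.rho_mem ⟨hL.le, le_rfl⟩ hr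
  have sub : Icc 0 r ⊆ Icc 0 L := Icc_subset_Icc_right hr.2.le
  have hρc : ContinuousOn ρ (Icc 0 r) := h.smooth_rho.continuousOn.mono sub
  have hmaps : MapsTo ρ (Icc 0 r) (Icc 0 (ρ r)) := fun q hq =>
    ⟨by rw [← h.rho_axis]; exact h.strictMonoOn_rho.monotoneOn ⟨le_rfl, hL.le⟩ (sub hq) hq.1,
      h.strictMonoOn_rho.monotoneOn (sub hq) hrc hq.2⟩
  set m := prof L μ ρ
  set y := ρ r with hyd
  have a0 : 0 < √y := Real.sqrt_pos.2 hy.1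
  have hKc : ContinuousOn (fun q => conj (kerK m l (ρ q) y)) (Icc 0 r) :=
    Complex.continuous_conj.comp_continuousOn ((continuousOn_kerK hm l hy).comp hρc hmaps)
  have hZc : ContinuousOn (fun q => kerZ m l (ρ q) y) (Icc 0 r) :=
    (continuousOn_kerZ hm l hy).comp hρc hmaps
  have hXc := (continuousOn_angVar hL h hη).mono sub
  have hπc := (continuousOn_flatVar hL h hη).mono sub
  -- the primitive: its value at the axis is the contribution of the axis, and it vanishes at `r`
  set f : ℝ → ℝ := fun q => kerZ m l (ρ q) y * angVar L μ η q
    + √(y - ρ q) / √y * (conj (kerK m l (ρ q) y) * flatVar L μ η q).re with hf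
  have hfc : ContinuousOn f (Icc 0 r) := (hZc.mul hXc).add
    (((continuousOn_const.sub hρc).sqrt.div_const _).mul
      (Complex.continuous_re.comp_continuousOn (hKc.mul hπc)))
  set g₁ : ℝ → ℝ := fun q => warp ρ r q * (conj (kerK m l (ρ q) y) * dframeM L μ η q).re with hg₁
  set g₂ : ℝ → ℝ := fun q => (√y)⁻¹ * (√(y - ρ q))⁻¹ *
    (conj (kerK m l (ρ q) y) * varDens L μ η ρ q).re with hg₂
  have i₁ : IntegrableOn g₁ (Ioo 0 r) := integrableOn_warp_mul hL h hr'
    (Complex.continuous_re.comp_continuousOn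
      (hKc.mul ((continuousOn_dframeM hL h hη).mono sub)))
  have i₂ : IntegrableOn g₂ (Ioo 0 r) := by
    have := (integrableOn_warp_mul hL h hr' (Complex.continuous_re.comp_continuousOn
      (hKc.mul ((continuousOn_varDens hL h hη).mono sub)))).const_mul y⁻¹
    refine this.congr (ae_of_all _ fun q => ?_)
    have e : y⁻¹ * warp ρ r q = (√y)⁻¹ * (√(y - ρ q))⁻¹ := by
      rw [warp, ← hyd, div_eq_mul_inv, ← mul_assoc]
      congr 1
      nth_rewrite 1 [← Real.mul_self_sqrt hy.1.le]
      field_simp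
    simp only [hg₂, Function.comp, ← mul_assoc, e]
    rfl
  have hd : ∀ q ∈ Ioo 0 r, HasDerivAt f (g₁ q - g₂ q) q := by
    intro q hq
    have hqL : q ∈ Ioo 0 L := Ioo_subset_Ioo_right hr.2.le hq
    have hx := h.rho_mem hrc hq
    have hb : 0 < y - ρ q := sub_pos.2 hx.2
    have b0 : 0 < √(y - ρ q) := Real.sqrt_pos.2 hb
    have dρ := h.hasDerivAt_rho hqL
    have dZ := (hasDerivAt_kerZ hm l hx.1 hx.2 hy.2).scomp q dρ
    have dK := (hasDerivAt_kerK hm l hx.1 hx.2 hy.2).scomp q dρ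
    have dK' := Complex.conjCLE.toContinuousLinearMap.hasFDerivAt.comp_hasDerivAt q dK
    have dX := hasDerivAt_angVar hL h hη hqL
    have dπ := hasDerivAt_flatVar hL h hη hqL
    have ds := ((dρ.const_sub y).sqrt hb.ne').div_const √y
    have dR := Complex.reCLM.hasFDerivAt.comp_hasDerivAt q (dK'.mul dπ)
    have eM := prof_rho h hqL
    refine ((dZ.mul dX).add (ds.mul dR)).congr_deriv ?_
    have id := total_derivative_identity a0.ne' b0.ne'
      (show ρ q = √y ^ 2 - √(y - ρ q) ^ 2 by
        rw [Real.sq_sqrt hy.1.le, Real.sq_sqrt hb.le]; ring)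
      (dBranch L ρ q) (kerZ m l (ρ q) y) (angVar L μ η q) (kerK m l (ρ q) y)
      (flatVar L μ η q) (dflatVar L μ η q) (frameM L μ q)
    simp only [hg₁, hg₂, warp, dframeM, varDens]
    rw [← hyd, ← id, ← eM]
    simp
    ring
  have key := intervalIntegral.integral_eq_sub_of_hasDerivAt_of_le hr.1.le hfc hd (by
    rw [intervalIntegrable_iff_integrableOn_Ioo_of_le hr.1.le]
    exact i₁.sub i₂)
  rw [intervalIntegral.integral_of_le hr.1.le, integral_Ioc_eq_integral_Ioo,
    integral_sub i₁ i₂] at key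
  have f0 : f 0 = (conj (kerK m l 0 y) * symPart (μ 0) (η 0)).re
      + rotPart (μ 0) (η 0) * kerZ m l 0 y := by
    have : flatVar L μ η 0 = symPart (μ 0) (η 0) := by simp [flatVar, theta, phase]
    simp only [hf, h.rho_axis, sub_zero, div_self a0.ne', one_mul, this, angVar_zero]
    ring
  have fr : f r = 0 := by
    simp only [hf, ← hyd, kerZ_self hm l hy, sub_self, Real.sqrt_zero]
    ring
  rw [← f0]
  linarith

end Data

theorem continuousAt_prop_axis {Y : ℝ} {m m' : ℝ → ℂ} (hm : IsProfile Y m m') {y : ℝ}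
    (hy : y ∈ Ioo 0 Y) : ContinuousAt (fun y => prop m 0 y) y := by
  have h0 : 0 < y / 2 := half_pos hy.1
  obtain ⟨C, hC⟩ := exists_hasDerivAt_prop_left hm (x₁ := y / 2) (a := 3 / 4 * y)
    (b := (y + Y) / 2) h0 (by linarith [hy.1]) (by linarith [hy.2])
  have hn : Ioo (3 / 4 * y) ((y + Y) / 2) ∈ 𝓝 y :=
    Ioo_mem_nhds (by linarith [hy.1]) (by linarith [hy.2])
  obtain ⟨D, hD, -⟩ := hC y (Ioo_subset_Icc_self (mem_of_mem_nhds hn)) 0 ⟨le_rfl, h0.le⟩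
  have h2 := hasDerivAt_prop_snd hm h0 (half_lt_self hy.1) hy.2
  refine (hD.continuousAt.mul h2.continuousAt).congr ?_
  filter_upwards [hn] with z hz
  have hz0 : 0 < z := lt_trans (by linarith [hy.1]) hz.1
  have := prop_adjugate_mul hm (x := y / 2) (y := z) ⟨hz0, by linarith [hz.2, hy.2]⟩
    ⟨h0.le, by linarith [hz.1, hy.1]⟩
  change prop m 0 z * (prop m (y / 2) z).adjugate * prop m (y / 2) z = prop m 0 z
  rw [Matrix.mul_assoc, this, Matrix.mul_one]

theorem continuousOn_flatMetric {Y : ℝ} {m m' : ℝ → ℂ} (hm : IsProfile Y m m') :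
    ContinuousOn (flatMetric m) (Ioo 0 Y) := fun _ hy =>
  ((continuousAt_prop_axis hm hy).mul
    (transL.continuous.continuousAt.comp (continuousAt_prop_axis hm hy))).continuousWithinAt

section Data
variable {L : ℝ} {μ η : ℝ → ℂ} {ρ : ℝ → ℝ}

/-- The deformed metric is the flat frame metric of the profile, conjugated by the zweibein on the
axis. -/
theorem deformedMetric_eq_flatMetric (hL : 0 < L) (h : IsRegularData L μ ρ) {r : ℝ}
    (hr : r ∈ Ioo 0 L) : deformedMetric L μ ρ r
      = zweibein (μ 0) * flatMetric (prof L μ ρ) (ρ r) * (zweibein (μ 0))ᵀ := by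
  rw [deformedMetric_eq hL h hr, pathOrdExp_frameConn hL h hr (left_mem_Icc.2 hr.1.le), h.rho_axis]
  rfl

theorem continuousOn_deformedMetric (hL : 0 < L) (h : IsRegularData L μ ρ) :
    ContinuousOn (deformedMetric L μ ρ) (Ioo 0 L) := by
  obtain ⟨m', hm⟩ := exists_isProfile hL h
  have h1 : ContinuousOn (fun r => flatMetric (prof L μ ρ) (ρ r)) (Ioo 0 L) :=
    (continuousOn_flatMetric hm).comp (h.smooth_rho.continuousOn.mono Ioo_subset_Icc_self)
      fun r hr => h.rho_mem ⟨hL.le, le_rfl⟩ hr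
  exact ((continuousOn_const.mul h1).mul continuousOn_const).congr fun r hr =>
    deformedMetric_eq_flatMetric hL h hr

/-- The deformed metric depends on the variation in a Lipschitz way, uniformly on compact sets of
deformation points. -/
theorem exists_deformedMetric_pert_le (hL : 0 < L) (h : IsRegularData L μ ρ)
    (hη : ContDiffOn ℝ ∞ η (Icc 0 L)) {ra : ℝ} (hra : 0 < ra) :
    ∃ δ C, 0 < δ ∧ 0 ≤ C ∧ ∀ t, |t| < δ → IsRegularData L (pert μ η t) ρ ∧
      ∀ r ∈ Ioo ra L, ‖deformedMetric L (pert μ η t) ρ r - deformedMetric L μ ρ r‖ ≤ C * |t| := by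
  by_cases hraL : ra ≤ L
  swap
  · obtain ⟨δ, C, δ0, C0, hb⟩ := exists_frameM_pert_le hL h hη
    exact ⟨δ, C, δ0, C0, fun t ht => ⟨(hb t ht).1, fun r hr => absurd (hr.1.trans hr.2) (by
      linarith)⟩⟩
  obtain ⟨δ₁, C, δ0, C0, hb⟩ := exists_frameM_pert_le hL h hη
  obtain ⟨Cw, Cw0, hw⟩ := h.exists_warp_le hL hra hraL
  obtain ⟨N, hN⟩ := isCompact_Icc.exists_bound_of_continuousOn (continuousOn_frameM hL h)
  have N0 : 0 ≤ N := (norm_nonneg _).trans (hN 0 ⟨le_rfl, hL.le⟩)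
  set I := Cw * (L + 2 * √L) with hI
  have I0 : 0 ≤ I := by positivity
  set V : ℝ → M2 := fun t => zweibein (pert μ η t 0) with hV
  have dV : HasDerivAt V _ 0 := hasDerivAt_zweibein_pert (η := η) hL h
  obtain ⟨CV, hCV⟩ := dV.isBigO_sub.bound
  rw [Metric.eventually_nhds_iff] at hCV
  obtain ⟨δ₂, δ₂0, hCV⟩ := hCV
  set δ := min δ₁ (min δ₂ 1) with hδ
  have hδ1 : ∀ t, |t| < δ → |t| < δ₁ := fun t ht => ht.trans_le (min_le_left _ _)
  have hδ2 : ∀ t, |t| < δ → |t| < δ₂ := fun t ht =>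
    ht.trans_le ((min_le_right _ _).trans (min_le_left _ _))
  have hδ3 : ∀ t, |t| < δ → |t| ≤ 1 := fun t ht =>
    (ht.trans_le ((min_le_right _ _).trans (min_le_right _ _))).le
  set K := |CV| with hK
  have hVb : ∀ t, |t| < δ → ‖V t - V 0‖ ≤ K * |t| := fun t ht => by
    have := hCV (y := t) (by simpa using hδ2 t ht)
    rw [sub_zero, Real.norm_eq_abs] at this
    exact this.trans (mul_le_mul_of_nonneg_right (le_abs_self _) (abs_nonneg _))
  -- `T` bounds the size of the varied connections, `D` the Lipschitz constant of their transports,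
  -- and `w`, `Dw` are the same for the deformed zweibein
  set T := ‖symL‖ * ((N + C) * I) with hT
  set D := 2 * Real.exp T ^ 3 * (‖symL‖ * C * I) with hD
  set v := ‖V 0‖ with hv
  set w := (v + K) * Real.exp T with hw'
  set Dw := K * Real.exp T + v * D with hDw
  refine ⟨δ, Dw * (‖transL‖ * w) + w * (‖transL‖ * Dw), lt_min δ0 (lt_min δ₂0 one_pos),
    by positivity, fun t ht => ⟨(hb t (hδ1 t ht)).1, fun r hr => ?_⟩⟩
  have hrI : r ∈ Ioo 0 L := ⟨hra.trans hr.1, hr.2⟩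
  have hr' := Ioo_subset_Ioc_self hrI
  have sub : Ioo 0 r ⊆ Icc 0 L := Ioo_subset_Icc_self.trans (Icc_subset_Icc_right hr.2.le)
  have hwi := integrableOn_warp hL h hr'
  have hwI : ∫ q in Ioo 0 r, warp ρ r q ≤ I := by
    obtain ⟨i1, i2⟩ := integrableOn_warpBound (C := Cw) hrI.1.le
    calc _ ≤ ∫ q in Ioo 0 r, Cw * (1 + (√(r - q))⁻¹) :=
          setIntegral_mono_on hwi i1 measurableSet_Ioo
            fun q hq => hw r ⟨hr.1.le, hr.2.le⟩ q hq
      _ = Cw * (r + 2 * √r) := i2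
      _ ≤ I := by
          have := Real.sqrt_le_sqrt hr.2.le
          exact mul_le_mul_of_nonneg_left (by linarith [hr.2]) Cw0
  have tailb : ∀ s, |s| < δ → tail (frameConn L (pert μ η s) ρ r) r 0 ≤ T := fun s hs => by
    have hc := isConn_frameConn hL (hb s (hδ1 s hs)).1 hr'
    rw [tail, intervalIntegral.integral_of_le hrI.1.le, integral_Ioc_eq_integral_Ioo]
    calc _ ≤ ∫ q in Ioo 0 r, ‖symL‖ * (N + C) * warp ρ r q := by
          refine setIntegral_mono_on hc.int.norm (hwi.const_mul _) measurableSet_Ioo fun q hq => ?_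
          refine (symL.le_opNorm _).trans ?_
          rw [norm_smul, Real.norm_of_nonneg (warp_nonneg _ _), mul_assoc, mul_comm (N + C)]
          refine mul_le_mul_of_nonneg_left (mul_le_mul_of_nonneg_left ?_ (warp_nonneg _ _))
            (norm_nonneg _)
          have h1 := (hb s (hδ1 s hs)).2 q (sub hq)
          have h2 := hN q (sub hq)
          have h3 := norm_le_norm_add_norm_sub' (frameM L (pert μ η s) q) (frameM L μ q)
          have h4 := mul_le_mul_of_nonneg_left (hδ3 s hs) C0
          linarith
      _ = ‖symL‖ * (N + C) * ∫ q in Ioo 0 r, warp ρ r q := integral_const_mul _ _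
      _ ≤ ‖symL‖ * (N + C) * I := mul_le_mul_of_nonneg_left hwI (by positivity)
      _ = T := by rw [hT]; ring
  have δpos : |(0 : ℝ)| < δ := by rw [abs_zero]; exact lt_min δ0 (lt_min δ₂0 one_pos)
  set R : ℝ → M2 := fun t => pathOrdExp (frameConn L (pert μ η t) ρ r) 0 r with hR
  have h0 : (0 : ℝ) ∈ Icc 0 r := ⟨le_rfl, hrI.1.le⟩
  have Rb : ∀ s, |s| < δ → ‖R s‖ ≤ Real.exp T := fun s hs =>
    ((isTransport_frameConn hL (hb s (hδ1 s hs)).1 hr').norm_le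
      (isConn_frameConn hL (hb s (hδ1 s hs)).1 hr') (trace_frameConn r) h0).trans
      (Real.exp_le_exp.2 (tailb s hs))
  have Rd : ‖R t - R 0‖ ≤ D * |t| := by
    have hz := (hb 0 (hδ1 0 δpos)).1
    have ht' := (hb t (hδ1 t ht)).1
    have := (isTransport_frameConn hL hz hr').norm_sub_le (isConn_frameConn hL hz hr')
      (isConn_frameConn hL ht' hr') (isTransport_frameConn hL ht' hr') (trace_frameConn r)
      (trace_frameConn r) h0 (tailb 0 δpos) (tailb t ht)
      (g := fun q => ‖symL‖ * C * |t| * warp ρ r q) (hwi.const_mul _) (fun q hq => by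
        rw [pert_zero]
        refine (norm_frameConn_sub_le _ _ _ _).trans ?_
        have := mul_le_mul_of_nonneg_left ((hb t (hδ1 t ht)).2 q (sub hq))
          (mul_nonneg (norm_nonneg symL) (warp_nonneg (ρ := ρ) r q))
        linarith)
    refine this.trans ?_
    rw [integral_const_mul, hD]
    have e := mul_le_mul_of_nonneg_left hwI
      (show 0 ≤ 2 * Real.exp T ^ 3 * (‖symL‖ * C * |t|) by positivity)
    linarith
  have Vt : ∀ s, |s| < δ → ‖V s‖ ≤ v + K := fun s hs => by
    have h3 := norm_le_norm_add_norm_sub' (V s) (V 0)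
    have h4 := mul_le_mul_of_nonneg_left (hδ3 s hs) (abs_nonneg CV)
    have h5 := hVb s hs
    linarith
  set W : ℝ → M2 := fun t => V t * R t with hW
  have Wb : ∀ s, |s| < δ → ‖W s‖ ≤ w := fun s hs => (norm_mul_le _ _).trans
    (mul_le_mul (Vt s hs) (Rb s hs) (norm_nonneg _) (by positivity))
  have Wd : ‖W t - W 0‖ ≤ Dw * |t| := by
    have e : W t - W 0 = (V t - V 0) * R t + V 0 * (R t - R 0) := by
      simp only [hW, Matrix.sub_mul, Matrix.mul_sub]; abel
    rw [e]
    refine (norm_add_le _ _).trans ?_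
    have h1 := (norm_mul_le (V t - V 0) (R t)).trans
      (mul_le_mul (hVb t ht) (Rb t ht) (norm_nonneg _) (by positivity))
    have h2 := (norm_mul_le (V 0) (R t - R 0)).trans
      (mul_le_mul_of_nonneg_left Rd (norm_nonneg _))
    rw [hDw]
    linarith
  have dm : ∀ s, |s| < δ → deformedMetric L (pert μ η s) ρ r = W s * transL (W s) := fun s hs => by
    rw [deformedMetric_eq hL (hb s (hδ1 s hs)).1 hrI, show transL (W s) = (W s)ᵀ from rfl, hW,
      Matrix.transpose_mul]
    simp only [Matrix.mul_assoc, hV, hR]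
  have d0 := dm 0 δpos
  rw [pert_zero] at d0
  rw [dm t ht, d0]
  have e : W t * transL (W t) - W 0 * transL (W 0)
      = (W t - W 0) * transL (W t) + W 0 * transL (W t - W 0) := by
    rw [map_sub, Matrix.sub_mul, Matrix.mul_sub]; abel
  rw [e]
  refine (norm_add_le _ _).trans ?_
  have h1 := (norm_mul_le (W t - W 0) (transL (W t))).trans (mul_le_mul Wd
    ((transL.le_opNorm _).trans (mul_le_mul_of_nonneg_left (Wb t ht) (norm_nonneg _)))
    (norm_nonneg _) (by positivity))
  have h2 := (norm_mul_le (W 0) (transL (W t - W 0))).trans (mul_le_mul (Wb 0 δpos)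
    ((transL.le_opNorm _).trans (mul_le_mul_of_nonneg_left Wd (norm_nonneg _)))
    (norm_nonneg _) (by positivity))
  linarith

end Data

/-! ### Smeared components of the deformed metric -/

/-- For `y ≤ x` the square root of `y - x` is zero and so is its inverse: the integral extends over
`x < y` only. -/
theorem integrableOn_inv_sqrt_shift {x Y : ℝ} (hx : 0 ≤ x) :
    IntegrableOn (fun y => (√(y - x))⁻¹) (Ioo 0 Y) ∧
    ∫ y in Ioo 0 Y, (√(y - x))⁻¹ ≤ ∫ u in Ioo 0 Y, (√u)⁻¹ := by
  set k : ℝ → ℝ := (Ioo 0 Y).indicator fun u => (√u)⁻¹ with hk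
  have hki : Integrable k := (integrable_indicator_iff measurableSet_Ioo).2 (integrableOn_inv_sqrt Y)
  have hks : Integrable fun y => k (y - x) := hki.comp_sub_right x
  have e : ∀ y ∈ Ioo 0 Y, (√(y - x))⁻¹ = k (y - x) := by
    intro y hy
    by_cases hyx : 0 < y - x
    · rw [hk, indicator_of_mem (show y - x ∈ Ioo 0 Y from ⟨hyx, by linarith [hy.2]⟩)]
    · rw [hk, indicator_of_notMem (fun h => hyx h.1), Real.sqrt_eq_zero_of_nonpos (not_lt.1 hyx),
        _root_.inv_zero]
  refine ⟨hks.integrableOn.congr_fun (fun y hy => (e y hy).symm) measurableSet_Ioo, ?_⟩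
  rw [setIntegral_congr_fun measurableSet_Ioo e, ← integral_indicator measurableSet_Ioo]
  calc _ ≤ ∫ y, k (y - x) := by
        rw [integral_indicator measurableSet_Ioo]
        exact setIntegral_le_integral hks (ae_of_all _ fun y =>
          indicator_nonneg (fun u _ => by positivity) _)
    _ = ∫ y, k y := integral_sub_right_eq_self k x
    _ = _ := integral_indicator measurableSet_Ioo
    _ ≤ _ := le_rfl

/-- The half-integral in terms of `y = x + u`; for `y ≤ x` the factor `(√(y - x))⁻¹` is zero. -/
theorem smearK_eq {b Y C : ℝ} {β : ℝ → ℝ} {φ : ℝ × ℝ → ℂ} (h : IsSmearedKernel b C β φ)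
    (hb : b ≤ Y) {x : ℝ} (hx : 0 ≤ x) :
    smearK b φ x = √x • ∫ y in Ioo 0 Y, (√(y - x))⁻¹ • φ (x, y) := by
  have e1 : smearK b φ x = ∫ u, (√u)⁻¹ • shiftK φ x u := by
    refine setIntegral_eq_integral_of_forall_compl_eq_zero fun u hu => ?_
    rcases le_or_gt u 0 with h0 | h0
    · rw [Real.sqrt_eq_zero_of_nonpos h0, _root_.inv_zero, zero_smul]
    · rw [shiftK, h.vanish _ _ (by have := fun h1 => hu ⟨h0, h1⟩; linarith [not_lt.1 this]), smul_zero,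
        smul_zero]
  have e2 : ∫ y in Ioo 0 Y, (√(y - x))⁻¹ • φ (x, y) = ∫ y, (√(y - x))⁻¹ • φ (x, y) := by
    refine setIntegral_eq_integral_of_forall_compl_eq_zero fun y hy => ?_
    rcases le_or_gt y 0 with h0 | h0
    · rw [Real.sqrt_eq_zero_of_nonpos (by linarith), _root_.inv_zero, zero_smul]
    · rw [h.vanish _ _ (by have := fun h1 => hy ⟨h0, h1⟩; linarith [not_lt.1 this]), smul_zero]
  have e3 := integral_add_left_eq_self (μ := volume) (fun y => (√(y - x))⁻¹ • φ (x, y)) x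
  rw [e1, e2, ← e3, ← integral_smul]
  refine integral_congr_ae (ae_of_all _ fun u => ?_)
  simp only [shiftK, add_sub_cancel_left]
  rw [smul_comm]

/-- Pairing with `v`, as a real linear functional. -/
def pairL (v : ℂ) : ℂ →L[ℝ] ℝ :=
  Complex.reCLM.comp (((ContinuousLinearMap.mul ℝ ℂ).flip v).comp
    Complex.conjCLE.toContinuousLinearMap)

theorem pairL_apply (v w : ℂ) : pairL v w = (conj w * v).re := rfl

theorem abs_pairL_le (v w : ℂ) : |pairL v w| ≤ ‖w‖ * ‖v‖ := by
  rw [pairL_apply]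
  exact (Complex.abs_re_le_norm _).trans (by rw [norm_mul, RCLike.norm_conj])

section Data
variable {L : ℝ} {μ η : ℝ → ℂ} {ρ : ℝ → ℝ}

section Fubini
variable {b C : ℝ} {β : ℝ → ℝ} {φ : ℝ × ℝ → ℂ} {v : ℝ → ℂ}

/-- The double integrand of the variation of a smeared component. -/
def varIntegrand (ρ : ℝ → ℝ) (φ : ℝ × ℝ → ℂ) (v : ℝ → ℂ) (p : ℝ × ℝ) : ℝ :=
  (√(p.2 - ρ p.1))⁻¹ * pairL (v p.1) (φ (ρ p.1, p.2))

theorem varIntegrand_eq_zero {q y : ℝ} (h : y ≤ ρ q) : varIntegrand ρ φ v (q, y) = 0 := by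
  simp [varIntegrand, Real.sqrt_eq_zero_of_nonpos (sub_nonpos.2 h)]

theorem aestronglyMeasurable_varIntegrand (hL : 0 < L) (h : IsRegularData L μ ρ)
    (hφ : IsSmearedKernel b C β φ) (hv : ContinuousOn v (Icc 0 L)) :
    AEStronglyMeasurable (varIntegrand ρ φ v)
      ((volume.restrict (Ioo 0 L)).prod (volume.restrict (Ioo 0 (ρ L)))) := by
  rw [Measure.prod_restrict]
  set S : Set (ℝ × ℝ) := Ioo 0 L ×ˢ Ioo 0 (ρ L) with hS
  have hSo : IsOpen S := isOpen_Ioo.prod isOpen_Ioo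
  have hρc : ContinuousOn (fun p : ℝ × ℝ => ρ p.1) S :=
    h.smooth_rho.continuousOn.comp continuous_fst.continuousOn
      fun p hp => Ioo_subset_Icc_self hp.1
  have hdc : ContinuousOn (fun p : ℝ × ℝ => p.2 - ρ p.1) S := continuous_snd.continuousOn.sub hρc
  set D := S ∩ (fun p : ℝ × ℝ => p.2 - ρ p.1) ⁻¹' Ioi 0 with hD
  have hDo : IsOpen D := hdc.isOpen_inter_preimage hSo isOpen_Ioi
  have hc : ContinuousOn (varIntegrand ρ φ v) D := by
    have c1 : ContinuousOn (fun p : ℝ × ℝ => (√(p.2 - ρ p.1))⁻¹) D :=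
      ((hdc.mono inter_subset_left).sqrt).inv₀ fun p hp => (Real.sqrt_pos.2 hp.2).ne'
    have c2 : ContinuousOn (fun p : ℝ × ℝ => φ (ρ p.1, p.2)) D := fun p hp => by
      have hx : 0 < ρ p.1 := (h.rho_mem ⟨hL.le, le_rfl⟩ hp.1.1).1
      have d := (hφ.diff (ρ p.1) p.2 hx (sub_pos.1 hp.2)).continuousAt
      have c : ContinuousWithinAt (fun p : ℝ × ℝ => (ρ p.1, p.2)) D p :=
        (hρc.mono inter_subset_left p hp).prodMk continuous_snd.continuousWithinAt
      exact ContinuousAt.comp_continuousWithinAt (f := fun p : ℝ × ℝ => (ρ p.1, p.2)) d c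
    have c3 : ContinuousOn (fun p : ℝ × ℝ => v p.1) D := hv.comp continuous_fst.continuousOn
      fun p hp => Ioo_subset_Icc_self hp.1.1
    exact c1.mul (Complex.continuous_re.comp_continuousOn
      ((Complex.continuous_conj.comp_continuousOn c2).mul c3))
  have hm : AEStronglyMeasurable (D.indicator (varIntegrand ρ φ v)) (volume.restrict S) := by
    rw [aestronglyMeasurable_indicator_iff hDo.measurableSet]
    rw [Measure.restrict_restrict hDo.measurableSet, inter_eq_left.2 inter_subset_left]
    exact hc.aestronglyMeasurable hDo.measurableSet
  refine hm.congr ?_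
  filter_upwards [ae_restrict_mem hSo.measurableSet] with p hp
  by_cases hpD : p ∈ D
  · rw [indicator_of_mem hpD]
  · rw [indicator_of_notMem hpD]
    exact (varIntegrand_eq_zero (not_lt.1 fun h => hpD ⟨hp, sub_pos.2 h⟩)).symm

theorem abs_varIntegrand_le (hL : 0 < L) (h : IsRegularData L μ ρ) (hφ : IsSmearedKernel b C β φ)
    {N : ℝ} (hN : ∀ q ∈ Icc 0 L, ‖v q‖ ≤ N) {q : ℝ} (hq : q ∈ Ioo 0 L) (y : ℝ) :
    |varIntegrand ρ φ v (q, y)| ≤ C * N * (√(y - ρ q))⁻¹ := by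
  have hvq := hN q (Ioo_subset_Icc_self hq)
  have hx : 0 < ρ q := (h.rho_mem ⟨hL.le, le_rfl⟩ hq).1
  have C0 : 0 ≤ C := (norm_nonneg _).trans (hφ.bound _ (ρ q + 1) hx (by linarith))
  rcases le_or_gt y (ρ q) with hy | hy
  · rw [varIntegrand_eq_zero hy, abs_zero]
    have := (norm_nonneg _).trans hvq
    positivity
  · rw [varIntegrand, abs_mul, abs_of_nonneg (by positivity), mul_comm]
    refine mul_le_mul_of_nonneg_right ((abs_pairL_le _ _).trans ?_) (by positivity)
    exact mul_le_mul (hφ.bound _ _ hx hy) hvq (norm_nonneg _) C0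

/-- Absolute convergence of the double integral, which justifies exchanging the integrations over
field points and deformation points. -/
theorem integrable_varIntegrand (hL : 0 < L) (h : IsRegularData L μ ρ)
    (hφ : IsSmearedKernel b C β φ) (hv : ContinuousOn v (Icc 0 L)) :
    Integrable (varIntegrand ρ φ v)
      ((volume.restrict (Ioo 0 L)).prod (volume.restrict (Ioo 0 (ρ L)))) := by
  obtain ⟨N, hN⟩ := isCompact_Icc.exists_bound_of_continuousOn hv
  have hm := aestronglyMeasurable_varIntegrand hL h hφ hv
  have hsec : ∀ q ∈ Ioo 0 L, IntegrableOn (fun y => C * N * (√(y - ρ q))⁻¹) (Ioo 0 (ρ L)) :=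
    fun q hq => ((integrableOn_inv_sqrt_shift (h.rho_mem ⟨hL.le, le_rfl⟩ hq).1.le).1).const_mul _
  have C0 : 0 ≤ C := (norm_nonneg _).trans (hφ.bound 1 2 one_pos one_lt_two)
  have N0 : 0 ≤ N := (norm_nonneg _).trans (hN 0 ⟨le_rfl, hL.le⟩)
  rw [integrable_prod_iff hm]
  constructor
  · filter_upwards [ae_restrict_mem measurableSet_Ioo, hm.prodMk_left] with q hq hmq
    exact Integrable.mono' (hsec q hq) hmq
      (ae_of_all _ fun y => abs_varIntegrand_le hL h hφ hN hq y)
  · have hI : IntegrableOn (fun _ : ℝ => C * N * ∫ u in Ioo 0 (ρ L), (√u)⁻¹) (Ioo 0 L) :=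
      integrableOn_const_Ioo _
    refine Integrable.mono' hI hm.norm.integral_prod_right' ?_
    filter_upwards [ae_restrict_mem measurableSet_Ioo] with q hq
    have hx := (h.rho_mem ⟨hL.le, le_rfl⟩ hq).1.le
    rw [Real.norm_of_nonneg (integral_nonneg fun _ => norm_nonneg _)]
    calc _ ≤ ∫ y in Ioo 0 (ρ L), C * N * (√(y - ρ q))⁻¹ :=
          integral_mono_of_nonneg (ae_of_all _ fun _ => norm_nonneg _) (hsec q hq)
            (ae_of_all _ fun y => abs_varIntegrand_le hL h hφ hN hq y)
      _ = C * N * ∫ y in Ioo 0 (ρ L), (√(y - ρ q))⁻¹ := integral_const_mul _ _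
      _ ≤ _ := mul_le_mul_of_nonneg_left (integrableOn_inv_sqrt_shift hx).2 (by positivity)

/-- Exchanging the order of integration turns the variation of a smeared component into a pairing
with the half-integral of its kernel. -/
theorem integral_varIntegrand (hL : 0 < L) (h : IsRegularData L μ ρ)
    (hφ : IsSmearedKernel b C β φ) (hb : b ≤ ρ L) (hv : ContinuousOn v (Icc 0 L)) :
    IntegrableOn (fun q => (√(ρ q))⁻¹ * pairL (v q) (smearK b φ (ρ q))) (Ioo 0 L) ∧
    IntegrableOn (fun y => ∫ q in Ioo 0 L, varIntegrand ρ φ v (q, y)) (Ioo 0 (ρ L)) ∧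
    ∫ y in Ioo 0 (ρ L), ∫ q in Ioo 0 L, varIntegrand ρ φ v (q, y)
      = ∫ q in Ioo 0 L, (√(ρ q))⁻¹ * pairL (v q) (smearK b φ (ρ q)) := by
  have hi := integrable_varIntegrand hL h hφ hv
  have hsec : ∀ q ∈ Ioo 0 L, ∫ y in Ioo 0 (ρ L), varIntegrand ρ φ v (q, y)
      = (√(ρ q))⁻¹ * pairL (v q) (smearK b φ (ρ q)) := by
    intro q hq
    have hx := (h.rho_mem ⟨hL.le, le_rfl⟩ hq).1
    have hint : IntegrableOn (fun y => (√(y - ρ q))⁻¹ • φ (ρ q, y)) (Ioo 0 (ρ L)) := by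
      have c2 : ContinuousOn (fun y => φ (ρ q, y)) (Ioo (ρ q) (ρ L)) := fun y hy =>
        (ContinuousAt.comp (f := fun y => (ρ q, y)) (hφ.diff _ _ hx hy.1).continuousAt
          (by fun_prop)).continuousWithinAt
      have c1 : ContinuousOn (fun y => (√(y - ρ q))⁻¹) (Ioo (ρ q) (ρ L)) :=
        ContinuousOn.inv₀ (by fun_prop) fun y hy => (Real.sqrt_pos.2 (sub_pos.2 hy.1)).ne'
      have hs : Ioo (ρ q) (ρ L) ⊆ Ioo 0 (ρ L) := Ioo_subset_Ioo_left hx.le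
      have : IntegrableOn (fun y => (√(y - ρ q))⁻¹ • φ (ρ q, y)) (Ioo (ρ q) (ρ L)) := by
        refine Integrable.mono' (((integrableOn_inv_sqrt_shift hx.le).1.mono_set hs).mul_const C)
          ((c1.smul c2).aestronglyMeasurable measurableSet_Ioo) ?_
        filter_upwards [ae_restrict_mem measurableSet_Ioo] with y hy
        rw [norm_smul, Real.norm_of_nonneg (by positivity)]
        exact mul_le_mul_of_nonneg_left (hφ.bound _ _ hx hy.1) (by positivity)
      refine this.of_forall_sdiff_eq_zero measurableSet_Ioo fun y hy => ?_
      have : y ≤ ρ q := not_lt.1 fun h => hy.2 ⟨h, hy.1.2⟩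
      rw [Real.sqrt_eq_zero_of_nonpos (sub_nonpos.2 this), _root_.inv_zero, zero_smul]
    have e := (pairL (v q)).integral_comp_comm hint
    rw [smearK_eq hφ hb hx.le, map_smul, ← e, smul_eq_mul, ← mul_assoc,
      inv_mul_cancel₀ (Real.sqrt_pos.2 hx).ne', one_mul]
    refine integral_congr_ae (ae_of_all _ fun y => ?_)
    simp only [varIntegrand, map_smul, smul_eq_mul]
  have hae : (fun q => ∫ y in Ioo 0 (ρ L), varIntegrand ρ φ v (q, y))
      =ᵐ[volume.restrict (Ioo 0 L)] fun q => (√(ρ q))⁻¹ * pairL (v q) (smearK b φ (ρ q)) := by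
    filter_upwards [ae_restrict_mem measurableSet_Ioo] with q hq using hsec q hq
  refine ⟨hi.integral_prod_left.congr hae, hi.integral_prod_right, ?_⟩
  rw [← integral_congr_ae hae]
  exact (integral_integral_swap (f := fun q y => varIntegrand ρ φ v (q, y)) hi).symm

end Fubini
end Data

section Data
variable {L : ℝ} {μ η : ℝ → ℂ} {ρ : ℝ → ℝ} {a b : ℝ} {f f' : ℝ → ℝ}

/-- A component of the deformed metric, smeared with a function of the area density. -/
def smearedE (L : ℝ) (l : M2 →L[ℝ] ℝ) (f : ℝ → ℝ) (ν : ℝ → ℂ) (ρ : ℝ → ℝ) : ℝ :=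
  ∫ y in Ioo 0 (ρ L), f y * l (deformedMetric L ν ρ (rInv L ρ y))

theorem continuousOn_component (hL : 0 < L) (h : IsRegularData L μ ρ) (l : M2 →L[ℝ] ℝ) :
    ContinuousOn (fun y => l (deformedMetric L μ ρ (rInv L ρ y))) (Ioo 0 (ρ L)) := by
  have h1 : ContinuousOn (rInv L ρ) (Ioo 0 (ρ L)) := fun y hy =>
    (h.hasDerivAt_rInv hL hy).continuousAt.continuousWithinAt
  exact l.continuous.comp_continuousOn ((continuousOn_deformedMetric hL h).comp h1
    fun y hy => (h.rInv_mem hL hy).1)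

/-- At a fixed deformation point the double integrand gives the weighted variation of
`variation_eq`. -/
theorem integral_varIntegrand_weightK (hL : 0 < L) (h : IsRegularData L μ ρ) (l : M2 →L[ℝ] ℝ)
    (v : ℝ → ℂ) {y : ℝ} (hy : y ∈ Ioo 0 (ρ L)) :
    ∫ q in Ioo 0 L, varIntegrand ρ (weightK (prof L μ ρ) l f) v (q, y)
      = f y * ∫ q in Ioo 0 (rInv L ρ y), (√y)⁻¹ * (√(y - ρ q))⁻¹ *
        (conj (kerK (prof L μ ρ) l (ρ q) y) * v q).re := by
  obtain ⟨hr, hρr⟩ := h.rInv_mem hL hy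
  rw [← integral_const_mul, setIntegral_eq_of_subset_of_forall_sdiff_eq_zero measurableSet_Ioo
    (Ioo_subset_Ioo_right hr.2.le) fun q hq => varIntegrand_eq_zero ?_]
  · refine integral_congr_ae (ae_of_all _ fun q => ?_)
    simp only [varIntegrand, weightK, map_smul, smul_eq_mul, pairL_apply]
    ring
  · have hq' : rInv L ρ y ≤ q := not_lt.1 fun hlt => hq.2 ⟨hq.1.1, hlt⟩
    have := h.strictMonoOn_rho.monotoneOn (Ioo_subset_Icc_self hr) (Ioo_subset_Icc_self hq.1) hq'
    rwa [hρr] at this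

/-- The variation of a smeared component of the deformed metric. -/
theorem hasDerivAt_smearedE (hL : 0 < L) (h : IsRegularData L μ ρ)
    (hη : ContDiffOn ℝ ∞ η (Icc 0 L)) (ha : 0 < a) (hb : b < ρ L) (hf : IsWeight a b f f')
    (l : M2 →L[ℝ] ℝ) :
    HasDerivAt (fun t => smearedE L l f (pert μ η t) ρ)
      (∫ q in Ioo 0 L, (√(ρ q))⁻¹ * pairL (varDens L μ η ρ q)
        (smearK b (weightK (prof L μ ρ) (conjFrame (zweibein (μ 0)) l) f) (ρ q))) 0 := by
  obtain ⟨m', hm⟩ := exists_isProfile hL h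
  set l' := conjFrame (zweibein (μ 0)) l
  obtain ⟨C, -, hφ⟩ := exists_isSmearedKernel hm ha hb hf l'
  obtain ⟨-, i2, i3⟩ := integral_varIntegrand hL h (hφ C le_rfl) hb.le
    (continuousOn_varDens hL h hη)
  rw [← i3]
  by_cases hab : a ≤ b
  swap
  -- without support the weight is zero
  · have f0 : ∀ y, f y = 0 := fun y => hf.support y fun hy => hab (hy.1.trans hy.2).le
    have z : ∫ y in Ioo 0 (ρ L), ∫ q in Ioo 0 L,
        varIntegrand ρ (weightK (prof L μ ρ) l' f) (varDens L μ η ρ) (q, y) = 0 := by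
      simp [varIntegrand, weightK, f0]
    rw [z]
    simpa [smearedE, f0] using hasDerivAt_const (0 : ℝ) (0 : ℝ)
  have haY : a ∈ Ioo 0 (ρ L) := ⟨ha, hab.trans_lt hb⟩
  obtain ⟨hra, hρra⟩ := h.rInv_mem hL haY
  obtain ⟨δ, D, δ0, D0, hbd⟩ := exists_deformedMetric_pert_le hL h hη hra.1
  have hfi : IntegrableOn f (Ioo 0 (ρ L)) :=
    (hf.cont.continuousOn.integrableOn_Icc).mono_set Ioo_subset_Icc_self
  have hsub : Icc a b ⊆ Ioo 0 (ρ L) := fun y hy => ⟨ha.trans_le hy.1, hy.2.trans_lt hb⟩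
  refine hasDerivAt_integral_of_lipschitz_at (g := fun y => |f y| * (‖l‖ * D)) δ0
    (fun t ht => (hf.cont.continuousOn.mul
      (continuousOn_component hL (hbd t ht).1 l)).aestronglyMeasurable measurableSet_Ioo) ?_
    i2.aestronglyMeasurable (hfi.abs.mul_const _) ?_ ?_
  · rw [pert_zero]
    have hc : IntegrableOn (fun y => f y * l (deformedMetric L μ ρ (rInv L ρ y))) (Icc a b) :=
      (hf.cont.continuousOn.mul ((continuousOn_component hL h l).mono hsub)).integrableOn_Icc
    refine hc.of_forall_sdiff_eq_zero measurableSet_Ioo fun y hy => ?_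
    rw [hf.support y fun hy' => hy.2 (Ioo_subset_Icc_self hy'), zero_mul]
  · filter_upwards [ae_restrict_mem measurableSet_Ioo] with y hy t ht
    rw [pert_zero, ← mul_sub, ← map_sub, norm_mul, Real.norm_eq_abs, mul_assoc]
    by_cases hyab : y ∈ Ioo a b
    · refine mul_le_mul_of_nonneg_left ((l.le_opNorm _).trans ?_) (abs_nonneg _)
      rw [mul_assoc]
      refine mul_le_mul_of_nonneg_left ((hbd t ht).2 _ ⟨?_, (h.rInv_mem hL hy).1.2⟩) (norm_nonneg _)
      obtain ⟨hr, hρr⟩ := h.rInv_mem hL hy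
      rw [← h.strictMonoOn_rho.lt_iff_lt (Ioo_subset_Icc_self hra) (Ioo_subset_Icc_self hr),
        hρra, hρr]
      exact hyab.1
    · rw [hf.support y hyab]; simp
  · filter_upwards [ae_restrict_mem measurableSet_Ioo] with y hy
    obtain ⟨hr, hρr⟩ := h.rInv_mem hL hy
    have := (hasDerivAt_deformedMetric_pert hL h hη l hr).const_mul (f y)
    refine this.congr_deriv ?_
    rw [variation_eq hL h hη _ hr, integral_varIntegrand_weightK hL h _ _ hy, hρr]

/-- In the functional derivative `ρ'` tames the profile, and `√ρ` the singularity `ρ^(-1/2)` of the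
derivative of the half-integral at the axis. -/
theorem exists_dsmearK_bound (hL : 0 < L) (h : IsRegularData L μ ρ) {C : ℝ} {φ : ℝ × ℝ → ℂ}
    (hφ : IsSmearedKernel b C (fun x => C * (1 + ‖prof L μ ρ x‖)) φ) :
    ∃ N, ∀ q ∈ Ioo 0 L, dBranch L ρ q * √(ρ q) * ‖dsmearK b φ (ρ q)‖ ≤ N := by
  have hc : ContinuousOn (fun q => C * (dBranch L ρ q / 2)
      + ρ q * C * (dBranch L ρ q + ‖frameM L μ q‖)) (Icc 0 L) := by
    have c1 := (contDiffOn_dBranch hL h.smooth_rho).continuousOn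
    have c2 := h.smooth_rho.continuousOn
    have c3 := (continuousOn_frameM hL h).norm
    exact (continuousOn_const.mul (c1.div_const 2)).add
      ((c2.mul continuousOn_const).mul (c1.add c3))
  obtain ⟨N, hN⟩ := isCompact_Icc.exists_bound_of_continuousOn hc
  have I0 : 0 ≤ ∫ u in Ioo 0 b, (√u)⁻¹ := integral_nonneg fun _ => by positivity
  refine ⟨(∫ u in Ioo 0 b, (√u)⁻¹) * N, fun q hq => ?_⟩
  have hx := (h.rho_mem ⟨hL.le, le_rfl⟩ hq).1
  have hs := Real.sqrt_pos.2 hx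
  have hρ' := h.dBranch_rho_pos hq
  have e := mul_le_mul_of_nonneg_left (norm_dsmearK_le hφ hx)
    (show 0 ≤ dBranch L ρ q * √(ρ q) by positivity)
  refine e.trans ?_
  rw [mul_left_comm]
  refine mul_le_mul_of_nonneg_left (le_trans (le_of_eq ?_) ((le_abs_self _).trans
    (hN q (Ioo_subset_Icc_self hq)))) I0
  have e2 : ‖frameM L μ q‖ = dBranch L ρ q * ‖prof L μ ρ (ρ q)‖ := by
    rw [← prof_rho h hq, norm_smul, Real.norm_of_nonneg hρ'.le]
  have e3 : √(ρ q) * √(ρ q) = ρ q := Real.mul_self_sqrt hx.le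
  rw [e2, shiftBound]
  rw [show ∀ A B D : ℝ, A * √(ρ q) * (1 / (2 * √(ρ q)) * B + √(ρ q) * D)
    = B * (A / 2) * (√(ρ q) * (√(ρ q))⁻¹) + A * (√(ρ q) * √(ρ q)) * D by
      intros; field_simp, mul_inv_cancel₀ hs.ne', e3]
  ring

theorem aestronglyMeasurable_dsmearK_rho (hL : 0 < L) (h : IsRegularData L μ ρ) {C : ℝ}
    {β : ℝ → ℝ} {φ : ℝ × ℝ → ℂ} (hφ : IsSmearedKernel b C β φ)
    (hβ : ContinuousOn β (Ioo 0 (ρ L))) :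
    AEStronglyMeasurable (fun q => dsmearK b φ (ρ q)) (volume.restrict (Ioo 0 L)) := by
  have hρ : AEMeasurable ρ (volume.restrict (Ioo 0 L)) :=
    (h.smooth_rho.continuousOn.mono Ioo_subset_Icc_self).aemeasurable measurableSet_Ioo
  have h1 : AEStronglyMeasurable (fun q => deriv (smearK b φ) (ρ q)) (volume.restrict (Ioo 0 L)) :=
    ((measurable_deriv (smearK b φ)).comp_aemeasurable hρ).aestronglyMeasurable
  refine h1.congr ?_
  filter_upwards [ae_restrict_mem measurableSet_Ioo] with q hq
  exact (hasDerivAt_smearK hφ hβ (h.rho_mem ⟨hL.le, le_rfl⟩ hq)).deriv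

end Data

section Data
variable {L : ℝ} {μ η : ℝ → ℂ} {ρ : ℝ → ℝ} {a b C : ℝ} {f f' : ℝ → ℝ} {φ : ℝ × ℝ → ℂ}

theorem smearK_eq_zero {β : ℝ → ℝ} (hφ : IsSmearedKernel b C β φ) {x : ℝ} (hx : b ≤ x) :
    smearK b φ x = 0 := by
  refine setIntegral_eq_zero_of_forall_eq_zero fun u hu => ?_
  rw [shiftK, hφ.vanish _ _ (by linarith [hu.1]), smul_zero, smul_zero]

/-- Integration by parts along the branch. Both boundary terms vanish: the half-integral is
`O(√ρ)` at the axis, and vanishes beyond the support of the weight. -/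
theorem integral_pairing_by_parts (hL : 0 < L) (h : IsRegularData L μ ρ)
    (hη : ContDiffOn ℝ ∞ η (Icc 0 L)) (hb : b < ρ L)
    (hφ : IsSmearedKernel b C (fun x => C * (1 + ‖prof L μ ρ x‖)) φ) :
    ∫ q in Ioo 0 L, (√(ρ q))⁻¹ * pairL (varDens L μ η ρ q) (smearK b φ (ρ q))
      = -∫ q in Ioo 0 L, pairL (√(ρ q) • flatVar L μ η q) (dBranch L ρ q • dsmearK b φ (ρ q)) := by
  obtain ⟨m', hm⟩ := exists_isProfile hL h
  have hβ : ContinuousOn (fun x => C * (1 + ‖prof L μ ρ x‖)) (Ioo 0 (ρ L)) :=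
    continuousOn_const.mul (continuousOn_const.add hm.cont.norm)
  have hρm : ∀ q ∈ Ioo 0 L, ρ q ∈ Ioo 0 (ρ L) := fun q hq => h.rho_mem ⟨hL.le, le_rfl⟩ hq
  have i2 := (integral_varIntegrand hL h hφ hb.le (continuousOn_varDens hL h hη)).1
  obtain ⟨N, hN⟩ := isCompact_Icc.exists_bound_of_continuousOn (continuousOn_flatVar hL h hη)
  have N0 : 0 ≤ N := (norm_nonneg _).trans (hN 0 ⟨le_rfl, hL.le⟩)
  have i1 : IntegrableOn (fun q => pairL (√(ρ q) • flatVar L μ η q)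
      (dBranch L ρ q • dsmearK b φ (ρ q))) (Ioo 0 L) := by
    obtain ⟨K, hK⟩ := exists_dsmearK_bound hL h hφ
    have m1 := aestronglyMeasurable_dsmearK_rho hL h hφ hβ
    have m2 : AEStronglyMeasurable (dBranch L ρ) (volume.restrict (Ioo 0 L)) :=
      ((contDiffOn_dBranch hL h.smooth_rho).continuousOn.mono
        Ioo_subset_Icc_self).aestronglyMeasurable measurableSet_Ioo
    have m3 : AEStronglyMeasurable (fun q => √(ρ q) • flatVar L μ η q)
        (volume.restrict (Ioo 0 L)) :=
      ((h.smooth_rho.continuousOn.sqrt.smul (continuousOn_flatVar hL h hη)).mono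
        Ioo_subset_Icc_self).aestronglyMeasurable measurableSet_Ioo
    have m4 : AEStronglyMeasurable (fun q => conj (dBranch L ρ q • dsmearK b φ (ρ q))
        * (√(ρ q) • flatVar L μ η q)) (volume.restrict (Ioo 0 L)) :=
      (Complex.continuous_conj.comp_aestronglyMeasurable (m2.smul m1)).mul m3
    refine Integrable.mono' (integrableOn_const_Ioo (K * N))
      (Complex.continuous_re.comp_aestronglyMeasurable m4) ?_
    filter_upwards [ae_restrict_mem measurableSet_Ioo] with q hq
    refine (abs_pairL_le _ _).trans ?_
    rw [norm_smul, norm_smul, Real.norm_of_nonneg (h.dBranch_rho_pos hq).le,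
      Real.norm_of_nonneg (Real.sqrt_nonneg _)]
    have h1 := hK q hq
    have h2 := mul_le_mul h1 (hN q (Ioo_subset_Icc_self hq)) (norm_nonneg _)
      ((by have := (h.dBranch_rho_pos hq).le; positivity : (0 : ℝ) ≤ _).trans h1)
    linarith
  -- the product whose derivative is the difference of the two sides
  set g : ℝ → ℝ := fun q => pairL (√(ρ q) • flatVar L μ η q) (smearK b φ (ρ q)) with hg
  have hd : ∀ q ∈ Ioo 0 L, HasDerivAt g
      (pairL (√(ρ q) • flatVar L μ η q) (dBranch L ρ q • dsmearK b φ (ρ q))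
        + (√(ρ q))⁻¹ * pairL (varDens L μ η ρ q) (smearK b φ (ρ q))) q := by
    intro q hq
    have hx := hρm q hq
    have hs := Real.sqrt_pos.2 hx.1
    have dρ := h.hasDerivAt_rho hq
    have dk := (hasDerivAt_smearK hφ hβ hx).scomp q dρ
    have dk' := Complex.conjCLE.toContinuousLinearMap.hasFDerivAt.comp_hasDerivAt q dk
    have dc := (dρ.sqrt hx.1.ne').smul (hasDerivAt_flatVar hL h hη hq)
    refine (Complex.reCLM.hasFDerivAt.comp_hasDerivAt q (dk'.mul dc)).congr_deriv ?_
    have e : √(ρ q) • dflatVar L μ η q + (dBranch L ρ q / (2 * √(ρ q))) • flatVar L μ η q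
        = (√(ρ q))⁻¹ • varDens L μ η ρ q := by
      rw [varDens, smul_add, smul_smul, smul_smul]
      congr 2
      · nth_rewrite 3 [← Real.mul_self_sqrt hx.1.le]
        field_simp
      · field_simp
    rw [e, ← smul_eq_mul (√(ρ q))⁻¹, pairL_apply, pairL_apply, ← Complex.smul_re, ← mul_smul_comm,
      ← Complex.add_re]
    rfl
  have hρt : Tendsto ρ (𝓝[>] 0) (𝓝 0) := by
    have := (h.smooth_rho.continuousOn.mono Ioo_subset_Icc_self : ContinuousOn ρ (Ioo 0 L))
    have h2 := (h.smooth_rho.continuousOn 0 ⟨le_rfl, hL.le⟩).mono_left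
      (nhdsWithin_mono 0 Ioo_subset_Icc_self)
    rwa [nhdsWithin_Ioo_eq_nhdsGT hL, h.rho_axis] at h2
  have hρL : Tendsto ρ (𝓝[<] L) (𝓝 (ρ L)) := by
    have h2 := (h.smooth_rho.continuousOn L ⟨hL.le, le_rfl⟩).mono_left
      (nhdsWithin_mono L Ioo_subset_Icc_self)
    rwa [nhdsWithin_Ioo_eq_nhdsLT hL] at h2
  have t0 : Tendsto g (𝓝[>] 0) (𝓝 0) := by
    set I := ∫ u in Ioo 0 b, (√u)⁻¹
    have h2 : Tendsto (fun q => I * C * N * ρ q) (𝓝[>] 0) (𝓝 0) := by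
      simpa using hρt.const_mul (I * C * N)
    refine squeeze_zero_norm' ?_ h2
    filter_upwards [Ioo_mem_nhdsGT hL] with q hq
    have hx := hρm q hq
    have e1 := norm_smearK_le hφ hx.1
    refine (abs_pairL_le _ _).trans ?_
    rw [norm_smul, Real.norm_of_nonneg (Real.sqrt_nonneg _)]
    have e2 := mul_le_mul e1 (mul_le_mul_of_nonneg_left (hN q (Ioo_subset_Icc_self hq))
      (Real.sqrt_nonneg (ρ q))) (by positivity) ((norm_nonneg _).trans e1)
    refine e2.trans (le_of_eq ?_)
    nth_rewrite 3 [← Real.mul_self_sqrt hx.1.le]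
    ring
  have tL : Tendsto g (𝓝[<] L) (𝓝 0) := by
    refine tendsto_const_nhds.congr' ?_
    filter_upwards [hρL.eventually (lt_mem_nhds hb)] with q hq
    simp only [hg, smearK_eq_zero hφ hq.le, map_zero]
  have key := intervalIntegral.integral_eq_sub_of_hasDerivAt_of_tendsto hL hd (by
    rw [intervalIntegrable_iff_integrableOn_Ioo_of_le hL.le]
    exact i1.add i2) t0 tL
  rw [intervalIntegral.integral_of_le hL.le, integral_Ioc_eq_integral_Ioo, integral_add i1 i2,
    sub_zero] at key
  linarith

/-- The functional derivative with respect to `μ` of a smeared component, in terms of the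
derivative `D` of the half-integral of its kernel. -/
def funDeriv (L : ℝ) (μ : ℝ → ℂ) (ρ : ℝ → ℝ) (D : ℝ → ℂ) (q : ℝ) : ℂ :=
  (-(1 / 2) * (dBranch L ρ q * √(ρ q) * (1 - ‖μ q‖ ^ 2)⁻¹) : ℝ)
    * (conj (D (ρ q)) * phase (theta L μ q))

theorem integrableOn_funDeriv (hL : 0 < L) (h : IsRegularData L μ ρ)
    (hφ : IsSmearedKernel b C (fun x => C * (1 + ‖prof L μ ρ x‖)) φ) :
    IntegrableOn (funDeriv L μ ρ (dsmearK b φ)) (Icc 0 L) := by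
  obtain ⟨m', hm⟩ := exists_isProfile hL h
  have hβ : ContinuousOn (fun x => C * (1 + ‖prof L μ ρ x‖)) (Ioo 0 (ρ L)) :=
    continuousOn_const.mul (continuousOn_const.add hm.cont.norm)
  obtain ⟨K, hK⟩ := exists_dsmearK_bound hL h hφ
  have cw := continuousOn_inv_one_sub h
  obtain ⟨W, hW⟩ := isCompact_Icc.exists_bound_of_continuousOn cw
  have m1 := aestronglyMeasurable_dsmearK_rho hL h hφ hβ
  have m2 : AEStronglyMeasurable (fun q => (((-(1 / 2) * (dBranch L ρ q * √(ρ q)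
      * (1 - ‖μ q‖ ^ 2)⁻¹) : ℝ)) : ℂ)) (volume.restrict (Ioo 0 L)) :=
    ((Complex.continuous_ofReal.comp_continuousOn (continuousOn_const.mul
      (((contDiffOn_dBranch hL h.smooth_rho).continuousOn.mul h.smooth_rho.continuousOn.sqrt).mul
        cw))).mono Ioo_subset_Icc_self).aestronglyMeasurable measurableSet_Ioo
  have m3 : AEStronglyMeasurable (fun q => phase (theta L μ q)) (volume.restrict (Ioo 0 L)) :=
    ((continuousOn_phase_theta hL h).mono Ioo_subset_Icc_self).aestronglyMeasurable
      measurableSet_Ioo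
  rw [integrableOn_Icc_iff_integrableOn_Ioo]
  refine Integrable.mono' (integrableOn_const_Ioo (1 / 2 * (K * W)))
    (m2.mul ((Complex.continuous_conj.comp_aestronglyMeasurable m1).mul m3)) ?_
  filter_upwards [ae_restrict_mem measurableSet_Ioo] with q hq
  have hρ' := (h.dBranch_rho_pos hq).le
  have w0 := (inv_pos.2 (one_sub_normSq_pos (h.norm_mu_lt q (Ioo_subset_Icc_self hq)))).le
  have hWq := hW q (Ioo_subset_Icc_self hq)
  rw [Real.norm_of_nonneg w0] at hWq
  rw [funDeriv, norm_mul, norm_mul, norm_phase, RCLike.norm_conj, Complex.norm_real,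
    Real.norm_eq_abs, abs_mul, abs_neg, abs_of_pos (by norm_num : (0 : ℝ) < 1 / 2), mul_one,
    abs_of_nonneg (by positivity)]
  have h1 := hK q hq
  have h2 := mul_le_mul h1 hWq w0 ((by positivity : (0 : ℝ) ≤ _).trans h1)
  linarith

/-- Smeared components of the deformed metric have integrable functional derivatives. -/
theorem isFunctionalDeriv_smearedE (hL : 0 < L) (h : IsRegularData L μ ρ) (ha : 0 < a)
    (hb : b < ρ L) (hf : IsWeight a b f f') (l : M2 →L[ℝ] ℝ)
    (hφ : IsSmearedKernel b C (fun x => C * (1 + ‖prof L μ ρ x‖))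
      (weightK (prof L μ ρ) (conjFrame (zweibein (μ 0)) l) f))
    {F : (ℝ → ℂ) → (ℝ → ℝ) → ℂ}
    (hF : ∀ ν, IsRegularData L ν ρ → F ν ρ = (smearedE L l f ν ρ : ℂ)) :
    IsFunctionalDeriv L F μ ρ
      (funDeriv L μ ρ (dsmearK b (weightK (prof L μ ρ) (conjFrame (zweibein (μ 0)) l) f)))
      (fun q => conj (funDeriv L μ ρ
        (dsmearK b (weightK (prof L μ ρ) (conjFrame (zweibein (μ 0)) l) f)) q)) := by
  set D := dsmearK b (weightK (prof L μ ρ) (conjFrame (zweibein (μ 0)) l) f)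
  have hi := integrableOn_funDeriv hL h hφ
  refine ⟨hi, Complex.conjCLE.toContinuousLinearMap.integrable_comp hi, fun η hη => ?_⟩
  obtain ⟨δ, _, δ0, _, hbd⟩ := exists_frameM_pert_le hL h hη
  have d := (hasDerivAt_smearedE hL h hη ha hb hf l).ofReal_comp
  have ev : (fun t : ℝ => F (fun x => μ x + t * η x) ρ)
      =ᶠ[𝓝 0] fun t => (smearedE L l f (pert μ η t) ρ : ℂ) := by
    filter_upwards [Metric.ball_mem_nhds 0 δ0] with t ht
    exact hF _ (hbd t (by simpa using ht)).1
  refine (d.congr_of_eventuallyEq ev).congr_deriv ?_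
  rw [integral_pairing_by_parts hL h hη hb hφ, intervalIntegral.integral_of_le hL.le,
    integral_Ioc_eq_integral_Ioo, ← integral_neg, ← integral_complex_ofReal]
  refine integral_congr_ae (ae_of_all _ fun q => ?_)
  have e : ∀ z : ℂ, z + conj z = ((2 * z.re : ℝ) : ℂ) := fun z => by
    rw [Complex.add_conj]
  simp only
  rw [← map_mul, e, pairL_apply, flatVar, symPart, funDeriv]
  congr 1
  generalize phase (theta L μ q) = p
  generalize (1 - ‖μ q‖ ^ 2)⁻¹ = w
  change -(conj (dBranch L ρ q • D (ρ q)) * (√(ρ q) • (p * w • η q))).re = _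
  simp
  ring

end Data

/-! ### The bracket of smeared components -/

section Data
variable {L : ℝ} {μ : ℝ → ℂ} {ρ : ℝ → ℝ} {b C : ℝ} {φ ψ : ℝ × ℝ → ℂ}

/-- The exponent in the bracket of `μ` with its conjugate is twice the angle by which the frame is
rotated between the two points. -/
theorem exp_integral_eq_phase (hL : 0 < L) (h : IsRegularData L μ ρ) {x y : ℝ}
    (hx : x ∈ Icc 0 L) (hy : y ∈ Icc 0 L) :
    Complex.exp (∫ z in x..y,
        (conj (μ z) * dBranch L μ z - μ z * conj (dBranch L μ z)) / ((1 - ‖μ z‖ ^ 2 : ℝ) : ℂ))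
      = phase (theta L μ y) * conj (phase (theta L μ x)) := by
  have e : ∀ z, (conj (μ z) * dBranch L μ z - μ z * conj (dBranch L μ z))
      / ((1 - ‖μ z‖ ^ 2 : ℝ) : ℂ) = 2 * Complex.I * (rotDens L μ z : ℂ) := by
    intro z
    rw [show μ z * conj (dBranch L μ z) = conj (conj (μ z) * dBranch L μ z) by simp,
      Complex.sub_conj, rotDens, rotPart]
    push_cast
    rw [div_eq_mul_inv]
    ring
  have hi : ∀ {q}, q ∈ Icc 0 L → IntervalIntegrable (rotDens L μ) volume 0 q := fun hq =>
    ((continuousOn_rotDens hL h).mono (Icc_subset_Icc_right hq.2)).intervalIntegrable_of_Icc hq.1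
  have e2 : ∫ z in x..y, rotDens L μ z = theta L μ y - theta L μ x :=
    (intervalIntegral.integral_interval_sub_left (hi hy) (hi hx)).symm
  simp_rw [e]
  rw [intervalIntegral.integral_const_mul, intervalIntegral.integral_ofReal, e2, phase, phase,
    ← Complex.exp_conj, ← Complex.exp_add]
  congr 1
  simp [Complex.conj_ofNat]
  ring

/-- In the bracket of two functional derivatives the phases and the factors of the bracket of `μ`
with its conjugate cancel, up to the step function. -/
theorem funDeriv_mul_muBarBracket (hL : 0 < L) (h : IsRegularData L μ ρ) (G₂ : ℝ) (D E : ℝ → ℂ)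
    {x y : ℝ} (hx : x ∈ Ioo 0 L) (hy : y ∈ Ioo 0 L) :
    funDeriv L μ ρ D x * conj (funDeriv L μ ρ E y) * muBarBracket G₂ L μ ρ x y
      = if y ≤ x then (Real.pi * G₂ : ℝ) *
        (conj (dBranch L ρ x • D (ρ x)) * dBranch L ρ y • E (ρ y)) else 0 := by
  have hx' := Ioo_subset_Icc_self hx
  have hy' := Ioo_subset_Icc_self hy
  rw [muBarBracket, exp_integral_eq_phase hL h hx' hy', funDeriv, funDeriv]
  split_ifs with hxy
  swap
  · simp
  have sx := (Real.sqrt_pos.2 (h.rho_mem ⟨hL.le, le_rfl⟩ hx).1).ne'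
  have sy := (Real.sqrt_pos.2 (h.rho_mem ⟨hL.le, le_rfl⟩ hy).1).ne'
  have wx := (one_sub_normSq_pos (h.norm_mu_lt x hx')).ne'
  have wy := (one_sub_normSq_pos (h.norm_mu_lt y hy')).ne'
  have px := phase_mul_conj (theta L μ x)
  have py := phase_mul_conj (theta L μ y)
  -- the constants combine as `(1/2)² · 4π G₂ = π G₂`
  have cx : √(ρ x) * (1 - ‖μ x‖ ^ 2)⁻¹ * ((1 - ‖μ x‖ ^ 2) / √(ρ x)) = 1 := by field_simp
  have cy : √(ρ y) * (1 - ‖μ y‖ ^ 2)⁻¹ * ((1 - ‖μ y‖ ^ 2) / √(ρ y)) = 1 := by field_simp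
  generalize phase (theta L μ x) = p at *
  generalize phase (theta L μ y) = q at *
  have cx' : ((√(ρ x) : ℝ) : ℂ) * (((1 - ‖μ x‖ ^ 2)⁻¹ : ℝ) : ℂ) * (((1 - ‖μ x‖ ^ 2) / √(ρ x) : ℝ) : ℂ)
      = 1 := by exact_mod_cast cx
  have cy' : ((√(ρ y) : ℝ) : ℂ) * (((1 - ‖μ y‖ ^ 2)⁻¹ : ℝ) : ℂ) * (((1 - ‖μ y‖ ^ 2) / √(ρ y) : ℝ) : ℂ)
      = 1 := by exact_mod_cast cy
  generalize (1 - ‖μ x‖ ^ 2)⁻¹ = u at *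
  generalize (1 - ‖μ y‖ ^ 2)⁻¹ = v at *
  generalize (1 - ‖μ x‖ ^ 2) / √(ρ x) = u' at *
  generalize (1 - ‖μ y‖ ^ 2) / √(ρ y) = v' at *
  simp only [map_mul, Complex.conj_ofReal, Complex.conj_conj, Complex.real_smul, Complex.ofReal_mul]
  push_cast
  linear_combination ((Real.pi : ℂ) * G₂ * (dBranch L ρ x : ℝ) * (dBranch L ρ y : ℝ) * conj (D (ρ x)) * E (ρ y)
      * (p * conj p) * (q * conj q)) * (cx' * ((√(ρ y) : ℝ) : ℂ) * (v : ℂ) * (v' : ℂ) + cy')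
    + (Real.pi : ℂ) * G₂ * (dBranch L ρ x : ℝ) * (dBranch L ρ y : ℝ) * conj (D (ρ x)) * E (ρ y)
      * (px * (q * conj q) + py)

/-- Integrable both at the axis, where the derivative of the half-integral is of order `ρ^(-1/2)`
plus the profile, and elsewhere. -/
theorem integrableOn_dsmearK_rho (hL : 0 < L) (h : IsRegularData L μ ρ)
    (hφ : IsSmearedKernel b C (fun x => C * (1 + ‖prof L μ ρ x‖)) φ) :
    IntegrableOn (fun q => dBranch L ρ q • dsmearK b φ (ρ q)) (Ioo 0 L) := by
  obtain ⟨m', hm⟩ := exists_isProfile hL h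
  have hβ : ContinuousOn (fun x => C * (1 + ‖prof L μ ρ x‖)) (Ioo 0 (ρ L)) :=
    continuousOn_const.mul (continuousOn_const.add hm.cont.norm)
  refine ((h.integral_rho ⟨hL.le, le_rfl⟩ (dsmearK b φ)).1).1 ?_
  have hd : ∀ x ∈ Ioo 0 (ρ L), deriv (smearK b φ) x = dsmearK b φ x := fun x hx =>
    (hasDerivAt_smearK hφ hβ hx).deriv
  have hmeas : AEStronglyMeasurable (dsmearK b φ) (volume.restrict (Ioo 0 (ρ L))) :=
    (measurable_deriv (smearK b φ)).aestronglyMeasurable.congr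
      ((ae_restrict_mem measurableSet_Ioo).mono hd)
  have i1 : IntegrableOn (fun x => C * (1 + ‖prof L μ ρ x‖)) (Ioo 0 (ρ L)) :=
    ((integrableOn_const_Ioo 1).add hm.int.norm).const_mul _
  have C0 : 0 ≤ C := (norm_nonneg _).trans (hφ.bound 1 2 one_pos one_lt_two)
  have hb : IntegrableOn (fun x => (∫ u in Ioo 0 b, (√u)⁻¹) * (C / 2 * (√x)⁻¹
      + √(ρ L) * (C * (1 + ‖prof L μ ρ x‖)))) (Ioo 0 (ρ L)) :=
    (((integrableOn_inv_sqrt _).const_mul _).add (i1.const_mul _)).const_mul _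
  refine Integrable.mono' hb hmeas ?_
  filter_upwards [ae_restrict_mem measurableSet_Ioo] with x hx
  refine (norm_dsmearK_le hφ hx.1).trans (mul_le_mul_of_nonneg_left ?_
    (integral_nonneg fun _ => by positivity))
  have h1 := Real.sqrt_le_sqrt hx.2.le
  have h2 := mul_le_mul_of_nonneg_right h1
    (show 0 ≤ C * (1 + ‖prof L μ ρ x‖) by positivity)
  have h3 : 1 / (2 * √x) * C = C / 2 * (√x)⁻¹ := by rw [one_div, mul_inv]; ring
  rw [shiftBound, h3]
  linarith

/-- The primitive of `dsmearK` along the branch, from the axis and from the outer end. -/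
theorem integral_dsmearK_rho (hL : 0 < L) (h : IsRegularData L μ ρ) (hb : b < ρ L)
    (hφ : IsSmearedKernel b C (fun x => C * (1 + ‖prof L μ ρ x‖)) φ) {x : ℝ} (hx : x ∈ Ioo 0 L) :
    ∫ q in Ioo 0 x, dBranch L ρ q • dsmearK b φ (ρ q) = smearK b φ (ρ x) ∧
    ∫ q in Ioo x L, dBranch L ρ q • dsmearK b φ (ρ q) = -smearK b φ (ρ x) := by
  obtain ⟨m', hm⟩ := exists_isProfile hL h
  have hβ : ContinuousOn (fun x => C * (1 + ‖prof L μ ρ x‖)) (Ioo 0 (ρ L)) :=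
    continuousOn_const.mul (continuousOn_const.add hm.cont.norm)
  have hρm : ∀ q ∈ Ioo 0 L, ρ q ∈ Ioo 0 (ρ L) := fun q hq => h.rho_mem ⟨hL.le, le_rfl⟩ hq
  have hi := integrableOn_dsmearK_rho hL h hφ
  have hd : ∀ q ∈ Ioo 0 L, HasDerivAt (fun q => smearK b φ (ρ q))
      (dBranch L ρ q • dsmearK b φ (ρ q)) q := fun q hq =>
    (hasDerivAt_smearK hφ hβ (hρm q hq)).scomp q (h.hasDerivAt_rho hq)
  have t0 : Tendsto (fun q => smearK b φ (ρ q)) (𝓝[>] 0) (𝓝 0) := by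
    have hρt : Tendsto (fun q => √(ρ q)) (𝓝[>] 0) (𝓝 0) := by
      have h2 := (h.smooth_rho.continuousOn.sqrt 0 ⟨le_rfl, hL.le⟩).mono_left
        (nhdsWithin_mono 0 Ioo_subset_Icc_self)
      rw [nhdsWithin_Ioo_eq_nhdsGT hL] at h2
      simp only [h.rho_axis, Real.sqrt_zero] at h2
      exact h2
    have h2 : Tendsto (fun q => (∫ u in Ioo 0 b, (√u)⁻¹) * (√(ρ q) * C)) (𝓝[>] 0) (𝓝 0) := by
      simpa using (hρt.mul_const C).const_mul (∫ u in Ioo 0 b, (√u)⁻¹)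
    refine squeeze_zero_norm' ?_ h2
    filter_upwards [Ioo_mem_nhdsGT hL] with q hq using norm_smearK_le hφ (hρm q hq).1
  have tL : Tendsto (fun q => smearK b φ (ρ q)) (𝓝[<] L) (𝓝 0) := by
    have hρL : Tendsto ρ (𝓝[<] L) (𝓝 (ρ L)) := by
      have h2 := (h.smooth_rho.continuousOn L ⟨hL.le, le_rfl⟩).mono_left
        (nhdsWithin_mono L Ioo_subset_Icc_self)
      rwa [nhdsWithin_Ioo_eq_nhdsLT hL] at h2
    refine tendsto_const_nhds.congr' ?_
    filter_upwards [hρL.eventually (lt_mem_nhds hb)] with q hq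
    exact (smearK_eq_zero hφ hq.le).symm
  have tx := (hd x hx).continuousAt
  constructor
  · have := intervalIntegral.integral_eq_sub_of_hasDerivAt_of_tendsto hx.1
      (fun q hq => hd q ⟨hq.1, hq.2.trans hx.2⟩) (by
        rw [intervalIntegrable_iff_integrableOn_Ioo_of_le hx.1.le]
        exact hi.mono_set (Ioo_subset_Ioo_right hx.2.le)) t0 (tx.tendsto.mono_left nhdsWithin_le_nhds)
    rwa [intervalIntegral.integral_of_le hx.1.le, integral_Ioc_eq_integral_Ioo, sub_zero] at this
  · have := intervalIntegral.integral_eq_sub_of_hasDerivAt_of_tendsto hx.2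
      (fun q hq => hd q ⟨hx.1.trans hq.1, hq.2⟩) (by
        rw [intervalIntegrable_iff_integrableOn_Ioo_of_le hx.2.le]
        exact hi.mono_set (Ioo_subset_Ioo_left hx.1.le)) (tx.tendsto.mono_left nhdsWithin_le_nhds) tL
    rwa [intervalIntegral.integral_of_le hx.2.le, integral_Ioc_eq_integral_Ioo, zero_sub] at this

/-- The integral over a part `T` of the square of a product, as an iterated integral. -/
theorem integral_indicator_mul {κ κ' : ℝ → ℂ} {c : ℂ} {T : Set (ℝ × ℝ)} (hT : MeasurableSet T)
    (h1 : IntegrableOn κ (Ioo 0 L)) (h2 : IntegrableOn κ' (Ioo 0 L)) :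
    Integrable (T.indicator fun p : ℝ × ℝ => c * (κ p.1 * κ' p.2))
      ((volume.restrict (Ioo 0 L)).prod (volume.restrict (Ioo 0 L))) ∧
    IntegrableOn (fun x => c * (κ x * ∫ y in Ioo 0 L, {y | (x, y) ∈ T}.indicator κ' y))
      (Ioo 0 L) ∧
    ∫ p, T.indicator (fun p : ℝ × ℝ => c * (κ p.1 * κ' p.2)) p
        ∂(volume.restrict (Ioo 0 L)).prod (volume.restrict (Ioo 0 L))
      = ∫ x in Ioo 0 L, c * (κ x * ∫ y in Ioo 0 L, {y | (x, y) ∈ T}.indicator κ' y) := by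
  have hi : Integrable (T.indicator fun p : ℝ × ℝ => c * (κ p.1 * κ' p.2))
      ((volume.restrict (Ioo 0 L)).prod (volume.restrict (Ioo 0 L))) :=
    (((Integrable.mul_prod h1 h2).const_mul c).indicator hT)
  have e : ∀ x, ∫ y in Ioo 0 L, T.indicator (fun p : ℝ × ℝ => c * (κ p.1 * κ' p.2)) (x, y)
      = c * (κ x * ∫ y in Ioo 0 L, {y | (x, y) ∈ T}.indicator κ' y) := by
    intro x
    rw [← integral_const_mul, ← integral_const_mul]
    refine integral_congr_ae (ae_of_all _ fun y => ?_)
    by_cases hxy : (x, y) ∈ T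
    · simp only [indicator_of_mem hxy]
      rw [indicator_of_mem (show y ∈ {y | (x, y) ∈ T} from hxy)]
    · simp only [indicator_of_notMem hxy]
      rw [indicator_of_notMem (show y ∉ {y | (x, y) ∈ T} from hxy)]
      simp
  refine ⟨hi, hi.integral_prod_left.congr (ae_of_all _ e), ?_⟩
  rw [integral_prod _ hi]
  exact integral_congr_ae (ae_of_all _ e)

/-- The bracket of two functionals whose functional derivatives come from half-integrals. -/
theorem hasPoissonBracket_funDeriv (hL : 0 < L) (h : IsRegularData L μ ρ) (G₂ : ℝ) (hb : b < ρ L)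
    (hφ : IsSmearedKernel b C (fun x => C * (1 + ‖prof L μ ρ x‖)) φ)
    (hψ : IsSmearedKernel b C (fun x => C * (1 + ‖prof L μ ρ x‖)) ψ)
    {F G : (ℝ → ℂ) → (ℝ → ℝ) → ℂ}
    (hF : IsFunctionalDeriv L F μ ρ (funDeriv L μ ρ (dsmearK b φ))
      (fun q => conj (funDeriv L μ ρ (dsmearK b φ) q)))
    (hG : IsFunctionalDeriv L G μ ρ (funDeriv L μ ρ (dsmearK b ψ))
      (fun q => conj (funDeriv L μ ρ (dsmearK b ψ) q))) :
    HasPoissonBracket G₂ L F G μ ρ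
      ((2 * Real.pi * G₂ * ∫ x in Ioo 0 (ρ L), ⟪dsmearK b φ x, smearK b ψ x⟫ : ℝ) : ℂ) := by
  set A : ℝ → ℂ := fun q => dBranch L ρ q • dsmearK b φ (ρ q) with hA
  set E : ℝ → ℂ := fun q => dBranch L ρ q • dsmearK b ψ (ρ q) with hE
  have iA : IntegrableOn A (Ioo 0 L) := integrableOn_dsmearK_rho hL h hφ
  have iE : IntegrableOn E (Ioo 0 L) := integrableOn_dsmearK_rho hL h hψ
  have iA' : IntegrableOn (fun q => conj (A q)) (Ioo 0 L) :=
    Complex.conjCLE.toContinuousLinearMap.integrable_comp iA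
  have iE' : IntegrableOn (fun q => conj (E q)) (Ioo 0 L) :=
    Complex.conjCLE.toContinuousLinearMap.integrable_comp iE
  -- the two terms of the bracket live on the two triangles cut out by the step function
  set c : ℂ := ((Real.pi * G₂ : ℝ) : ℂ) with hc
  set T₁ : Set (ℝ × ℝ) := {p | p.2 ≤ p.1} with hT₁
  set T₂ : Set (ℝ × ℝ) := {p | p.1 ≤ p.2} with hT₂
  have mT₁ : MeasurableSet T₁ := measurableSet_le measurable_snd measurable_fst
  have mT₂ : MeasurableSet T₂ := measurableSet_le measurable_fst measurable_snd
  have hν : volume.restrict (Icc 0 L ×ˢ Icc 0 L)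
      = (volume.restrict (Ioo 0 L)).prod (volume.restrict (Ioo (0 : ℝ) L)) := by
    rw [Measure.volume_eq_prod, ← Measure.prod_restrict,
      Measure.restrict_congr_set Ioo_ae_eq_Icc.symm]
  have hmem : ∀ᵐ p ∂volume.restrict (Icc 0 L ×ˢ Icc 0 L), p ∈ Ioo 0 L ×ˢ Ioo 0 L := by
    rw [hν, Measure.prod_restrict]
    exact ae_restrict_mem (measurableSet_Ioo.prod measurableSet_Ioo)
  obtain ⟨j1, k1, e1⟩ := integral_indicator_mul (c := c) mT₁ iA' iE
  obtain ⟨j2, k2, e2⟩ := integral_indicator_mul (c := c) mT₂ iA iE'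
  rw [← hν] at j1 j2 e1 e2
  have a1 : (T₁.indicator fun p : ℝ × ℝ => c * (conj (A p.1) * E p.2))
      =ᵐ[volume.restrict (Icc 0 L ×ˢ Icc 0 L)] fun p =>
        funDeriv L μ ρ (dsmearK b φ) p.1 * conj (funDeriv L μ ρ (dsmearK b ψ) p.2)
          * muBarBracket G₂ L μ ρ p.1 p.2 := by
    filter_upwards [hmem] with p hp
    rw [funDeriv_mul_muBarBracket hL h G₂ _ _ hp.1 hp.2]
    rfl
  have a2 : (T₂.indicator fun p : ℝ × ℝ => c * (A p.1 * conj (E p.2)))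
      =ᵐ[volume.restrict (Icc 0 L ×ˢ Icc 0 L)] fun p =>
        conj (funDeriv L μ ρ (dsmearK b φ) p.1) * funDeriv L μ ρ (dsmearK b ψ) p.2
          * muBarBracket G₂ L μ ρ p.2 p.1 := by
    filter_upwards [hmem] with p hp
    rw [mul_comm (conj _), funDeriv_mul_muBarBracket hL h G₂ _ _ hp.2 hp.1, mul_comm (conj _)]
    rfl
  refine ⟨_, _, _, _, hF, hG, j1.congr a1, j2.congr a2, ?_⟩
  rw [integral_sub (j1.congr a1) (j2.congr a2), ← integral_congr_ae a1, ← integral_congr_ae a2,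
    e1, e2]
  -- on the triangles one derivative is integrated back, from the axis or from the outer end
  have s1 : ∀ x ∈ Ioo 0 L, ∫ y in Ioo 0 L, {y | (x, y) ∈ T₁}.indicator E y
      = smearK b ψ (ρ x) := by
    intro x hx
    rw [← (integral_dsmearK_rho hL h hb hψ hx).1,
      setIntegral_indicator (show MeasurableSet {y | (x, y) ∈ T₁} from
        measurableSet_le measurable_id measurable_const),
      ← integral_Ioc_eq_integral_Ioo (x := (0 : ℝ)) (y := x)]
    congr 2
    ext y
    simp only [mem_inter_iff, mem_Ioo, mem_ofPred_eq, mem_Ioc, hT₁]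
    exact ⟨fun hy => ⟨hy.1.1, hy.2⟩, fun hy => ⟨⟨hy.1, hy.2.trans_lt hx.2⟩, hy.2⟩⟩
  have s2 : ∀ x ∈ Ioo 0 L, ∫ y in Ioo 0 L, {y | (x, y) ∈ T₂}.indicator (fun y => conj (E y)) y
      = -conj (smearK b ψ (ρ x)) := by
    intro x hx
    rw [← map_neg, ← (integral_dsmearK_rho hL h hb hψ hx).2, ← integral_conj,
      setIntegral_indicator (show MeasurableSet {y | (x, y) ∈ T₂} from
        measurableSet_le measurable_const measurable_id),
      ← integral_Ico_eq_integral_Ioo (x := x) (y := L)]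
    congr 2
    ext y
    simp only [mem_inter_iff, mem_Ioo, mem_ofPred_eq, mem_Ico, hT₂]
    exact ⟨fun hy => ⟨hy.2, hy.1.2⟩, fun hy => ⟨⟨hx.1.trans_le hy.1, hy.2⟩, hy.1⟩⟩
  rw [← integral_sub k1 k2, (h.integral_rho ⟨hL.le, le_rfl⟩ _).2, ← integral_const_mul,
    ← integral_complex_ofReal]
  refine setIntegral_congr_fun measurableSet_Ioo fun x hx => ?_
  rw [s1 x hx, s2 x hx, hc, smul_eq_mul, ← real_inner_smul_left, Complex.inner, hA]
  simp only
  generalize dBranch L ρ x • dsmearK b φ (ρ x) = z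
  generalize smearK b ψ (ρ x) = w
  apply Complex.ext <;> simp <;> ring

end Data

/-- The frame of the axis is absorbed into the matrix that takes components. -/
theorem conjFrame_entryL (V A : M2) (i j : Fin 2) :
    conjFrame V (entryL A i j) = entryL (A * V) i j := by
  ext X
  rw [conjFrame_apply, entryL_apply, entryL_apply, Matrix.transpose_mul]
  simp only [Matrix.mul_assoc]

/-! ### Weights from test functions -/

theorem IsWeight.mono {a b a' b' : ℝ} {f f' : ℝ → ℝ} (hf : IsWeight a b f f') (ha : a' ≤ a)
    (hb : b ≤ b') : IsWeight a' b' f f' :=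
  ⟨hf.deriv, hf.cont_deriv, fun y hy => hf.support y fun h => hy (Ioo_subset_Ioo ha hb h)⟩

/-- A function with continuous derivative on `(0, Y)` that vanishes off `(a, b)` is a weight on the
whole line. -/
theorem isWeight_of_hasDerivAt {a b Y : ℝ} {f D : ℝ → ℝ} (ha : 0 < a) (hb : b < Y)
    (hd : ∀ y ∈ Ioo 0 Y, HasDerivAt f (D y) y) (hD : ContinuousOn D (Ioo 0 Y))
    (hs : ∀ y, y ∉ Ioo a b → f y = 0) : IsWeight a b f (deriv f) := by
  -- off `(0, Y)` the function vanishes in a neighbourhood, because `[a, b]` is inside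
  have hout : ∀ y, y ∉ Ioo 0 Y → f =ᶠ[𝓝 y] 0 := by
    intro y hy
    have : (Icc a b)ᶜ ∈ 𝓝 y := isClosed_Icc.isOpen_compl.mem_nhds fun h =>
      hy ⟨ha.trans_le h.1, h.2.trans_lt hb⟩
    filter_upwards [this] with z hz using hs z fun h => hz (Ioo_subset_Icc_self h)
  refine ⟨fun y => ?_, continuous_iff_continuousAt.2 fun y => ?_, hs⟩
  · by_cases hy : y ∈ Ioo 0 Y
    · exact (hd y hy).differentiableAt.hasDerivAt
    · exact ((hasDerivAt_const y (0 : ℝ)).congr_of_eventuallyEq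
        (hout y hy)).differentiableAt.hasDerivAt
  · by_cases hy : y ∈ Ioo 0 Y
    · have hn : Ioo 0 Y ∈ 𝓝 y := isOpen_Ioo.mem_nhds hy
      refine (hD.continuousAt hn).congr ?_
      filter_upwards [hn] with z hz using (hd z hz).deriv.symm
    · have : deriv f =ᶠ[𝓝 y] fun _ => 0 := by
        refine (hout y hy).deriv.trans (Eventually.of_forall fun z => ?_)
        exact deriv_const z 0
      exact continuousAt_const.congr this.symm

/-- The support of a test function lies in a smaller open interval, which is nonempty even if the
function is zero. -/
theorem IsTestFunction.exists_support {s t : ℝ} {f : ℝ → ℝ} (hst : s < t)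
    (hf : IsTestFunction (Ioo s t) f) :
    ∃ a b, s < a ∧ a < b ∧ b < t ∧ ∀ x, x ∉ Ioo a b → f x = 0 := by
  rcases (tsupport f).eq_empty_or_nonempty with he | hne
  · refine ⟨(2 * s + t) / 3, (s + 2 * t) / 3, by linarith, by linarith, by linarith, fun x _ => ?_⟩
    exact image_eq_zero_of_notMem_tsupport (by rw [he]; exact fun h => h)
  · obtain ⟨p, hp, hpl⟩ := hf.compact.exists_isLeast hne
    obtain ⟨q, hq, hqg⟩ := hf.compact.exists_isGreatest hne
    have h1 := hf.support hp
    have h2 := hf.support hq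
    have h3 : p ≤ q := hpl hq
    refine ⟨(s + p) / 2, (q + t) / 2, by linarith [h1.1], by linarith [h1.1, h2.2],
      by linarith [h2.2], fun x hx => image_eq_zero_of_notMem_tsupport fun hxs => hx ⟨?_, ?_⟩⟩
    · linarith [hpl hxs, h1.1]
    · linarith [hqg hxs, h2.2]

theorem IsTestFunction.integral_eq {S : Set ℝ} {f : ℝ → ℝ} (hf : IsTestFunction S f) (Φ : ℝ → ℝ) :
    ∫ x, f x * Φ x = ∫ x in S, f x * Φ x :=
  (setIntegral_eq_integral_of_forall_compl_eq_zero fun x hx => by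
    rw [image_eq_zero_of_notMem_tsupport fun h => hx (hf.support h), zero_mul]).symm

section Data
variable {L : ℝ} {μ : ℝ → ℂ} {ρ : ℝ → ℝ}

/-- A test function on the branch as a weight in terms of the area density. -/
def branchWeight (L : ℝ) (ρ : ℝ → ℝ) (f : ℝ → ℝ) (y : ℝ) : ℝ :=
  (Ioo 0 (ρ L)).indicator (fun y => f (rInv L ρ y) / dBranch L ρ (rInv L ρ y)) y

theorem branchWeight_rho (hL : 0 < L) (h : IsRegularData L μ ρ) (f : ℝ → ℝ) {x : ℝ}
    (hx : x ∈ Ioo 0 L) : branchWeight L ρ f (ρ x) = f x / dBranch L ρ x := by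
  rw [branchWeight, indicator_of_mem (h.rho_mem ⟨hL.le, le_rfl⟩ hx),
    h.rInv_rho (Ioo_subset_Icc_self hx)]

/-- Off the axis the inverse of the area density is continuously differentiable, so test functions
on the branch become weights. -/
theorem exists_isWeight_branchWeight (hL : 0 < L) (h : IsRegularData L μ ρ) {f : ℝ → ℝ}
    (hf : IsTestFunction (Ioo 0 L) f) : ∃ a b f', 0 < a ∧ a < b ∧ b < ρ L ∧
      IsWeight a b (branchWeight L ρ f) f' := by
  obtain ⟨p, q, hp, hpq, hq, hs⟩ := hf.exists_support hL
  have hpI : p ∈ Ioo 0 L := ⟨hp, hpq.trans hq⟩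
  have hqI : q ∈ Ioo 0 L := ⟨hp.trans hpq, hq⟩
  have hap := h.rho_mem ⟨hL.le, le_rfl⟩ hpI
  have hbq := h.rho_mem ⟨hL.le, le_rfl⟩ hqI
  have cρ' := contDiffOn_dBranch hL h.smooth_rho
  have cr : ContinuousOn (rInv L ρ) (Ioo 0 (ρ L)) := fun y hy =>
    (h.hasDerivAt_rInv hL hy).continuousAt.continuousWithinAt
  have mr : MapsTo (rInv L ρ) (Ioo 0 (ρ L)) (Icc 0 L) := fun y hy =>
    Ioo_subset_Icc_self (h.rInv_mem hL hy).1
  have c1 : ContinuousOn (fun y => dBranch L ρ (rInv L ρ y)) (Ioo 0 (ρ L)) :=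
    cρ'.continuousOn.comp cr mr
  have c2 : ContinuousOn (fun y => dBranch L (dBranch L ρ) (rInv L ρ y)) (Ioo 0 (ρ L)) :=
    (contDiffOn_dBranch hL cρ').continuousOn.comp cr mr
  have n1 : ∀ y ∈ Ioo 0 (ρ L), dBranch L ρ (rInv L ρ y) ≠ 0 := fun y hy =>
    (h.dBranch_rho_pos (h.rInv_mem hL hy).1).ne'
  have cf : ContinuousOn (fun y => f (rInv L ρ y)) (Ioo 0 (ρ L)) :=
    hf.smooth.continuous.comp_continuousOn cr
  have cf' : ContinuousOn (fun y => deriv f (rInv L ρ y)) (Ioo 0 (ρ L)) :=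
    (hf.smooth.continuous_deriv (by simp)).comp_continuousOn cr
  refine ⟨ρ p, ρ q, _, hap.1, h.strictMonoOn_rho (Ioo_subset_Icc_self hpI)
    (Ioo_subset_Icc_self hqI) hpq, hbq.2, isWeight_of_hasDerivAt (Y := ρ L) hap.1 hbq.2
    (D := fun y => (deriv f (rInv L ρ y) * (dBranch L ρ (rInv L ρ y))⁻¹ * dBranch L ρ (rInv L ρ y)
      - f (rInv L ρ y) * (dBranch L (dBranch L ρ) (rInv L ρ y) * (dBranch L ρ (rInv L ρ y))⁻¹))
      / dBranch L ρ (rInv L ρ y) ^ 2) (fun y hy => ?_) ?_ fun y hy => ?_⟩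
  · obtain ⟨hr, hρr⟩ := h.rInv_mem hL hy
    have dr := h.hasDerivAt_rInv hL hy
    have df : HasDerivAt (fun y => f (rInv L ρ y)) _ y :=
      ((hf.smooth.differentiable (by simp) _).hasDerivAt).comp y dr
    have dd : HasDerivAt (fun y => dBranch L ρ (rInv L ρ y)) _ y :=
      (hasDerivAt_of_contDiffOn cρ' hr).comp y dr
    refine (df.div dd (n1 y hy)).congr_of_eventuallyEq ?_
    filter_upwards [isOpen_Ioo.mem_nhds hy] with z hz
    rw [branchWeight, indicator_of_mem hz]
    rfl
  · exact (((cf'.mul (c1.inv₀ n1)).mul c1).sub (cf.mul (c2.mul (c1.inv₀ n1)))).div (c1.pow 2)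
      fun y hy => pow_ne_zero 2 (n1 y hy)
  · by_cases hyI : y ∈ Ioo 0 (ρ L)
    · obtain ⟨hr, hρr⟩ := h.rInv_mem hL hyI
      rw [branchWeight, indicator_of_mem hyI, hs, zero_div]
      intro hr'
      refine hy ⟨?_, ?_⟩
      · rw [← hρr]
        exact h.strictMonoOn_rho (Ioo_subset_Icc_self hpI) (Ioo_subset_Icc_self hr) hr'.1
      · rw [← hρr]
        exact h.strictMonoOn_rho (Ioo_subset_Icc_self hr) (Ioo_subset_Icc_self hqI) hr'.2
    · rw [branchWeight, indicator_of_notMem hyI]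

/-- Smearing along the branch, in terms of the area density; the weight contains the Jacobian. -/
theorem smeared_eq_smearedE (hL : 0 < L) (h : IsRegularData L μ ρ) {f : ℝ → ℝ}
    (hf : IsTestFunction (Ioo 0 L) f) (l : M2 →L[ℝ] ℝ) (ν : ℝ → ℂ) :
    ∫ x, f x * l (deformedMetric L ν ρ x) = smearedE L l (branchWeight L ρ f) ν ρ := by
  rw [hf.integral_eq, smearedE, (h.integral_rho ⟨hL.le, le_rfl⟩ _).2]
  refine setIntegral_congr_fun measurableSet_Ioo fun x hx => ?_
  simp only [branchWeight_rho hL h f hx, h.rInv_rho (Ioo_subset_Icc_self hx), smul_eq_mul]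
  have := (h.dBranch_rho_pos hx).ne'
  field_simp

/-- A test function of the spectral parameter as a weight in terms of the area density. -/
def spectralWeight (ρplus : ℝ) (f : ℝ → ℝ) (y : ℝ) : ℝ := 2 * f (2 * y - ρplus)

theorem exists_isWeight_spectralWeight {ρplus Y : ℝ} (hY : 0 < Y) {f : ℝ → ℝ}
    (hf : IsTestFunction (Ioo (-ρplus) (2 * Y - ρplus)) f) : ∃ a b f', 0 < a ∧ a < b ∧ b < Y ∧
      IsWeight a b (spectralWeight ρplus f) f' := by
  obtain ⟨p, q, hp, hpq, hq, hs⟩ := hf.exists_support (by linarith)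
  have hd : ∀ y, HasDerivAt (spectralWeight ρplus f) (2 * (deriv f (2 * y - ρplus) * 2)) y := by
    intro y
    have h1 : HasDerivAt (fun y => 2 * y - ρplus) 2 y := by
      simpa using ((hasDerivAt_id y).const_mul 2).sub_const ρplus
    exact (((hf.smooth.differentiable (by simp) _).hasDerivAt).comp y h1).const_mul 2
  have hc := hf.smooth.continuous_deriv (by simp)
  refine ⟨(p + ρplus) / 2, (q + ρplus) / 2, _, by linarith, by linarith, by linarith, hd,
    by fun_prop, fun y hy => ?_⟩
  rw [spectralWeight, hs _ fun h => hy ⟨by linarith [h.1], by linarith [h.2]⟩, mul_zero]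

/-- Smearing in the spectral parameter `w = 2y - ρ⁺`, in terms of the area density `y`. -/
theorem smeared_spectral_eq_smearedE {ρplus : ℝ} {f : ℝ → ℝ}
    (hf : IsTestFunction (Ioo (-ρplus) (2 * ρ L - ρplus)) f) (l : M2 →L[ℝ] ℝ) (ν : ℝ → ℂ) :
    ∫ w, f w * l (monodromy L ρplus ν ρ w) = smearedE L l (spectralWeight ρplus f) ν ρ := by
  set G : ℝ → ℝ := fun w => f w * l (monodromy L ρplus ν ρ w) with hG
  have e1 : ∫ y, G (2 * y - ρplus) = 2⁻¹ * ∫ w, G w := by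
    have h2 := Measure.integral_comp_mul_left (fun w : ℝ => G (w - ρplus)) 2
    rw [integral_sub_right_eq_self G ρplus, smul_eq_mul, abs_of_pos (by norm_num)] at h2
    exact h2
  have e2 : smearedE L l (spectralWeight ρplus f) ν ρ = ∫ y, 2 * G (2 * y - ρplus) := by
    rw [smearedE, ← setIntegral_eq_integral_of_forall_compl_eq_zero (s := Ioo 0 (ρ L))
      (f := fun y => 2 * G (2 * y - ρplus))]
    · refine integral_congr_ae (ae_of_all _ fun y => ?_)
      simp only [hG, monodromy, pointOfSpectral, spectralWeight, rInv, sub_add_cancel, mul_assoc]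
      rw [mul_div_cancel_left₀ y two_ne_zero]
    · intro y hy
      change 2 * (f (2 * y - ρplus) * _) = 0
      rw [image_eq_zero_of_notMem_tsupport (f := f) (x := 2 * y - ρplus)
        fun hs => hy ⟨by linarith [(hf.support hs).1],
        by linarith [(hf.support hs).2]⟩]
      simp
  rw [e2, integral_const_mul, e1]
  ring

end Data

/-! ### The brackets -/

theorem continuousOn_quadE_flatMetric {Y : ℝ} {m m' : ℝ → ℂ} (hm : IsProfile Y m m') (A : M2)
    (i j k l : Fin 2) :
    ContinuousOn (fun p : ℝ × ℝ => quadE (A * flatMetric m p.1 * Aᵀ) (A * flatMetric m p.2 * Aᵀ)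
      (i, k) (j, l)) (Ioo 0 Y ×ˢ Ioo 0 Y) := by
  have hs : ∀ y, (A * flatMetric m y * Aᵀ)ᵀ = A * flatMetric m y * Aᵀ := fun y => by
    simp [Matrix.transpose_mul, flatMetric_transpose, Matrix.mul_assoc]
  simp only [quadE_apply (hs _) (hs _), ← entryL_apply]
  have c1 : ∀ a b, ContinuousOn (fun p : ℝ × ℝ => entryL A a b (flatMetric m p.1))
      (Ioo 0 Y ×ˢ Ioo 0 Y) := fun a b => (entryL A a b).continuous.comp_continuousOn
    ((continuousOn_flatMetric hm).comp continuousOn_fst fun p hp => hp.1)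
  have c2 : ∀ a b, ContinuousOn (fun p : ℝ × ℝ => entryL A a b (flatMetric m p.2))
      (Ioo 0 Y ×ˢ Ioo 0 Y) := fun a b => (entryL A a b).continuous.comp_continuousOn
    ((continuousOn_flatMetric hm).comp continuousOn_snd fun p hp => hp.2)
  exact (continuousOn_const.mul (((((c1 _ _).mul (c2 _ _)).add ((c1 _ _).mul (c2 _ _))).add
    ((c1 _ _).mul (c2 _ _))).add ((c1 _ _).mul (c2 _ _)))).sub
      (continuousOn_const.mul ((c1 _ _).mul (c2 _ _)))

/-- The density is continuous with compact support in the open square. -/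
theorem integrableOn_bracketDensity {Y a b : ℝ} {m m' : ℝ → ℂ} {f f' g g' : ℝ → ℝ}
    (hm : IsProfile Y m m') (ha : 0 < a) (hb : b < Y)
    (hf : IsWeight a b f f') (hg : IsWeight a b g g') (A : M2) (i j k l : Fin 2) :
    IntegrableOn (bracketDensity m (entryL A i j) (entryL A k l) f g) (Ioo 0 Y ×ˢ Ioo 0 Y) := by
  have sub : Icc a b ×ˢ Icc a b ⊆ Ioo 0 Y ×ˢ Ioo 0 Y :=
    prod_mono (Icc_subset_Ioo ha hb) (Icc_subset_Ioo ha hb)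
  have c : ContinuousOn (bracketDensity m (entryL A i j) (entryL A k l) f g)
      (Icc a b ×ˢ Icc a b) := by
    have c := ((hf.cont.comp continuous_fst).mul (hg.cont.comp continuous_snd)).continuousOn.mul
      ((continuousOn_const (c := (8 : ℝ))).mul ((continuousOn_quadE_flatMetric hm A i j k l).mono sub))
    refine c.congr fun p hp => ?_
    rw [bracketDensity, axisPairing_entryL hm A i j k l (sub hp).1 (sub hp).2]
    rfl
  refine IntegrableOn.of_forall_sdiff_eq_zero
    (c.integrableOn_compact (isCompact_Icc.prod isCompact_Icc))
    (measurableSet_Ioo.prod measurableSet_Ioo) fun p hp => ?_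
  have hp' : p.1 ∉ Icc a b ∨ p.2 ∉ Icc a b := by
    by_contra hc
    push Not at hc
    exact hp.2 hc
  rw [bracketDensity]
  rcases hp' with h | h
  · rw [hf.support _ fun h' => h (Ioo_subset_Icc_self h'), zero_mul, zero_mul]
  · rw [hg.support _ fun h' => h (Ioo_subset_Icc_self h'), mul_zero, zero_mul]

section Data
variable {L : ℝ} {μ : ℝ → ℂ} {ρ : ℝ → ℝ}

/-- The bracket of two smeared components of `A E Aᵗ`, in terms of the area density. -/
theorem exists_hasPoissonBracket_smearedE (hL : 0 < L) (h : IsRegularData L μ ρ) (G₂ : ℝ) (A : M2)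
    (i j k l : Fin 2) {f g : ℝ → ℝ}
    (hf : ∃ a b f', 0 < a ∧ a < b ∧ b < ρ L ∧ IsWeight a b f f')
    (hg : ∃ a b g', 0 < a ∧ a < b ∧ b < ρ L ∧ IsWeight a b g g')
    {F G : (ℝ → ℂ) → (ℝ → ℝ) → ℂ}
    (hF : ∀ ν, IsRegularData L ν ρ → F ν ρ = (smearedE L (entryL A i j) f ν ρ : ℂ))
    (hG : ∀ ν, IsRegularData L ν ρ → G ν ρ = (smearedE L (entryL A k l) g ν ρ : ℂ)) :
    ∃ B : ℝ, HasPoissonBracket G₂ L F G μ ρ (B : ℂ) ∧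
      Tendsto (fun ε : ℝ =>
        ∫ p in {p : ℝ × ℝ | p.1 ∈ Ioo 0 (ρ L) ∧ p.2 ∈ Ioo 0 (ρ L) ∧ ε < |p.1 - p.2|},
          f p.1 * g p.2 * (16 * Real.pi * G₂ * quadE (A * deformedMetric L μ ρ (rInv L ρ p.1) * Aᵀ)
            (A * deformedMetric L μ ρ (rInv L ρ p.2) * Aᵀ) (i, k) (j, l)) / (p.1 - p.2))
        (𝓝[>] 0) (𝓝 B) := by
  obtain ⟨a₁, b₁, f', ha₁, hab₁, hb₁, hf⟩ := hf
  obtain ⟨a₂, b₂, g', ha₂, hab₂, hb₂, hg⟩ := hg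
  obtain ⟨m', hm⟩ := exists_isProfile hL h
  -- a common interval for the two weights, and a common constant for the two kernels
  have ha : 0 < min a₁ a₂ := lt_min ha₁ ha₂
  have hb : max b₁ b₂ < ρ L := max_lt hb₁ hb₂
  have hab : min a₁ a₂ < max b₁ b₂ :=
    (min_le_left _ _).trans_lt (hab₁.trans_le (le_max_left _ _))
  replace hf := hf.mono (min_le_left a₁ a₂) (le_max_left b₁ b₂)
  replace hg := hg.mono (min_le_right a₁ a₂) (le_max_right b₁ b₂)
  set a := min a₁ a₂
  set b := max b₁ b₂
  set A' := A * zweibein (μ 0) with hA'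
  obtain ⟨C₁, -, h1⟩ := exists_isSmearedKernel hm ha hb hf (conjFrame (zweibein (μ 0)) (entryL A i j))
  obtain ⟨C₂, -, h2⟩ := exists_isSmearedKernel hm ha hb hg (conjFrame (zweibein (μ 0)) (entryL A k l))
  have k1 := h1 (max C₁ C₂) (le_max_left _ _)
  have k2 := h2 (max C₁ C₂) (le_max_right _ _)
  have key := hasPoissonBracket_funDeriv hL h G₂ hb k1 k2
    (isFunctionalDeriv_smearedE hL h ha hb hf _ k1 hF)
    (isFunctionalDeriv_smearedE hL h ha hb hg _ k2 hG)
  rw [conjFrame_entryL, conjFrame_entryL] at key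
  obtain ⟨j1, j2⟩ := integral_smearK_weightK hm ha hab hb hf hg (entryL A' i j) (entryL A' k l)
  rw [j2] at key
  refine ⟨_, key, ?_⟩
  -- the factor `16π G₂` is `2π G₂` times the `8` of `axisPairing_entryL`
  refine ((tendsto_truncated (integrableOn_bracketDensity hm ha hb hf hg A' i j k l) j1).const_mul
    (2 * Real.pi * G₂)).congr fun ε => ?_
  rw [← integral_const_mul]
  refine setIntegral_congr_fun ?_ fun p hp => ?_
  · exact measurableSet_Ioo.preimage measurable_fst |>.inter
      ((measurableSet_Ioo.preimage measurable_snd).inter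
        (measurableSet_lt measurable_const (measurable_fst.sub measurable_snd).abs))
  obtain ⟨r1, e1⟩ := h.rInv_mem hL hp.1
  obtain ⟨r2, e2⟩ := h.rInv_mem hL hp.2.1
  have t : ∀ X : M2, A * (zweibein (μ 0) * X * (zweibein (μ 0))ᵀ) * Aᵀ = A' * X * A'ᵀ := fun X => by
    rw [hA', Matrix.transpose_mul]
    simp only [Matrix.mul_assoc]
  simp only [bracketDensity]
  rw [axisPairing_entryL hm A' i j k l hp.1 hp.2.1, deformedMetric_eq_flatMetric hL h r1,
    deformedMetric_eq_flatMetric hL h r2, e1, e2, t, t]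
  ring

/-- The brackets of the deformed metric: `A = 1`, and the principal value is transformed from `y` to
the coordinate on the branch. -/
theorem exists_hasPoissonBracket_deformedMetric (hL : 0 < L) (h : IsRegularData L μ ρ) (G₂ : ℝ)
    {f g : ℝ → ℝ} (hf : IsTestFunction (Ioo 0 L) f) (hg : IsTestFunction (Ioo 0 L) g)
    (a b c d : Fin 2) : ∃ B : ℝ,
      HasPoissonBracket G₂ L (smeared f fun μ' ρ' x => deformedMetric L μ' ρ' x a b)
        (smeared g fun μ' ρ' x => deformedMetric L μ' ρ' x c d) μ ρ (B : ℂ) ∧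
      HasPrincipalValue (Ioo 0 L) ρ (fun x y => f x * g y * (16 * Real.pi * G₂ *
        quadE (deformedMetric L μ ρ x) (deformedMetric L μ ρ y) (a, c) (b, d))) B := by
  obtain ⟨B, hB, hT⟩ := exists_hasPoissonBracket_smearedE hL h G₂ 1 a b c d
    (exists_isWeight_branchWeight hL h hf) (exists_isWeight_branchWeight hL h hg)
    (F := smeared f fun μ' ρ' x => deformedMetric L μ' ρ' x a b)
    (G := smeared g fun μ' ρ' x => deformedMetric L μ' ρ' x c d)
    (fun ν _ => by rw [← smeared_eq_smearedE hL h hf]; simp [smeared])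
    (fun ν _ => by rw [← smeared_eq_smearedE hL h hg]; simp [smeared])
  refine ⟨B, hB, hasPrincipalValue_of_tendsto measurableSet_Ioo one_pos (fun x _ y _ => ?_)
    (fun x hx => h.hasDerivAt_rho hx) (fun x hx => h.dBranch_rho_pos hx) h.injOn_rho
    (h.image_rho ⟨hL.le, le_rfl⟩) (fun x hx y hy => ?_)
    (Ψ := fun p => branchWeight L ρ f p.1 * branchWeight L ρ g p.2 * (16 * Real.pi * G₂ *
      quadE (1 * deformedMetric L μ ρ (rInv L ρ p.1) * (1 : M2)ᵀ)
        (1 * deformedMetric L μ ρ (rInv L ρ p.2) * (1 : M2)ᵀ) (a, c) (b, d))) hT⟩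
  · rw [one_mul]
  · simp only [branchWeight_rho hL h _ hx, branchWeight_rho hL h _ hy,
      h.rInv_rho (Ioo_subset_Icc_self hx), h.rInv_rho (Ioo_subset_Icc_self hy),
      Matrix.transpose_one, Matrix.mul_one, Matrix.one_mul]
    have := (h.dBranch_rho_pos hx).ne'
    have := (h.dBranch_rho_pos hy).ne'
    field_simp

/-- The brackets of the monodromy matrix: `A = Z⁻¹`, and the principal value is transformed from `y`
to `w`, with `w₁ - w₂ = 2 (y₁ - y₂)`. -/
theorem exists_hasPoissonBracket_monodromyInt (hL : 0 < L) (h : IsRegularData L μ ρ) (G₂ ρplus : ℝ)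
    (Z : M2) {f g : ℝ → ℝ} (hf : IsTestFunction (Ioo (-ρplus) (2 * ρ L - ρplus)) f)
    (hg : IsTestFunction (Ioo (-ρplus) (2 * ρ L - ρplus)) g) (i j k l : Fin 2) : ∃ B : ℝ,
      HasPoissonBracket G₂ L (smeared f fun μ' ρ' w => monodromyInt Z L ρplus μ' ρ' w i j)
        (smeared g fun μ' ρ' w => monodromyInt Z L ρplus μ' ρ' w k l) μ ρ (B : ℂ) ∧
      HasPrincipalValue (Ioo (-ρplus) (2 * ρ L - ρplus)) id
        (fun w₁ w₂ => f w₁ * g w₂ * (32 * Real.pi * G₂ *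
          quadM (monodromyInt Z L ρplus μ ρ w₁) (monodromyInt Z L ρplus μ ρ w₂) (i, k) (j, l)))
        B := by
  obtain ⟨B, hB, hT⟩ := exists_hasPoissonBracket_smearedE hL h G₂ Z⁻¹ i j k l
    (exists_isWeight_spectralWeight (h.rho_L_pos hL) hf)
    (exists_isWeight_spectralWeight (h.rho_L_pos hL) hg)
    (F := smeared f fun μ' ρ' w => monodromyInt Z L ρplus μ' ρ' w i j)
    (G := smeared g fun μ' ρ' w => monodromyInt Z L ρplus μ' ρ' w k l)
    (fun ν _ => by rw [← smeared_spectral_eq_smearedE hf]; rfl)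
    (fun ν _ => by rw [← smeared_spectral_eq_smearedE hg]; rfl)
  refine ⟨B, hB, hasPrincipalValue_of_tendsto measurableSet_Ioo two_pos
    (lam := fun w => (w + ρplus) / 2) (lam' := fun _ => 1 / 2) (fun x _ y _ => ?_)
    (fun x _ => ((hasDerivAt_id x).add_const ρplus).div_const 2) (fun x _ => by norm_num)
    (fun x _ y _ hxy => by simpa using hxy) ?_ (fun x _ y _ => ?_) hT⟩
  · simp only [id]
    ring
  · ext y
    refine ⟨?_, fun hy => ⟨2 * y - ρplus, ⟨by linarith [hy.1], by linarith [hy.2]⟩, by ring⟩⟩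
    rintro ⟨w, hw, rfl⟩
    exact ⟨by linarith [hw.1], by linarith [hw.2]⟩
  · have e : ∀ w : ℝ, spectralWeight ρplus f ((w + ρplus) / 2) = 2 * f w := fun w => by
      rw [spectralWeight]; congr 2; ring
    have e' : ∀ w : ℝ, spectralWeight ρplus g ((w + ρplus) / 2) = 2 * g w := fun w => by
      rw [spectralWeight]; congr 2; ring
    rw [quadM_eq_quadE]
    simp only [e, e', monodromyInt, monodromy, pointOfSpectral, rInv]
    ring

end Data

theorem transpose_deformedMetric (L : ℝ) (μ : ℝ → ℂ) (ρ : ℝ → ℝ) (r : ℝ) :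
    (deformedMetric L μ ρ r)ᵀ = deformedMetric L μ ρ r := by
  rw [deformedMetric, Matrix.transpose_mul, Matrix.transpose_transpose]

end CylGravity
end
end

theorem mainTheorem1 (G₂ L : ℝ) (hL : 0 < L) (μ : ℝ → ℂ) (ρ : ℝ → ℝ)
    (hreg : CylGravity.IsRegularData L μ ρ) :
    -- the brackets of the deformed conformal metric, in components and in index free form
    (∀ f g : ℝ → ℝ, CylGravity.IsTestFunction (Ioo 0 L) f → CylGravity.IsTestFunction (Ioo 0 L) g →
      ∀ a b c d : Fin 2, ∃ B : ℝ,
        CylGravity.HasPoissonBracket G₂ L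
          (CylGravity.smeared f fun μ' ρ' x => CylGravity.deformedMetric L μ' ρ' x a b)
          (CylGravity.smeared g fun μ' ρ' x => CylGravity.deformedMetric L μ' ρ' x c d)
          μ ρ (B : ℂ) ∧
        CylGravity.HasPrincipalValue (Ioo 0 L) ρ
          (fun x y => f x * g y * (16 * Real.pi * G₂ *
            CylGravity.symPairs (fun a' b' c' d' =>
              CylGravity.deformedMetric L μ ρ x a' d' * CylGravity.deformedMetric L μ ρ y c' b'
              - 1 / 2 * (CylGravity.deformedMetric L μ ρ x a' b'
                  * CylGravity.deformedMetric L μ ρ y c' d')) a b c d)) B ∧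
        CylGravity.HasPrincipalValue (Ioo 0 L) ρ
          (fun x y => f x * g y * (16 * Real.pi * G₂ *
            CylGravity.quadE (CylGravity.deformedMetric L μ ρ x) (CylGravity.deformedMetric L μ ρ y)
              (a, c) (b, d))) B) ∧
    -- the brackets of the monodromy matrix, in internal components
    (∀ (ρplus : ℝ) (Z : Matrix (Fin 2) (Fin 2) ℝ), Z.det = 1 →
      ∀ f g : ℝ → ℝ, CylGravity.IsTestFunction (Ioo (-ρplus) (2 * ρ L - ρplus)) f →
        CylGravity.IsTestFunction (Ioo (-ρplus) (2 * ρ L - ρplus)) g →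
      ∀ i j k l : Fin 2, ∃ B : ℝ,
        CylGravity.HasPoissonBracket G₂ L
          (CylGravity.smeared f fun μ' ρ' w => CylGravity.monodromyInt Z L ρplus μ' ρ' w i j)
          (CylGravity.smeared g fun μ' ρ' w => CylGravity.monodromyInt Z L ρplus μ' ρ' w k l)
          μ ρ (B : ℂ) ∧
        CylGravity.HasPrincipalValue (Ioo (-ρplus) (2 * ρ L - ρplus)) id
          (fun w₁ w₂ => f w₁ * g w₂ * (32 * Real.pi * G₂ *
            CylGravity.quadM (CylGravity.monodromyInt Z L ρplus μ ρ w₁)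
              (CylGravity.monodromyInt Z L ρplus μ ρ w₂) (i, k) (j, l))) B) := by
  refine ⟨fun f g hf hg a b c d => ?_, fun ρplus Z _ f g hf hg i j k l =>
    CylGravity.exists_hasPoissonBracket_monodromyInt hL hreg G₂ ρplus Z hf hg i j k l⟩
  obtain ⟨B, hB, hP⟩ :=
    CylGravity.exists_hasPoissonBracket_deformedMetric hL hreg G₂ hf hg a b c d
  refine ⟨B, hB, ?_, hP⟩
  simpa only [CylGravity.quadE_eq_symPairs (CylGravity.transpose_deformedMetric L μ ρ _)
    (CylGravity.transpose_deformedMetric L μ ρ _)] using hP
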